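/- **Theorem 1.3 ($r^p$-weighted estimates for $r^2\partial_r(r\psi)$, $\ell\ge 1$).** *Background.* Let $M\ge 0$, $\beta>0$, $0\le r_{\min}<R_0$, and let $D$ be smooth on $[r_{\min},\infty)$ and positive on $(r_{\min},\infty)$, with $D(r)=1-\frac{2M}{r}+O_3(r^{-1-\beta})$ on $[R_0,\infty)$ (the error and its derivatives of order $j\le 3$ are $O(r^{-1-\beta-j})$). Consider the metric $$g=-D\,dv^2+2\,dv\,dr+r^2 g_{\mathbb S^2},\qquad r\ge r_{\min},$$ where either $r_{\min}>0$ and $D(r_{\min})=0$ (event horizon), or $r_{\min}=0$, $D$ is bounded below by a positive constant and $g$ extends smoothly to the centre $r=0$. Let $T=\partial_v$, $\frac{dr_*}{dr}=\frac1D$, $r_*(R_0)=R_0$, and $u=v-2r_*$. In Bondi coordinates $(u,r,\omega)$, in which $g=-D\,du^2-2\,du\,dr+r^2g_{\mathbb S^2}$, let $\partial_r$ be the coordinate field, $L=\frac D2\partial_r$ and $T=\partial_u$. All occurrences of $\partial_r$ below refer to these coordinates. Let $\Omega_1,\Omega_2,\Omega_3$ be the standard rotation fields, $\Omega^k=\Omega_1^{k_1}\Omega_2^{k_2}\Omega_3^{k_3}$,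 and $\slashed\nabla$ the covariant derivative on the spheres of constant $(u,r)$. Let $\Sigma=\Sigma_0$ consist of a smooth hypersurface that is spacelike up to its boundary, a graph $v=\sigma(x)$ over $r_{\min}\le r\le R_0$ which meets the cone $u=0$ exactly at $r=R_0$, and of $\{u=0,\ r\ge R_0\}$. Let $\Sigma_\tau$, $\tau\ge0$, be its translate by time $\tau$ along $T$ and $\mathcal R=\bigcup_{\tau\ge 0}\Sigma_\tau$. For $R\ge R_0$ put $\mathcal N_u=\{u\}\times[R,\infty)\times\mathbb S^2$ and $\mathcal A_{u_1}^{u_2}=\bigcup_{u_1\le u\le u_2}\mathcal N_u$. With the stress-energy tensor $\mathbf T[f]=df\otimes df-\frac12 g\,|\nabla f|_g^2$ let $J^V[f]\cdot W=\mathbf T[f](V,W)$. On the spacelike part of $\Sigma_\tau$, $n_\tau$ is the future unit normal and $d\mu_\tau$ the induced volume; on the null part $n_\tau=L$ and $d\mu_\tau=r^2d\omega\,dr$. A *solution* is a smooth $\psi:\mathcal R\to\mathbb R$ with $\square_g\psi=0$ and $\psi|_\Sigma\to0$ as $r\to\infty$. *Local decay assumption.* Let $N$ be either $T$, or, if $r_{\min}>0$,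 a continuous future directed strictly timelike vector field invariant under the flow of $T$ and equal to $T$ for $r\ge R_0$. Assume that for every word $\alpha$ in the derivatives $\partial_u,\partial_r,\Omega_1,\Omega_2,\Omega_3$ and every $\rho\ge R_0$ there is a constant $C_{\alpha,\rho}$ such that for all solutions $\psi$ and all $0\le\tau_1<\tau_2$ $$\int_{\tau_1}^{\tau_2}\int_{\{u=\tau,\ \rho\le r\le\rho+1\}}J^T[\partial^\alpha\psi]\cdot L\;r^2d\omega\,dr\,d\tau\le C_{\alpha,\rho}\sum_{k\le|\alpha|}\int_{\Sigma_{\tau_1}}J^N[T^k\psi]\cdot n_{\tau_1}\,d\mu_{\tau_1}.$$ *Conclusion.* There is a positive function $R\mapsto C(R)$, depending only on the background, $\Sigma$, $N$ and the constants $C_{\alpha,\rho}$, such that for every $p\in(-4,2]$ there is an $R\ge R_0$ with the following property. Let $\psi$ be a solution supported on angular frequencies $\ell\ge1$ (its mean over every sphere of constant $(v,r)$ contained in $\mathcal R$ vanishes), put $\phi=r\psi$ and $\Phi=r^2\partial_r\phi$, and assume that $$\sum_{|k|\le2}\int_\Sigma J^T[\Omega^k\psi]\cdot n_\Sigma\,d\mu_\Sigma<\infty$$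 and that the limits $$\lim_{r\to\infty}\sum_{|k|\le2}\int_{\mathbb S^2}(\Omega^k\phi)^2d\omega\Big|_{u=0},\qquad \lim_{r\to\infty}\int_{\mathbb S^2}\Phi^2d\omega\Big|_{u=0}$$ exist and are finite. Then for all $0\le u_1<u_2$ $$\begin{aligned}\int_{\mathcal N_{u_2}}r^p(\partial_r\Phi)^2\,d\omega\,dr&+\int_{\mathcal A_{u_1}^{u_2}}\Big[(p+4)r^{p-1}(\partial_r\Phi)^2+(2-p)r^{p-1}|\slashed\nabla\Phi|^2\Big]d\omega\,dr\,du\\&\le C(R)\int_{\mathcal N_{u_1}}r^p(\partial_r\Phi)^2\,d\omega\,dr+C(R)\sum_{l\le1}\int_{\Sigma_{u_1}}J^N[T^l\psi]\cdot n_{u_1}\,d\mu_{u_1},\end{aligned}$$ as an inequality in $[0,\infty]$. In particular, for $N=T$ the last sum consists of the $T$-energies of $\psi$ and $T\psi$. -/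

import Mathlib

open MeasureTheory Set Filter Topology
open scoped ContDiff RealInnerProductSpace

noncomputable section

namespace RpHierarchy

/-- Spatial points `x = r ω`, with `r = ‖x‖` and `ω` in the unit sphere. -/
abbrev E3 := EuclideanSpace ℝ (Fin 3)

/-- Points `(v, x)` in ingoing Eddington-Finkelstein coordinates `(v, r, ω)`, `x = r ω`; also
tangent vectors in these coordinates. -/
abbrev Spt := ℝ × E3

/-- The round unit sphere. -/
abbrev S2 := Metric.sphere (0 : E3) 1

/-- The standard area measure `dω` of the unit sphere. -/
abbrev dω : Measure S2 := (volume : Measure E3).toSphere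

/-- The unit radial vector `x / r`. -/
def radial (x : E3) : E3 := ‖x‖⁻¹ • x

/-- The metric `g = -D dv² + 2 dv dr + r² g_{S²}`, where `dr = ⟨x / r, dx⟩` and
`r² g_{S²} = |dx|² - dr²`. -/
def metric (D : ℝ → ℝ) (x : E3) (X Y : Spt) : ℝ :=
  -D ‖x‖ * X.1 * Y.1 + X.1 * ⟪radial x, Y.2⟫ + Y.1 * ⟪radial x, X.2⟫
    + (⟪X.2, Y.2⟫ - ⟪radial x, X.2⟫ * ⟪radial x, Y.2⟫)

/-- The Euclidean gradient of `f` in the spatial variables, at fixed `v`. -/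
def spatialGrad (f : Spt → ℝ) (p : Spt) : E3 :=
  WithLp.toLp 2 fun i => fderiv ℝ f p (0, EuclideanSpace.single i 1)

/-- The gradient of `f` with respect to `g`, with components `g^{ab} ∂_b f`; see `metric_grad`. -/
def grad (D : ℝ → ℝ) (f : Spt → ℝ) (p : Spt) : Spt :=
  (fderiv ℝ f p (0, radial p.2),
    (fderiv ℝ f p (1, 0) + (D ‖p.2‖ - 1) * fderiv ℝ f p (0, radial p.2)) • radial p.2
      + spatialGrad f p)

lemma inner_spatialGrad (f : Spt → ℝ) (p : Spt) (y : E3) :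
    ⟪spatialGrad f p, y⟫ = fderiv ℝ f p (0, y) := by
  have hy : ((0 : ℝ), y) = ∑ i, y i • ((0 : ℝ), (EuclideanSpace.single i (1 : ℝ) : E3)) := by
    refine Prod.ext (by simp [Prod.fst_sum]) ?_
    ext j
    fin_cases j <;> simp [Fin.sum_univ_three]
  rw [hy, map_sum]
  simp only [map_smul]
  simp [spatialGrad, PiLp.inner_apply]

/-- `grad` is the metric gradient: `g(∇f, Y) = Y f`. -/
lemma metric_grad (D : ℝ → ℝ) (f : Spt → ℝ) (p Y : Spt) (hp : p.2 ≠ 0) :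
    metric D p.2 (grad D f p) Y = fderiv ℝ f p Y := by
  have hn : ⟪radial p.2, radial p.2⟫ = 1 := by
    have h : ‖p.2‖ ≠ 0 := norm_ne_zero_iff.mpr hp
    simp only [radial, inner_smul_left, inner_smul_right, real_inner_self_eq_norm_sq]
    simp only [conj_trivial]
    field_simp
  have hg : ⟪radial p.2, spatialGrad f p⟫ = fderiv ℝ f p (0, radial p.2) := by
    rw [real_inner_comm, inner_spatialGrad]
  have hY : fderiv ℝ f p Y = Y.1 * fderiv ℝ f p (1, 0) + fderiv ℝ f p (0, Y.2) := by
    have : Y = Y.1 • ((1 : ℝ), (0 : E3)) + ((0 : ℝ), Y.2) := by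
      refine Prod.ext ?_ ?_ <;> simp
    conv_lhs => rw [this]
    rw [map_add, map_smul, smul_eq_mul]
  rw [hY]
  simp only [metric, grad, inner_add_left, inner_add_right, inner_smul_left, inner_smul_right,
    hn, hg, inner_spatialGrad, conj_trivial]
  ring

/-- The wave operator `|det g|^{-1/2} ∂_a (|det g|^{1/2} g^{ab} ∂_b f)`. In the coordinates `(v, x)`
one has `det g = -1`. -/
def box (D : ℝ → ℝ) (f : Spt → ℝ) (p : Spt) : ℝ :=
  fderiv ℝ (fun q => (grad D f q).1) p (1, 0)
    + ∑ i : Fin 3, fderiv ℝ (fun q => (grad D f q).2 i) p (0, EuclideanSpace.single i 1)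

/-- The stress-energy tensor `T[f](X, Y) = (X f) (Y f) - g(X, Y) |∇f|² / 2`. -/
def stress (D : ℝ → ℝ) (f : Spt → ℝ) (p X Y : Spt) : ℝ :=
  fderiv ℝ f p X * fderiv ℝ f p Y - metric D p.2 X Y * fderiv ℝ f p (grad D f p) / 2

/-- The derivative of a function along a vector field. -/
def der (X : Spt → Spt) (f : Spt → ℝ) : Spt → ℝ := fun p => fderiv ℝ f p (X p)

/-- The Killing field `T = ∂_v` (equal to `∂_u` in Bondi coordinates). -/
def vT : Spt → Spt := fun _ => (1, 0)

/-- The outgoing null field `∂_r` of the Bondi coordinates `(u, r, ω)`, where `v = u + 2 r_*(r)`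
and `dr_* / dr = 1 / D`. -/
def vR (D : ℝ → ℝ) : Spt → Spt := fun p => (2 / D ‖p.2‖, radial p.2)

/-- The outgoing null field `L = (D / 2) ∂_r` (Bondi `∂_r`), normalised by `L v = 1`. -/
def vL (D : ℝ → ℝ) : Spt → Spt := fun p => (D ‖p.2‖ / 2) • vR D p

/-- The rotation fields `Ω₁ = z ∂_y - y ∂_z`, `Ω₂ = x ∂_z - z ∂_x`, `Ω₃ = x ∂_y - y ∂_x`. -/
def vΩ (i : Fin 3) : Spt → Spt := fun p =>
  (0, (![!₂[0, p.2 2, -p.2 1], !₂[-p.2 2, 0, p.2 0], !₂[-p.2 1, p.2 0, 0]] : Fin 3 → E3) i)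

/-- `Ω^k = Ω₁^{k₁} Ω₂^{k₂} Ω₃^{k₃}`. -/
def Ωpow (k : Fin 3 → ℕ) (f : Spt → ℝ) : Spt → ℝ :=
  (der (vΩ 0))^[k 0] ((der (vΩ 1))^[k 1] ((der (vΩ 2))^[k 2] f))

/-- The multi-indices `k ∈ ℕ³` with `|k| ≤ m`. -/
def multiIndices (m : ℕ) : Finset (Fin 3 → ℕ) :=
  (Fintype.piFinset fun _ => Finset.range (m + 1)).filter fun k => ∑ i, k i ≤ m

/-- `|∇̸ f|²`, the squared length of the gradient of `f` along the spheres of constant `(u, r)`,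
which are round of radius `r`. -/
def angGradSq (f : Spt → ℝ) (p : Spt) : ℝ := (∑ i, der (vΩ i) f p ^ 2) / ‖p.2‖ ^ 2

/-- The frame `∂_u, ∂_r, Ω₁, Ω₂, Ω₃` of derivatives in the far region. -/
def frame (D : ℝ → ℝ) : Fin 5 → Spt → Spt := ![vT, vR D, vΩ 0, vΩ 1, vΩ 2]

/-- Iterated derivatives `∂^α f`, for a word `α` in the frame fields. -/
def wordDer (D : ℝ → ℝ) : List (Fin 5) → (Spt → ℝ) → Spt → ℝ
  | [], f => f
  | i :: α, f => der (frame D i) (wordDer D α f)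

/-- The radiation field `φ = r ψ`. -/
def radField (ψ : Spt → ℝ) : Spt → ℝ := fun p => ‖p.2‖ * ψ p

/-- The commuted radiation field `Φ = r² ∂_r (r ψ)` (Bondi `∂_r`). -/
def Phi (D : ℝ → ℝ) (ψ : Spt → ℝ) : Spt → ℝ := fun p => ‖p.2‖ ^ 2 * der (vR D) (radField ψ) p

/-- The tortoise coordinate: `dr_* / dr = 1 / D`, `r_*(R₀) = R₀`. -/
def tortoise (D : ℝ → ℝ) (R₀ r : ℝ) : ℝ := R₀ + ∫ t in R₀..r, (D t)⁻¹

/-- The shift between `v` and a time function that is regular on the whole spacetime: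
`v` itself if there is a horizon (`rmin > 0`), and `t = v - r_*(r)` if there is a regular centre
(`rmin = 0`), where `(v, x)` are not smooth coordinates at `x = 0`. -/
def shift (D : ℝ → ℝ) (rmin R₀ r : ℝ) : ℝ :=
  open Classical in if rmin = 0 then tortoise D R₀ r else 0

/-- A spherically symmetric, stationary, asymptotically flat background with either a future event
horizon at `r = rmin > 0` or a regular centre `rmin = 0`, together with the inner part
`{v = sig x, r ≤ R₀}` of a spacelike-null initial hypersurface. -/
structure Background where
  /-- the metric coefficient -/
  D : ℝ → ℝ
  /-- the mass -/
  M : ℝ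
  /-- the order of the error term in the asymptotics of `D` -/
  β : ℝ
  /-- the smallest area radius -/
  rmin : ℝ
  /-- the area radius at which the hypersurfaces turn from spacelike to null -/
  R₀ : ℝ
  /-- the inner part of the initial hypersurface, as a graph over `x` -/
  sig : E3 → ℝ
  M_nonneg : 0 ≤ M
  β_pos : 0 < β
  rmin_nonneg : 0 ≤ rmin
  rmin_lt : rmin < R₀
  /-- `D = 1 - 2M/r + O₃(r^{-1-β})` on `[R₀, ∞)`. -/
  asymp : ∀ j ≤ 3, ∃ c : ℝ, ∀ r, R₀ ≤ r →
    |iteratedDeriv j (fun t => D t - (1 - 2 * M / t)) r| ≤ c * r ^ (-(1 + β) - (j : ℝ))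
  D_pos : ∀ r, rmin < r → 0 < D r
  D_smooth : ContDiffOn ℝ ∞ D (Ici rmin)
  /-- If `rmin > 0`, then `r = rmin` is a horizon. -/
  horizon : 0 < rmin → D rmin = 0
  /-- If `rmin = 0`, then `D` is bounded below and the metric extends smoothly to the centre. -/
  centre : rmin = 0 →
    (∃ d > 0, ∀ r, 0 ≤ r → d ≤ D r) ∧ D 0 = 1 ∧ ContDiff ℝ ∞ fun x : E3 => D ‖x‖
  /-- The inner part is a smooth hypersurface, up to its boundary. -/
  sig_smooth : ∃ U : Set E3, IsOpen U ∧ {x | rmin ≤ ‖x‖ ∧ ‖x‖ ≤ R₀} ⊆ U ∧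
    ContDiffOn ℝ ∞ (fun x => sig x - shift D rmin R₀ ‖x‖) U
  /-- The inner part is spacelike, up to its boundary (and up to the centre): the differential of
  `v - sig x` is uniformly timelike. -/
  sig_spacelike : ∃ c > 0, ∀ x : E3, rmin ≤ ‖x‖ → ‖x‖ ≤ R₀ → x ≠ 0 →
    fderiv ℝ (fun p : Spt => p.1 - sig p.2) (0, x)
      (grad D (fun p : Spt => p.1 - sig p.2) (0, x)) ≤ -c
  /-- At `r = R₀` the inner part meets the outgoing null cone `u = v - 2 r_* = 0`. -/
  sig_match : ∀ x : E3, ‖x‖ = R₀ → sig x = 2 * R₀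

namespace Background

variable (B : Background)

/-- The tortoise coordinate of the background. -/
def rstar (r : ℝ) : ℝ := tortoise B.D B.R₀ r

/-- The initial hypersurface `Σ = {v = s x}`: the given spacelike hypersurface for `r ≤ R₀`,
continued by the outgoing null cone `u = 0` for `r ≥ R₀`. -/
def s (x : E3) : ℝ := if ‖x‖ ≤ B.R₀ then B.sig x else 2 * B.rstar ‖x‖

/-- The spacetime region `𝓡 = J⁺(Σ)`, the union over `τ ≥ 0` of the translates
`Σ_τ = {v = τ + s x}`. -/
def region : Set Spt := {p | B.rmin ≤ ‖p.2‖ ∧ B.s p.2 ≤ p.1}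

/-- The point of `Σ_τ` over `x`. -/
def slicePt (τ : ℝ) (x : E3) : Spt := (τ + B.s x, x)

/-- The point with Bondi coordinates `(u, r, y)`, `y` in the unit sphere. -/
def bondiPt (u r : ℝ) (y : S2) : Spt := (u + 2 * B.rstar r, r • (y : E3))

/-- Smooth functions on `𝓡`: in coordinates that are regular on the whole spacetime, restrictions of
smooth functions on a neighbourhood. -/
def SmoothOnRegion (f : Spt → ℝ) : Prop :=
  ∃ U : Set Spt, IsOpen U ∧
    {q : Spt | (q.1 + shift B.D B.rmin B.R₀ ‖q.2‖, q.2) ∈ B.region} ⊆ U ∧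
    ContDiffOn ℝ ∞ (fun q : Spt => f (q.1 + shift B.D B.rmin B.R₀ ‖q.2‖, q.2)) U

/-- Smooth solutions on `𝓡` of the wave equation whose data on `Σ` tend to `0` at infinity. -/
structure IsSolution (ψ : Spt → ℝ) : Prop where
  smooth : B.SmoothOnRegion ψ
  wave : ∀ p ∈ B.region, B.rmin < ‖p.2‖ → box B.D ψ p = 0
  decay : Tendsto (fun x => ψ (B.slicePt 0 x)) (cocompact E3) (𝓝 0)

/-- `ψ` is supported on angular frequencies `ℓ ≥ 1`: its `ℓ = 0` part, the mean over the
spheres of constant `(v, r)` in `𝓡`, vanishes. -/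
def HighFrequency (ψ : Spt → ℝ) : Prop :=
  ∀ v r : ℝ, 0 < r → (∀ y : S2, (v, r • (y : E3)) ∈ B.region) →
    ∫ y : S2, ψ (v, r • (y : E3)) ∂dω = 0

/-- The integral over `𝓝_u ∩ {r ∈ I}` of a nonnegative function, with respect to `dω dr`. -/
def nullInt (u : ℝ) (I : Set ℝ) (F : Spt → ℝ) : ENNReal :=
  ∫⁻ r in I, ∫⁻ y : S2, ENNReal.ofReal (F (B.bondiPt u r y)) ∂dω

/-- The density `J^N[f] · L r²` of the energy flux through the null cones `𝓝_u`. -/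
def nullDensity (N : E3 → Spt) (f : Spt → ℝ) (p : Spt) : ℝ :=
  stress B.D f p (N p.2) (vL B.D p) * ‖p.2‖ ^ 2

/-- The energy flux `∫_{Σ_τ} J^N[f] · n_τ dμ_τ`. On the spacelike part `r < R₀` the flux density
`J^N[f] · n dμ` is `T[f](N, -∇τ) dx`, where `τ = v - s x`: the normal is
`n = -∇τ / |∇τ|`, and the induced volume is `dμ = |∇τ| dx` as `|det g| = 1`. On the null part
`𝓝_τ` the conventions are `n = L` and `dμ = r² dω dr`. -/
def energy (N : E3 → Spt) (τ : ℝ) (f : Spt → ℝ) : ENNReal :=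
  (∫⁻ x in {x : E3 | B.rmin < ‖x‖ ∧ ‖x‖ < B.R₀}, ENNReal.ofReal
      (stress B.D f (B.slicePt τ x) (N x)
        (-grad B.D (fun p : Spt => p.1 - B.sig p.2) (B.slicePt τ x))))
    + B.nullInt τ (Ioi B.R₀) (B.nullDensity N f)

/-- The field `T`, as a stationary vector field. -/
def fieldT : E3 → Spt := fun _ => (1, 0)

/-- The admissible energy fields: `T` itself or, if there is a horizon, any stationary continuous
future directed strictly timelike field that equals `T` in the far region. -/
def IsEnergyField (N : E3 → Spt) : Prop :=
  N = fieldT ∨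
    (0 < B.rmin ∧ ContinuousOn N {x | B.rmin ≤ ‖x‖} ∧
      (∀ x, B.rmin ≤ ‖x‖ → metric B.D x (N x) (N x) < 0 ∧ metric B.D x (N x) (fieldT x) < 0) ∧
      ∀ x, B.R₀ ≤ ‖x‖ → N x = fieldT x)

/-- The local integrated energy decay (Morawetz) assumption in the far region, with the energies
of `N` on its right-hand side. -/
def LocalMorawetz (N : E3 → Spt) : Prop :=
  ∀ (α : List (Fin 5)) (ρ : ℝ), B.R₀ ≤ ρ → ∃ C : ℝ, 0 < C ∧
    ∀ ψ, B.IsSolution ψ → ∀ τ₁ τ₂ : ℝ, 0 ≤ τ₁ → τ₁ < τ₂ →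
      ∫⁻ τ in Ioc τ₁ τ₂,
          B.nullInt τ (Icc ρ (ρ + 1)) (B.nullDensity fieldT (wordDer B.D α ψ))
        ≤ ENNReal.ofReal C *
          ∑ k ∈ Finset.range (α.length + 1), B.energy N τ₁ ((der vT)^[k] ψ)

/-- The assumptions on the initial data: finite `T`-energies of `Ω^k ψ`, `|k| ≤ 2`, and finite
limits at infinity along `u = 0` for the radiation fields. -/
structure DataAssumptions (ψ : Spt → ℝ) : Prop where
  energy_lt_top : ∑ k ∈ multiIndices 2, B.energy fieldT 0 (Ωpow k ψ) < ⊤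
  limit_phi : ∃ l : ℝ, Tendsto
    (fun r => ∑ k ∈ multiIndices 2,
      ∫ y : S2, Ωpow k (radField ψ) (B.bondiPt 0 r y) ^ 2 ∂dω) atTop (𝓝 l)
  limit_Phi : ∃ l : ℝ, Tendsto
    (fun r => ∫ y : S2, Phi B.D ψ (B.bondiPt 0 r y) ^ 2 ∂dω) atTop (𝓝 l)

/-- The weighted flux `∫_{𝓝_u} r^p (∂_r Φ)² dω dr` over `r ≥ R`. -/
def rpFlux (p R u : ℝ) (ψ : Spt → ℝ) : ENNReal :=
  B.nullInt u (Ioi R) fun q => ‖q.2‖ ^ p * der (vR B.D) (Phi B.D ψ) q ^ 2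

/-- The bulk integral over `u₁ ≤ u ≤ u₂`, `r ≥ R` of
`(p + 4) r^{p-1} (∂_r Φ)² + (2 - p) r^{p-1} |∇̸ Φ|²` with respect to `dω dr du`. -/
def rpBulk (p R u₁ u₂ : ℝ) (ψ : Spt → ℝ) : ENNReal :=
  ∫⁻ u in Ioc u₁ u₂, B.nullInt u (Ioi R) fun q =>
    (p + 4) * ‖q.2‖ ^ (p - 1) * der (vR B.D) (Phi B.D ψ) q ^ 2
      + (2 - p) * ‖q.2‖ ^ (p - 1) * angGradSq (Phi B.D ψ) q

end Background

end RpHierarchy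

end

open RpHierarchy

noncomputable section

/-! ### Rotation fields integrate to zero over the unit sphere. -/

namespace RpHierarchy

/-! Write `φ = rψ`, `Φ = r²∂_rφ` and `Δ̸ = Σ Ω_i²`. In Bondi coordinates the wave equation for `φ`,
multiplied by `r²` and differentiated once more in `r`, becomes a transport equation in `u` for
`∂_rΦ` (`wave_der_vR_Phi`). Its only coefficient without sufficient decay is that of `φ`, which is
`2M r⁻²` to leading order. Passing to `h = Φ + Mφ` (`hatPhi`) absorbs it into the angular operator:
with `g = ∂_r h`, `2∂_u g = D∂_r g + (2D' - 2D/r)g + r⁻²(Δ̸ + 2)h + O(r^{-2-σ})(h, φ)`, where `σ =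
min(β, 1)` (`wave_der_vR_hatPhi`, `exists_coef_bounds`).

Multiplication by `r^p g` and integration by parts (`energy_identity`, `CutBox.energy_ineq`) produce
a bulk term `(p+4) r^{p-1} g²` from the first order terms and a bulk term `(2-p) r^{p-3}(|Ωh|² -
2h²)` from the angular operator. For frequencies `ℓ ≥ 1` the latter has a nonnegative mean over
every sphere, by the sharp Poincaré inequality (`sphere_poincare`), whose constant is exactly the
`2` in `Δ̸ + 2`. That inequality follows from an integrated Bochner inequality for polynomials and a
duality argument.

The error terms carry an extra factor `r^{-σ}`. Hardy's inequality (`CutBox.hardy`) therefore bounds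
them, up to and including `p = 2`, by the `g²` bulk with the small factor `(R-1)^{-σ}`, and they are
absorbed once `R` is large compared with `1/(p+4)` (`CutBox.energy_absorbed`). Hardy's inequality
also converts between `h` and `Φ` (`flux_f_le`, `flux_g_le`, `hardy_pair`). For `p < 2` it recovers
`|ΩΦ|²` from `|Ωh|² - 2h²`. The losses `1/(p+4)` and `1/(2-p)` are at most `R`, because `R` is
chosen after `p`; this is why the constant depends on `R` alone (`CutBox.core`).

Nothing has to be known at null infinity. A cutoff in the advanced time `v` makes all integrals
compact. The terms with its derivative either cancel (those with `g²`) or have a sign (in Hardy's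
inequality pointwise, in the energy identity after integration over spheres), and the cutoff is
removed by monotone convergence (`nullInt_add_bulk_le`).

The radial cutoff leaves terms on the slab `R-1 ≤ r ≤ R`. Those integrated in `u` come from local
decay for `ψ`, `Tψ` and `Ω_iψ`; `Φ²` on the later cone comes from integrating `∂_u(Φ²)`
(`exists_slab_le`). The flux of `∂_rΦ` through the slab of the first cone contains two
`r`-derivatives of `φ`; there the wave equation is read as an elliptic equation along the cone with
a source made of `Tψ` (`elliptic`, `slab_der_vR_Phi_le`). In this way only the energies of `ψ` and
`Tψ` at `u₁` occur. -/

/-- The infinitesimal rotations of `E3`, the spatial parts of the fields `Ω_i`. -/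
def rotGen (i : Fin 3) (x : E3) : E3 :=
  (![!₂[0, x 2, -x 1], !₂[-x 2, 0, x 0], !₂[-x 1, x 0, 0]] : Fin 3 → E3) i

lemma vΩ_eq (i : Fin 3) (p : Spt) : vΩ i p = (0, rotGen i p.2) := rfl

lemma inner_rotGen_self (i : Fin 3) (x : E3) : ⟪x, rotGen i x⟫ = 0 := by
  fin_cases i <;> simp [rotGen, PiLp.inner_apply, Fin.sum_univ_three] <;> ring

lemma rotGen_smul (i : Fin 3) (c : ℝ) (x : E3) : rotGen i (c • x) = c • rotGen i x := by
  ext j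
  fin_cases i <;> fin_cases j <;> simp [rotGen]

/-- `rotGen` as a continuous linear map. -/
def rotGenL (i : Fin 3) : E3 →L[ℝ] E3 :=
  LinearMap.toContinuousLinearMap
    { toFun := rotGen i
      map_add' := fun x y => by
        ext j
        fin_cases i <;> fin_cases j <;> simp [rotGen] <;> ring
      map_smul' := rotGen_smul i }

lemma contDiff_rotGen (i : Fin 3) : ContDiff ℝ ∞ (rotGen i) := (rotGenL i).contDiff

lemma fderiv_apply_eq_sum (h : E3 → ℝ) (x v : E3) :
    fderiv ℝ h x v = ∑ j, v j * fderiv ℝ h x (EuclideanSpace.single j 1) := by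
  have hv : v = ∑ j, v j • (EuclideanSpace.single j (1 : ℝ) : E3) := by
    ext k
    fin_cases k <;> simp [Fin.sum_univ_three]
  conv_lhs => rw [hv]
  simp [map_sum]

/-- For `j ≠ k` the field `x_j ∂_k` is divergence free, so integration by parts leaves no term.
Every rotation field is a difference of two such fields. -/
lemma integral_coord_mul_fderiv_single {F : E3 → ℝ} (hF : ContDiff ℝ 1 F)
    (hc : HasCompactSupport F) {j k : Fin 3} (hjk : j ≠ k) :
    ∫ x : E3, x j * fderiv ℝ F x (EuclideanSpace.single k 1) = 0 := by
  have hd : Differentiable ℝ F := hF.differentiable one_ne_zero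
  have hcoord : ∀ x : E3, HasFDerivAt (fun x : E3 => x j)
      (EuclideanSpace.proj j : E3 →L[ℝ] ℝ) x := fun x =>
    (EuclideanSpace.proj j : E3 →L[ℝ] ℝ).hasFDerivAt
  have hcf : ∀ x : E3, fderiv ℝ (fun x : E3 => x j) x (EuclideanSpace.single k 1) = 0 := by
    intro x
    rw [(hcoord x).fderiv]
    simp [hjk]
  have hcont : Continuous fun x : E3 => x j := by fun_prop
  have hfd : Continuous fun x => fderiv ℝ F x (EuclideanSpace.single k 1) :=
    (hF.continuous_fderiv one_ne_zero).clm_apply continuous_const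
  have hcs : HasCompactSupport fun x => fderiv ℝ F x (EuclideanSpace.single k 1) :=
    hc.fderiv_apply (𝕜 := ℝ) _
  rw [integral_mul_fderiv_eq_neg_fderiv_mul_of_integrable]
  · simp [hcf]
  · simp [hcf]
  · exact (hcont.mul hfd).integrable_of_hasCompactSupport hcs.mul_left
  · exact (hcont.mul hF.continuous).integrable_of_hasCompactSupport hc.mul_left
  · exact fun x _ => (hcoord x).differentiableAt
  · exact fun x _ => hd x

lemma integral_fderiv_rotGen {F : E3 → ℝ} (hF : ContDiff ℝ 1 F)
    (hc : HasCompactSupport F) (i : Fin 3) :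
    ∫ x : E3, fderiv ℝ F x (rotGen i x) = 0 := by
  have hint : ∀ j k : Fin 3,
      Integrable fun x : E3 => x j * fderiv ℝ F x (EuclideanSpace.single k 1) := by
    intro j k
    have hcont : Continuous fun x : E3 => x j := by fun_prop
    have hfd : Continuous fun x => fderiv ℝ F x (EuclideanSpace.single k 1) :=
      (hF.continuous_fderiv one_ne_zero).clm_apply continuous_const
    exact (hcont.mul hfd).integrable_of_hasCompactSupport (hc.fderiv_apply (𝕜 := ℝ) _).mul_left
  have key : ∀ j k l m : Fin 3, j ≠ k → l ≠ m →
      ∫ x : E3, (x j * fderiv ℝ F x (EuclideanSpace.single k 1)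
        - x l * fderiv ℝ F x (EuclideanSpace.single m 1)) = 0 := by
    intro j k l m hjk hlm
    rw [integral_sub (hint _ _) (hint _ _), integral_coord_mul_fderiv_single hF hc hjk,
      integral_coord_mul_fderiv_single hF hc hlm, sub_zero]
  fin_cases i
  · rw [← key 2 1 1 2 (by decide) (by decide)]
    refine integral_congr_ae (.of_forall fun x => ?_)
    simp only [fderiv_apply_eq_sum F x (rotGen _ x)]
    simp [rotGen, Fin.sum_univ_three]
    ring
  · rw [← key 0 2 2 0 (by decide) (by decide)]
    refine integral_congr_ae (.of_forall fun x => ?_)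
    simp only [fderiv_apply_eq_sum F x (rotGen _ x)]
    simp [rotGen, Fin.sum_univ_three]
    ring
  · rw [← key 0 1 1 0 (by decide) (by decide)]
    refine integral_congr_ae (.of_forall fun x => ?_)
    simp only [fderiv_apply_eq_sum F x (rotGen _ x)]
    simp [rotGen, Fin.sum_univ_three]
    ring

/-- Integration in polar coordinates for a product of a radial and an angular function. -/
lemma integral_radial_mul_angular (k : ℝ → ℝ) (G : S2 → ℝ) (G' : E3 → ℝ)
    (hG : ∀ y : S2, ∀ r : ℝ, 0 < r → G' (r • (y : E3)) = G y) :
    ∫ x : E3, k ‖x‖ * G' x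
      = (∫ y : S2, G y ∂dω) * ∫ r : Ioi (0 : ℝ), k r ∂(Measure.volumeIoiPow 2) := by
  have hdim : Module.finrank ℝ E3 - 1 = 2 := by simp
  have hmp := (volume : Measure E3).measurePreserving_homeomorphUnitSphereProd
  rw [hdim] at hmp
  calc ∫ x : E3, k ‖x‖ * G' x
      = ∫ x : ({(0 : E3)}ᶜ : Set E3), k ‖(x : E3)‖ * G' x
          ∂((volume : Measure E3).comap (Subtype.val)) := by
        rw [integral_subtype_comap (measurableSet_singleton _).compl fun x : E3 => k ‖x‖ * G' x,
          restrict_compl_singleton]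
    _ = ∫ z, G z.1 * k z.2 ∂((volume : Measure E3).toSphere.prod (Measure.volumeIoiPow 2)) := by
        rw [← hmp.integral_comp (Homeomorph.measurableEmbedding _)]
        refine integral_congr_ae (.of_forall fun x => ?_)
        have hx : 0 < ‖(x : E3)‖ := norm_pos_iff.mpr x.2
        have h1 := hG (homeomorphUnitSphereProd E3 x).1 ‖(x : E3)‖ hx
        simp only [homeomorphUnitSphereProd_apply_fst_coe] at h1
        rw [smul_smul, mul_inv_cancel₀ hx.ne', one_smul] at h1
        simp only [homeomorphUnitSphereProd_apply_snd_coe]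
        rw [h1, mul_comm]
    _ = _ := integral_prod_mul G fun r : Ioi (0 : ℝ) => k r

/-- A smooth radial bump supported in the annulus `1 ≤ r² ≤ 4`. -/
def annulusBump (r : ℝ) : ℝ := Real.smoothTransition (r ^ 2 - 1) * Real.smoothTransition (4 - r ^ 2)

/-- A direction orthogonal to `x` does not change the norm to first order, so only the factor `z` in
`‖z‖⁻¹ z` is differentiated. -/
lemma hasFDerivAt_inv_norm_smul {x : E3} (hx : x ≠ 0) (v : E3) (hv : ⟪x, v⟫ = 0) :
    DifferentiableAt ℝ (fun z : E3 => ‖z‖⁻¹ • z) x ∧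
      fderiv ℝ (fun z : E3 => ‖z‖⁻¹ • z) x v = ‖x‖⁻¹ • v := by
  have hn : ‖x‖ ≠ 0 := norm_ne_zero_iff.mpr hx
  have h1 : DifferentiableAt ℝ (fun z : E3 => ‖z‖) x := differentiableAt_id.norm ℝ hx
  have h2 : fderiv ℝ (fun z : E3 => ‖z‖) x v = 0 := by
    have h3 : HasFDerivAt (fun z : E3 => ‖z‖ ^ 2) (2 • (innerSL ℝ x)) x := by
      simpa using (hasFDerivAt_id x).norm_sq
    have h4 := (h1.hasFDerivAt.pow 2).unique h3
    have h5 := congrArg (fun L : E3 →L[ℝ] ℝ => L v) h4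
    simp [hv] at h5
    rcases h5 with h5 | h5
    · exact absurd h5 hx
    · exact h5
  have h6 : HasFDerivAt (fun z : E3 => ‖z‖⁻¹)
      ((-(‖x‖ ^ 2)⁻¹) • fderiv ℝ (fun z : E3 => ‖z‖) x) x :=
    (hasDerivAt_inv hn).comp_hasFDerivAt x h1.hasFDerivAt
  have h7 := h6.smul (hasFDerivAt_id x)
  refine ⟨h7.differentiableAt, ?_⟩
  have h8 : fderiv ℝ (fun z : E3 => ‖z‖⁻¹ • z) x = _ := h7.fderiv
  rw [h8]
  simp [h2]

/-- Rotation fields are antisymmetric: the integral of `Ω_i h` over the unit sphere vanishes. -/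
theorem integral_sphere_rotGen {h : E3 → ℝ} (hh : ∀ y ∈ Metric.sphere (0 : E3) 1, ContDiffAt ℝ 1 h y)
    (i : Fin 3) : ∫ y : S2, fderiv ℝ h y (rotGen i y) ∂dω = 0 := by
  -- The statement is lifted to `ℝ³`: `h` is extended to be homogeneous of degree zero and
  -- multiplied by a radial bump that vanishes near the origin. Rotations annihilate the bump, and
  -- polar coordinates split the vanishing volume integral into the sphere integral times a radial
  -- integral.
  set N : E3 → E3 := fun z => ‖z‖⁻¹ • z with hN
  have hNs : ∀ x : E3, x ≠ 0 → N x ∈ Metric.sphere (0 : E3) 1 := by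
    intro x hx
    simp [hN, norm_smul, hx]
  set κ : E3 → ℝ := fun x => annulusBump ‖x‖ with hκ
  have hκs : ContDiff ℝ ∞ κ := by
    have h1 : ContDiff ℝ ∞ fun x : E3 => ‖x‖ ^ 2 := contDiff_norm_sq ℝ
    exact (Real.smoothTransition.contDiff.comp (h1.sub contDiff_const)).mul
      (Real.smoothTransition.contDiff.comp (contDiff_const.sub h1))
  have hκ0 : ∀ x : E3, ‖x‖ ≤ 1 → κ x = 0 := by
    intro x hx
    simp only [hκ, annulusBump]
    rw [Real.smoothTransition.zero_of_nonpos (by nlinarith [norm_nonneg x]), zero_mul]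
  have hκ2 : ∀ x : E3, 2 ≤ ‖x‖ → κ x = 0 := by
    intro x hx
    simp only [hκ, annulusBump]
    rw [Real.smoothTransition.zero_of_nonpos (x := 4 - ‖x‖ ^ 2) (by nlinarith [norm_nonneg x]),
      mul_zero]
  have hcsκ : HasCompactSupport κ := by
    refine HasCompactSupport.intro (isCompact_closedBall (0 : E3) 2) fun x hx => hκ2 x ?_
    simp at hx
    exact hx.le
  set F : E3 → ℝ := fun x => κ x * h (N x) with hFdef
  have hNd : ∀ x : E3, x ≠ 0 → ContDiffAt ℝ ∞ N x := by
    intro x hx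
    exact ((contDiffAt_norm ℝ hx).inv (norm_ne_zero_iff.mpr hx)).smul contDiffAt_id
  have hF : ContDiff ℝ 1 F := by
    rw [contDiff_iff_contDiffAt]
    intro x
    by_cases hx : x = 0
    · subst hx
      have : F =ᶠ[𝓝 0] fun _ => 0 := by
        filter_upwards [Metric.ball_mem_nhds (0 : E3) one_pos] with z hz
        simp only [hFdef]
        rw [hκ0 z (by simpa using (Metric.mem_ball.mp hz).le), zero_mul]
      exact contDiffAt_const.congr_of_eventuallyEq this
    · have h1 : ContDiffAt ℝ 1 N x := (hNd x hx).of_le (by exact_mod_cast le_top)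
      have h2 : ContDiffAt ℝ 1 κ x := hκs.contDiffAt.of_le (by exact_mod_cast le_top)
      exact h2.mul ((hh _ (hNs x hx)).comp x h1)
  have hcs : HasCompactSupport F := hcsκ.mul_right
  have h0 := integral_fderiv_rotGen hF hcs i
  have hform : ∀ x : E3, fderiv ℝ F x (rotGen i x)
      = κ x * fderiv ℝ h (N x) (rotGen i (N x)) := by
    intro x
    by_cases hx : x = 0
    · subst hx
      have : F =ᶠ[𝓝 0] fun _ => 0 := by
        filter_upwards [Metric.ball_mem_nhds (0 : E3) one_pos] with z hz
        simp only [hFdef]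
        rw [hκ0 z (by simpa using (Metric.mem_ball.mp hz).le), zero_mul]
      rw [this.fderiv_eq, hκ0 0 (by simp)]
      simp
    · have hv := inner_rotGen_self i x
      obtain ⟨hd, hfd⟩ := hasFDerivAt_inv_norm_smul hx _ hv
      have h1 : HasFDerivAt h (fderiv ℝ h (N x)) (N x) :=
        ((hh _ (hNs x hx)).differentiableAt one_ne_zero).hasFDerivAt
      have h2 : HasFDerivAt κ (fderiv ℝ κ x) x :=
        (hκs.differentiable (by simp)).differentiableAt.hasFDerivAt
      have h3 := h2.mul (h1.comp x hd.hasFDerivAt)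
      have h4 : fderiv ℝ κ x (rotGen i x) = 0 := by
        have h5 : HasFDerivAt (fun z : E3 => ‖z‖ ^ 2) (2 • (innerSL ℝ x)) x := by
          simpa using (hasFDerivAt_id x).norm_sq
        have hst : ∀ t, HasDerivAt Real.smoothTransition (deriv Real.smoothTransition t) t :=
          fun t => (Real.smoothTransition.contDiff (n := 1)
            |>.differentiable one_ne_zero).differentiableAt.hasDerivAt
        have h6 := ((hst _).comp_hasFDerivAt x (h5.sub_const 1)).mul
          ((hst _).comp_hasFDerivAt x (h5.const_sub 4))
        have h7 : fderiv ℝ κ x = _ := HasFDerivAt.fderiv h6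
        rw [h7]
        simp [hv]
      have h8 : fderiv ℝ F x = _ := HasFDerivAt.fderiv h3
      rw [h8]
      simp [h4]
      left
      rw [hfd, rotGen_smul]
  simp only [hform] at h0
  have hNy : ∀ y : S2, ∀ r : ℝ, 0 < r → N (r • (y : E3)) = y := by
    intro y r hr
    have : ‖(y : E3)‖ = 1 := by simp
    simp only [hN, norm_smul, this, mul_one, Real.norm_eq_abs, abs_of_pos hr, smul_smul]
    rw [inv_mul_cancel₀ hr.ne', one_smul]
  have e1 := integral_radial_mul_angular annulusBump
    (fun y => fderiv ℝ h y (rotGen i y)) (fun x => fderiv ℝ h (N x) (rotGen i (N x)))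
    (fun y r hr => by rw [hNy y r hr])
  -- The same splitting with angular factor `1` expresses the positive volume integral of the bump
  -- through the same radial integral, which therefore is not zero.
  have e2 := integral_radial_mul_angular annulusBump (fun _ => 1) (fun _ => 1)
    (fun y r hr => rfl)
  simp only [hκ] at h0
  rw [h0] at e1
  have hpos : 0 < ∫ x : E3, annulusBump ‖x‖ * 1 := by
    simp only [mul_one]
    have hx0 : κ (EuclideanSpace.single 0 (3 / 2)) ≠ 0 := by
      simp only [hκ, annulusBump]
      have : ‖(EuclideanSpace.single 0 (3 / 2 : ℝ) : E3)‖ = 3 / 2 := by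
        simp
      rw [this]
      exact (mul_pos (Real.smoothTransition.pos_of_pos (by norm_num))
        (Real.smoothTransition.pos_of_pos (by norm_num))).ne'
    exact hκs.continuous.integral_pos_of_hasCompactSupport_nonneg_nonzero hcsκ
      (fun x => mul_nonneg (Real.smoothTransition.nonneg _) (Real.smoothTransition.nonneg _)) hx0
  rw [e2] at hpos
  rcases mul_eq_zero.mp e1.symm with h | h
  · exact h
  · rw [h, mul_zero] at hpos
    exact absurd hpos (lt_irrefl _)

end RpHierarchy

/-! ### Polynomials on the sphere: Bochner's inequality and the sharp Poincaré inequality. -/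

namespace RpHierarchy

/-- Polynomials in the three coordinates of `E3`. -/
abbrev Poly3 := MvPolynomial (Fin 3) ℝ

open MvPolynomial

/-- The value of a polynomial at a point of `E3`. -/
def polyEval (q : Poly3) (x : E3) : ℝ := eval (fun i => x i) q

/-- The rotation fields as derivations of the polynomial ring. -/
def rotD (i : Fin 3) : Derivation ℝ Poly3 Poly3 :=
  mkDerivation ℝ ((![![0, X 2, -X 1], ![-X 2, 0, X 0], ![-X 1, X 0, 0]] : Fin 3 → Fin 3 → Poly3) i)

lemma contDiff_polyEval (q : Poly3) : ContDiff ℝ ∞ (polyEval q) := by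
  induction q using MvPolynomial.induction_on with
  | C a =>
    have : polyEval (C a) = fun _ => a := by ext x; simp [polyEval]
    rw [this]; exact contDiff_const
  | add p q hp hq =>
    have : polyEval (p + q) = fun x => polyEval p x + polyEval q x := by
      ext x; simp [polyEval]
    rw [this]; exact hp.add hq
  | mul_X p i hp =>
    have : polyEval (p * X i) = fun x => polyEval p x * x i := by
      ext x; simp [polyEval]
    rw [this]; exact hp.mul (by fun_prop)

lemma fderiv_polyEval (q : Poly3) (i : Fin 3) (x : E3) :
    fderiv ℝ (polyEval q) x (rotGen i x) = polyEval (rotD i q) x := by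
  have hd : ∀ q : Poly3, DifferentiableAt ℝ (polyEval q) x := fun q =>
    ((contDiff_polyEval q).differentiable (by simp)).differentiableAt
  induction q using MvPolynomial.induction_on with
  | C a =>
    have : polyEval (C a) = fun _ => a := by ext x; simp [polyEval]
    rw [this]
    simp [polyEval]
  | add p q hp hq =>
    have : polyEval (p + q) = fun x => polyEval p x + polyEval q x := by
      ext x; simp [polyEval]
    rw [this, fderiv_fun_add (hd p) (hd q)]
    simp only [add_apply, hp, hq, map_add]
    simp [polyEval]
  | mul_X p j hp =>
    have : polyEval (p * X j) = fun x => polyEval p x * x j := by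
      ext x; simp [polyEval]
    have hc : HasFDerivAt (fun x : E3 => x j) (EuclideanSpace.proj j : E3 →L[ℝ] ℝ) x :=
      (EuclideanSpace.proj j : E3 →L[ℝ] ℝ).hasFDerivAt
    have h2 := ((hd p).hasFDerivAt.mul hc).fderiv
    rw [this]
    have h3 : fderiv ℝ (fun x : E3 => polyEval p x * x j) x = _ := h2
    rw [h3, Derivation.leibniz]
    simp only [add_apply, smul_apply, hp, smul_eq_mul]
    have h4 : rotGen i x j = polyEval (rotD i (X j)) x := by
      fin_cases i <;> fin_cases j <;> simp [rotD, rotGen, polyEval, mkDerivation_X]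
    rw [show (EuclideanSpace.proj j : E3 →L[ℝ] ℝ) (rotGen i x) = _ from h4]
    simp [polyEval]

/-- A derivation of a polynomial ring is determined by its values on the variables, so the `so(3)`
relations need to be checked there only. -/
lemma rotD_commutator (i j k : Fin 3) (h : (i, j, k) ∈ [((0 : Fin 3), (1 : Fin 3), (2 : Fin 3)),
    (1, 2, 0), (2, 0, 1)]) (q : Poly3) :
    rotD i (rotD j q) = rotD j (rotD i q) - rotD k q := by
  have : ⁅rotD i, rotD j⁆ = -rotD k := by
    refine derivation_ext fun l => ?_
    simp only [List.mem_cons, Prod.mk.injEq, List.not_mem_nil, or_false] at h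
    rcases h with ⟨rfl, rfl, rfl⟩ | ⟨rfl, rfl, rfl⟩ | ⟨rfl, rfl, rfl⟩ <;> fin_cases l <;>
      simp [Derivation.commutator_apply, rotD, mkDerivation_X]
  have h2 := congrArg (fun D : Derivation ℝ Poly3 Poly3 => D q) this
  simp only [Derivation.commutator_apply, Derivation.neg_apply] at h2
  linear_combination h2

/-- The spherical Laplacian `Σ Ω_i²` on polynomials. -/
def rotLap (q : Poly3) : Poly3 := ∑ i, rotD i (rotD i q)

/-- The Casimir operator commutes with the generators: the commutator contributions of the two other
generators cancel in pairs. -/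
lemma rotD_rotLap (i : Fin 3) (q : Poly3) :
    rotD i (rotLap q) = ∑ j, rotD j (rotD j (rotD i q)) := by
  have h01 := rotD_commutator 0 1 2 (by simp)
  have h12 := rotD_commutator 1 2 0 (by simp)
  have h20 := rotD_commutator 2 0 1 (by simp)
  simp only [rotLap, Fin.sum_univ_three, map_add]
  fin_cases i
  · simp only [Fin.zero_eta, h01, h20, map_sub]
    ring
  · simp only [Fin.mk_one, h01, h12, map_sub]
    ring
  · simp only [Fin.reduceFinMk, h12, h20, map_sub]
    ring

lemma pderiv_comm (i j : Fin 3) (q : Poly3) : pderiv i (pderiv j q) = pderiv j (pderiv i q) := by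
  have : ⁅(pderiv i : Derivation ℝ Poly3 Poly3), (pderiv j : Derivation ℝ Poly3 Poly3)⁆ = 0 := by
    refine derivation_ext fun l => ?_
    simp only [Derivation.commutator_apply, pderiv_X, Derivation.coe_zero, Pi.zero_apply]
    simp only [Pi.single_apply]
    split_ifs <;> simp
  have h2 := congrArg (fun D : Derivation ℝ Poly3 Poly3 => D q) this
  simp only [Derivation.commutator_apply, Derivation.coe_zero, Pi.zero_apply] at h2
  linear_combination h2

/-- The Laplacian on polynomials. -/
def polyLap (q : Poly3) : Poly3 := ∑ i, pderiv i (pderiv i q)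

lemma rotD_eq (q : Poly3) : rotD 0 q = X 2 * pderiv 1 q - X 1 * pderiv 2 q ∧
    rotD 1 q = X 0 * pderiv 2 q - X 2 * pderiv 0 q ∧
    rotD 2 q = X 0 * pderiv 1 q - X 1 * pderiv 0 q := by
  have key : ∀ i a b, ∀ c d : Fin 3, (∀ l : Fin 3, rotD i (X l) =
      (a • pderiv c - b • pderiv d : Derivation ℝ Poly3 Poly3) (X l)) →
      rotD i q = a * pderiv c q - b * pderiv d q := by
    intro i a b c d h
    have h2 := congrArg (fun D : Derivation ℝ Poly3 Poly3 => D q) (derivation_ext h)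
    simpa using h2
  refine ⟨key _ _ _ _ _ fun l => ?_, key _ _ _ _ _ fun l => ?_, key _ _ _ _ _ fun l => ?_⟩ <;>
  fin_cases l <;> simp [rotD, mkDerivation_X, pderiv_X]

/-- `Σ Ω_i² = |x|²Δ - E(E+1)` with the Euler field `E`, which acts as the scalar `n` on homogeneous
polynomials of degree `n`; Euler's identity is used for `q` and for `E q`. -/
lemma rotLap_eq {q : Poly3} {n : ℕ} (hq : q.IsHomogeneous n) :
    rotLap q = (∑ i, X i ^ 2) * polyLap q - ((n : ℝ) * (n + 1)) • q := by
  have hE := hq.sum_X_mul_pderiv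
  have hE2 : ∑ i : Fin 3, X i * pderiv i q = (C (n : ℝ) : Poly3) * q := by
    rw [hE, nsmul_eq_mul]; simp
  have hEE2 : ∑ i : Fin 3, X i * pderiv i (∑ j : Fin 3, X j * pderiv j q)
      = (C (n : ℝ) : Poly3) * (C (n : ℝ) * q) := by
    rw [hE2, ← hE2, Finset.mul_sum]
    refine Finset.sum_congr rfl fun i _ => ?_
    rw [hE2, Derivation.leibniz, pderiv_C]
    simp only [smul_eq_mul, mul_zero, add_zero]
    ring
  have hs : ((n : ℝ) * (n + 1)) • q = (C (n : ℝ) : Poly3) * (C (n : ℝ) * q) + C (n : ℝ) * q := by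
    rw [smul_eq_C_mul]; simp only [map_mul, map_add, map_one]; ring
  rw [hs, ← hEE2, ← hE2]
  have c01 := pderiv_comm 0 1 q
  have c02 := pderiv_comm 0 2 q
  have c12 := pderiv_comm 1 2 q
  simp only [rotLap, polyLap, Fin.sum_univ_three]
  obtain ⟨e0, e1, e2⟩ := rotD_eq q
  rw [e0, e1, e2, (rotD_eq _).1, (rotD_eq _).2.1, (rotD_eq _).2.2]
  simp only [map_add, map_sub, Derivation.leibniz, pderiv_X, smul_eq_mul, Pi.single_apply]
  simp only [Fin.isValue, one_ne_zero, zero_ne_one, if_false, if_true, Fin.reduceEq]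
  rw [c01, c02, c12]
  ring

lemma polyEval_normSq {x : E3} (hx : x ∈ Metric.sphere (0 : E3) 1) :
    x 0 ^ 2 + x 1 ^ 2 + x 2 ^ 2 = 1 := by
  have h1 : ‖x‖ = 1 := by simpa using hx
  have h2 := EuclideanSpace.real_norm_sq_eq x
  rw [h1, Fin.sum_univ_three] at h2
  linarith

/-- Every polynomial is, on the unit sphere, a spherical Laplacian plus a constant. -/
lemma exists_rotLap_of_homogeneous (n : ℕ) : ∀ q : Poly3, q.IsHomogeneous n →
    ∃ k : Poly3, ∃ c : ℝ, ∀ x ∈ Metric.sphere (0 : E3) 1,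
      polyEval q x = polyEval (rotLap k) x + c := by
  induction n using Nat.strong_induction_on with
  | _ n ih =>
    intro q hq
    rcases Nat.eq_zero_or_pos n with rfl | hn
    · rw [← totalDegree_zero_iff_isHomogeneous, totalDegree_eq_zero_iff_eq_C] at hq
      refine ⟨0, coeff 0 q, fun x _ => ?_⟩
      rw [hq]
      simp [polyEval, rotLap]
    · have hL : (polyLap q).IsHomogeneous (n - 1 - 1) :=
        IsHomogeneous.sum _ _ _ fun i _ => hq.pderiv.pderiv
      obtain ⟨k, c, hk⟩ := ih (n - 1 - 1) (by omega) _ hL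
      set a : ℝ := (n : ℝ) * (n + 1) with ha
      have ha0 : a ≠ 0 := by positivity
      -- On the sphere `rotLap_eq` reads `a q = Δq - rotLap q` with `a = n(n+1) ≠ 0`, and the
      -- induction hypothesis writes `Δq` as `rotLap k + c`. The truncated degree `n - 1 - 1` is
      -- harmless for `n = 1`, where `Δq` vanishes.
      refine ⟨a⁻¹ • (k - q), a⁻¹ * c, fun x hx => ?_⟩
      have h1 := congrArg (fun q => polyEval q x) (rotLap_eq hq)
      have h2 := polyEval_normSq hx
      have h3 := hk x hx
      have h4 : polyEval (rotLap (a⁻¹ • (k - q))) x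
          = a⁻¹ * (polyEval (rotLap k) x - polyEval (rotLap q) x) := by
        simp only [rotLap, polyEval, Derivation.map_smul, map_sub, Fin.sum_univ_three, map_add, smul_eval]
        ring
      rw [h4]
      have h5 : polyEval (rotLap q) x = polyEval (polyLap q) x - a * polyEval q x := by
        rw [h1]
        simp only [polyEval, map_sub, map_mul, Fin.sum_univ_three, map_add, map_pow, eval_X,
          smul_eval, ← ha, h2, one_mul]
      rw [h5, h3]
      field_simp
      ring

lemma exists_rotLap (q : Poly3) : ∃ k : Poly3, ∃ c : ℝ, ∀ x ∈ Metric.sphere (0 : E3) 1,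
    polyEval q x = polyEval (rotLap k) x + c := by
  induction q using MvPolynomial.induction_on' with
  | monomial u a => exact exists_rotLap_of_homogeneous _ _ (isHomogeneous_monomial a rfl)
  | add p q hp hq =>
    obtain ⟨k, c, hk⟩ := hp
    obtain ⟨k', c', hk'⟩ := hq
    refine ⟨k + k', c + c', fun x hx => ?_⟩
    have h1 := hk x hx
    have h2 := hk' x hx
    simp only [polyEval, rotLap, map_add, Finset.sum_add_distrib] at h1 h2 ⊢
    rw [h1, h2]
    ring

lemma integrable_sphere {f : S2 → ℝ} (hf : Continuous f) : Integrable f dω :=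
  hf.integrable_of_hasCompactSupport (HasCompactSupport.of_compactSpace f)

lemma continuous_polyEval_sphere (q : Poly3) : Continuous fun y : S2 => polyEval q y :=
  (contDiff_polyEval q).continuous.comp continuous_subtype_val

lemma integral_rotD (i : Fin 3) (q : Poly3) : ∫ y : S2, polyEval (rotD i q) y ∂dω = 0 := by
  rw [← integral_sphere_rotGen (h := polyEval q)
    (fun y _ => (contDiff_polyEval q).contDiffAt.of_le (by exact_mod_cast le_top)) i]
  refine integral_congr_ae (.of_forall fun y => (fderiv_polyEval q i y).symm)

lemma integral_mul_rotD (i : Fin 3) (p q : Poly3) :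
    ∫ y : S2, polyEval p y * polyEval (rotD i q) y ∂dω
      = -∫ y : S2, polyEval (rotD i p) y * polyEval q y ∂dω := by
  have h := integral_rotD i (p * q)
  have e : ∀ y : S2, polyEval (rotD i (p * q)) y
      = polyEval p y * polyEval (rotD i q) y + polyEval (rotD i p) y * polyEval q y := by
    intro y
    rw [Derivation.leibniz]
    simp only [polyEval, smul_eq_mul, map_add, map_mul]
    ring
  simp only [e] at h
  rw [integral_add] at h
  · linarith
  · exact integrable_sphere ((continuous_polyEval_sphere _).mul (continuous_polyEval_sphere _))
  · exact integrable_sphere ((continuous_polyEval_sphere _).mul (continuous_polyEval_sphere _))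

/-- The algebra behind the pointwise Bochner inequality. -/
lemma bochner_algebra (T : Fin 3 → Fin 3 → ℝ) (n v w : Fin 3 → ℝ) (hn : ∑ i, n i ^ 2 = 1)
    (hT : ∀ i, ∑ j, n j * T j i = 0) (hw : ∀ j, ∑ i, T j i * n i = w j)
    (hwv : ∑ i, w i ^ 2 = ∑ i, v i ^ 2) :
    (∑ i, T i i) ^ 2 / 2 + ∑ i, v i ^ 2 ≤ ∑ i, ∑ j, T j i ^ 2 := by
  -- Cauchy-Schwarz for `T - w⊗n` against the tangential projection `I - n⊗n`: the pairing is the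
  -- trace of `T`, the projection has squared norm `2`, and `|T - w⊗n|² = |T|² - |w|²` because `T n
  -- = w`.
  have hcs := Finset.sum_mul_sq_le_sq_mul_sq (Finset.univ : Finset (Fin 3 × Fin 3))
    (fun z => T z.1 z.2 - w z.1 * n z.2) (fun z => (if z.1 = z.2 then 1 else 0) - n z.1 * n z.2)
  simp only [Fintype.sum_prod_type, Fin.sum_univ_three] at hcs hn hT hw hwv ⊢
  have t0 := hT 0
  have t1 := hT 1
  have t2 := hT 2
  have w0 := hw 0
  have w1 := hw 1
  have w2 := hw 2
  simp only [Fin.isValue, one_ne_zero, zero_ne_one, if_false, if_true, Fin.reduceEq] at hcs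
  have hnw : n 0 * w 0 + n 1 * w 1 + n 2 * w 2 = 0 := by
    rw [← w0, ← w1, ← w2]
    linear_combination n 0 * t0 + n 1 * t1 + n 2 * t2
  generalize hA : (T 0 0 - w 0 * n 0) * (1 - n 0 * n 0) +
    (T 0 1 - w 0 * n 1) * (0 - n 0 * n 1) + (T 0 2 - w 0 * n 2) * (0 - n 0 * n 2) +
    ((T 1 0 - w 1 * n 0) * (0 - n 1 * n 0) + (T 1 1 - w 1 * n 1) * (1 - n 1 * n 1) +
    (T 1 2 - w 1 * n 2) * (0 - n 1 * n 2)) +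
    ((T 2 0 - w 2 * n 0) * (0 - n 2 * n 0) + (T 2 1 - w 2 * n 1) * (0 - n 2 * n 1) +
    (T 2 2 - w 2 * n 2) * (1 - n 2 * n 2)) = A at hcs
  have hA2 : A = T 0 0 + T 1 1 + T 2 2 := by
    rw [← hA]
    linear_combination -n 0 * t0 - n 1 * t1 - n 2 * t2
      + (n 0 * w 0 + n 1 * w 1 + n 2 * w 2) * hn
  have hB : (1 - n 0 * n 0) ^ 2 + (0 - n 0 * n 1) ^ 2 + (0 - n 0 * n 2) ^ 2 +
      ((0 - n 1 * n 0) ^ 2 + (1 - n 1 * n 1) ^ 2 + (0 - n 1 * n 2) ^ 2) +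
      ((0 - n 2 * n 0) ^ 2 + (0 - n 2 * n 1) ^ 2 + (1 - n 2 * n 2) ^ 2) = 2 := by
    linear_combination (n 0 ^ 2 + n 1 ^ 2 + n 2 ^ 2 - 1) * hn
  have hC : (T 0 0 - w 0 * n 0) ^ 2 + (T 0 1 - w 0 * n 1) ^ 2 + (T 0 2 - w 0 * n 2) ^ 2 +
      ((T 1 0 - w 1 * n 0) ^ 2 + (T 1 1 - w 1 * n 1) ^ 2 + (T 1 2 - w 1 * n 2) ^ 2) +
      ((T 2 0 - w 2 * n 0) ^ 2 + (T 2 1 - w 2 * n 1) ^ 2 + (T 2 2 - w 2 * n 2) ^ 2)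
      = T 0 0 ^ 2 + T 1 0 ^ 2 + T 2 0 ^ 2 + (T 0 1 ^ 2 + T 1 1 ^ 2 + T 2 1 ^ 2) +
        (T 0 2 ^ 2 + T 1 2 ^ 2 + T 2 2 ^ 2) - (v 0 ^ 2 + v 1 ^ 2 + v 2 ^ 2) := by
    linear_combination -2 * w 0 * w0 - 2 * w 1 * w1 - 2 * w 2 * w2 - hwv
      + (w 0 ^ 2 + w 1 ^ 2 + w 2 ^ 2) * hn
  rw [hA2, hB, hC] at hcs
  linarith

/-- The rows of `T_{ji} = Ω_jΩ_i k` are not tangential: differentiating the relation `n·Ωk = 0`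
shows that `T n = w` with `w = -n × Ωk`, which has the length of `Ωk`. This part is the curvature
contribution, and the rest is bounded below by its trace. The unit vector is `n = (x, y, -z)`; the
minus sign comes from the orientation of `Ω₃` relative to `Ω₁` and `Ω₂`. -/
lemma bochner_pointwise (k : Poly3) {x : E3} (hx : x ∈ Metric.sphere (0 : E3) 1) :
    polyEval (rotLap k) x ^ 2 / 2 + ∑ i, polyEval (rotD i k) x ^ 2
      ≤ ∑ i, ∑ j, polyEval (rotD j (rotD i k)) x ^ 2 := by
  have hc : ∀ q : Poly3, X 0 * rotD 0 q + X 1 * rotD 1 q - X 2 * rotD 2 q = 0 := by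
    intro q
    rw [(rotD_eq q).1, (rotD_eq q).2.1, (rotD_eq q).2.2]
    ring
  have hsph := polyEval_normSq hx
  have hce : ∀ q : Poly3, x 0 * polyEval (rotD 0 q) x + x 1 * polyEval (rotD 1 q) x
      - x 2 * polyEval (rotD 2 q) x = 0 := by
    intro q
    have := congrArg (fun q => polyEval q x) (hc q)
    simpa [polyEval] using this
  have hd : ∀ j : Fin 3, polyEval (rotD j (X 0)) x * polyEval (rotD 0 k) x
      + x 0 * polyEval (rotD j (rotD 0 k)) x
      + (polyEval (rotD j (X 1)) x * polyEval (rotD 1 k) x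
      + x 1 * polyEval (rotD j (rotD 1 k)) x)
      - (polyEval (rotD j (X 2)) x * polyEval (rotD 2 k) x
      + x 2 * polyEval (rotD j (rotD 2 k)) x) = 0 := by
    intro j
    have := congrArg (fun q => polyEval (rotD j q) x) (hc k)
    simp only [map_add, map_sub, Derivation.leibniz, smul_eq_mul, map_zero] at this
    simp only [polyEval, map_add, map_sub, map_mul, eval_X, map_zero] at this ⊢
    linear_combination this
  have h := bochner_algebra (fun j i => polyEval (rotD j (rotD i k)) x)
    ![x 0, x 1, -x 2] (fun i => polyEval (rotD i k) x)
    ![-(x 2 * polyEval (rotD 1 k) x + x 1 * polyEval (rotD 2 k) x),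
      x 2 * polyEval (rotD 0 k) x + x 0 * polyEval (rotD 2 k) x,
      x 1 * polyEval (rotD 0 k) x - x 0 * polyEval (rotD 1 k) x] ?_ ?_ ?_ ?_
  · have e : polyEval (rotLap k) x = ∑ i, polyEval (rotD i (rotD i k)) x := by
      simp [rotLap, polyEval]
    rw [e]
    exact h
  · simp only [Fin.sum_univ_three]
    simpa using hsph
  · intro i
    have := hce (rotD i k)
    simp only [Fin.sum_univ_three]
    simp
    linarith
  · intro j
    have := hd j
    have e0 : polyEval (rotD j (X 0)) x = rotGen j x 0 := by
      fin_cases j <;> simp [rotD, rotGen, polyEval, mkDerivation_X]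
    have e1 : polyEval (rotD j (X 1)) x = rotGen j x 1 := by
      fin_cases j <;> simp [rotD, rotGen, polyEval, mkDerivation_X]
    have e2 : polyEval (rotD j (X 2)) x = rotGen j x 2 := by
      fin_cases j <;> simp [rotD, rotGen, polyEval, mkDerivation_X]
    rw [e0, e1, e2] at this
    simp only [Fin.sum_univ_three]
    fin_cases j <;> simp [rotGen] at this ⊢ <;> linarith
  · have := hce k
    simp only [Fin.sum_univ_three]
    simp
    linear_combination (polyEval (rotD 0 k) x ^ 2 + polyEval (rotD 1 k) x ^ 2
      + polyEval (rotD 2 k) x ^ 2) * hsph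
      - (x 0 * polyEval (rotD 0 k) x + x 1 * polyEval (rotD 1 k) x
      - x 2 * polyEval (rotD 2 k) x) * this

/-- The integrated Bochner inequality on the unit sphere, for polynomials. -/
lemma bochner_integral (k : Poly3) :
    2 * ∑ i, ∫ y : S2, polyEval (rotD i k) y ^ 2 ∂dω ≤ ∫ y : S2, polyEval (rotLap k) y ^ 2 ∂dω := by
  have hint : ∀ p q : Poly3, Integrable (fun y : S2 => polyEval p y * polyEval q y) dω := fun p q =>
    integrable_sphere ((continuous_polyEval_sphere _).mul (continuous_polyEval_sphere _))
  have hint2 : ∀ p : Poly3, Integrable (fun y : S2 => polyEval p y ^ 2) dω := fun p =>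
    integrable_sphere ((continuous_polyEval_sphere _).pow 2)
  -- One derivative of the second factor is moved to the first, carried through the Casimir operator
  -- by `rotD_rotLap`, and a second integration by parts leaves the full sum of squares. No
  -- curvature term appears here; it sits entirely in the pointwise inequality.
  have h1 : ∫ y : S2, polyEval (rotLap k) y ^ 2 ∂dω
      = ∑ i, ∑ j, ∫ y : S2, polyEval (rotD j (rotD i k)) y ^ 2 ∂dω := by
    have e1 : ∀ y : S2, polyEval (rotLap k) y ^ 2
        = ∑ i, polyEval (rotLap k) y * polyEval (rotD i (rotD i k)) y := by
      intro y
      rw [← Finset.mul_sum, sq]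
      congr 1
      simp [rotLap, polyEval]
    simp only [e1]
    rw [integral_finsetSum _ fun i _ => hint _ _]
    refine Finset.sum_congr rfl fun i _ => ?_
    rw [integral_mul_rotD, rotD_rotLap]
    have e2 : ∀ y : S2, polyEval (∑ j, rotD j (rotD j (rotD i k))) y * polyEval (rotD i k) y
        = ∑ j, polyEval (rotD i k) y * polyEval (rotD j (rotD j (rotD i k))) y := by
      intro y
      rw [← Finset.mul_sum, mul_comm]
      congr 1
      simp [polyEval]
    simp only [e2]
    rw [integral_finsetSum _ fun i _ => hint _ _, ← Finset.sum_neg_distrib]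
    refine Finset.sum_congr rfl fun j _ => ?_
    rw [integral_mul_rotD, neg_neg]
    simp only [sq]
  have h2 : ∫ y : S2, (polyEval (rotLap k) y ^ 2 / 2 + ∑ i, polyEval (rotD i k) y ^ 2) ∂dω
      ≤ ∫ y : S2, ∑ i, ∑ j, polyEval (rotD j (rotD i k)) y ^ 2 ∂dω := by
    refine integral_mono ?_ ?_ fun y => bochner_pointwise k y.2
    · exact ((hint2 _).div_const 2).add (integrable_finsetSum _ fun i _ => hint2 _)
    · exact integrable_finsetSum _ fun i _ => integrable_finsetSum _ fun j _ => hint2 _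
  rw [integral_add ((hint2 _).div_const 2) (integrable_finsetSum _ fun i _ => hint2 _),
    integral_div, integral_finsetSum _ (fun i _ => hint2 _),
    integral_finsetSum _ (fun i _ => integrable_finsetSum _ fun j _ => hint2 _)] at h2
  simp only [integral_finsetSum _ (fun j _ => hint2 _)] at h2
  rw [← h1] at h2
  linarith

/-- The coordinate functions on the sphere. -/
def coordMap (i : Fin 3) : C(S2, ℝ) := ⟨fun y => (y : E3) i, by fun_prop⟩

lemma coordMap_apply (i : Fin 3) (y : S2) : coordMap i y = (y : E3) i := rfl

lemma separatesPoints_coordMap : (Algebra.adjoin ℝ (range coordMap)).SeparatesPoints := by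
  intro y z hyz
  have : ∃ i, (y : E3) i ≠ (z : E3) i := by
    by_contra hcon
    push Not at hcon
    exact hyz (Subtype.ext (PiLp.ext hcon))
  obtain ⟨i, hi⟩ := this
  refine ⟨fun y => coordMap i y, ⟨coordMap i, ?_, rfl⟩, hi⟩
  exact Algebra.subset_adjoin (mem_range_self i)

lemma aeval_coordMap (q : Poly3) (y : S2) : (aeval coordMap q : C(S2, ℝ)) y = polyEval q y := by
  induction q using MvPolynomial.induction_on with
  | C a => simp [polyEval]
  | add p q hp hq =>
    rw [map_add, ContinuousMap.add_apply, hp, hq]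
    simp [polyEval]
  | mul_X p j hp =>
    rw [map_mul, ContinuousMap.mul_apply, hp, aeval_X, coordMap_apply]
    simp [polyEval]

/-- Polynomials are uniformly dense in the continuous functions on the sphere. -/
lemma exists_poly_near {h : S2 → ℝ} (hh : Continuous h) {ε : ℝ} (hε : 0 < ε) :
    ∃ q : Poly3, ∀ y : S2, |polyEval q y - h y| < ε := by
  obtain ⟨G, hG⟩ := ContinuousMap.exists_mem_subalgebra_near_continuous_of_separatesPoints
    _ separatesPoints_coordMap h hh ε hε
  have hm : (G : C(S2, ℝ)) ∈ (aeval coordMap : Poly3 →ₐ[ℝ] C(S2, ℝ)).range := by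
    rw [← Algebra.adjoin_range_eq_range_aeval]
    exact G.2
  obtain ⟨q, hq⟩ := hm
  refine ⟨q, fun y => ?_⟩
  have h1 : polyEval q y = (G : C(S2, ℝ)) y := by
    rw [← aeval_coordMap q y]
    exact congrArg (fun F : C(S2, ℝ) => F y) hq
  have h2 := hG y
  rw [Real.norm_eq_abs] at h2
  rw [h1]
  exact h2

/-- The sharp Poincaré inequality on the unit sphere: the first eigenvalue is `2`. -/
theorem sphere_poincare {h : E3 → ℝ} (hh : ∀ y ∈ Metric.sphere (0 : E3) 1, ContDiffAt ℝ 1 h y)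
    (hmean : ∫ y : S2, h y ∂dω = 0) :
    2 * ∫ y : S2, h y ^ 2 ∂dω ≤ ∫ y : S2, ∑ i, fderiv ℝ h y (rotGen i y) ^ 2 ∂dω := by
  have hc : Continuous fun y : S2 => h y := continuous_iff_continuousAt.mpr fun y =>
    (hh y y.2).continuousAt.comp continuous_subtype_val.continuousAt
  have hdc : ∀ i, Continuous fun y : S2 => fderiv ℝ h y (rotGen i y) := by
    intro i
    rw [continuous_iff_continuousAt]
    intro y
    have h1 : ContinuousAt (fderiv ℝ h) y := (hh y y.2).continuousAt_fderiv one_ne_zero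
    have h2 : ContinuousAt (fun x : E3 => fderiv ℝ h x (rotGen i x)) y :=
      h1.clm_apply (contDiff_rotGen i).continuous.continuousAt
    exact ContinuousAt.comp (f := fun y : S2 => (y : E3)) h2 continuous_subtype_val.continuousAt
  set N : ℝ := ∫ y : S2, ∑ i, fderiv ℝ h y (rotGen i y) ^ 2 ∂dω with hN
  have hNint : Integrable (fun y : S2 => ∑ i, fderiv ℝ h y (rotGen i y) ^ 2) dω :=
    integrable_sphere (continuous_finsetSum _ fun i _ => (hdc i).pow 2)
  -- Duality. On the sphere `q = rotLap k + c`; the mean zero condition on `h` removes `c`, and one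
  -- integration by parts gives `-Σ∫ Ω_ih Ω_ik ≤ N/4 + Σ∫(Ω_ik)²`. The last sum is at most half of
  -- `∫(rotLap k)²` by Bochner, and `∫(rotLap k)² ≤ ∫q²` because `rotLap k` has mean zero. Only one
  -- derivative of `h` is used.
  have key : ∀ q : Poly3, ∫ y : S2, h y * polyEval q y ∂dω
      ≤ N / 4 + (∫ y : S2, polyEval q y ^ 2 ∂dω) / 2 := by
    intro q
    obtain ⟨k, c, hk⟩ := exists_rotLap q
    have hcq := continuous_polyEval_sphere
    have e1 : ∫ y : S2, h y * polyEval q y ∂dω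
        = ∑ i, ∫ y : S2, h y * polyEval (rotD i (rotD i k)) y ∂dω := by
      have : ∀ y : S2, h y * polyEval q y
          = (∑ i, h y * polyEval (rotD i (rotD i k)) y) + h y * c := by
        intro y
        rw [hk y y.2, ← Finset.mul_sum, mul_add]
        simp [rotLap, polyEval]
      simp only [this]
      rw [integral_add, integral_mul_const, hmean, zero_mul, add_zero, integral_finsetSum]
      · exact fun i _ => integrable_sphere (hc.fun_mul (hcq _))
      · exact integrable_finsetSum _ fun i _ => integrable_sphere (hc.fun_mul (hcq _))
      · exact integrable_sphere (hc.fun_mul continuous_const)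
    have e2 : ∀ i, ∫ y : S2, h y * polyEval (rotD i (rotD i k)) y ∂dω
        = -∫ y : S2, fderiv ℝ h y (rotGen i y) * polyEval (rotD i k) y ∂dω := by
      intro i
      have h0 := integral_sphere_rotGen (h := fun x => h x * polyEval (rotD i k) x)
        (fun y hy => (hh y hy).mul
          ((contDiff_polyEval _).contDiffAt.of_le (by exact_mod_cast le_top))) i
      have h1 : ∀ y : S2, fderiv ℝ (fun x => h x * polyEval (rotD i k) x) y (rotGen i y)
          = h y * polyEval (rotD i (rotD i k)) y
            + fderiv ℝ h y (rotGen i y) * polyEval (rotD i k) y := by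
        intro y
        rw [fderiv_fun_mul ((hh y y.2).differentiableAt one_ne_zero)
          ((contDiff_polyEval _).differentiable (by simp)).differentiableAt]
        simp only [add_apply, smul_apply, smul_eq_mul,
          fderiv_polyEval]
        ring
      simp only [h1] at h0
      rw [integral_add] at h0
      · linarith
      · exact integrable_sphere (hc.fun_mul (hcq _))
      · exact integrable_sphere ((hdc i).fun_mul (hcq _))
    have e3 : ∫ y : S2, h y * polyEval q y ∂dω
        ≤ N / 4 + ∑ i, ∫ y : S2, polyEval (rotD i k) y ^ 2 ∂dω := by
      rw [e1]
      simp only [e2]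
      rw [Finset.sum_neg_distrib, ← integral_finsetSum _
          (fun i _ => integrable_sphere ((hdc i).fun_mul (hcq _))), ← integral_neg,
        ← integral_finsetSum _ (fun i _ => integrable_sphere ((hcq _).fun_pow 2)), hN, ← integral_div,
        ← integral_add (hNint.div_const 4)
          (integrable_finsetSum _ fun i _ => integrable_sphere ((hcq _).fun_pow 2))]
      refine integral_mono ?_ ?_ fun y => ?_
      · exact (integrable_finsetSum _ fun i _ => integrable_sphere ((hdc i).fun_mul (hcq _))).neg
      · exact (hNint.div_const 4).add
          (integrable_finsetSum _ fun i _ => integrable_sphere ((hcq _).fun_pow 2))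
      · simp only [← Finset.sum_neg_distrib, Finset.sum_div, ← Finset.sum_add_distrib]
        refine Finset.sum_le_sum fun i _ => ?_
        nlinarith [sq_nonneg (fderiv ℝ h y (rotGen i y) / 2 + polyEval (rotD i k) y)]
    have e4 := bochner_integral k
    have e5 : ∫ y : S2, polyEval (rotLap k) y ^ 2 ∂dω ≤ ∫ y : S2, polyEval q y ^ 2 ∂dω := by
      have hz : ∫ y : S2, polyEval (rotLap k) y ∂dω = 0 := by
        have : ∀ y : S2, polyEval (rotLap k) y = ∑ i, polyEval (rotD i (rotD i k)) y := by
          intro y; simp [rotLap, polyEval]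
        simp only [this]
        rw [integral_finsetSum _ fun i _ => integrable_sphere (hcq _)]
        exact Finset.sum_eq_zero fun i _ => integral_rotD _ _
      have : ∫ y : S2, (polyEval (rotLap k) y ^ 2 + 2 * c * polyEval (rotLap k) y) ∂dω
          ≤ ∫ y : S2, polyEval q y ^ 2 ∂dω := by
        refine integral_mono ?_ (integrable_sphere ((hcq _).fun_pow 2)) fun y => ?_
        · exact integrable_sphere (((hcq _).fun_pow 2).add (continuous_const.fun_mul (hcq _)))
        · simp only [hk y y.2]
          nlinarith [sq_nonneg c]
      rw [integral_add (integrable_sphere ((hcq _).fun_pow 2))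
        (integrable_sphere (continuous_const.fun_mul (hcq _))), integral_const_mul, hz, mul_zero,
        add_zero] at this
      exact this
    linarith
  -- If `q` is within `√ε` of `h`, then `h² - ε ≤ 2hq - q²` pointwise, and by `key` the integral of
  -- the right side is at most `N/2`. Uniform density is enough, since no derivative of `q` enters.
  have hle : ∀ ε : ℝ, 0 < ε →
      ∫ y : S2, h y ^ 2 ∂dω ≤ N / 2 + ε * dω.real univ := by
    intro ε hε
    obtain ⟨q, hq⟩ := exists_poly_near hc (Real.sqrt_pos.mpr hε)
    have h1 := key q
    have hcq := continuous_polyEval_sphere q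
    have h2 : ∫ y : S2, (h y ^ 2 - ε) ∂dω
        ≤ ∫ y : S2, (2 * (h y * polyEval q y) - polyEval q y ^ 2) ∂dω := by
      refine integral_mono ?_ ?_ fun y => ?_
      · exact integrable_sphere ((hc.fun_pow 2).sub continuous_const)
      · exact integrable_sphere ((continuous_const.fun_mul (hc.fun_mul hcq)).sub (hcq.fun_pow 2))
      · have h3 := sq_lt_sq' (neg_lt_of_abs_lt (hq y)) (lt_of_abs_lt (hq y))
        rw [Real.sq_sqrt hε.le] at h3
        simp only
        nlinarith
    rw [integral_sub (integrable_sphere (hc.fun_pow 2)) (integrable_const _),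
      integral_sub (integrable_sphere (continuous_const.fun_mul (hc.fun_mul hcq)))
        (integrable_sphere (hcq.fun_pow 2)), integral_const_mul, integral_const, smul_eq_mul] at h2
    linarith
  have hfin : ∫ y : S2, h y ^ 2 ∂dω ≤ N / 2 := by
    refine le_of_forall_pos_le_add fun ε hε => ?_
    have hA : 0 ≤ dω.real univ := measureReal_nonneg
    have := hle (ε / (dω.real univ + 1)) (by positivity)
    refine this.trans ?_
    gcongr
    rw [div_mul_eq_mul_div, div_le_iff₀ (by positivity)]
    nlinarith
  linarith

end RpHierarchy

/-! ### Calculus of the frame fields and the wave operator in the Bondi frame. -/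

namespace RpHierarchy

lemma hasFDerivAt_norm_E3 {x : E3} (hx : x ≠ 0) :
    HasFDerivAt (fun z : E3 => ‖z‖) (‖x‖⁻¹ • innerSL ℝ x) x := by
  have hn : ‖x‖ ≠ 0 := norm_ne_zero_iff.mpr hx
  have h1 : DifferentiableAt ℝ (fun z : E3 => ‖z‖) x := differentiableAt_id.norm ℝ hx
  have h3 : HasFDerivAt (fun z : E3 => ‖z‖ ^ 2) (2 • (innerSL ℝ x)) x := by
    simpa using (hasFDerivAt_id x).norm_sq
  have h4 := (h1.hasFDerivAt.pow 2).unique h3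
  have h5 : fderiv ℝ (fun z : E3 => ‖z‖) x = ‖x‖⁻¹ • innerSL ℝ x := by
    ext v
    have h5 := congrArg (fun L : E3 →L[ℝ] ℝ => L v) h4
    simp at h5
    simp only [smul_apply, smul_eq_mul, innerSL_apply_apply]
    field_simp
    linarith
  rw [← h5]
  exact h1.hasFDerivAt

lemma hasFDerivAt_radial {x : E3} (hx : x ≠ 0) :
    HasFDerivAt radial (‖x‖⁻¹ • ContinuousLinearMap.id ℝ E3
      + ((-(‖x‖ ^ 2)⁻¹) • (‖x‖⁻¹ • innerSL ℝ x)).smulRight x) x := by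
  have hn : ‖x‖ ≠ 0 := norm_ne_zero_iff.mpr hx
  have h6 : HasFDerivAt (fun z : E3 => ‖z‖⁻¹) _ x :=
    (hasDerivAt_inv hn).comp_hasFDerivAt x (hasFDerivAt_norm_E3 hx)
  exact h6.smul (hasFDerivAt_id x)

lemma contDiffAt_radial {x : E3} (hx : x ≠ 0) : ContDiffAt ℝ ∞ radial x :=
  ((contDiffAt_norm ℝ hx).inv (norm_ne_zero_iff.mpr hx)).smul contDiffAt_id

lemma inner_radial_self {x : E3} (hx : x ≠ 0) : ⟪radial x, radial x⟫ = 1 := by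
  have h : ‖x‖ ≠ 0 := norm_ne_zero_iff.mpr hx
  simp only [radial, inner_smul_left, inner_smul_right, real_inner_self_eq_norm_sq, conj_trivial]
  field_simp

lemma norm_radial {x : E3} (hx : x ≠ 0) : ‖radial x‖ = 1 := by
  have h := inner_radial_self hx
  rw [real_inner_self_eq_norm_sq] at h
  nlinarith [norm_nonneg (radial x)]

lemma inner_self_radial {x : E3} (hx : x ≠ 0) : ⟪x, radial x⟫ = ‖x‖ := by
  have h : ‖x‖ ≠ 0 := norm_ne_zero_iff.mpr hx
  simp only [radial, inner_smul_right, real_inner_self_eq_norm_sq]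
  field_simp

lemma norm_smul_radial (x : E3) : ‖x‖ • radial x = x := by
  by_cases hx : x = 0
  · simp [hx]
  · rw [radial, smul_smul, mul_inv_cancel₀ (norm_ne_zero_iff.mpr hx), one_smul]

lemma rotGen_coords : (∀ x : E3, rotGen 0 x 0 = 0) ∧ (∀ x : E3, rotGen 0 x 1 = x 2) ∧
    (∀ x : E3, rotGen 0 x 2 = -x 1) ∧ (∀ x : E3, rotGen 1 x 0 = -x 2) ∧
    (∀ x : E3, rotGen 1 x 1 = 0) ∧ (∀ x : E3, rotGen 1 x 2 = x 0) ∧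
    (∀ x : E3, rotGen 2 x 0 = -x 1) ∧ (∀ x : E3, rotGen 2 x 1 = x 0) ∧
    (∀ x : E3, rotGen 2 x 2 = 0) := by
  refine ⟨?_, ?_, ?_, ?_, ?_, ?_, ?_, ?_, ?_⟩ <;> intro x <;> simp [rotGen]

section Calculus

variable {W : Set Spt} {R₀ : ℝ} {D : ℝ → ℝ}

lemma contDiffOn_radialFun {a : ℝ → ℝ} (ha : ContDiffOn ℝ ∞ a (Ioi R₀)) (hR : 0 ≤ R₀)
    (hW : ∀ p ∈ W, R₀ < ‖p.2‖) : ContDiffOn ℝ ∞ (fun p : Spt => a ‖p.2‖) W := by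
  intro p hp
  have hp2 : p.2 ≠ 0 := by
    intro h
    have := hW p hp
    rw [h, norm_zero] at this
    linarith
  have h1 : ContDiffAt ℝ ∞ a ‖p.2‖ := ha.contDiffAt (isOpen_Ioi.mem_nhds (hW p hp))
  have h2 : ContDiffAt ℝ ∞ (fun p : Spt => ‖p.2‖) p := (contDiffAt_snd).norm ℝ hp2
  exact (ContDiffAt.comp p h1 h2).contDiffWithinAt

lemma contDiffOn_vR (hD : ContDiffOn ℝ ∞ D (Ioi R₀)) (hD0 : ∀ r, R₀ < r → 0 < D r) (hR : 0 ≤ R₀)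
    (hW : ∀ p ∈ W, R₀ < ‖p.2‖) : ContDiffOn ℝ ∞ (vR D) W := by
  refine ContDiffOn.prodMk ?_ ?_
  · exact contDiffOn_const.div (contDiffOn_radialFun hD hR hW) fun p hp => (hD0 _ (hW p hp)).ne'
  · intro p hp
    have hp2 : p.2 ≠ 0 := by
      intro h
      have := hW p hp
      rw [h, norm_zero] at this
      linarith
    exact ((contDiffAt_radial hp2).comp p contDiffAt_snd).contDiffWithinAt

lemma contDiff_vT : ContDiff ℝ ∞ vT := contDiff_const

lemma contDiff_vΩ (i : Fin 3) : ContDiff ℝ ∞ (vΩ i) :=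
  contDiff_const.prodMk ((contDiff_rotGen i).comp contDiff_snd)

lemma contDiffOn_der (hWo : IsOpen W) {X : Spt → Spt} (hX : ContDiffOn ℝ ∞ X W) {f : Spt → ℝ}
    (hf : ContDiffOn ℝ ∞ f W) : ContDiffOn ℝ ∞ (der X f) W :=
  (hf.fderiv_of_isOpen hWo (by simp)).clm_apply hX

lemma fderiv_der {X : Spt → Spt} {f : Spt → ℝ} {p : Spt} (hf : ContDiffAt ℝ 2 f p)
    (hX : DifferentiableAt ℝ X p) (v : Spt) :
    fderiv ℝ (der X f) p v
      = fderiv ℝ (fderiv ℝ f) p v (X p) + fderiv ℝ f p (fderiv ℝ X p v) := by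
  have h1 : DifferentiableAt ℝ (fderiv ℝ f) p :=
    (hf.fderiv_right (m := 1) (by norm_num)).differentiableAt one_ne_zero
  have h2 : fderiv ℝ (der X f) p = _ := fderiv_clm_apply h1 hX
  rw [h2]
  simp [add_comm]

/-- The second derivatives of `f` cancel by symmetry of the Hessian, so two fields commute on `f` as
soon as `DX·Y = DY·X` at the point. -/
lemma der_comm {X Y : Spt → Spt} {f : Spt → ℝ} {p : Spt} (hf : ContDiffAt ℝ 2 f p)
    (hX : DifferentiableAt ℝ X p) (hY : DifferentiableAt ℝ Y p)
    (hXY : fderiv ℝ X p (Y p) = fderiv ℝ Y p (X p)) :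
    der X (der Y f) p = der Y (der X f) p := by
  have hs : IsSymmSndFDerivAt ℝ f p := hf.isSymmSndFDerivAt (by simp)
  change fderiv ℝ (der Y f) p (X p) = fderiv ℝ (der X f) p (Y p)
  rw [fderiv_der hf hY (X p), fderiv_der hf hX (Y p), hXY, hs.eq]

lemma fderiv_vΩ (i : Fin 3) (p v : Spt) : fderiv ℝ (vΩ i) p v = (0, rotGen i v.2) := by
  have h : HasFDerivAt (vΩ i)
      ((0 : Spt →L[ℝ] ℝ).prod ((rotGenL i).comp (ContinuousLinearMap.snd ℝ ℝ E3))) p :=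
    (hasFDerivAt_const (0 : ℝ) p).prodMk ((rotGenL i).hasFDerivAt.comp p hasFDerivAt_snd)
  rw [h.fderiv]
  rfl

lemma fderiv_vT (p v : Spt) : fderiv ℝ vT p v = 0 := by
  have : HasFDerivAt vT (0 : Spt →L[ℝ] Spt) p := hasFDerivAt_const _ _
  rw [this.fderiv]
  rfl

lemma hasFDerivAt_vR {p : Spt} (hp : p.2 ≠ 0) {D' : ℝ} (hD : HasDerivAt D D' ‖p.2‖)
    (hD0 : D ‖p.2‖ ≠ 0) :
    DifferentiableAt ℝ (vR D) p ∧ ∀ v, fderiv ℝ (vR D) p v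
      = (-(2 * D' / D ‖p.2‖ ^ 2) * (‖p.2‖⁻¹ * ⟪p.2, v.2⟫),
        ‖p.2‖⁻¹ • v.2 - ((‖p.2‖ ^ 2)⁻¹ * (‖p.2‖⁻¹ * ⟪p.2, v.2⟫)) • p.2) := by
  have hsnd : HasFDerivAt (fun q : Spt => q.2) (ContinuousLinearMap.snd ℝ ℝ E3) p := hasFDerivAt_snd
  have h1 : HasFDerivAt (fun q : Spt => ‖q.2‖) _ p := (hasFDerivAt_norm_E3 hp).comp p hsnd
  have h2 : HasDerivAt (fun t => 2 / D t) (-(2 * D' / D ‖p.2‖ ^ 2)) ‖p.2‖ := by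
    have := (hasDerivAt_const ‖p.2‖ (2 : ℝ)).fun_div hD hD0
    simpa [neg_div] using this
  have h3 : HasFDerivAt (fun q : Spt => 2 / D ‖q.2‖) _ p :=
    HasDerivAt.comp_hasFDerivAt (h₂ := fun t => 2 / D t) p h2 h1
  have h4 : HasFDerivAt (fun q : Spt => radial q.2) _ p := (hasFDerivAt_radial hp).comp p hsnd
  have h5 : HasFDerivAt (vR D) _ p := h3.prodMk h4
  refine ⟨h5.differentiableAt, fun v => ?_⟩
  rw [h5.fderiv]
  refine Prod.ext ?_ ?_
  · simp
  · simp [sub_eq_add_neg]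

lemma der_vT_comm_vR {f : Spt → ℝ} {p : Spt} (hf : ContDiffAt ℝ 2 f p) (hp : p.2 ≠ 0) {D' : ℝ}
    (hD : HasDerivAt D D' ‖p.2‖) (hD0 : D ‖p.2‖ ≠ 0) :
    der vT (der (vR D) f) p = der (vR D) (der vT f) p := by
  obtain ⟨h1, h2⟩ := hasFDerivAt_vR hp hD hD0
  refine der_comm hf (contDiff_vT.differentiable (by simp)).differentiableAt h1 ?_
  rw [fderiv_vT, h2]
  simp [vT, ← Prod.zero_eq_mk]

lemma der_vΩ_comm_vR {f : Spt → ℝ} {p : Spt} (hf : ContDiffAt ℝ 2 f p) (hp : p.2 ≠ 0) {D' : ℝ}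
    (hD : HasDerivAt D D' ‖p.2‖) (hD0 : D ‖p.2‖ ≠ 0) (i : Fin 3) :
    der (vΩ i) (der (vR D) f) p = der (vR D) (der (vΩ i) f) p := by
  obtain ⟨h1, h2⟩ := hasFDerivAt_vR hp hD hD0
  refine der_comm hf ((contDiff_vΩ i).differentiable (by simp)).differentiableAt h1 ?_
  rw [fderiv_vΩ, h2, vΩ_eq, vR]
  simp only [inner_rotGen_self, mul_zero, zero_smul, sub_zero]
  rw [radial, rotGen_smul]

/-- The wave operator in terms of the Bondi frame. -/
lemma box_eq {f : Spt → ℝ} {p : Spt} (hf : ContDiffAt ℝ 3 f p) (hp : p.2 ≠ 0) {D' : ℝ}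
    (hD : HasDerivAt D D' ‖p.2‖) (hD0 : D ‖p.2‖ ≠ 0) :
    box D f p = D ‖p.2‖ * der (vR D) (der (vR D) f) p + D' * der (vR D) f p
      - 2 * der vT (der (vR D) f) p + 2 / ‖p.2‖ * (D ‖p.2‖ * der (vR D) f p - der vT f p)
      + (‖p.2‖ ^ 2)⁻¹ * ∑ i, der (vΩ i) (der (vΩ i) f) p := by
  have hf2 : ContDiffAt ℝ 2 f p := hf.of_le (by norm_num)
  have hr : ‖p.2‖ ≠ 0 := norm_ne_zero_iff.mpr hp
  have hs : IsSymmSndFDerivAt ℝ f p := hf2.isSymmSndFDerivAt (by simp)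
  set H := fderiv ℝ (fderiv ℝ f) p with hH
  set G := fderiv ℝ f p with hG
  have hfd : HasFDerivAt (fderiv ℝ f) H p :=
    ((hf2.fderiv_right (m := 1) (by norm_num)).differentiableAt one_ne_zero).hasFDerivAt
  have hsnd : HasFDerivAt (fun q : Spt => q.2) (ContinuousLinearMap.snd ℝ ℝ E3) p := hasFDerivAt_snd
  set n : E3 := radial p.2 with hn
  have hni : ⟪p.2, n⟫ = ‖p.2‖ := inner_self_radial hp
  have hxn : p.2 = ‖p.2‖ • n := (norm_smul_radial p.2).symm
  have hk : ∀ c : ℝ, c • p.2 = (c * ‖p.2‖) • n := by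
    intro c
    conv_lhs => rw [hxn]
    rw [smul_smul]
  obtain ⟨Lr, hrad, hLr⟩ : ∃ Lr : Spt →L[ℝ] E3, HasFDerivAt (fun q : Spt => radial q.2) Lr p ∧
      ∀ v, Lr v = ‖p.2‖⁻¹ • (v.2 - ⟪n, v.2⟫ • n) := by
    refine ⟨_, (hasFDerivAt_radial hp).comp p hsnd, fun v => ?_⟩
    have e : ⟪p.2, v.2⟫ = ‖p.2‖ * ⟪n, v.2⟫ := by
      conv_lhs => rw [hxn]
      rw [real_inner_smul_left]
    simp only [ContinuousLinearMap.comp_apply, add_apply, smul_apply, ContinuousLinearMap.coe_snd',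
      ContinuousLinearMap.id_apply, ContinuousLinearMap.smulRight_apply, innerSL_apply_apply,
      smul_eq_mul, e, hk, sub_eq_add_neg, smul_smul, ← neg_smul]
    rw [smul_add, smul_smul]
    congr 2
    field_simp
  obtain ⟨LD, hDn, hLD⟩ : ∃ LD : Spt →L[ℝ] ℝ, HasFDerivAt (fun q : Spt => D ‖q.2‖) LD p ∧
      ∀ v, LD v = D' * ⟪n, v.2⟫ := by
    refine ⟨_, hD.comp_hasFDerivAt p ((hasFDerivAt_norm_E3 hp).comp p hsnd), fun v => ?_⟩
    have e : ⟪p.2, v.2⟫ = ‖p.2‖ * ⟪n, v.2⟫ := by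
      conv_lhs => rw [hxn]
      rw [real_inner_smul_left]
    simp only [ContinuousLinearMap.comp_apply, smul_apply, ContinuousLinearMap.coe_snd',
      innerSL_apply_apply, smul_eq_mul, e]
    field_simp
  have hX : HasFDerivAt (fun q : Spt => ((0 : ℝ), radial q.2)) _ p :=
    (hasFDerivAt_const (0 : ℝ) p).prodMk hrad
  have hXf : HasFDerivAt (fun q : Spt => fderiv ℝ f q (0, radial q.2)) _ p := hfd.clm_apply hX
  have hTf : HasFDerivAt (fun q : Spt => fderiv ℝ f q (1, 0)) _ p :=
    hfd.clm_apply (hasFDerivAt_const ((1 : ℝ), (0 : E3)) p)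
  have ha := hTf.fun_add ((hDn.sub_const 1).fun_mul hXf)
  have hnn : n 0 ^ 2 + n 1 ^ 2 + n 2 ^ 2 = 1 := by
    have h2 := EuclideanSpace.real_norm_sq_eq n
    rw [hn, norm_radial hp, ← hn, Fin.sum_univ_three] at h2
    linarith
  have hx : ∀ j, p.2 j = ‖p.2‖ * n j := by
    intro j
    conv_lhs => rw [hxn]
    simp
  have hbas : ∀ (L : Spt →L[ℝ] ℝ) (v : E3), L (0, v) = ∑ j, v j * L (0, EuclideanSpace.single j 1) := by
    intro L v
    have hv : ((0 : ℝ), v) = ∑ i, v i • ((0 : ℝ), (EuclideanSpace.single i (1 : ℝ) : E3)) := by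
      refine Prod.ext (by simp [Prod.fst_sum]) ?_
      ext j
      fin_cases j <;> simp [Fin.sum_univ_three]
    rw [hv, map_sum]
    simp only [map_smul, smul_eq_mul]
  have hG0 : G (0, 0) = 0 := G.map_zero
  have hg1 : fderiv ℝ (fun q => (grad D f q).1) p (1, 0) = H (1, 0) (0, n) := by
    simp only [grad]
    rw [hXf.fderiv]
    simp [hLr, ← hG, hG0, hn]
  have hg2 : ∀ i : Fin 3, fderiv ℝ (fun q => (grad D f q).2 i) p (0, EuclideanSpace.single i 1)
      = n i * (H (0, EuclideanSpace.single i 1) (1, 0) + (D ‖p.2‖ - 1) *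
          (H (0, EuclideanSpace.single i 1) (0, n)
            + (‖p.2‖⁻¹ * (G (0, EuclideanSpace.single i 1) - n i * G (0, n))))
          + D' * n i * G (0, n))
        + (G (1, 0) + (D ‖p.2‖ - 1) * G (0, n)) * (‖p.2‖⁻¹ * (1 - n i * n i))
        + H (0, EuclideanSpace.single i 1) (0, EuclideanSpace.single i 1) := by
    intro i
    have e1 : (fun q => (grad D f q).2 i) = fun q =>
        (fderiv ℝ f q (1, 0) + (D ‖q.2‖ - 1) * fderiv ℝ f q (0, radial q.2)) * radial q.2 i
          + fderiv ℝ f q (0, EuclideanSpace.single i 1) := by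
      funext q
      simp [grad, spatialGrad]
    rw [e1]
    have hri : HasFDerivAt (fun q : Spt => radial q.2 i) _ p :=
      (EuclideanSpace.proj i : E3 →L[ℝ] ℝ).hasFDerivAt.comp p hrad
    have hei : HasFDerivAt (fun q : Spt => fderiv ℝ f q (0, EuclideanSpace.single i 1)) _ p :=
      hfd.clm_apply (hasFDerivAt_const ((0 : ℝ), (EuclideanSpace.single i 1 : E3)) p)
    rw [((ha.fun_mul hri).fun_add hei).fderiv]
    have hni1 : ⟪n, (EuclideanSpace.single i (1 : ℝ) : E3)⟫ = n i := by
      simp [EuclideanSpace.inner_single_right]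
    have hL1 : Lr (0, EuclideanSpace.single i 1)
        = ‖p.2‖⁻¹ • ((EuclideanSpace.single i (1 : ℝ) : E3) - n i • n) := by
      rw [hLr, hni1]
    have hG1 : G (0, Lr (0, EuclideanSpace.single i 1))
        = ‖p.2‖⁻¹ * (G (0, EuclideanSpace.single i 1) - n i * G (0, n)) := by
      have e : ((0 : ℝ), Lr (0, EuclideanSpace.single i 1))
          = ‖p.2‖⁻¹ • (((0 : ℝ), (EuclideanSpace.single i (1 : ℝ) : E3)) - n i • ((0 : ℝ), n)) := by
        rw [hL1]
        refine Prod.ext (by simp) (by simp)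
      rw [e, map_smul, map_sub, map_smul]
      simp only [smul_eq_mul]
    have hL2 : (Lr (0, EuclideanSpace.single i 1)) i = ‖p.2‖⁻¹ * (1 - n i * n i) := by
      rw [hL1]
      simp
    have hLD1 : LD (0, EuclideanSpace.single i 1) = D' * n i := by
      rw [hLD, hni1]
    have e2 : (EuclideanSpace.proj i ∘SL Lr : Spt →L[ℝ] ℝ) (0, EuclideanSpace.single i 1)
        = ‖p.2‖⁻¹ * (1 - n i * n i) := hL2
    simp only [add_apply, smul_apply, smul_eq_mul, e2, hLD1, ContinuousLinearMap.comp_apply,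
      ContinuousLinearMap.prod_apply, zero_apply, hG1, ContinuousLinearMap.flip_apply,
      map_zero, ← hG, ← hn, zero_add]
    ring
  have hΩ : ∀ i : Fin 3, der (vΩ i) (der (vΩ i) f) p
      = H (0, rotGen i p.2) (0, rotGen i p.2) + G (0, rotGen i (rotGen i p.2)) := by
    intro i
    have := fderiv_der hf2 ((contDiff_vΩ i).differentiable (by simp)).differentiableAt (vΩ i p)
    rw [fderiv_vΩ] at this
    exact this
  obtain ⟨hRd, hRf⟩ := hasFDerivAt_vR hp hD hD0
  have hvR : vR D p = (2 / D ‖p.2‖) • ((1 : ℝ), (0 : E3)) + ((0 : ℝ), n) := by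
    refine Prod.ext ?_ ?_ <;> simp [vR, hn]
  have hRR : der (vR D) (der (vR D) f) p = H (vR D p) (vR D p)
      - 2 * D' / D ‖p.2‖ ^ 2 * G (1, 0) := by
    have h1 := fderiv_der hf2 hRd (vR D p)
    rw [hRf] at h1
    have e : ((-(2 * D' / D ‖p.2‖ ^ 2) * (‖p.2‖⁻¹ * ⟪p.2, (vR D p).2⟫),
        ‖p.2‖⁻¹ • (vR D p).2 - ((‖p.2‖ ^ 2)⁻¹ * (‖p.2‖⁻¹ * ⟪p.2, (vR D p).2⟫)) • p.2) : Spt)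
        = (-(2 * D' / D ‖p.2‖ ^ 2)) • ((1 : ℝ), (0 : E3)) := by
      have e2 : (vR D p).2 = n := rfl
      rw [e2, hni]
      refine Prod.ext ?_ ?_
      · simp [hr]
      · simp only [Prod.smul_snd, smul_zero, sub_eq_zero]
        rw [hn, radial, smul_smul]
        congr 1
        field_simp
    rw [e, map_smul, smul_eq_mul] at h1
    simp only [der] at h1 ⊢
    rw [h1]
    ring
  have hTR : der vT (der (vR D) f) p = H (1, 0) (vR D p) := by
    have h1 := fderiv_der hf2 hRd (vT p)
    rw [hRf] at h1
    simp only [vT, inner_zero_right, mul_zero, zero_smul, smul_zero, sub_zero] at h1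
    rw [show ((0 : ℝ), (0 : E3)) = 0 from rfl, map_zero, add_zero] at h1
    exact h1
  have hR1 : der (vR D) f p = 2 / D ‖p.2‖ * G (1, 0) + G (0, n) := by
    rw [der, hvR, map_add, map_smul, smul_eq_mul]
  have hT1 : der vT f p = G (1, 0) := rfl
  obtain ⟨r00, r01, r02, r10, r11, r12, r20, r21, r22⟩ := rotGen_coords
  -- The quadratic part is the Lagrange identity: summing the Hessian over the three rotation
  -- vectors gives `r²` times its trace over the plane orthogonal to `n`. The first order part comes
  -- from applying each generator twice, which sums to `-2x`.
  have hsum : ∑ i : Fin 3, (H (0, rotGen i p.2) (0, rotGen i p.2) + G (0, rotGen i (rotGen i p.2)))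
      = ‖p.2‖ ^ 2 * (∑ i : Fin 3, H (0, EuclideanSpace.single i 1) (0, EuclideanSpace.single i 1)
        - H (0, n) (0, n)) - 2 * ‖p.2‖ * G (0, n) := by
    have hb2 : ∀ v w : E3, H (0, v) (0, w) = ∑ i, ∑ j, v i * w j *
        H (0, EuclideanSpace.single i 1) (0, EuclideanSpace.single j 1) := by
      intro v w
      have h1 := hbas (H.flip (0, w)) v
      simp only [ContinuousLinearMap.flip_apply] at h1
      rw [h1]
      refine Finset.sum_congr rfl fun i _ => ?_
      rw [hbas (H _) w, Finset.mul_sum]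
      refine Finset.sum_congr rfl fun j _ => ?_
      ring
    have s01 : H (0, EuclideanSpace.single 1 1) (0, EuclideanSpace.single 0 1)
      = H (0, EuclideanSpace.single 0 1) (0, EuclideanSpace.single 1 1) := hs.eq _ _
    have s02 : H (0, EuclideanSpace.single 2 1) (0, EuclideanSpace.single 0 1)
      = H (0, EuclideanSpace.single 0 1) (0, EuclideanSpace.single 2 1) := hs.eq _ _
    have s12 : H (0, EuclideanSpace.single 2 1) (0, EuclideanSpace.single 1 1)
      = H (0, EuclideanSpace.single 1 1) (0, EuclideanSpace.single 2 1) := hs.eq _ _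
    simp only [fun i => hb2 (rotGen i p.2) (rotGen i p.2), hb2 n n,
      fun i => hbas G (rotGen i (rotGen i p.2)), hbas G n, Fin.sum_univ_three]
    simp only [r00, r01, r02, r10, r11, r12, r20, r21, r22, hx 0, hx 1, hx 2]
    rw [s01, s02, s12]
    generalize H (0, EuclideanSpace.single 0 1) (0, EuclideanSpace.single 0 1) = h00
    generalize H (0, EuclideanSpace.single 0 1) (0, EuclideanSpace.single 1 1) = h01
    generalize H (0, EuclideanSpace.single 0 1) (0, EuclideanSpace.single 2 1) = h02
    generalize H (0, EuclideanSpace.single 1 1) (0, EuclideanSpace.single 1 1) = h11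
    generalize H (0, EuclideanSpace.single 1 1) (0, EuclideanSpace.single 2 1) = h12
    generalize H (0, EuclideanSpace.single 2 1) (0, EuclideanSpace.single 2 1) = h22
    linear_combination ‖p.2‖ ^ 2 * (h00 + h11 + h22) * hnn
  simp only [hΩ]
  rw [hsum, hRR, hTR, hR1, hT1, box, hg1]
  simp only [hg2]
  have hHn : ∀ w : Spt, ∑ i : Fin 3, n i * H (0, EuclideanSpace.single i 1) w = H (0, n) w := by
    intro w
    have h1 := hbas (H.flip w) n
    simp only [ContinuousLinearMap.flip_apply] at h1
    rw [h1]
  have hGn := hbas G n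
  have hHT := hHn (1, 0)
  have hHN := hHn (0, n)
  have hsym : H (1, 0) (0, n) = H (0, n) (1, 0) := hs.eq _ _
  rw [hvR]
  simp only [map_add, map_smul, add_apply, smul_apply, smul_eq_mul, hsym]
  simp only [Fin.sum_univ_three] at hGn hHT hHN ⊢
  have hinv : ‖p.2‖ * ‖p.2‖⁻¹ = 1 := mul_inv_cancel₀ hr
  have hdinv : D ‖p.2‖ * (D ‖p.2‖)⁻¹ = 1 := mul_inv_cancel₀ hD0
  simp only [div_eq_mul_inv, ← inv_pow]
  generalize H (1, 0) (1, 0) = hTT at *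
  generalize ‖p.2‖ = r at *
  generalize r⁻¹ = ri at *
  generalize D r = d at *
  generalize d⁻¹ = di at *
  linear_combination hHT + (d - 1) * hHN - (d - 1) * ri * hGn
    + (-(d - 1) * ri * G (0, n) + D' * G (0, n) - (G (1, 0) + (d - 1) * G (0, n)) * ri) * hnn
    - 4 * di * hTT * hdinv - 4 * H (0, n) (1, 0) * hdinv + 2 * D' * di * G (1, 0) * hdinv
    - 4 * ri * G (1, 0) * hdinv - (ri * r + 1) * (H (0, EuclideanSpace.single 0 1)
      (0, EuclideanSpace.single 0 1) + H (0, EuclideanSpace.single 1 1)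
      (0, EuclideanSpace.single 1 1) + H (0, EuclideanSpace.single 2 1)
      (0, EuclideanSpace.single 2 1) - H (0, n) (0, n)) * hinv + 2 * ri * G (0, n) * hinv

end Calculus

end RpHierarchy

/-! ### The far region in Bondi coordinates: derivatives and means over spheres. -/

namespace RpHierarchy

lemma der_congr {X : Spt → Spt} {f g : Spt → ℝ} {p : Spt} (h : f =ᶠ[𝓝 p] g) :
    der X f p = der X g p := by
  simp only [der, h.fderiv_eq]

lemma der_add {X : Spt → Spt} {f g : Spt → ℝ} {p : Spt} (hf : DifferentiableAt ℝ f p)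
    (hg : DifferentiableAt ℝ g p) : der X (fun q => f q + g q) p = der X f p + der X g p := by
  simp only [der, fderiv_fun_add hf hg, add_apply]

lemma hasFDerivAt_radialFun {a : ℝ → ℝ} {a' : ℝ} {p : Spt} (hp : p.2 ≠ 0)
    (ha : HasDerivAt a a' ‖p.2‖) :
    ∃ L : Spt →L[ℝ] ℝ, HasFDerivAt (fun q : Spt => a ‖q.2‖) L p ∧
      ∀ v, L v = a' * (‖p.2‖⁻¹ * ⟪p.2, v.2⟫) := by
  have hsnd : HasFDerivAt (fun q : Spt => q.2) (ContinuousLinearMap.snd ℝ ℝ E3) p := hasFDerivAt_snd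
  exact ⟨_, ha.comp_hasFDerivAt p ((hasFDerivAt_norm_E3 hp).comp p hsnd), fun v => by simp⟩

section RadialProduct

variable {a : ℝ → ℝ} {a' : ℝ} {p : Spt} {F : Spt → ℝ} (hp : p.2 ≠ 0)
  (ha : HasDerivAt a a' ‖p.2‖) (hF : DifferentiableAt ℝ F p)
include hp ha hF

lemma der_radial_mul (X : Spt → Spt) : der X (fun q => a ‖q.2‖ * F q) p
    = a' * (‖p.2‖⁻¹ * ⟪p.2, (X p).2⟫) * F p + a ‖p.2‖ * der X F p := by
  obtain ⟨L, hL, hLv⟩ := hasFDerivAt_radialFun hp ha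
  have h := (hL.fun_mul hF.hasFDerivAt).fderiv
  simp only [der]
  rw [h]
  simp only [add_apply, smul_apply, smul_eq_mul, hLv]
  ring

lemma der_vR_radial_mul (D : ℝ → ℝ) : der (vR D) (fun q => a ‖q.2‖ * F q) p
    = a' * F p + a ‖p.2‖ * der (vR D) F p := by
  rw [der_radial_mul hp ha hF]
  have h1 : ((vR D p).2 : E3) = radial p.2 := rfl
  rw [h1, inner_self_radial hp, inv_mul_cancel₀ (norm_ne_zero_iff.mpr hp), mul_one]

lemma der_vT_radial_mul : der vT (fun q => a ‖q.2‖ * F q) p = a ‖p.2‖ * der vT F p := by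
  rw [der_radial_mul hp ha hF]
  simp [vT]

lemma der_vΩ_radial_mul (i : Fin 3) :
    der (vΩ i) (fun q => a ‖q.2‖ * F q) p = a ‖p.2‖ * der (vΩ i) F p := by
  rw [der_radial_mul hp ha hF, vΩ_eq, inner_rotGen_self]
  simp

end RadialProduct

namespace Background

variable (B : Background)

/-- The far region `{u ≥ 0, r > R₀}`. -/
def far : Set Spt := {p | B.R₀ < ‖p.2‖ ∧ 2 * B.rstar ‖p.2‖ ≤ p.1}

/-- Open neighbourhoods of the far region, inside `r > R₀`. -/
structure FarNhd (W : Set Spt) : Prop where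
  isOpen : IsOpen W
  far_subset : B.far ⊆ W
  lt : ∀ p ∈ W, B.R₀ < ‖p.2‖

lemma R₀_pos : 0 < B.R₀ := B.rmin_nonneg.trans_lt B.rmin_lt

lemma contDiffAt_D {r : ℝ} (hr : B.rmin < r) : ContDiffAt ℝ ∞ B.D r :=
  B.D_smooth.contDiffAt (Ici_mem_nhds hr)

lemma contDiffOn_D : ContDiffOn ℝ ∞ B.D (Ioi B.R₀) := fun _ hr =>
  (B.contDiffAt_D (B.rmin_lt.trans hr)).contDiffWithinAt

lemma D_pos' {r : ℝ} (hr : B.R₀ < r) : 0 < B.D r := B.D_pos r (B.rmin_lt.trans hr)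

lemma hasDerivAt_D {r : ℝ} (hr : B.rmin < r) : HasDerivAt B.D (deriv B.D r) r :=
  ((B.contDiffAt_D hr).differentiableAt (by simp)).hasDerivAt

lemma contDiffOn_deriv_D : ContDiffOn ℝ ∞ (deriv B.D) (Ioi B.rmin) := by
  have h : ContDiffOn ℝ ∞ B.D (Ioi B.rmin) := B.D_smooth.mono Ioi_subset_Ici_self
  exact ((contDiffOn_infty_iff_deriv_of_isOpen isOpen_Ioi).mp h).2

lemma hasDerivAt_deriv_D {r : ℝ} (hr : B.rmin < r) :
    HasDerivAt (deriv B.D) (deriv (deriv B.D) r) r :=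
  ((B.contDiffOn_deriv_D.contDiffAt (Ioi_mem_nhds hr)).differentiableAt (by simp)).hasDerivAt

lemma hasDerivAt_rstar {r : ℝ} (hr : B.rmin < r) : HasDerivAt B.rstar (B.D r)⁻¹ r := by
  have hc : ContinuousOn (fun t => (B.D t)⁻¹) (Ioi B.rmin) := fun t ht =>
    ((B.contDiffAt_D ht).continuousAt.inv₀ (B.D_pos t ht).ne').continuousWithinAt
  have hsub : uIcc B.R₀ r ⊆ Ioi B.rmin := fun t ht => (lt_min B.rmin_lt hr).trans_le ht.1
  have h := intervalIntegral.integral_hasDerivAt_right (f := fun t => (B.D t)⁻¹) (a := B.R₀) (b := r)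
    ((hc.mono hsub).intervalIntegrable)
    (hc.stronglyMeasurableAtFilter isOpen_Ioi _ hr) (hc.continuousAt (Ioi_mem_nhds hr))
  exact h.const_add B.R₀

lemma contDiffOn_rstar : ContDiffOn ℝ ∞ B.rstar (Ioi B.rmin) := by
  rw [contDiffOn_infty_iff_deriv_of_isOpen isOpen_Ioi]
  refine ⟨fun r hr => (B.hasDerivAt_rstar hr).differentiableAt.differentiableWithinAt, ?_⟩
  have h : ContDiffOn ℝ ∞ (fun t => (B.D t)⁻¹) (Ioi B.rmin) := fun t ht =>
    ((B.contDiffAt_D ht).inv (B.D_pos t ht).ne').contDiffWithinAt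
  exact h.congr fun r hr => (B.hasDerivAt_rstar hr).deriv

/-- Smoothness on the region is formulated in the coordinate `v - shift`. For `r > R₀` the shift is
smooth, being `r_*` or `0`, and undoing it gives smoothness in `(v, x)`. Because the neighbourhood
is open, two-sided derivatives exist even on the boundary cone `u = 0`. -/
lemma exists_farNhd {ψ : Spt → ℝ} (hψ : B.SmoothOnRegion ψ) :
    ∃ W, B.FarNhd W ∧ ContDiffOn ℝ ∞ ψ W := by
  obtain ⟨U, hUo, hU, hs⟩ := hψ
  set sh : ℝ → ℝ := shift B.D B.rmin B.R₀ with hsh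
  have hshs : ContDiffOn ℝ ∞ sh (Ioi B.R₀) := by
    by_cases h : B.rmin = 0
    · have : sh = B.rstar := by
        funext r; simp [hsh, shift, h, rstar]
      rw [this]
      exact B.contDiffOn_rstar.mono (Ioi_subset_Ioi B.rmin_lt.le)
    · have : sh = fun _ => 0 := by
        funext r; simp [hsh, shift, h]
      rw [this]
      exact contDiffOn_const
  set V : Set Spt := {p | B.R₀ < ‖p.2‖} with hV
  have hVo : IsOpen V := isOpen_lt continuous_const (continuous_snd.norm)
  have hm : ContDiffOn ℝ ∞ (fun p : Spt => ((p.1 - sh ‖p.2‖, p.2) : Spt)) V :=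
    (contDiffOn_fst.sub (contDiffOn_radialFun hshs B.R₀_pos.le fun p hp => hp)).prodMk contDiffOn_snd
  refine ⟨V ∩ (fun p : Spt => ((p.1 - sh ‖p.2‖, p.2) : Spt)) ⁻¹' U, ⟨?_, ?_, fun p hp => hp.1⟩, ?_⟩
  · exact hm.continuousOn.isOpen_inter_preimage hVo hUo
  · intro p hp
    refine ⟨hp.1, hU ?_⟩
    simp only [mem_ofPred_eq, sub_add_cancel]
    refine ⟨(B.rmin_lt.trans hp.1).le, ?_⟩
    simp only [s, not_le.mpr hp.1, if_false]
    exact hp.2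
  · have h := hs.comp (hm.mono inter_subset_left) (fun p hp => hp.2)
    refine h.congr fun p _ => ?_
    simp

section Bondi

variable {B}

lemma norm_smul_sphere {r : ℝ} (hr : 0 < r) (y : S2) : ‖r • (y : E3)‖ = r := by
  have : ‖(y : E3)‖ = 1 := by simp
  rw [norm_smul, this, mul_one, Real.norm_eq_abs, abs_of_pos hr]

lemma norm_bondiPt {u r : ℝ} (hr : B.R₀ < r) (y : S2) : ‖(B.bondiPt u r y).2‖ = r :=
  norm_smul_sphere (B.R₀_pos.trans hr) y

lemma bondiPt_mem_far {u r : ℝ} (hu : 0 ≤ u) (hr : B.R₀ < r) (y : S2) : B.bondiPt u r y ∈ B.far := by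
  refine ⟨by rwa [norm_bondiPt hr], ?_⟩
  rw [norm_bondiPt hr, bondiPt]
  linarith

lemma continuousOn_bondiPt :
    ContinuousOn (fun z : ℝ × ℝ × S2 => B.bondiPt z.1 z.2.1 z.2.2) {z | B.R₀ < z.2.1} := by
  have h1 : ContinuousOn (fun z : ℝ × ℝ × S2 => B.rstar z.2.1) {z | B.R₀ < z.2.1} :=
    B.contDiffOn_rstar.continuousOn.comp (by fun_prop) fun z hz => B.rmin_lt.trans hz
  refine ContinuousOn.prodMk ?_ ?_
  · exact continuousOn_fst.add (continuousOn_const.mul h1)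
  · exact Continuous.continuousOn (by fun_prop)

/-- The domain of the coordinates `(u, r, y)` in the far region. -/
def farDom (B : Background) : Set (ℝ × ℝ × S2) := {z | 0 ≤ z.1 ∧ B.R₀ < z.2.1}

variable {W : Set Spt} {F : Spt → ℝ}

lemma continuousOn_ev (hW : B.FarNhd W) (hF : ContinuousOn F W) :
    ContinuousOn (fun z : ℝ × ℝ × S2 => F (B.bondiPt z.1 z.2.1 z.2.2)) B.farDom :=
  hF.comp (continuousOn_bondiPt.mono fun _ hz => hz.2) fun _ hz =>
    hW.far_subset (bondiPt_mem_far hz.1 hz.2 _)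

lemma FarNhd.contDiffAt (hW : B.FarNhd W) (hF : ContDiffOn ℝ ∞ F W) {p : Spt} (hp : p ∈ W) :
    ContDiffAt ℝ ∞ F p := hF.contDiffAt (hW.isOpen.mem_nhds hp)

lemma FarNhd.ne_zero (hW : B.FarNhd W) {p : Spt} (hp : p ∈ W) : p.2 ≠ 0 := by
  intro h
  have := hW.lt p hp
  rw [h, norm_zero] at this
  linarith [B.R₀_pos]

lemma FarNhd.differentiableAt (hW : B.FarNhd W) (hF : ContDiffOn ℝ ∞ F W) {p : Spt} (hp : p ∈ W) :
    DifferentiableAt ℝ F p := (hW.contDiffAt hF hp).differentiableAt (by simp)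

lemma radial_smul_sphere {r : ℝ} (hr : 0 < r) (y : S2) : radial (r • (y : E3)) = y := by
  rw [radial, norm_smul_sphere hr, smul_smul, inv_mul_cancel₀ hr.ne', one_smul]

lemma hasDerivAt_ev_r (hW : B.FarNhd W) (hF : ContDiffOn ℝ ∞ F W) {u r : ℝ} (hu : 0 ≤ u)
    (hr : B.R₀ < r) (y : S2) :
    HasDerivAt (fun t => F (B.bondiPt u t y)) (der (vR B.D) F (B.bondiPt u r y)) r := by
  have h1 : HasDerivAt (fun t => B.bondiPt u t y) (2 * (B.D r)⁻¹, (1 : ℝ) • (y : E3)) r :=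
    (((B.hasDerivAt_rstar (B.rmin_lt.trans hr)).const_mul 2).const_add u).prodMk
      ((hasDerivAt_id r).smul_const (y : E3))
  have h2 := (hW.differentiableAt hF (hW.far_subset (bondiPt_mem_far hu hr y))).hasFDerivAt
  have h3 := h2.comp_hasDerivAt r h1
  have e : vR B.D (B.bondiPt u r y) = (2 * (B.D r)⁻¹, (1 : ℝ) • (y : E3)) := by
    rw [vR, norm_bondiPt hr]
    simp only [bondiPt, radial_smul_sphere (B.R₀_pos.trans hr), one_smul, div_eq_mul_inv]
  rw [der, e]
  exact h3

lemma hasDerivAt_ev_u (hW : B.FarNhd W) (hF : ContDiffOn ℝ ∞ F W) {u r : ℝ} (hu : 0 ≤ u)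
    (hr : B.R₀ < r) (y : S2) :
    HasDerivAt (fun t => F (B.bondiPt t r y)) (der vT F (B.bondiPt u r y)) u := by
  have h1 : HasDerivAt (fun t => B.bondiPt t r y) (1, 0) u :=
    ((hasDerivAt_id u).add_const _).prodMk (hasDerivAt_const u _)
  have h2 := (hW.differentiableAt hF (hW.far_subset (bondiPt_mem_far hu hr y))).hasFDerivAt
  exact h2.comp_hasDerivAt u h1

/-- The restriction of `F` to a sphere of constant `(u, r)`, extended to a neighbourhood. -/
lemma sphereFun_props (hW : B.FarNhd W) (hF : ContDiffOn ℝ ∞ F W) {u r : ℝ} (hu : 0 ≤ u)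
    (hr : B.R₀ < r) :
    (∀ y ∈ Metric.sphere (0 : E3) 1,
      ContDiffAt ℝ 1 (fun x : E3 => F (u + 2 * B.rstar r, r • x)) y) ∧
    ∀ (y : S2) (i : Fin 3), fderiv ℝ (fun x : E3 => F (u + 2 * B.rstar r, r • x)) y (rotGen i y)
      = der (vΩ i) F (B.bondiPt u r y) := by
  have hpt : ∀ y ∈ Metric.sphere (0 : E3) 1, ((u + 2 * B.rstar r, r • y) : Spt) ∈ W :=
    fun y hy => hW.far_subset (bondiPt_mem_far hu hr ⟨y, hy⟩)
  have hin : ContDiff ℝ ∞ fun x : E3 => ((u + 2 * B.rstar r, r • x) : Spt) :=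
    contDiff_const.prodMk (contDiff_id.const_smul r)
  refine ⟨fun y hy => ?_, fun y i => ?_⟩
  · have h1 : ContDiffAt ℝ 1 F (u + 2 * B.rstar r, r • y) :=
      (hW.contDiffAt hF (hpt y hy)).of_le (by exact_mod_cast le_top)
    exact h1.comp y (hin.contDiffAt.of_le (by exact_mod_cast le_top))
  · have h1 := (hW.differentiableAt hF (hpt y y.2)).hasFDerivAt
    have h2 : HasFDerivAt (fun x : E3 => ((u + 2 * B.rstar r, r • x) : Spt))
        ((0 : E3 →L[ℝ] ℝ).prod (r • ContinuousLinearMap.id ℝ E3)) (y : E3) :=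
      (hasFDerivAt_const _ _).prodMk ((hasFDerivAt_id (y : E3)).const_smul r)
    have h3 : HasFDerivAt (fun x : E3 => F (u + 2 * B.rstar r, r • x)) _ (y : E3) :=
      h1.comp (y : E3) h2
    rw [h3.fderiv, der, vΩ_eq]
    simp only [bondiPt, rotGen_smul]
    rfl

lemma integral_vΩ (hW : B.FarNhd W) (hF : ContDiffOn ℝ ∞ F W) {u r : ℝ} (hu : 0 ≤ u)
    (hr : B.R₀ < r) (i : Fin 3) : ∫ y : S2, der (vΩ i) F (B.bondiPt u r y) ∂dω = 0 := by
  obtain ⟨h1, h2⟩ := sphereFun_props hW hF hu hr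
  rw [← integral_sphere_rotGen h1 i]
  simp only [h2]

lemma poincare_ev (hW : B.FarNhd W) (hF : ContDiffOn ℝ ∞ F W) {u r : ℝ} (hu : 0 ≤ u)
    (hr : B.R₀ < r) (hm : ∫ y : S2, F (B.bondiPt u r y) ∂dω = 0) :
    2 * ∫ y : S2, F (B.bondiPt u r y) ^ 2 ∂dω
      ≤ ∫ y : S2, ∑ i, der (vΩ i) F (B.bondiPt u r y) ^ 2 ∂dω := by
  obtain ⟨h1, h2⟩ := sphereFun_props hW hF hu hr
  have h3 := sphere_poincare h1 hm
  simp only [h2] at h3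
  exact h3

lemma FarNhd.contDiffOn_vR (hW : B.FarNhd W) : ContDiffOn ℝ ∞ (vR B.D) W :=
  RpHierarchy.contDiffOn_vR B.contDiffOn_D (fun _ h => B.D_pos' h) B.R₀_pos.le hW.lt

lemma FarNhd.der_vR (hW : B.FarNhd W) (hF : ContDiffOn ℝ ∞ F W) :
    ContDiffOn ℝ ∞ (der (vR B.D) F) W := contDiffOn_der hW.isOpen hW.contDiffOn_vR hF

lemma FarNhd.der_vT (hW : B.FarNhd W) (hF : ContDiffOn ℝ ∞ F W) :
    ContDiffOn ℝ ∞ (der vT F) W := contDiffOn_der hW.isOpen contDiff_vT.contDiffOn hF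

lemma FarNhd.der_vΩ (hW : B.FarNhd W) (hF : ContDiffOn ℝ ∞ F W) (i : Fin 3) :
    ContDiffOn ℝ ∞ (der (vΩ i) F) W := contDiffOn_der hW.isOpen (contDiff_vΩ i).contDiffOn hF

lemma FarNhd.radial_mul (hW : B.FarNhd W) (hF : ContDiffOn ℝ ∞ F W) {a : ℝ → ℝ}
    (ha : ContDiffOn ℝ ∞ a (Ioi B.R₀)) : ContDiffOn ℝ ∞ (fun p => a ‖p.2‖ * F p) W :=
  (contDiffOn_radialFun ha B.R₀_pos.le hW.lt).mul hF

lemma FarNhd.radField (hW : B.FarNhd W) (hF : ContDiffOn ℝ ∞ F W) :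
    ContDiffOn ℝ ∞ (radField F) W := hW.radial_mul hF (a := fun r => r) contDiffOn_id

lemma FarNhd.Phi (hW : B.FarNhd W) (hF : ContDiffOn ℝ ∞ F W) :
    ContDiffOn ℝ ∞ (Phi B.D F) W :=
  hW.radial_mul (hW.der_vR (hW.radField hF)) (a := fun r => r ^ 2) (contDiffOn_id.pow 2)

lemma FarNhd.comm_TR (hW : B.FarNhd W) (hF : ContDiffOn ℝ ∞ F W) {p : Spt} (hp : p ∈ W) :
    der vT (der (vR B.D) F) p = der (vR B.D) (der vT F) p :=
  der_vT_comm_vR ((hW.contDiffAt hF hp).of_le (WithTop.coe_le_coe.mpr (le_top : (2 : ℕ∞) ≤ ⊤))) (hW.ne_zero hp)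
    (B.hasDerivAt_D (B.rmin_lt.trans (hW.lt p hp))) (B.D_pos' (hW.lt p hp)).ne'

lemma FarNhd.comm_ΩR (hW : B.FarNhd W) (hF : ContDiffOn ℝ ∞ F W) {p : Spt} (hp : p ∈ W)
    (i : Fin 3) : der (vΩ i) (der (vR B.D) F) p = der (vR B.D) (der (vΩ i) F) p :=
  der_vΩ_comm_vR ((hW.contDiffAt hF hp).of_le (WithTop.coe_le_coe.mpr (le_top : (2 : ℕ∞) ≤ ⊤))) (hW.ne_zero hp)
    (B.hasDerivAt_D (B.rmin_lt.trans (hW.lt p hp))) (B.D_pos' (hW.lt p hp)).ne' i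

lemma FarNhd.der_congr (hW : B.FarNhd W) {X : Spt → Spt} {f g : Spt → ℝ} (h : ∀ p ∈ W, f p = g p)
    {p : Spt} (hp : p ∈ W) : der X f p = der X g p :=
  RpHierarchy.der_congr (by filter_upwards [hW.isOpen.mem_nhds hp] with q hq using h q hq)

/-- The mean of a solution of angular frequencies `ℓ ≥ 1` vanishes on far spheres. -/
lemma integral_eq_zero_of_highFrequency {ψ : Spt → ℝ} (hψ : B.HighFrequency ψ) {u r : ℝ}
    (hu : 0 ≤ u) (hr : B.R₀ < r) : ∫ y : S2, ψ (B.bondiPt u r y) ∂dω = 0 := by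
  refine hψ _ r (B.R₀_pos.trans hr) fun y => ?_
  have h := bondiPt_mem_far hu hr y
  refine ⟨(B.rmin_lt.trans h.1).le, ?_⟩
  have h1 : ‖(r • (y : E3))‖ = r := norm_smul_sphere (B.R₀_pos.trans hr) y
  simp only [s, h1, not_le.mpr hr, if_false]
  linarith

lemma integrable_ev (hW : B.FarNhd W) (hF : ContinuousOn F W) {u r : ℝ} (hu : 0 ≤ u)
    (hr : B.R₀ < r) : Continuous fun y : S2 => F (B.bondiPt u r y) := by
  have h := continuousOn_ev hW hF
  rw [← continuousOn_univ]
  exact h.comp (f := fun y : S2 => ((u, r, y) : ℝ × ℝ × S2)) (by fun_prop) fun y _ => ⟨hu, hr⟩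

/-- Bounds on compact sets of parameters. -/
lemma exists_bound_ev (hW : B.FarNhd W) (hF : ContinuousOn F W) {u₁ u₂ a b : ℝ} (hu : 0 ≤ u₁)
    (ha : B.R₀ < a) : ∃ C : ℝ, ∀ u ∈ Icc u₁ u₂, ∀ r ∈ Icc a b, ∀ y : S2,
      ‖F (B.bondiPt u r y)‖ ≤ C := by
  have hK : IsCompact (Icc u₁ u₂ ×ˢ Icc a b ×ˢ (univ : Set S2)) :=
    isCompact_Icc.prod (isCompact_Icc.prod isCompact_univ)
  have hc : ContinuousOn (fun z : ℝ × ℝ × S2 => F (B.bondiPt z.1 z.2.1 z.2.2))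
      (Icc u₁ u₂ ×ˢ Icc a b ×ˢ (univ : Set S2)) :=
    (continuousOn_ev hW hF).mono fun z hz => ⟨hu.trans hz.1.1, ha.trans_le hz.2.1.1⟩
  obtain ⟨C, hC⟩ := hK.exists_bound_of_continuousOn hc
  exact ⟨C, fun u hu r hr y => hC (u, r, y) ⟨hu, hr, mem_univ _⟩⟩

lemma integral_vR_eq_zero (hW : B.FarNhd W) (hF : ContDiffOn ℝ ∞ F W)
    (hm : ∀ u r : ℝ, 0 ≤ u → B.R₀ < r → ∫ y : S2, F (B.bondiPt u r y) ∂dω = 0)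
    {u r : ℝ} (hu : 0 ≤ u) (hr : B.R₀ < r) :
    ∫ y : S2, der (vR B.D) F (B.bondiPt u r y) ∂dω = 0 := by
  obtain ⟨a, ha, har⟩ := exists_between hr
  obtain ⟨C, hC⟩ := exists_bound_ev hW (hW.der_vR hF).continuousOn hu ha (u₂ := u) (b := r + 1)
  have h := hasDerivAt_integral_of_dominated_loc_of_deriv_le (μ := dω) (bound := fun _ => C)
    (F := fun t (y : S2) => F (B.bondiPt u t y))
    (F' := fun t (y : S2) => der (vR B.D) F (B.bondiPt u t y)) (x₀ := r) (s := Icc a (r + 1))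
    (Icc_mem_nhds har (by linarith)) ?_ ?_ ?_ ?_ (integrable_const C) ?_
  · have h2 : (fun t => ∫ y : S2, F (B.bondiPt u t y) ∂dω) =ᶠ[𝓝 r] fun _ => 0 := by
      filter_upwards [Ioi_mem_nhds hr] with t ht using hm u t hu ht
    exact (h.2.congr_of_eventuallyEq h2.symm).unique (hasDerivAt_const r 0)
  · filter_upwards [Ioi_mem_nhds hr] with t ht
    exact (integrable_ev hW hF.continuousOn hu ht).aestronglyMeasurable
  · exact integrable_sphere (integrable_ev hW hF.continuousOn hu hr)
  · exact (integrable_ev hW (hW.der_vR hF).continuousOn hu hr).aestronglyMeasurable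
  · exact .of_forall fun y t ht => hC u ⟨le_rfl, le_rfl⟩ t ht y
  · exact .of_forall fun y t ht => hasDerivAt_ev_r hW hF hu (ha.trans_le ht.1) y

/-- The mean is known to vanish for `u ≥ 0` only, so at `u = 0` it cannot simply be differentiated
on a neighbourhood. Fubini and the fundamental theorem show instead that the integral of the mean of
`∂_uF` over every interval `[u, u + v]` vanishes; its right derivative at `u` is the asserted value.
-/
lemma integral_vT_eq_zero (hW : B.FarNhd W) (hF : ContDiffOn ℝ ∞ F W)
    (hm : ∀ u r : ℝ, 0 ≤ u → B.R₀ < r → ∫ y : S2, F (B.bondiPt u r y) ∂dω = 0)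
    {u r : ℝ} (hu : 0 ≤ u) (hr : B.R₀ < r) :
    ∫ y : S2, der vT F (B.bondiPt u r y) ∂dω = 0 := by
  have key : ∀ v, 0 ≤ v → ∫ t in u..(u + v), ∫ y : S2, der vT F (B.bondiPt t r y) ∂dω = 0 := by
    intro v hv
    have hc : ContinuousOn (fun z : ℝ × S2 => der vT F (B.bondiPt z.1 r z.2))
        (Icc u (u + v) ×ˢ univ) :=
      (continuousOn_ev hW (hW.der_vT hF).continuousOn).comp
        (f := fun z : ℝ × S2 => ((z.1, r, z.2) : ℝ × ℝ × S2)) (by fun_prop)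
        fun z hz => ⟨hu.trans hz.1.1, hr⟩
    have hi : Integrable (fun z : ℝ × S2 => der vT F (B.bondiPt z.1 r z.2))
        ((volume.restrict (Ioc u (u + v))).prod dω) := by
      have h1 := hc.integrableOn_compact (μ := (volume : Measure ℝ).prod dω)
        (isCompact_Icc.prod isCompact_univ)
      rw [IntegrableOn, ← Measure.prod_restrict, Measure.restrict_univ] at h1
      exact h1.mono_measure (Measure.prod_mono (Measure.restrict_mono Ioc_subset_Icc_self le_rfl)
        le_rfl)
    rw [intervalIntegral.integral_of_le (by linarith), integral_integral_swap hi]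
    have e : ∀ y : S2, ∫ t in Ioc u (u + v), der vT F (B.bondiPt t r y)
        = F (B.bondiPt (u + v) r y) - F (B.bondiPt u r y) := by
      intro y
      rw [← intervalIntegral.integral_of_le (by linarith)]
      refine intervalIntegral.integral_eq_sub_of_hasDerivAt (E := ℝ)
        (f := fun t => F (B.bondiPt t r y)) (fun t ht => ?_) ?_
      · rw [uIcc_of_le (by linarith)] at ht
        exact hasDerivAt_ev_u hW hF (hu.trans ht.1) hr y
      · refine ContinuousOn.intervalIntegrable ?_
        rw [uIcc_of_le (by linarith)]
        exact hc.comp (f := fun t : ℝ => (t, y)) (by fun_prop) fun t ht => ⟨ht, mem_univ _⟩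
    simp only [e]
    rw [integral_sub (integrable_sphere (integrable_ev hW hF.continuousOn (by linarith) hr))
      (integrable_sphere (integrable_ev hW hF.continuousOn hu hr)), hm _ _ (by linarith) hr,
      hm _ _ hu hr, sub_zero]
  obtain ⟨C, hC⟩ := exists_bound_ev hW (hW.der_vT (hW.der_vT hF)).continuousOn hu hr
    (u₂ := u + 1) (b := r)
  set m : ℝ → ℝ := fun t => ∫ y : S2, der vT F (B.bondiPt t r y) ∂dω with hmdef
  have hmc : ContinuousOn m (Icc u (u + 1)) := by
    obtain ⟨C', hC'⟩ := exists_bound_ev hW (hW.der_vT hF).continuousOn hu hr (u₂ := u + 1) (b := r)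
    refine continuousOn_of_dominated (bound := fun _ => C') ?_ ?_ (integrable_const _) ?_
    · intro t ht
      exact (integrable_ev hW (hW.der_vT hF).continuousOn (hu.trans ht.1) hr).aestronglyMeasurable
    · exact fun t ht => .of_forall fun y => hC' t ht r ⟨le_rfl, le_rfl⟩ y
    · refine .of_forall fun y => ?_
      exact (continuousOn_ev hW (hW.der_vT hF).continuousOn).comp
        (f := fun t : ℝ => ((t, r, y) : ℝ × ℝ × S2)) (by fun_prop) fun t ht => ⟨hu.trans ht.1, hr⟩
  have hd : HasDerivWithinAt (fun v => ∫ t in u..v, m t) (m u) (Ici u) u :=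
    intervalIntegral.integral_hasDerivWithinAt_right (f := m) (a := u) (b := u) (t := Ioi u) (by simp)
      (by
        refine ⟨Icc u (u + 1), Icc_mem_nhdsGT (by linarith), ?_⟩
        exact hmc.aestronglyMeasurable measurableSet_Icc)
      ((hmc u ⟨le_rfl, by linarith⟩).mono_of_mem_nhdsWithin (Icc_mem_nhdsGE (by linarith)) |>.mono
        Ioi_subset_Ici_self)
  have hz : HasDerivWithinAt (fun v => ∫ t in u..v, m t) 0 (Ici u) u := by
    refine (hasDerivWithinAt_const u (Ici u) (0 : ℝ)).congr (fun v hv => ?_) (by simp)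
    have := key (v - u) (by simpa using hv)
    simpa using this
  exact UniqueDiffWithinAt.eq_deriv _ (uniqueDiffOn_Ici u u self_mem_Ici) hd hz

end Bondi

end Background

end RpHierarchy

/-! ### The equations satisfied by `φ`, `Φ`, `∂_rΦ` and by the corrected quantity. -/

namespace RpHierarchy

namespace Background

lemma _root_.RpHierarchy.der_const_mul {X : Spt → Spt} {f : Spt → ℝ} {p : Spt} {c : ℝ}
    (hf : DifferentiableAt ℝ f p) : der X (fun q => c * f q) p = c * der X f p := by
  simp only [der, fderiv_const_mul hf, smul_apply, smul_eq_mul]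

/-- The spherical Laplacian `Σ Ω_i²`. -/
def _root_.RpHierarchy.sphLap (f : Spt → ℝ) (p : Spt) : ℝ := ∑ i, der (vΩ i) (der (vΩ i) f) p

/-- The corrected quantity `h = Φ + M φ`; its equation has no `r⁻² φ` term. -/
def hatPhi (B : Background) (ψ : Spt → ℝ) : Spt → ℝ :=
  fun p => Phi B.D ψ p + B.M * radField ψ p

/-- The coefficient of `h` in the equation for `∂_r h`. -/
def coefH (B : Background) (r : ℝ) : ℝ :=
  deriv (deriv B.D) r - 3 * deriv B.D r / r + 2 * (B.D r - 1) / r ^ 2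
    - B.M * (deriv B.D r / r ^ 2 - 2 * B.D r / r ^ 3)

/-- The coefficient of `φ` in the equation for `∂_r h`. -/
def coefPhi (B : Background) (r : ℝ) : ℝ :=
  -(deriv B.D r + r * deriv (deriv B.D) r + 2 * B.M / r ^ 2) - B.M * deriv B.D r / r
    - B.M * B.coefH r

section Equations

variable {B : Background} {W : Set Spt} {ψ : Spt → ℝ}

lemma der_vR_radField_eq (hW : B.FarNhd W) {p : Spt} (hp : p ∈ W) :
     der (vR B.D) (radField ψ) p = (‖p.2‖ ^ 2)⁻¹ * Phi B.D ψ p := by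
  have hr : ‖p.2‖ ≠ 0 := norm_ne_zero_iff.mpr (hW.ne_zero hp)
  simp only [Phi]
  field_simp

section Pointwise

variable (hW : B.FarNhd W) (hψ : ContDiffOn ℝ ∞ ψ W) {p : Spt} (hp : p ∈ W)
include hW hψ hp

lemma der_vR_radField : der (vR B.D) (radField ψ) p = ψ p + ‖p.2‖ * der (vR B.D) ψ p := by
  have h : der (vR B.D) (radField ψ) p = _ :=
    der_vR_radial_mul (a := fun r => r) (hW.ne_zero hp) (hasDerivAt_id ‖p.2‖)
      (hW.differentiableAt hψ hp) B.D
  rw [h, one_mul]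

lemma der_vT_radField : der vT (radField ψ) p = ‖p.2‖ * der vT ψ p :=
  der_vT_radial_mul (a := fun r => r) (hW.ne_zero hp) (hasDerivAt_id ‖p.2‖)
    (hW.differentiableAt hψ hp)

lemma der_vΩ_radField (i : Fin 3) : der (vΩ i) (radField ψ) p = ‖p.2‖ * der (vΩ i) ψ p :=
  der_vΩ_radial_mul (a := fun r => r) (hW.ne_zero hp) (hasDerivAt_id ‖p.2‖)
    (hW.differentiableAt hψ hp) i

lemma sphLap_radial_mul {a : ℝ → ℝ} (ha : ContDiffOn ℝ ∞ a (Ioi B.R₀)) :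
    sphLap (fun q => a ‖q.2‖ * ψ q) p = a ‖p.2‖ * sphLap ψ p := by
  simp only [sphLap, Finset.mul_sum]
  have had : ∀ q ∈ W, HasDerivAt a (deriv a ‖q.2‖) ‖q.2‖ := fun q hq =>
    ((ha.contDiffAt (Ioi_mem_nhds (hW.lt q hq))).differentiableAt (by simp)).hasDerivAt
  refine Finset.sum_congr rfl fun i _ => ?_
  rw [hW.der_congr (g := fun q => a ‖q.2‖ * der (vΩ i) ψ q)
    (fun q hq => der_vΩ_radial_mul (hW.ne_zero hq) (had q hq) (hW.differentiableAt hψ hq) i) hp]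
  exact der_vΩ_radial_mul (hW.ne_zero hp) (had p hp) (hW.differentiableAt (hW.der_vΩ hψ i) hp) i

lemma sphLap_radField : sphLap (radField ψ) p = ‖p.2‖ * sphLap ψ p :=
  sphLap_radial_mul hW hψ hp (a := fun r => r) contDiffOn_id

lemma sphLap_der_vR : sphLap (der (vR B.D) ψ) p = der (vR B.D) (sphLap ψ) p := by
  have h1 : der (vR B.D) (sphLap ψ) p = ∑ i, der (vR B.D) (der (vΩ i) (der (vΩ i) ψ)) p := by
    have hd : ∀ i ∈ (Finset.univ : Finset (Fin 3)),
        DifferentiableAt ℝ (der (vΩ i) (der (vΩ i) ψ)) p := fun i _ =>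
      hW.differentiableAt (hW.der_vΩ (hW.der_vΩ hψ i) i) hp
    have := fderiv_fun_sum hd
    simp only [der] at this ⊢
    change fderiv ℝ (fun q => ∑ i, der (vΩ i) (der (vΩ i) ψ) q) p _ = _
    simp only [der]
    rw [this]
    simp
  rw [h1]
  refine Finset.sum_congr rfl fun i _ => ?_
  rw [← hW.comm_ΩR (hW.der_vΩ hψ i) hp i]
  exact hW.der_congr (fun q hq => hW.comm_ΩR hψ hq i) hp

lemma der_vR_der_vR_radField : der (vR B.D) (der (vR B.D) (radField ψ)) p
    = 2 * der (vR B.D) ψ p + ‖p.2‖ * der (vR B.D) (der (vR B.D) ψ) p := by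
  rw [hW.der_congr (fun q hq => der_vR_radField hW hψ hq) hp,
    der_add (hW.differentiableAt hψ hp)
      (hW.differentiableAt (hW.radial_mul (hW.der_vR hψ) (a := fun r => r) contDiffOn_id) hp)]
  have h := der_vR_radial_mul (hW.ne_zero hp) (hasDerivAt_id ‖p.2‖)
    (hW.differentiableAt (hW.der_vR hψ) hp) B.D
  simp only [id, one_mul] at h
  rw [h]
  ring

lemma der_vT_der_vR_radField : der vT (der (vR B.D) (radField ψ)) p
    = der vT ψ p + ‖p.2‖ * der vT (der (vR B.D) ψ) p := by
  rw [hW.der_congr (fun q hq => der_vR_radField hW hψ hq) hp,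
    der_add (hW.differentiableAt hψ hp)
      (hW.differentiableAt (hW.radial_mul (hW.der_vR hψ) (a := fun r => r) contDiffOn_id) hp)]
  have h := der_vT_radial_mul (a := fun r => r) (hW.ne_zero hp) (hasDerivAt_id ‖p.2‖)
    (hW.differentiableAt (hW.der_vR hψ) hp)
  rw [h]

/-- The wave equation for the radiation field. -/
lemma wave_radField (hbox : box B.D ψ p = 0) :
    2 * der vT (der (vR B.D) (radField ψ)) p
      = B.D ‖p.2‖ * der (vR B.D) (der (vR B.D) (radField ψ)) p
        + deriv B.D ‖p.2‖ * der (vR B.D) (radField ψ) p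
        - deriv B.D ‖p.2‖ / ‖p.2‖ * radField ψ p + (‖p.2‖ ^ 2)⁻¹ * sphLap (radField ψ) p := by
  have hne := hW.ne_zero hp
  have hr : ‖p.2‖ ≠ 0 := norm_ne_zero_iff.mpr hne
  have hlt := hW.lt p hp
  have h := box_eq ((hW.contDiffAt hψ hp).of_le (WithTop.coe_le_coe.mpr (le_top : (3 : ℕ∞) ≤ ⊤)))
    hne (B.hasDerivAt_D (B.rmin_lt.trans hlt)) (B.D_pos' hlt).ne'
  rw [hbox] at h
  rw [der_vT_der_vR_radField hW hψ hp, der_vR_der_vR_radField hW hψ hp, der_vR_radField hW hψ hp,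
    sphLap_radField hW hψ hp]
  change 0 = _ + (‖p.2‖ ^ 2)⁻¹ * sphLap ψ p at h
  simp only [radField]
  field_simp at h ⊢
  linear_combination h

lemma der_vR_Phi : der (vR B.D) (Phi B.D ψ) p
    = 2 * ‖p.2‖ * der (vR B.D) (radField ψ) p
      + ‖p.2‖ ^ 2 * der (vR B.D) (der (vR B.D) (radField ψ)) p := by
  have h : der (vR B.D) (Phi B.D ψ) p = _ :=
    der_vR_radial_mul (a := fun r => r ^ 2) (hW.ne_zero hp) (hasDerivAt_pow 2 ‖p.2‖)
      (hW.differentiableAt (hW.der_vR (hW.radField hψ)) hp) B.D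
  rw [h]
  simp

lemma der_vT_Phi : der vT (Phi B.D ψ) p = ‖p.2‖ ^ 2 * der vT (der (vR B.D) (radField ψ)) p :=
  der_vT_radial_mul (a := fun r => r ^ 2) (hW.ne_zero hp) (hasDerivAt_pow 2 ‖p.2‖)
    (hW.differentiableAt (hW.der_vR (hW.radField hψ)) hp)

/-- The transport equation for `Φ` in the direction `∂_u`. -/
lemma wave_Phi (hbox : box B.D ψ p = 0) :
    2 * der vT (Phi B.D ψ) p = B.D ‖p.2‖ * der (vR B.D) (Phi B.D ψ) p
      + (deriv B.D ‖p.2‖ - 2 * B.D ‖p.2‖ / ‖p.2‖) * Phi B.D ψ p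
      - ‖p.2‖ * deriv B.D ‖p.2‖ * radField ψ p + sphLap (radField ψ) p := by
  have hr : ‖p.2‖ ≠ 0 := norm_ne_zero_iff.mpr (hW.ne_zero hp)
  have h := wave_radField hW hψ hp hbox
  rw [der_vT_Phi hW hψ hp, der_vR_Phi hW hψ hp]
  simp only [Phi]
  field_simp at h ⊢
  linear_combination h

/-- `∂_r` commutes with the rotations, so differentiating `Δ̸φ` reproduces `r⁻²Δ̸Φ` and introduces
no new unknown into the equation for `∂_rΦ`. -/
lemma der_vR_sphLap_radField :
    der (vR B.D) (sphLap (radField ψ)) p = (‖p.2‖ ^ 2)⁻¹ * sphLap (Phi B.D ψ) p := by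
  rw [← sphLap_der_vR hW (hW.radField hψ) hp]
  have hsm : ContDiffOn ℝ ∞ (fun r : ℝ => (r ^ 2)⁻¹) (Ioi B.R₀) :=
    (contDiffOn_id.pow 2).inv fun r hr => (pow_pos (B.R₀_pos.trans hr) 2).ne'
  rw [← sphLap_radial_mul hW (hW.Phi hψ) hp hsm]
  simp only [sphLap]
  refine Finset.sum_congr rfl fun i _ => ?_
  refine hW.der_congr (fun q hq => ?_) hp
  exact hW.der_congr (fun q hq => der_vR_radField_eq hW hq) hq

lemma der_vR_hatPhi : der (vR B.D) (B.hatPhi ψ) p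
    = der (vR B.D) (Phi B.D ψ) p + B.M * ((‖p.2‖ ^ 2)⁻¹ * Phi B.D ψ p) := by
  have h1 := hW.differentiableAt (hW.radField hψ) hp
  have h2 : der (vR B.D) (B.hatPhi ψ) p = _ :=
    der_add (hW.differentiableAt (hW.Phi hψ) hp) (h1.const_mul B.M)
  rw [h2, ← der_vR_radField_eq hW hp]
  rw [der_const_mul h1]

lemma der_hatPhi (X : Spt → Spt) : der X (B.hatPhi ψ) p
    = der X (Phi B.D ψ) p + B.M * der X (radField ψ) p := by
  have h1 := hW.differentiableAt (hW.radField hψ) hp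
  have h2 : der X (B.hatPhi ψ) p = _ :=
    der_add (hW.differentiableAt (hW.Phi hψ) hp) (h1.const_mul B.M)
  rw [h2]
  rw [der_const_mul h1]

end Pointwise

lemma FarNhd.hatPhi (hW : B.FarNhd W) (hψ : ContDiffOn ℝ ∞ ψ W) :
    ContDiffOn ℝ ∞ (B.hatPhi ψ) W :=
  (hW.Phi hψ).add (contDiffOn_const.mul (hW.radField hψ))

lemma FarNhd.sphLap (hW : B.FarNhd W) (hψ : ContDiffOn ℝ ∞ ψ W) :
    ContDiffOn ℝ ∞ (sphLap ψ) W :=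
  ContDiffOn.sum fun i _ => hW.der_vΩ (hW.der_vΩ hψ i) i

lemma sphLap_hatPhi (hW : B.FarNhd W) (hψ : ContDiffOn ℝ ∞ ψ W) {p : Spt} (hp : p ∈ W) :
    sphLap (B.hatPhi ψ) p = sphLap (Phi B.D ψ) p + B.M * sphLap (radField ψ) p := by
  simp only [RpHierarchy.sphLap, Finset.mul_sum, ← Finset.sum_add_distrib]
  refine Finset.sum_congr rfl fun i _ => ?_
  rw [hW.der_congr (fun q hq => der_hatPhi hW hψ hq (vΩ i)) hp]
  have h1 := hW.differentiableAt (hW.der_vΩ (hW.radField hψ) i) hp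
  rw [der_add (hW.differentiableAt (hW.der_vΩ (hW.Phi hψ) i) hp) (h1.const_mul B.M)]
  congr 1
  rw [der_const_mul h1]

/-- The equation for `f = ∂_r Φ`. -/
lemma wave_der_vR_Phi (hW : B.FarNhd W) (hψ : ContDiffOn ℝ ∞ ψ W)
    (hbox : ∀ p ∈ B.far, box B.D ψ p = 0) {u r : ℝ} (hu : 0 ≤ u) (hr : B.R₀ < r) (y : S2) :
    2 * der vT (der (vR B.D) (Phi B.D ψ)) (B.bondiPt u r y)
      = B.D r * der (vR B.D) (der (vR B.D) (Phi B.D ψ)) (B.bondiPt u r y)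
        + (2 * deriv B.D r - 2 * B.D r / r) * der (vR B.D) (Phi B.D ψ) (B.bondiPt u r y)
        + (r ^ 2)⁻¹ * sphLap (Phi B.D ψ) (B.bondiPt u r y)
        + (deriv (deriv B.D) r - 3 * deriv B.D r / r + 2 * B.D r / r ^ 2)
          * Phi B.D ψ (B.bondiPt u r y)
        - (deriv B.D r + r * deriv (deriv B.D) r) * radField ψ (B.bondiPt u r y) := by
  have hr0 : r ≠ 0 := (B.R₀_pos.trans hr).ne'
  have hp := hW.far_subset (bondiPt_mem_far hu hr y)
  have hD := B.hasDerivAt_D (B.rmin_lt.trans hr)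
  have hD1 := B.hasDerivAt_deriv_D (B.rmin_lt.trans hr)
  have hΦ := hW.Phi hψ
  have hφ := hW.radField hψ
  have e0 := hasDerivAt_ev_r hW (hW.der_vT hΦ) hu hr y
  have e1 := hasDerivAt_ev_r hW (hW.der_vR hΦ) hu hr y
  have e2 := hasDerivAt_ev_r hW hΦ hu hr y
  have e3 := hasDerivAt_ev_r hW hφ hu hr y
  have e4 := hasDerivAt_ev_r hW (hW.sphLap hφ) hu hr y
  have hid : HasDerivAt (fun t : ℝ => t) 1 r := hasDerivAt_id r
  have hR := (((hD.fun_mul e1).fun_add (((hD1.fun_sub ((hD.const_mul 2).fun_div hid hr0)).fun_mul e2))).fun_sub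
    ((hid.fun_mul hD1).fun_mul e3)).fun_add e4
  -- The transport equation for `Φ` holds along a whole piece of the generator through the point, so
  -- its two sides have the same `r`-derivative; comparing them gives the equation for `∂_rΦ`.
  have heq : (fun t => 2 * der vT (Phi B.D ψ) (B.bondiPt u t y)) =ᶠ[𝓝 r]
      fun t => B.D t * der (vR B.D) (Phi B.D ψ) (B.bondiPt u t y)
        + (deriv B.D t - 2 * B.D t / t) * Phi B.D ψ (B.bondiPt u t y)
        - t * deriv B.D t * radField ψ (B.bondiPt u t y)
        + RpHierarchy.sphLap (radField ψ) (B.bondiPt u t y) := by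
    filter_upwards [Ioi_mem_nhds hr] with t ht
    have hpt := hW.far_subset (bondiPt_mem_far hu ht y)
    have h := wave_Phi hW hψ hpt (hbox _ (bondiPt_mem_far hu ht y))
    simp only [norm_bondiPt ht] at h
    exact h
  have h := ((e0.const_mul 2).congr_of_eventuallyEq heq.symm).unique hR
  rw [hW.comm_TR hΦ hp, h, der_vR_sphLap_radField hW hψ hp, der_vR_radField_eq hW hp]
  simp only [norm_bondiPt hr]
  field_simp
  ring

/-- The equation for `g = ∂_r h`, `h = Φ + M φ`. -/
lemma wave_der_vR_hatPhi (hW : B.FarNhd W) (hψ : ContDiffOn ℝ ∞ ψ W)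
    (hbox : ∀ p ∈ B.far, box B.D ψ p = 0) {u r : ℝ} (hu : 0 ≤ u) (hr : B.R₀ < r) (y : S2) :
    2 * der vT (der (vR B.D) (B.hatPhi ψ)) (B.bondiPt u r y)
      = B.D r * der (vR B.D) (der (vR B.D) (B.hatPhi ψ)) (B.bondiPt u r y)
        + (2 * deriv B.D r - 2 * B.D r / r) * der (vR B.D) (B.hatPhi ψ) (B.bondiPt u r y)
        + (r ^ 2)⁻¹ * (sphLap (B.hatPhi ψ) (B.bondiPt u r y) + 2 * B.hatPhi ψ (B.bondiPt u r y))
        + B.coefH r * B.hatPhi ψ (B.bondiPt u r y)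
        + B.coefPhi r * radField ψ (B.bondiPt u r y) := by
  have hr0 : r ≠ 0 := (B.R₀_pos.trans hr).ne'
  have hf := bondiPt_mem_far hu hr y
  have hp := hW.far_subset hf
  have hΦ := hW.Phi hψ
  have h1 := wave_der_vR_Phi hW hψ hbox hu hr y
  have h2 := wave_Phi hW hψ hp (hbox _ hf)
  have hsm : ContDiffOn ℝ ∞ (fun r : ℝ => (r ^ 2)⁻¹) (Ioi B.R₀) :=
    (contDiffOn_id.pow 2).inv fun r hr => (pow_pos (B.R₀_pos.trans hr) 2).ne'
  have hdr : HasDerivAt (fun r : ℝ => (r ^ 2)⁻¹) (-2 / r ^ 3) r := by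
    refine ((hasDerivAt_pow 2 r).fun_inv (pow_ne_zero 2 hr0)).congr_deriv ?_
    field_simp
    norm_num
    ring
  have hdr' : HasDerivAt (fun r : ℝ => (r ^ 2)⁻¹) (-2 / r ^ 3) ‖(B.bondiPt u r y).2‖ := by
    rw [norm_bondiPt hr]; exact hdr
  have hd1 := hW.differentiableAt (hW.der_vR hΦ) hp
  have hd2 : DifferentiableAt ℝ (fun q : Spt => (‖q.2‖ ^ 2)⁻¹ * Phi B.D ψ q) (B.bondiPt u r y) :=
    hW.differentiableAt (hW.radial_mul hΦ hsm) hp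
  have hX : ∀ X : Spt → Spt, der X (der (vR B.D) (B.hatPhi ψ)) (B.bondiPt u r y)
      = der X (der (vR B.D) (Phi B.D ψ)) (B.bondiPt u r y)
        + B.M * der X (fun q => (‖q.2‖ ^ 2)⁻¹ * Phi B.D ψ q) (B.bondiPt u r y) := by
    intro X
    rw [hW.der_congr (fun q hq => der_vR_hatPhi hW hψ hq) hp, der_add hd1 (hd2.const_mul B.M)]
    congr 1
    rw [der_const_mul hd2]
  have hT := der_vT_radial_mul (hW.ne_zero hp) hdr' (hW.differentiableAt hΦ hp)
  have hRR := der_vR_radial_mul (hW.ne_zero hp) hdr' (hW.differentiableAt hΦ hp) B.D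
  rw [hX, hX, hT, hRR, sphLap_hatPhi hW hψ hp, der_vR_hatPhi hW hψ hp]
  simp only [norm_bondiPt hr, hatPhi, coefPhi, coefH] at h2 ⊢
  generalize der vT (Phi B.D ψ) (B.bondiPt u r y) = TΦ at *
  generalize der vT (der (vR B.D) (Phi B.D ψ)) (B.bondiPt u r y) = Tf at *
  generalize der (vR B.D) (der (vR B.D) (Phi B.D ψ)) (B.bondiPt u r y) = Rf at *
  generalize der (vR B.D) (Phi B.D ψ) (B.bondiPt u r y) = f at *
  generalize Phi B.D ψ (B.bondiPt u r y) = Φ at *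
  generalize radField ψ (B.bondiPt u r y) = φ at *
  generalize RpHierarchy.sphLap (Phi B.D ψ) (B.bondiPt u r y) = LΦ at *
  generalize RpHierarchy.sphLap (radField ψ) (B.bondiPt u r y) = Lφ at *
  generalize deriv (deriv B.D) r = D2 at *
  generalize deriv B.D r = D1 at *
  generalize B.D r = D at *
  field_simp at h1 h2 ⊢
  -- The equation for `∂_rΦ` plus `M r⁻²` times the transport equation for `Φ`, with denominators
  -- cleared. The `Δ̸φ` of the latter completes `Δ̸Φ` to `Δ̸h`, and the leading part `2M r⁻²φ` of
  -- `-(D' + rD'')φ` completes `2Φ` to `2h`.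
  linear_combination r * h1 + B.M * h2

end Equations

end Background

end RpHierarchy

/-! ### Decay of the coefficients and growth of the tortoise coordinate. -/

namespace RpHierarchy

namespace Background

variable (B : Background)

/-- The rate `min(β, 1)` at which the coefficients decay beyond their leading order. -/
def rate : ℝ := min B.β 1

lemma rate_pos : 0 < B.rate := lt_min B.β_pos one_pos

lemma rate_le_one : B.rate ≤ 1 := min_le_right _ _

/-- The error term of `D`, with its first two derivatives. -/
lemma error_bounds : ∃ c : ℝ, 0 ≤ c ∧ ∀ r, B.R₀ < r → 1 ≤ r →
    |B.D r - (1 - 2 * B.M / r)| ≤ c * r ^ (-1 - B.rate) ∧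
    |deriv B.D r - 2 * B.M / r ^ 2| ≤ c * r ^ (-2 - B.rate) ∧
    |deriv (deriv B.D) r + 4 * B.M / r ^ 3| ≤ c * r ^ (-3 - B.rate) := by
  obtain ⟨c0, h0⟩ := B.asymp 0 (by norm_num)
  obtain ⟨c1, h1⟩ := B.asymp 1 (by norm_num)
  obtain ⟨c2, h2⟩ := B.asymp 2 (by norm_num)
  have d1 : ∀ r, B.R₀ < r → deriv (fun t => B.D t - (1 - 2 * B.M / t)) r
      = deriv B.D r - 2 * B.M / r ^ 2 := by
    intro r hr
    have hr0 : r ≠ 0 := (B.R₀_pos.trans hr).ne'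
    have h := (B.hasDerivAt_D (B.rmin_lt.trans hr)).fun_sub
      ((((hasDerivAt_id r).fun_inv hr0).const_mul (2 * B.M)).const_sub 1)
    simp only [id, ← div_eq_mul_inv] at h
    rw [h.deriv]
    field_simp
  have d2 : ∀ r, B.R₀ < r → deriv (deriv (fun t => B.D t - (1 - 2 * B.M / t))) r
      = deriv (deriv B.D) r + 4 * B.M / r ^ 3 := by
    intro r hr
    have hr0 : r ≠ 0 := (B.R₀_pos.trans hr).ne'
    have heq : deriv (fun t => B.D t - (1 - 2 * B.M / t)) =ᶠ[𝓝 r]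
        fun t => deriv B.D t - 2 * B.M * (t ^ 2)⁻¹ := by
      filter_upwards [Ioi_mem_nhds hr] with t ht
      rw [d1 t ht, div_eq_mul_inv]
    rw [heq.deriv_eq]
    have h := (B.hasDerivAt_deriv_D (B.rmin_lt.trans hr)).fun_sub
      (((hasDerivAt_pow 2 r).fun_inv (pow_ne_zero 2 hr0)).const_mul (2 * B.M))
    rw [h.deriv]
    field_simp
    norm_num
    ring
  refine ⟨max (max c0 c1) (max c2 0), le_max_of_le_right (le_max_right _ _), fun r hr h1r => ?_⟩
  have hσ : B.rate ≤ B.β := min_le_left _ _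
  -- For `r ≥ 1` the exponents may be raised, so the decay order `β` can be replaced by the smaller
  -- `B.rate`, and the three constants by their maximum.
  have key : ∀ (x e e' : ℝ) (c : ℝ), |x| ≤ c * r ^ e → e ≤ e' → c ≤ max (max c0 c1) (max c2 0) →
      |x| ≤ max (max c0 c1) (max c2 0) * r ^ e' := by
    intro x e e' c hx he hc
    calc |x| ≤ c * r ^ e := hx
      _ ≤ max (max c0 c1) (max c2 0) * r ^ e :=
          mul_le_mul_of_nonneg_right hc (Real.rpow_nonneg (by linarith) _)
      _ ≤ _ := mul_le_mul_of_nonneg_left (Real.rpow_le_rpow_of_exponent_le h1r he)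
          (le_max_of_le_right (le_max_right _ _))
  have a0 := h0 r hr.le
  have a1 := h1 r hr.le
  have a2 := h2 r hr.le
  rw [iteratedDeriv_zero] at a0
  rw [iteratedDeriv_one, d1 r hr] at a1
  rw [iteratedDeriv_succ, iteratedDeriv_one, d2 r hr] at a2
  refine ⟨key _ _ _ _ a0 ?_ ?_, key _ _ _ _ a1 ?_ ?_, key _ _ _ _ a2 ?_ ?_⟩
  · push_cast; linarith
  · exact le_max_of_le_left (le_max_left _ _)
  · push_cast; linarith
  · exact le_max_of_le_left (le_max_right _ _)
  · push_cast; linarith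
  · exact le_max_of_le_right (le_max_left _ _)

-- The gain `r^{-σ}` over the critical power `r⁻²` rests on a cancellation. In `coefPhi` the leading
-- parts of `D'` and `rD''` are `2M r⁻²` and `-4M r⁻²`, and the extra `2M r⁻²` produced by the
-- correction `Mφ` removes what is left. In `coefH` every summand is already of order `r⁻³`. The
-- radius `r₁` is chosen so that `|D - 1| ≤ 1/2` beyond it.
set_option maxHeartbeats 800000 in
lemma exists_coef_bounds : ∃ K r₁ : ℝ, 0 < K ∧ B.R₀ < r₁ ∧ 1 ≤ r₁ ∧ ∀ r, r₁ ≤ r →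
    1 / 2 ≤ B.D r ∧ B.D r ≤ 2 ∧ |deriv B.D r| ≤ K * r ^ (-1 - B.rate) ∧
    |B.coefH r| ≤ K * r ^ (-2 - B.rate) ∧ |B.coefPhi r| ≤ K * r ^ (-2 - B.rate) := by
  obtain ⟨c, hc, h⟩ := B.error_bounds
  have hσ := B.rate_pos
  have hσ1 := B.rate_le_one
  have hM := B.M_nonneg
  set A : ℝ := 2 * B.M + c with hA
  have hA0 : 0 ≤ A := by positivity
  -- Chosen generously: what is needed is that `K` dominates the three constants in `hKs`, which
  -- come from the bounds for `D'`, `coefH` and `coefPhi`.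
  set K : ℝ := 1 + 20 * A + 2 * c + B.M * (4 + 20 * A) + B.M ^ 2 * (A + 4) with hK
  have hKs : A ≤ K ∧ 7 * A + B.M * (A + 4) ≤ K ∧
      c + c + B.M * A + B.M * (7 * A + B.M * (A + 4)) ≤ K := by
    refine ⟨?_, ?_, ?_⟩ <;> (rw [hK, ← sub_nonneg]; ring_nf; positivity)
  refine ⟨K, B.R₀ + 1 + 2 * A, by positivity, by linarith, by linarith [B.R₀_pos], fun r hr => ?_⟩
  have hr0 : B.R₀ < r := by linarith
  have h1r : 1 ≤ r := by linarith [B.R₀_pos]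
  have hrp : 0 < r := by linarith
  obtain ⟨e0, e1, e2⟩ := h r hr0 h1r
  set E := B.D r - (1 - 2 * B.M / r) with hE
  set E1 := deriv B.D r - 2 * B.M / r ^ 2 with hE1
  set E2 := deriv (deriv B.D) r + 4 * B.M / r ^ 3 with hE2
  set s := r ^ (-B.rate) with hs
  have hs0 : 0 < s := Real.rpow_pos_of_pos hrp _
  have hs1 : s ≤ 1 := Real.rpow_le_one_of_one_le_of_nonpos h1r (by linarith)
  have hsr : r⁻¹ ≤ s := by
    rw [← Real.rpow_neg_one]
    exact Real.rpow_le_rpow_of_exponent_le h1r (by linarith)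
  have p1 : r ^ (-1 - B.rate) = r⁻¹ * s := by
    rw [sub_eq_add_neg, Real.rpow_add hrp, Real.rpow_neg_one]
  have p2 : r ^ (-2 - B.rate) = r⁻¹ ^ 2 * s := by
    rw [sub_eq_add_neg, Real.rpow_add hrp, Real.rpow_neg hrp.le, Real.rpow_two, inv_pow]
  have p3 : r ^ (-3 - B.rate) = r⁻¹ ^ 3 * s := by
    rw [sub_eq_add_neg, Real.rpow_add hrp, Real.rpow_neg hrp.le, Real.rpow_ofNat, inv_pow]
  rw [p1] at e0
  rw [p2] at e1
  rw [p3] at e2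
  rw [p1, p2]
  set i := r⁻¹ with hi
  have hi0 : 0 < i := inv_pos.mpr hrp
  have hi1 : i ≤ 1 := inv_le_one_of_one_le₀ h1r
  have eD : B.D r = E + 1 - 2 * B.M * i := by rw [hE, hi]; ring
  have eD1 : deriv B.D r = E1 + 2 * B.M * i ^ 2 := by rw [hE1, hi]; field_simp; ring
  have eD2 : deriv (deriv B.D) r = E2 - 4 * B.M * i ^ 3 := by rw [hE2, hi]; field_simp; ring
  have hiA : 2 * A * i ≤ 1 := by
    rw [hi, ← div_eq_mul_inv, div_le_one hrp]
    linarith [B.R₀_pos]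
  have bE : |E| ≤ c * i := e0.trans (by
    have : i * s ≤ i * 1 := mul_le_mul_of_nonneg_left hs1 hi0.le
    nlinarith)
  have bD : |B.D r - 1| ≤ A * i := by
    rw [eD, abs_le]
    have := abs_le.mp bE
    have : 0 ≤ B.M * i := by positivity
    constructor <;> nlinarith
  have hDl := abs_le.mp bD
  have hD2 : |B.D r| ≤ 2 := by rw [abs_le]; constructor <;> linarith
  have his : i * i ≤ i * s := mul_le_mul_of_nonneg_left hsr hi0.le
  have b1 : |deriv B.D r| ≤ A * i ^ 2 := by
    rw [eD1]
    refine (abs_add_le _ _).trans ?_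
    rw [abs_of_nonneg (by positivity : 0 ≤ 2 * B.M * i ^ 2)]
    have h1 : c * (i ^ 2 * s) ≤ c * (i ^ 2 * 1) :=
      mul_le_mul_of_nonneg_left (mul_le_mul_of_nonneg_left hs1 (by positivity)) hc
    have h2 : A * i ^ 2 = 2 * B.M * i ^ 2 + c * i ^ 2 := by rw [hA]; ring
    linarith only [h1, h2, e1]
  have b2 : |deriv (deriv B.D) r| ≤ 2 * A * i ^ 3 := by
    rw [eD2]
    refine (abs_sub _ _).trans ?_
    rw [abs_of_nonneg (by positivity : 0 ≤ 4 * B.M * i ^ 3)]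
    have h1 : c * (i ^ 3 * s) ≤ c * (i ^ 3 * 1) :=
      mul_le_mul_of_nonneg_left (mul_le_mul_of_nonneg_left hs1 (by positivity)) hc
    have h0 : 0 ≤ c * i ^ 3 := by positivity
    have h2 : A * i ^ 3 = 2 * B.M * i ^ 3 + c * i ^ 3 := by rw [hA]; ring
    linarith only [h1, h2, h0, e2]
  have bH : |B.coefH r| ≤ (7 * A + B.M * (A + 4)) * i ^ 3 := by
    have e : B.coefH r = deriv (deriv B.D) r - 3 * (deriv B.D r * i) + 2 * ((B.D r - 1) * i ^ 2)
        - B.M * (deriv B.D r * i ^ 2 - 2 * (B.D r * i ^ 3)) := by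
      rw [coefH, hi]; field_simp
    have q1 : |deriv B.D r * i| ≤ A * i ^ 3 := by
      rw [abs_mul, abs_of_pos hi0]
      calc _ ≤ A * i ^ 2 * i := mul_le_mul_of_nonneg_right b1 hi0.le
        _ = _ := by ring
    have q2 : |(B.D r - 1) * i ^ 2| ≤ A * i ^ 3 := by
      rw [abs_mul, abs_of_pos (by positivity : 0 < i ^ 2)]
      calc _ ≤ A * i * i ^ 2 := mul_le_mul_of_nonneg_right bD (by positivity)
        _ = _ := by ring
    have q3 : |deriv B.D r * i ^ 2| ≤ A * i ^ 3 := by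
      rw [abs_mul, abs_of_pos (by positivity : 0 < i ^ 2)]
      calc _ ≤ A * i ^ 2 * i ^ 2 := mul_le_mul_of_nonneg_right b1 (by positivity)
        _ = A * i ^ 3 * i := by ring
        _ ≤ A * i ^ 3 * 1 := mul_le_mul_of_nonneg_left hi1 (by positivity)
        _ = _ := by ring
    have q4 : |B.D r * i ^ 3| ≤ 2 * i ^ 3 := by
      rw [abs_mul, abs_of_pos (by positivity : 0 < i ^ 3)]
      exact mul_le_mul_of_nonneg_right hD2 (by positivity)
    have q5 : |B.M * (deriv B.D r * i ^ 2 - 2 * (B.D r * i ^ 3))| ≤ B.M * ((A + 4) * i ^ 3) := by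
      rw [abs_mul, abs_of_nonneg hM]
      refine mul_le_mul_of_nonneg_left ?_ hM
      rw [abs_le] at q3 q4 ⊢
      constructor <;> linarith only [q3.1, q3.2, q4.1, q4.2]
    rw [e]
    rw [abs_le] at b2 q1 q2 q5 ⊢
    constructor <;> linarith only [b2.1, b2.2, q1.1, q1.2, q2.1, q2.2, q5.1, q5.2]
  have bH' : |B.coefH r| ≤ (7 * A + B.M * (A + 4)) * (i ^ 2 * s) := bH.trans (by
    refine mul_le_mul_of_nonneg_left ?_ (by positivity)
    calc i ^ 3 = i ^ 2 * i := by ring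
      _ ≤ _ := mul_le_mul_of_nonneg_left hsr (by positivity))
  have his0 : 0 ≤ i ^ 2 * s := by positivity
  refine ⟨by linarith, by linarith, ?_, bH'.trans ?_, ?_⟩
  · refine b1.trans ?_
    calc A * i ^ 2 = A * (i * i) := by ring
      _ ≤ A * (i * s) := mul_le_mul_of_nonneg_left his hA0
      _ ≤ K * (i * s) := by
        refine mul_le_mul_of_nonneg_right ?_ (by positivity)
        exact hKs.1
  · refine mul_le_mul_of_nonneg_right ?_ his0
    exact hKs.2.1
  · have e : B.coefPhi r = -(E1 + r * E2) - B.M * (deriv B.D r * i) - B.M * B.coefH r := by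
      rw [coefPhi, hE1, hE2, hi]; field_simp; ring
    have q1 : |r * E2| ≤ c * (i ^ 2 * s) := by
      rw [abs_mul, abs_of_pos hrp]
      calc _ ≤ r * (c * (i ^ 3 * s)) := mul_le_mul_of_nonneg_left e2 hrp.le
        _ = c * (i ^ 2 * s) * (r * i) := by ring
        _ = _ := by rw [hi, mul_inv_cancel₀ hrp.ne', mul_one]
    have q2 : |B.M * (deriv B.D r * i)| ≤ B.M * (A * (i ^ 2 * s)) := by
      rw [abs_mul, abs_of_nonneg hM, abs_mul, abs_of_pos hi0]
      refine mul_le_mul_of_nonneg_left ?_ hM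
      calc _ ≤ A * i ^ 2 * i := mul_le_mul_of_nonneg_right b1 hi0.le
        _ = A * (i ^ 2 * i) := by ring
        _ ≤ _ := mul_le_mul_of_nonneg_left
            (mul_le_mul_of_nonneg_left hsr (by positivity)) hA0
    have q3 : |B.M * B.coefH r| ≤ B.M * ((7 * A + B.M * (A + 4)) * (i ^ 2 * s)) := by
      rw [abs_mul, abs_of_nonneg hM]
      exact mul_le_mul_of_nonneg_left bH' hM
    rw [e]
    calc _ ≤ (c + c + B.M * A + B.M * (7 * A + B.M * (A + 4))) * (i ^ 2 * s) := by
          rw [abs_le] at e1 q1 q2 q3 ⊢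
          constructor <;> linarith only [e1.1, e1.2, q1.1, q1.2, q2.1, q2.2, q3.1, q3.2]
      _ ≤ _ := mul_le_mul_of_nonneg_right hKs.2.2 his0

/-- For large `r` one has `1/D ≥ 1/2`, so `r_* - r/2` is nondecreasing there. -/
lemma tendsto_rstar : Tendsto B.rstar atTop atTop := by
  obtain ⟨K, r₁, -, hr₁, -, h⟩ := B.exists_coef_bounds
  have hd : ∀ r, r₁ ≤ r → HasDerivAt (fun t => B.rstar t - t / 2) ((B.D r)⁻¹ - 1 / 2) r :=
    fun r hr => (B.hasDerivAt_rstar (B.rmin_lt.trans (hr₁.trans_le hr))).fun_sub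
      ((hasDerivAt_id r).div_const 2)
  have hmono : MonotoneOn (fun t => B.rstar t - t / 2) (Ici r₁) := by
    refine monotoneOn_of_deriv_nonneg (convex_Ici _)
      (fun r hr => (hd r hr).continuousAt.continuousWithinAt)
      (fun r hr => (hd r (interior_subset hr)).differentiableAt.differentiableWithinAt)
      fun r hr => ?_
    have hr' : r₁ ≤ r := interior_subset hr
    rw [(hd r hr').deriv]
    have h1 := h r hr'
    rw [sub_nonneg, one_div]
    exact inv_anti₀ (by linarith [h1.1]) h1.2.1
  refine tendsto_atTop_mono' atTop (f₁ := fun r => r / 2 + (B.rstar r₁ - r₁ / 2)) ?_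
    (tendsto_atTop_add_const_right _ _ (tendsto_id.atTop_div_const two_pos))
  filter_upwards [eventually_ge_atTop r₁] with r hr
  have := hmono self_mem_Ici hr hr
  simp only at this
  linarith

end Background

end RpHierarchy

/-! ### Integrals over truncated cones and spacetime slabs. -/

namespace RpHierarchy

namespace Background

/-- The measure `τ ⊗ dr ⊗ dω` on `(u, r, y)` with `a ≤ r ≤ b`. -/
def boxMeasure (τ : Measure ℝ) (a b : ℝ) : Measure (ℝ × ℝ × S2) :=
  τ.prod ((volume.restrict (Icc a b)).prod dω)

/-- The integral of `F` over `a ≤ r ≤ b` with respect to `dτ(u) dr dω`. -/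
def farInt (B : Background) (τ : Measure ℝ) (a b : ℝ) (F : Spt → ℝ) : ℝ :=
  ∫ z, F (B.bondiPt z.1 z.2.1 z.2.2) ∂boxMeasure τ a b

/-- Finite measures on a compact interval of times `u ≥ 0`. -/
structure TimeMeasure (τ : Measure ℝ) (u₁ u₂ : ℝ) : Prop where
  finite : IsFiniteMeasure τ
  nonneg : 0 ≤ u₁
  mem : ∀ᵐ u ∂τ, u ∈ Icc u₁ u₂

/-- A Dirac mass in `u` yields fluxes through a single cone, Lebesgue measure on an interval yields
bulk integrals. All inequalities below that do not differentiate in `u` are proved for both at once.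
-/
lemma timeMeasure_dirac {u : ℝ} (hu : 0 ≤ u) : TimeMeasure (Measure.dirac u) u u :=
  ⟨inferInstance, hu, by simp [ae_dirac_eq]⟩

lemma timeMeasure_restrict {u₁ u₂ : ℝ} (hu : 0 ≤ u₁) :
    TimeMeasure (volume.restrict (Icc u₁ u₂)) u₁ u₂ :=
  ⟨inferInstance, hu, ae_restrict_mem measurableSet_Icc⟩

section FarInt

variable {B : Background} {W : Set Spt} {F G : Spt → ℝ} {τ : Measure ℝ} {u₁ u₂ a b : ℝ}

lemma boxMeasure_ae (hτ : TimeMeasure τ u₁ u₂) :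
    ∀ᵐ z ∂boxMeasure τ a b, z.1 ∈ Icc u₁ u₂ ∧ z.2.1 ∈ Icc a b := by
  have := hτ.finite
  have h1 : ∀ᵐ z ∂boxMeasure τ a b, z.1 ∈ Icc u₁ u₂ :=
    Measure.quasiMeasurePreserving_fst.ae hτ.mem
  have h2 : ∀ᵐ w ∂((volume.restrict (Icc a b)).prod dω), w.1 ∈ Icc a b :=
    Measure.quasiMeasurePreserving_fst.ae (ae_restrict_mem measurableSet_Icc)
  have h3 : ∀ᵐ z ∂boxMeasure τ a b, z.2.1 ∈ Icc a b :=
    Measure.quasiMeasurePreserving_snd.ae h2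
  filter_upwards [h1, h3] with z hz1 hz3 using ⟨hz1, hz3⟩

lemma integrable_box (hW : B.FarNhd W) (hF : ContinuousOn F W) (hτ : TimeMeasure τ u₁ u₂)
    (ha : B.R₀ < a) :
    Integrable (fun z : ℝ × ℝ × S2 => F (B.bondiPt z.1 z.2.1 z.2.2)) (boxMeasure τ a b) := by
  have := hτ.finite
  have hfin : IsFiniteMeasure (boxMeasure τ a b) := by unfold boxMeasure; infer_instance
  have hK : IsCompact (Icc u₁ u₂ ×ˢ Icc a b ×ˢ (univ : Set S2)) :=
    isCompact_Icc.prod (isCompact_Icc.prod isCompact_univ)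
  have hc : ContinuousOn (fun z : ℝ × ℝ × S2 => F (B.bondiPt z.1 z.2.1 z.2.2))
      (Icc u₁ u₂ ×ˢ Icc a b ×ˢ (univ : Set S2)) :=
    (continuousOn_ev hW hF).mono fun z hz => ⟨hτ.nonneg.trans hz.1.1, ha.trans_le hz.2.1.1⟩
  have h := hc.integrableOn_compact (μ := boxMeasure τ a b) hK
  rwa [IntegrableOn, Measure.restrict_eq_self_of_ae_mem] at h
  filter_upwards [boxMeasure_ae hτ] with z hz
  exact ⟨hz.1, hz.2, mem_univ _⟩

lemma farInt_const_mul (c : ℝ) : B.farInt τ a b (fun p => c * F p) = c * B.farInt τ a b F :=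
  integral_const_mul _ _

section Linear

variable (hW : B.FarNhd W) (hF : ContinuousOn F W) (hG : ContinuousOn G W)
  (hτ : TimeMeasure τ u₁ u₂) (ha : B.R₀ < a)
include hW hF hτ ha

include hG

lemma farInt_add : B.farInt τ a b (fun p => F p + G p) = B.farInt τ a b F + B.farInt τ a b G :=
  integral_add (integrable_box hW hF hτ ha) (integrable_box hW hG hτ ha)

lemma farInt_sub : B.farInt τ a b (fun p => F p - G p) = B.farInt τ a b F - B.farInt τ a b G :=
  integral_sub (integrable_box hW hF hτ ha) (integrable_box hW hG hτ ha)

lemma farInt_mono (h : ∀ u ∈ Icc u₁ u₂, ∀ r ∈ Icc a b, ∀ y : S2,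
    F (B.bondiPt u r y) ≤ G (B.bondiPt u r y)) : B.farInt τ a b F ≤ B.farInt τ a b G := by
  refine integral_mono_ae (integrable_box hW hF hτ ha) (integrable_box hW hG hτ ha) ?_
  filter_upwards [boxMeasure_ae hτ] with z hz using h _ hz.1 _ hz.2 _

end Linear

lemma farInt_sum (hW : B.FarNhd W) (hτ : TimeMeasure τ u₁ u₂) (ha : B.R₀ < a)
    {F : Fin 3 → Spt → ℝ} (hF : ∀ i, ContinuousOn (F i) W) :
    B.farInt τ a b (fun p => ∑ i, F i p) = ∑ i, B.farInt τ a b (F i) :=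
  integral_finsetSum _ fun i _ => integrable_box hW (hF i) hτ ha

lemma farInt_nonneg (hτ : TimeMeasure τ u₁ u₂) (h : ∀ u ∈ Icc u₁ u₂, ∀ r ∈ Icc a b, ∀ y : S2,
    0 ≤ F (B.bondiPt u r y)) : 0 ≤ B.farInt τ a b F := by
  refine integral_nonneg_of_ae ?_
  filter_upwards [boxMeasure_ae hτ] with z hz using h _ hz.1 _ hz.2 _

lemma farInt_congr (hτ : TimeMeasure τ u₁ u₂) (h : ∀ u ∈ Icc u₁ u₂, ∀ r ∈ Icc a b, ∀ y : S2,
    F (B.bondiPt u r y) = G (B.bondiPt u r y)) : B.farInt τ a b F = B.farInt τ a b G := by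
  refine integral_congr_ae ?_
  filter_upwards [boxMeasure_ae hτ] with z hz using h _ hz.1 _ hz.2 _

/-- The positivity available for `ℓ ≥ 1` holds only after integration over each sphere; Fubini makes
this sufficient, provided that the weight is constant on spheres. -/
lemma farInt_nonneg_of_sphere (hW : B.FarNhd W) (hF : ContinuousOn F W)
    (hτ : TimeMeasure τ u₁ u₂) (ha : B.R₀ < a)
    (h : ∀ u ∈ Icc u₁ u₂, ∀ r ∈ Icc a b, 0 ≤ ∫ y : S2, F (B.bondiPt u r y) ∂dω) :
    0 ≤ B.farInt τ a b F := by
  have := hτ.finite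
  have hi := integrable_box hW hF hτ ha (b := b)
  rw [farInt, boxMeasure, integral_prod _ hi]
  refine integral_nonneg_of_ae ?_
  filter_upwards [hτ.mem, hi.prod_right_ae] with u hu hiu
  rw [integral_prod _ hiu]
  refine integral_nonneg_of_ae ?_
  filter_upwards [ae_restrict_mem measurableSet_Icc] with r hr using h u hu r hr

/-- Sphere-wise comparison of integrals. -/
lemma farInt_mono_of_sphere (hW : B.FarNhd W) (hF : ContinuousOn F W) (hG : ContinuousOn G W)
    (hτ : TimeMeasure τ u₁ u₂) (ha : B.R₀ < a)
    (h : ∀ u ∈ Icc u₁ u₂, ∀ r ∈ Icc a b,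
      ∫ y : S2, F (B.bondiPt u r y) ∂dω ≤ ∫ y : S2, G (B.bondiPt u r y) ∂dω) :
    B.farInt τ a b F ≤ B.farInt τ a b G := by
  rw [← sub_nonneg, ← farInt_sub hW hG hF hτ ha]
  refine farInt_nonneg_of_sphere hW (hG.fun_sub hF) hτ ha fun u hu r hr => ?_
  have hu0 := hτ.nonneg.trans hu.1
  have hr0 := ha.trans_le hr.1
  rw [integral_sub (integrable_sphere (integrable_ev hW hG hu0 hr0))
    (integrable_sphere (integrable_ev hW hF hu0 hr0)), sub_nonneg]
  exact h u hu r hr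

lemma farInt_vΩ (hW : B.FarNhd W) (hF : ContDiffOn ℝ ∞ F W) (hτ : TimeMeasure τ u₁ u₂)
    (ha : B.R₀ < a) (i : Fin 3) : B.farInt τ a b (der (vΩ i) F) = 0 := by
  have hc := (hW.der_vΩ hF i).continuousOn
  have h0 : B.farInt τ a b (fun _ => 0) = 0 := by simp [farInt]
  have hs : ∀ u ∈ Icc u₁ u₂, ∀ r ∈ Icc a b,
      ∫ y : S2, der (vΩ i) F (B.bondiPt u r y) ∂dω = 0 := fun u hu r hr =>
    integral_vΩ hW hF (hτ.nonneg.trans hu.1) (ha.trans_le hr.1) i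
  rw [← h0]
  refine le_antisymm (farInt_mono_of_sphere hW hc continuousOn_const hτ ha fun u hu r hr => ?_)
    (farInt_mono_of_sphere hW continuousOn_const hc hτ ha fun u hu r hr => ?_)
  · rw [hs u hu r hr]; simp
  · rw [hs u hu r hr]; simp

/-- The fundamental theorem along the generators of the cones. In the applications the cutoffs
supply the vanishing at the two ends. -/
lemma farInt_vR (hW : B.FarNhd W) (hF : ContDiffOn ℝ ∞ F W) (hτ : TimeMeasure τ u₁ u₂)
    (ha : B.R₀ < a) (hab : a ≤ b) (h0 : ∀ u ∈ Icc u₁ u₂, ∀ y : S2, F (B.bondiPt u a y) = 0)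
    (h1 : ∀ u ∈ Icc u₁ u₂, ∀ y : S2, F (B.bondiPt u b y) = 0) :
    B.farInt τ a b (der (vR B.D) F) = 0 := by
  have := hτ.finite
  have hc := (hW.der_vR hF).continuousOn
  have hi := integrable_box hW hc hτ ha (b := b)
  rw [farInt, boxMeasure, integral_prod _ hi]
  refine integral_eq_zero_of_ae ?_
  filter_upwards [hτ.mem, hi.prod_right_ae] with u hu hiu
  rw [integral_prod_symm _ hiu]
  refine integral_eq_zero_of_ae (.of_forall fun y => ?_)
  have hu0 := hτ.nonneg.trans hu.1
  change ∫ r in Icc a b, der (vR B.D) F (B.bondiPt u r y) = 0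
  rw [integral_Icc_eq_integral_Ioc, ← intervalIntegral.integral_of_le hab,
    intervalIntegral.integral_eq_sub_of_hasDerivAt (E := ℝ) (f := fun r => F (B.bondiPt u r y)),
    h0 u hu y, h1 u hu y, sub_zero]
  · intro r hr
    rw [uIcc_of_le hab] at hr
    exact hasDerivAt_ev_r hW hF hu0 (ha.trans_le hr.1) y
  · refine ContinuousOn.intervalIntegrable ?_
    rw [uIcc_of_le hab]
    exact (continuousOn_ev hW hc).comp (f := fun r : ℝ => ((u, r, y) : ℝ × ℝ × S2)) (by fun_prop)
      fun r hr => ⟨hu0, ha.trans_le hr.1⟩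

lemma farInt_dirac (u : ℝ) : B.farInt (Measure.dirac u) a b F
    = ∫ w, F (B.bondiPt u w.1 w.2) ∂((volume.restrict (Icc a b)).prod dω) := by
  rw [farInt, boxMeasure, Measure.dirac_prod, measurableEmbedding_prodMk_left u |>.integral_map]

lemma farInt_vT (hW : B.FarNhd W) (hF : ContDiffOn ℝ ∞ F W) (hu : 0 ≤ u₁) (h12 : u₁ ≤ u₂)
    (ha : B.R₀ < a) : B.farInt (volume.restrict (Icc u₁ u₂)) a b (der vT F)
      = B.farInt (Measure.dirac u₂) a b F - B.farInt (Measure.dirac u₁) a b F := by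
  have hc := (hW.der_vT hF).continuousOn
  have hi := integrable_box hW hc (timeMeasure_restrict hu (u₂ := u₂)) ha (b := b)
  have hd : ∀ u, 0 ≤ u → Integrable (fun w : ℝ × S2 => F (B.bondiPt u w.1 w.2))
      ((volume.restrict (Icc a b)).prod dω) := by
    intro u hu
    have h := integrable_box hW hF.continuousOn (timeMeasure_dirac hu) ha (b := b)
    rwa [boxMeasure, Measure.dirac_prod, (measurableEmbedding_prodMk_left u).integrable_map_iff] at h
  rw [farInt, boxMeasure, integral_prod_symm _ hi, farInt_dirac, farInt_dirac,
    ← integral_sub (hd _ (hu.trans h12)) (hd _ hu)]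
  refine integral_congr_ae ?_
  have h2 : ∀ᵐ w ∂((volume.restrict (Icc a b)).prod dω), w.1 ∈ Icc a b :=
    Measure.quasiMeasurePreserving_fst.ae (ae_restrict_mem measurableSet_Icc)
  filter_upwards [h2] with w hw
  have hr := ha.trans_le hw.1
  change ∫ u in Icc u₁ u₂, der vT F (B.bondiPt u w.1 w.2) = _
  rw [integral_Icc_eq_integral_Ioc, ← intervalIntegral.integral_of_le h12,
    intervalIntegral.integral_eq_sub_of_hasDerivAt (E := ℝ) (f := fun u => F (B.bondiPt u w.1 w.2))]
  · intro u hu'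
    rw [uIcc_of_le h12] at hu'
    exact hasDerivAt_ev_u hW hF (hu.trans hu'.1) hr w.2
  · refine ContinuousOn.intervalIntegrable ?_
    rw [uIcc_of_le h12]
    exact (continuousOn_ev hW hc).comp (f := fun u : ℝ => ((u, w.1, w.2) : ℝ × ℝ × S2))
      (by fun_prop) fun u hu' => ⟨hu.trans hu'.1, hr⟩

lemma boxMeasure_restrict [SFinite τ] {a' b' : ℝ} (hsub : Icc a b ⊆ Icc a' b') :
    boxMeasure τ a b = (boxMeasure τ a' b').restrict (univ ×ˢ Icc a b ×ˢ univ) := by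
  rw [boxMeasure, boxMeasure, ← Measure.prod_restrict, ← Measure.prod_restrict,
    Measure.restrict_univ, Measure.restrict_univ, Measure.restrict_restrict measurableSet_Icc,
    inter_eq_left.mpr hsub]

lemma farInt_eq_of_subset (hτ : TimeMeasure τ u₁ u₂) {a' b' : ℝ} (hsub : Icc a b ⊆ Icc a' b')
    (h : ∀ u ∈ Icc u₁ u₂, ∀ r ∈ Icc a' b', r ∉ Icc a b → ∀ y : S2, F (B.bondiPt u r y) = 0) :
    B.farInt τ a' b' F = B.farInt τ a b F := by
  have := hτ.finite
  rw [farInt, farInt, boxMeasure_restrict hsub, ← integral_indicator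
    (MeasurableSet.univ.prod (measurableSet_Icc.prod MeasurableSet.univ))]
  refine integral_congr_ae ?_
  filter_upwards [boxMeasure_ae hτ] with z hz
  by_cases hm : z.2.1 ∈ Icc a b
  · rw [indicator_of_mem (show z ∈ univ ×ˢ Icc a b ×ˢ univ from ⟨mem_univ _, hm, mem_univ _⟩)]
  · rw [indicator_of_notMem (fun hz' => hm hz'.2.1), h _ hz.1 _ hz.2 hm]

lemma farInt_mono_set (hW : B.FarNhd W) (hF : ContinuousOn F W) (hτ : TimeMeasure τ u₁ u₂)
    {a' b' : ℝ} (ha' : B.R₀ < a') (hsub : Icc a b ⊆ Icc a' b')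
    (h : ∀ u ∈ Icc u₁ u₂, ∀ r ∈ Icc a' b', ∀ y : S2, 0 ≤ F (B.bondiPt u r y)) :
    B.farInt τ a b F ≤ B.farInt τ a' b' F := by
  have := hτ.finite
  rw [farInt, boxMeasure_restrict hsub]
  refine setIntegral_le_integral (integrable_box hW hF hτ ha') ?_
  filter_upwards [boxMeasure_ae hτ] with z hz using h _ hz.1 _ hz.2 _

/-- Integrals of nonnegative functions as lower integrals. -/
lemma ofReal_farInt (hW : B.FarNhd W) (hF : ContinuousOn F W) (hτ : TimeMeasure τ u₁ u₂)
    (ha : B.R₀ < a) (h : ∀ u ∈ Icc u₁ u₂, ∀ r ∈ Icc a b, ∀ y : S2, 0 ≤ F (B.bondiPt u r y)) :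
    ENNReal.ofReal (B.farInt τ a b F) = ∫⁻ u, B.nullInt u (Icc a b) F ∂τ ∧
      AEMeasurable (fun u => B.nullInt u (Icc a b) F) τ := by
  have := hτ.finite
  have hi := integrable_box hW hF hτ ha (b := b)
  have hm : AEMeasurable (fun z : ℝ × ℝ × S2 =>
      ENNReal.ofReal (F (B.bondiPt z.1 z.2.1 z.2.2))) (boxMeasure τ a b) :=
    hi.aestronglyMeasurable.aemeasurable.ennreal_ofReal
  have hslice : ∀ᵐ u ∂τ, ∫⁻ w, ENNReal.ofReal (F (B.bondiPt u w.1 w.2))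
      ∂((volume.restrict (Icc a b)).prod dω) = B.nullInt u (Icc a b) F := by
    filter_upwards [hi.prod_right_ae] with u hu
    rw [lintegral_prod _ hu.aestronglyMeasurable.aemeasurable.ennreal_ofReal]
    rfl
  constructor
  · rw [farInt, ofReal_integral_eq_lintegral_ofReal hi, boxMeasure, lintegral_prod _ hm]
    · exact lintegral_congr_ae hslice
    · filter_upwards [boxMeasure_ae hτ] with z hz using h _ hz.1 _ hz.2 _
  · exact hm.lintegral_prod_right'.congr hslice

lemma ofReal_farInt_dirac (hW : B.FarNhd W) (hF : ContinuousOn F W) {u : ℝ} (hu : 0 ≤ u)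
    (ha : B.R₀ < a) (h : ∀ r ∈ Icc a b, ∀ y : S2, 0 ≤ F (B.bondiPt u r y)) :
    ENNReal.ofReal (B.farInt (Measure.dirac u) a b F) = B.nullInt u (Icc a b) F := by
  rw [(ofReal_farInt hW hF (timeMeasure_dirac hu) ha fun v hv r hr y => ?_).1, lintegral_dirac]
  rw [show v = u from le_antisymm hv.2 hv.1]
  exact h r hr y

lemma nullInt_mono_set {u : ℝ} {I J : Set ℝ} (h : I ⊆ J) : B.nullInt u I F ≤ B.nullInt u J F :=
  lintegral_mono_set h

lemma nullInt_Ioi (u R : ℝ) : B.nullInt u (Ioi R) F = ⨆ n : ℕ, B.nullInt u (Icc R (R + n)) F := by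
  have hU : Ioi R = ⋃ n : ℕ, Ioc R (R + n) := by
    ext r
    simp only [mem_Ioi, mem_iUnion, mem_Ioc]
    constructor
    · intro h
      obtain ⟨n, hn⟩ := exists_nat_ge (r - R)
      exact ⟨n, h, by linarith⟩
    · rintro ⟨n, h, -⟩
      exact h
  rw [nullInt, hU, setLIntegral_iUnion_of_directed]
  · refine iSup_congr fun n => ?_
    rw [nullInt, Measure.restrict_congr_set Ioc_ae_eq_Icc]
  · refine Monotone.directed_le fun m n hmn => Ioc_subset_Ioc_right ?_
    have : (m : ℝ) ≤ n := Nat.cast_le.mpr hmn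
    linarith

/-- An inequality for fluxes and bulk integrals over `r > R` follows from those on bounded sets. -/
lemma nullInt_add_bulk_le (hW : B.FarNhd W) (hF : ContinuousOn F W) (hG : ContinuousOn G W)
    (hu : 0 ≤ u₁) (h12 : u₁ ≤ u₂) {R : ℝ} (hR : B.R₀ < R)
    (hF0 : ∀ u, 0 ≤ u → ∀ r, R ≤ r → ∀ y : S2, 0 ≤ F (B.bondiPt u r y))
    (hG0 : ∀ u, 0 ≤ u → ∀ r, R ≤ r → ∀ y : S2, 0 ≤ G (B.bondiPt u r y)) {X : ℝ}
    (h : ∀ n : ℕ, B.farInt (Measure.dirac u₂) R (R + n) F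
      + B.farInt (volume.restrict (Icc u₁ u₂)) R (R + n) G ≤ X) :
    B.nullInt u₂ (Ioi R) F + ∫⁻ u in Ioc u₁ u₂, B.nullInt u (Ioi R) G ≤ ENNReal.ofReal X := by
  have hu2 := hu.trans h12
  have hmono : ∀ (u : ℝ) (H : Spt → ℝ), Monotone fun n : ℕ => B.nullInt u (Icc R (R + n)) H := by
    intro u H m n hmn
    refine nullInt_mono_set (Icc_subset_Icc_right ?_)
    have : (m : ℝ) ≤ n := Nat.cast_le.mpr hmn
    linarith
  have hb := fun n : ℕ => ofReal_farInt hW hG (timeMeasure_restrict hu (u₂ := u₂)) hR (b := R + n)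
    fun u hu' r hr y => hG0 u (hu.trans hu'.1) r hr.1 y
  rw [Measure.restrict_congr_set (Ioc_ae_eq_Icc (a := u₁) (b := u₂)), nullInt_Ioi]
  simp only [nullInt_Ioi]
  -- Monotone convergence in the outer radius `R + n`, also inside the integral over `u`. The
  -- required measurability in `u` is part of `ofReal_farInt`.
  rw [lintegral_iSup' (fun n => (hb n).2) (.of_forall fun u => hmono u G),
    ENNReal.iSup_add_iSup_of_monotone (hmono _ _)
      (fun m n hmn => lintegral_mono fun u => hmono u G hmn)]
  refine iSup_le fun n => ?_
  rw [← (hb n).1, ← ofReal_farInt_dirac hW hF hu2 hR fun r hr y => hF0 u₂ hu2 r hr.1 y,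
    ← ENNReal.ofReal_add]
  · exact ENNReal.ofReal_le_ofReal (h n)
  · exact farInt_nonneg (timeMeasure_dirac hu2) fun u hu' r hr y =>
      hF0 u (hu2.trans hu'.1) r hr.1 y
  · exact farInt_nonneg (timeMeasure_restrict hu) fun u hu' r hr y =>
      hG0 u (hu.trans hu'.1) r hr.1 y

end FarInt

end Background

end RpHierarchy

/-! ### Cutoffs in `r` and in advanced time, and Hardy's inequality. -/

namespace RpHierarchy

lemma der_mul {X : Spt → Spt} {f g : Spt → ℝ} {p : Spt} (hf : DifferentiableAt ℝ f p)
    (hg : DifferentiableAt ℝ g p) :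
    der X (fun q => f q * g q) p = der X f p * g p + f p * der X g p := by
  simp only [der, fderiv_fun_mul hf hg, add_apply, smul_apply, smul_eq_mul]
  ring

lemma der_sq {X : Spt → Spt} {f : Spt → ℝ} {p : Spt} (hf : DifferentiableAt ℝ f p) :
    der X (fun q => f q ^ 2) p = 2 * (f p * der X f p) := by
  have : (fun q => f q ^ 2) = fun q => f q * f q := by funext q; ring
  rw [this, der_mul hf hf]
  ring

/-- The radial cutoff: `0` for `r ≤ R - 1` and `1` for `r ≥ R`. -/
def cut (R r : ℝ) : ℝ := Real.smoothTransition (r - (R - 1))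

/-- The derivative of the radial cutoff. -/
def cutDeriv (R r : ℝ) : ℝ := deriv Real.smoothTransition (r - (R - 1))

lemma hasDerivAt_smoothTransition (x : ℝ) :
    HasDerivAt Real.smoothTransition (deriv Real.smoothTransition x) x :=
  ((Real.smoothTransition.contDiff (n := 1)).differentiable one_ne_zero x).hasDerivAt

lemma deriv_smoothTransition_nonneg (x : ℝ) : 0 ≤ deriv Real.smoothTransition x :=
  Real.smoothTransition.monotone.deriv_nonneg

lemma deriv_smoothTransition_of_one_lt {x : ℝ} (hx : 1 < x) : deriv Real.smoothTransition x = 0 := by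
  have : Real.smoothTransition =ᶠ[𝓝 x] fun _ => 1 := by
    filter_upwards [Ioi_mem_nhds hx] with t ht using Real.smoothTransition.one_of_one_le (le_of_lt ht)
  rw [this.deriv_eq, deriv_const]

lemma deriv_smoothTransition_of_neg {x : ℝ} (hx : x < 0) : deriv Real.smoothTransition x = 0 := by
  have : Real.smoothTransition =ᶠ[𝓝 x] fun _ => 0 := by
    filter_upwards [Iio_mem_nhds hx] with t ht using Real.smoothTransition.zero_of_nonpos (le_of_lt ht)
  rw [this.deriv_eq, deriv_const]

lemma exists_deriv_smoothTransition_le : ∃ c : ℝ, 0 < c ∧ ∀ x, deriv Real.smoothTransition x ≤ c := by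
  have hc : Continuous (deriv Real.smoothTransition) :=
    (Real.smoothTransition.contDiff (n := 1)).continuous_deriv le_rfl
  obtain ⟨c, hc⟩ := isCompact_Icc.exists_bound_of_continuousOn (s := Icc (0 : ℝ) 1) hc.continuousOn
  refine ⟨max c 1, by positivity, fun x => ?_⟩
  by_cases h0 : x < 0
  · rw [deriv_smoothTransition_of_neg h0]; positivity
  by_cases h1 : 1 < x
  · rw [deriv_smoothTransition_of_one_lt h1]; positivity
  · exact ((le_abs_self _).trans (hc x ⟨not_lt.mp h0, not_lt.mp h1⟩)).trans (le_max_left _ _)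

lemma hasDerivAt_cut (R r : ℝ) : HasDerivAt (cut R) (cutDeriv R r) r := by
  have h := (hasDerivAt_smoothTransition (r - (R - 1))).comp r ((hasDerivAt_id r).sub_const (R - 1))
  exact h.congr_deriv (mul_one _)

lemma contDiff_cut (R : ℝ) : ContDiff ℝ ∞ (cut R) :=
  Real.smoothTransition.contDiff.comp (contDiff_id.sub contDiff_const)

lemma continuous_cutDeriv (R : ℝ) : Continuous (cutDeriv R) :=
  ((Real.smoothTransition.contDiff (n := 1)).continuous_deriv le_rfl).comp (by fun_prop)

lemma cutDeriv_nonneg (R r : ℝ) : 0 ≤ cutDeriv R r := deriv_smoothTransition_nonneg _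

lemma cutDeriv_eq_zero {R r : ℝ} (h : R < r) : cutDeriv R r = 0 :=
  deriv_smoothTransition_of_one_lt (by linarith)

lemma cut_nonneg (R r : ℝ) : 0 ≤ cut R r := Real.smoothTransition.nonneg _

lemma cut_le_one (R r : ℝ) : cut R r ≤ 1 := Real.smoothTransition.le_one _

lemma cut_left (R : ℝ) : cut R (R - 1) = 0 := Real.smoothTransition.zero_of_nonpos (by simp)

lemma cut_eq_one {R r : ℝ} (h : R ≤ r) : cut R r = 1 :=
  Real.smoothTransition.one_of_one_le (by linarith)

/-- The cutoff in advanced time: `1` for `v ≤ V - 1` and `0` for `v ≥ V`. -/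
def timeCut (V : ℝ) (p : Spt) : ℝ := Real.smoothTransition (V - p.1)

/-- The derivative of `timeCut` in `v`. -/
def timeCutDeriv (V : ℝ) (p : Spt) : ℝ := -deriv Real.smoothTransition (V - p.1)

lemma contDiff_timeCut (V : ℝ) : ContDiff ℝ ∞ (timeCut V) :=
  Real.smoothTransition.contDiff.comp (contDiff_const.sub contDiff_fst)

lemma continuous_timeCutDeriv (V : ℝ) : Continuous (timeCutDeriv V) :=
  (((Real.smoothTransition.contDiff (n := 1)).continuous_deriv le_rfl).comp (by fun_prop)).neg

lemma timeCut_nonneg (V : ℝ) (p : Spt) : 0 ≤ timeCut V p := Real.smoothTransition.nonneg _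

lemma timeCut_le_one (V : ℝ) (p : Spt) : timeCut V p ≤ 1 := Real.smoothTransition.le_one _

lemma timeCutDeriv_nonpos (V : ℝ) (p : Spt) : timeCutDeriv V p ≤ 0 :=
  neg_nonpos.mpr (deriv_smoothTransition_nonneg _)

lemma timeCut_eq_zero {V : ℝ} {p : Spt} (h : V ≤ p.1) : timeCut V p = 0 :=
  Real.smoothTransition.zero_of_nonpos (by linarith)

lemma timeCut_eq_one {V : ℝ} {p : Spt} (h : p.1 ≤ V - 1) : timeCut V p = 1 :=
  Real.smoothTransition.one_of_one_le (by linarith)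

lemma der_timeCut (V : ℝ) (X : Spt → Spt) (p : Spt) :
    der X (timeCut V) p = timeCutDeriv V p * (X p).1 := by
  have h1 : HasFDerivAt (fun q : Spt => V - q.1) (-(ContinuousLinearMap.fst ℝ ℝ E3)) p :=
    hasFDerivAt_fst.const_sub V
  have h := (hasDerivAt_smoothTransition (V - p.1)).comp_hasFDerivAt p h1
  have h2 : fderiv ℝ (timeCut V) p = _ := h.fderiv
  rw [der, h2, timeCutDeriv]
  simp

section Weighted

variable {a : ℝ → ℝ} {a' : ℝ} {p : Spt} {F : Spt → ℝ} (hp : p.2 ≠ 0)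
  (ha : HasDerivAt a a' ‖p.2‖) (hF : DifferentiableAt ℝ F p) (V : ℝ)
include hp ha hF

lemma der_vR_weighted (D : ℝ → ℝ) : der (vR D) (fun q => a ‖q.2‖ * (timeCut V q * F q)) p
    = a' * (timeCut V p * F p) + a ‖p.2‖ * (timeCutDeriv V p * (2 / D ‖p.2‖) * F p
      + timeCut V p * der (vR D) F p) := by
  have hZ : DifferentiableAt ℝ (timeCut V) p := (contDiff_timeCut V).differentiable (by simp) p
  rw [der_vR_radial_mul hp ha (hZ.fun_mul hF), der_mul hZ hF, der_timeCut, vR]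

lemma der_vT_weighted : der vT (fun q => a ‖q.2‖ * (timeCut V q * F q)) p
    = a ‖p.2‖ * (timeCutDeriv V p * F p + timeCut V p * der vT F p) := by
  have hZ : DifferentiableAt ℝ (timeCut V) p := (contDiff_timeCut V).differentiable (by simp) p
  rw [der_vT_radial_mul hp ha (hZ.fun_mul hF), der_mul hZ hF, der_timeCut, vT]
  simp

lemma der_vΩ_weighted (i : Fin 3) : der (vΩ i) (fun q => a ‖q.2‖ * (timeCut V q * F q)) p
    = a ‖p.2‖ * (timeCut V p * der (vΩ i) F p) := by
  have hZ : DifferentiableAt ℝ (timeCut V) p := (contDiff_timeCut V).differentiable (by simp) p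
  rw [der_vΩ_radial_mul hp ha (hZ.fun_mul hF), der_mul hZ hF, der_timeCut, vΩ_eq]
  simp

end Weighted

/-- The weight `χ(r) ζ(v) r^s`. -/
def wgt (R V s : ℝ) (p : Spt) : ℝ := cut R ‖p.2‖ * ‖p.2‖ ^ s * timeCut V p

lemma wgt_nonneg (R V s : ℝ) (p : Spt) : 0 ≤ wgt R V s p :=
  mul_nonneg (mul_nonneg (cut_nonneg _ _) (Real.rpow_nonneg (norm_nonneg _) _)) (timeCut_nonneg _ _)

lemma hasDerivAt_cut_rpow (R s : ℝ) {r : ℝ} (hr : 0 < r) :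
    HasDerivAt (fun r => cut R r * r ^ s) (cutDeriv R r * r ^ s + cut R r * (s * r ^ (s - 1))) r :=
  (hasDerivAt_cut R r).fun_mul (Real.hasDerivAt_rpow_const (Or.inl hr.ne'))

lemma contDiffOn_cut_rpow (R s : ℝ) {R₀ : ℝ} (h : 0 < R₀) :
    ContDiffOn ℝ ∞ (fun r => cut R r * r ^ s) (Ioi R₀) :=
  (contDiff_cut R).contDiffOn.mul fun _ hr =>
    (Real.contDiffAt_rpow_const_of_ne (h.trans hr).ne').contDiffWithinAt

namespace Background

variable {B : Background} {W : Set Spt} {F G : Spt → ℝ} {τ : Measure ℝ} {u₁ u₂ R V b : ℝ}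

lemma FarNhd.continuousOn_radial (hW : B.FarNhd W) {a : ℝ → ℝ} (ha : ContinuousOn a (Ioi B.R₀)) :
    ContinuousOn (fun p : Spt => a ‖p.2‖) W :=
  ha.comp (by fun_prop) hW.lt

lemma FarNhd.weighted (hW : B.FarNhd W) (hF : ContDiffOn ℝ ∞ F W) {a : ℝ → ℝ}
    (ha : ContDiffOn ℝ ∞ a (Ioi B.R₀)) (V : ℝ) :
    ContDiffOn ℝ ∞ (fun q => a ‖q.2‖ * (timeCut V q * F q)) W :=
  hW.radial_mul ((contDiff_timeCut V).contDiffOn.mul hF) ha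

lemma FarNhd.continuousOn_rpow (hW : B.FarNhd W) (s : ℝ) :
    ContinuousOn (fun p : Spt => ‖p.2‖ ^ s) W :=
  hW.continuousOn_radial fun _ hr =>
    (Real.continuousAt_rpow_const _ _ (Or.inl (B.R₀_pos.trans hr).ne')).continuousWithinAt

lemma FarNhd.continuousOn_wgt (hW : B.FarNhd W) (R V s : ℝ) : ContinuousOn (wgt R V s) W :=
  (((contDiff_cut R).continuous.comp (by fun_prop)).continuousOn.mul (hW.continuousOn_rpow s)).mul
    (contDiff_timeCut V).continuous.continuousOn

lemma continuousOn_cutDeriv (W : Set Spt) (R : ℝ) :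
    ContinuousOn (fun p : Spt => cutDeriv R ‖p.2‖) W :=
  ((continuous_cutDeriv R).comp (by fun_prop)).continuousOn

/-- Times and radii for which the cutoffs vanish at the ends of `[R - 1, b]`. -/
structure CutBox (B : Background) (τ : Measure ℝ) (u₁ u₂ R V b : ℝ) : Prop where
  time : TimeMeasure τ u₁ u₂
  lt : B.R₀ < R - 1
  one_le : 1 ≤ R - 1
  le : R ≤ b
  vanish : V ≤ u₁ + 2 * B.rstar b

lemma CutBox.cut_left (hB : CutBox B τ u₁ u₂ R V b) (u : ℝ) (y : S2) :
    cut R ‖(B.bondiPt u (R - 1) y).2‖ = 0 := by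
  rw [norm_bondiPt hB.lt, RpHierarchy.cut_left]

lemma CutBox.timeCut_right {u : ℝ} (hu : u ∈ Icc u₁ u₂) (y : S2) (hB : CutBox B τ u₁ u₂ R V b) :
    timeCut V (B.bondiPt u b y) = 0 :=
  timeCut_eq_zero (by simp only [bondiPt]; linarith [hB.vanish, hu.1])

/-- Slab integrals bound integrals that are supported where the radial cutoff varies. -/
lemma CutBox.cutDeriv_le (hB : CutBox B τ u₁ u₂ R V b) (hW : B.FarNhd W) (hF : ContinuousOn F W)
    (hF0 : ∀ p, 0 ≤ F p) {c : ℝ} (hc : ∀ x, deriv Real.smoothTransition x ≤ c) :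
    B.farInt τ (R - 1) b (fun p => cutDeriv R ‖p.2‖ * F p) ≤ c * B.farInt τ (R - 1) R F := by
  rw [← farInt_const_mul, farInt_eq_of_subset (a := R - 1) (b := R) hB.time
    (Icc_subset_Icc_right hB.le)]
  · refine farInt_mono hW ((continuousOn_cutDeriv W R).fun_mul hF)
      (continuousOn_const.fun_mul hF) hB.time hB.lt fun u hu r hr y => ?_
    exact mul_le_mul_of_nonneg_right (hc _) (hF0 _)
  · intro u hu r hr hr' y
    have hrR : R < r := by
      by_contra h
      exact hr' ⟨hr.1, not_lt.mp h⟩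
    simp only [norm_bondiPt (hB.lt.trans_le hr.1), cutDeriv_eq_zero hrR, zero_mul]

/-- Hardy's inequality for the cut-off weights. -/
lemma CutBox.hardy_aux (hB : CutBox B τ u₁ u₂ R V b) (hW : B.FarNhd W) (hF : ContDiffOn ℝ ∞ F W)
    {κ q : ℝ} (hκ : 0 < κ) (hq : κ ≤ -(q + 1)) :
    κ / 2 * B.farInt τ (R - 1) b (fun p => wgt R V q p * F p ^ 2)
      ≤ B.farInt τ (R - 1) b (fun p => cutDeriv R ‖p.2‖ * F p ^ 2)
        + 2 / κ * B.farInt τ (R - 1) b (fun p => wgt R V (q + 2) p * der (vR B.D) F p ^ 2) := by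
  have hF2 : ContDiffOn ℝ ∞ (fun p => F p ^ 2) W := hF.pow 2
  have ha := contDiffOn_cut_rpow R (q + 1) B.R₀_pos
  -- The integral of `∂_r(χ r^{q+1} ζ F²)` vanishes, by `χ` at `R - 1` and by `ζ` at `b`. The power
  -- contributes the coefficient `q + 1 ≤ -κ`, the derivative of `ζ` is nonpositive and is dropped,
  -- and the derivative of `χ` gives the slab term. Hence no decay of `F` is required.
  have h0 := farInt_vR hW (hW.weighted hF2 ha V) hB.time hB.lt (b := b) (by linarith [hB.le])
    (fun u hu y => by simp only [hB.cut_left, zero_mul])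
    (fun u hu y => by simp only [hB.timeCut_right hu y, zero_mul, mul_zero])
  have hFc := hF2.continuousOn
  have hGc := ((hW.der_vR hF).pow 2).continuousOn
  have c1 := (hW.continuousOn_wgt R V q).fun_mul hFc
  have c2 := (continuousOn_cutDeriv W R).fun_mul hFc
  have c3 := (hW.continuousOn_wgt R V (q + 2)).fun_mul hGc
  have hmono := farInt_mono (b := b) hW (hW.der_vR (hW.weighted hF2 ha V)).continuousOn
    (((c2.fun_add (continuousOn_const (c := 2 / κ) |>.fun_mul c3)).fun_sub
      (continuousOn_const (c := κ / 2) |>.fun_mul c1))) hB.time hB.lt ?_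
  · rw [h0, farInt_sub hW (c2.fun_add (continuousOn_const.fun_mul c3)) (continuousOn_const.fun_mul c1)
      hB.time hB.lt, farInt_add hW c2 (continuousOn_const.fun_mul c3) hB.time hB.lt,
      farInt_const_mul, farInt_const_mul] at hmono
    linarith
  · intro u hu r hr y
    have hr0 := hB.lt.trans_le hr.1
    have hrp := B.R₀_pos.trans hr0
    have hpW := hW.far_subset (bondiPt_mem_far (hB.time.nonneg.trans hu.1) hr0 y)
    have hn := norm_bondiPt (u := u) hr0 y
    have had := hasDerivAt_cut_rpow R (q + 1) hrp
    rw [← hn] at had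
    rw [der_vR_weighted (hW.ne_zero hpW) had (hW.differentiableAt hF2 hpW),
      der_sq (hW.differentiableAt hF hpW)]
    simp only [hn, wgt, add_sub_cancel_right]
    have hD := B.D_pos' hr0
    have hZ := timeCut_nonneg V (B.bondiPt u r y)
    have hZ1 := timeCut_le_one V (B.bondiPt u r y)
    have hZd := timeCutDeriv_nonpos V (B.bondiPt u r y)
    have hχ := cut_nonneg R r
    have hχd := cutDeriv_nonneg R r
    have e1 : r ^ (q + 1) = r ^ q * r := by rw [Real.rpow_add hrp, Real.rpow_one]
    have e2 : r ^ (q + 2) = r ^ q * r ^ 2 := by rw [Real.rpow_add hrp, Real.rpow_two]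
    have hq1 : r ^ (q + 1) ≤ 1 :=
      Real.rpow_le_one_of_one_le_of_nonpos (hB.one_le.trans hr.1) (by linarith)
    have hrq : 0 < r ^ q := Real.rpow_pos_of_pos hrp _
    rw [e2]
    rw [e1] at hq1 ⊢
    generalize F (B.bondiPt u r y) = f
    generalize der (vR B.D) F (B.bondiPt u r y) = f'
    generalize timeCut V (B.bondiPt u r y) = Z at *
    generalize timeCutDeriv V (B.bondiPt u r y) = Z' at *
    generalize cut R r = χ at *
    generalize cutDeriv R r = χ' at *
    generalize r ^ q = P at *
    have t1 : χ' * (P * r) * (Z * f ^ 2) ≤ χ' * f ^ 2 := by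
      have h1 : P * r * Z ≤ 1 * 1 := mul_le_mul hq1 hZ1 hZ (by norm_num)
      have h2 : χ' * f ^ 2 * (P * r * Z) ≤ χ' * f ^ 2 * (1 * 1) :=
        mul_le_mul_of_nonneg_left h1 (by positivity)
      linarith
    have t2 : χ * (P * r) * (Z' * (2 / B.D r) * f ^ 2) ≤ 0 := by
      have h1 : 0 ≤ χ * (P * r) * ((2 / B.D r) * f ^ 2) := by positivity
      nlinarith
    -- Young's inequality, balanced so that half of the favourable term `-κ F²` survives.
    have t3 : 2 * (r * f * f') ≤ κ / 2 * f ^ 2 + 2 / κ * (r ^ 2 * f' ^ 2) := by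
      have h1 : κ / 2 * f ^ 2 + 2 / κ * (r ^ 2 * f' ^ 2) - 2 * (r * f * f')
          = (κ * f - 2 * r * f') ^ 2 / (2 * κ) := by field_simp; ring
      have h2 : 0 ≤ (κ * f - 2 * r * f') ^ 2 / (2 * κ) := by positivity
      linarith
    have t4 : (q + 1) * f ^ 2 ≤ -κ * f ^ 2 := mul_le_mul_of_nonneg_right (by linarith) (sq_nonneg f)
    have t5 : χ * P * Z * ((q + 1) * f ^ 2 + 2 * (r * f * f'))
        ≤ χ * P * Z * (-κ * f ^ 2 + (κ / 2 * f ^ 2 + 2 / κ * (r ^ 2 * f' ^ 2))) :=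
      mul_le_mul_of_nonneg_left (by linarith) (by positivity)
    nlinarith

/-- Hardy's inequality, with the boundary term estimated by a slab integral. -/
lemma CutBox.hardy (hB : CutBox B τ u₁ u₂ R V b) (hW : B.FarNhd W) (hF : ContDiffOn ℝ ∞ F W)
    {c : ℝ} (hc : ∀ x, deriv Real.smoothTransition x ≤ c) {κ q : ℝ} (hκ : 0 < κ)
    (hq : κ ≤ -(q + 1)) :
    B.farInt τ (R - 1) b (fun p => wgt R V q p * F p ^ 2)
      ≤ 2 * c / κ * B.farInt τ (R - 1) R (fun p => F p ^ 2)
        + 4 / κ ^ 2 * B.farInt τ (R - 1) b (fun p => wgt R V (q + 2) p * der (vR B.D) F p ^ 2) := by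
  have h1 := hB.hardy_aux hW hF hκ hq
  have h2 := hB.cutDeriv_le hW (hF.pow 2).continuousOn (fun p => sq_nonneg (F p)) hc
  have h3 := h1.trans (add_le_add_left h2 _)
  have h4 := mul_le_mul_of_nonneg_left h3 (by positivity : 0 ≤ 2 / κ)
  calc _ = 2 / κ * (κ / 2 * B.farInt τ (R - 1) b (fun p => wgt R V q p * F p ^ 2)) := by
        field_simp
    _ ≤ _ := h4
    _ = _ := by field_simp; ring

end Background

end RpHierarchy

/-! ### The pointwise `r^p`-weighted energy identity. -/

namespace RpHierarchy

lemma der_sum {ι : Type*} {s : Finset ι} {X : Spt → Spt} {F : ι → Spt → ℝ} {p : Spt}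
    (hF : ∀ i ∈ s, DifferentiableAt ℝ (F i) p) :
    der X (fun q => ∑ i ∈ s, F i q) p = ∑ i ∈ s, der X (F i) p := by
  simp only [der, fderiv_fun_sum hF, sum_apply]

/-- The sum of the squares of the rotational derivatives. -/
def angSq (h : Spt → ℝ) (p : Spt) : ℝ := ∑ i, der (vΩ i) h p ^ 2

lemma angSq_nonneg (h : Spt → ℝ) (p : Spt) : 0 ≤ angSq h p :=
  Finset.sum_nonneg fun _ _ => sq_nonneg _

/-- The quadratic form that is nonnegative in the mean over spheres for frequencies `ℓ ≥ 1`. -/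
def angForm (h : Spt → ℝ) (p : Spt) : ℝ := angSq h p - 2 * h p ^ 2

namespace Background

variable {B : Background} {W : Set Spt} {h : Spt → ℝ}

lemma FarNhd.angSq (hW : B.FarNhd W) (hh : ContDiffOn ℝ ∞ h W) : ContDiffOn ℝ ∞ (angSq h) W :=
  ContDiffOn.sum fun i _ => (hW.der_vΩ hh i).pow 2

lemma FarNhd.angForm (hW : B.FarNhd W) (hh : ContDiffOn ℝ ∞ h W) : ContDiffOn ℝ ∞ (angForm h) W :=
  (hW.angSq hh).sub (contDiffOn_const.mul (hh.pow 2))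

lemma der_vR_angForm (hW : B.FarNhd W) (hh : ContDiffOn ℝ ∞ h W) {p : Spt} (hp : p ∈ W) :
    der (vR B.D) (RpHierarchy.angForm h) p
      = ∑ i, 2 * (der (vΩ i) h p * der (vR B.D) (der (vΩ i) h) p)
        - 4 * (h p * der (vR B.D) h p) := by
  have hd := hW.differentiableAt hh hp
  have hd2 : DifferentiableAt ℝ (fun q => h q ^ 2) p := hd.fun_pow 2
  have hdi := fun i => hW.differentiableAt (hW.der_vΩ hh i) hp
  have e : RpHierarchy.angForm h = fun q => (∑ i, der (vΩ i) h q ^ 2) + (-2) * h q ^ 2 := by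
    funext q
    simp only [RpHierarchy.angForm, RpHierarchy.angSq]
    ring
  rw [e, der_add (DifferentiableAt.fun_sum fun i _ => (hdi i).fun_pow 2) (hd2.const_mul _),
    der_sum fun i _ => (hdi i).fun_pow 2, der_const_mul hd2, der_sq hd]
  simp only [der_sq (hdi _)]
  ring

/-- This is where the restriction to `ℓ ≥ 1` and the exact value `2` of the first eigenvalue enter
the energy argument. -/
lemma integral_angForm_nonneg (hW : B.FarNhd W) (hh : ContDiffOn ℝ ∞ h W)
    (hm : ∀ u r : ℝ, 0 ≤ u → B.R₀ < r → ∫ y : S2, h (B.bondiPt u r y) ∂dω = 0) {u r : ℝ}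
    (hu : 0 ≤ u) (hr : B.R₀ < r) :
    0 ≤ ∫ y : S2, RpHierarchy.angForm h (B.bondiPt u r y) ∂dω := by
  have h1 := poincare_ev hW hh hu hr (hm u r hu hr)
  have i1 := integrable_sphere (integrable_ev hW (hW.angSq hh).continuousOn hu hr)
  have i2 := integrable_sphere (integrable_ev hW (hh.pow 2).continuousOn hu hr)
  simp only [RpHierarchy.angForm]
  rw [integral_sub i1 (i2.const_mul 2), integral_const_mul, sub_nonneg]
  exact h1

/-- The bulk terms of the `r^p`-weighted energy identity. -/
def energyBulk (B : Background) (R V s : ℝ) (h φ : Spt → ℝ) (p : Spt) : ℝ :=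
  cut R ‖p.2‖ * ‖p.2‖ ^ s * timeCut V p *
      ((-((s + 4) * B.D ‖p.2‖ / (2 * ‖p.2‖)) + 3 / 2 * deriv B.D ‖p.2‖) * der (vR B.D) h p ^ 2
        + der (vR B.D) h p * (B.coefH ‖p.2‖ * h p + B.coefPhi ‖p.2‖ * φ p)
        - (2 - s) / (2 * ‖p.2‖ ^ 3) * angForm h p)
    + cutDeriv R ‖p.2‖ * ‖p.2‖ ^ s * timeCut V p *
      (-(B.D ‖p.2‖ / 2) * der (vR B.D) h p ^ 2 + (2 * ‖p.2‖ ^ 2)⁻¹ * angForm h p)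
    + cut R ‖p.2‖ * ‖p.2‖ ^ s * timeCutDeriv V p * (‖p.2‖ ^ 2 * B.D ‖p.2‖)⁻¹ * angForm h p

/-- The pointwise `r^p`-weighted energy identity. -/
lemma energy_identity (hW : B.FarNhd W) (hh : ContDiffOn ℝ ∞ h W) {φ : Spt → ℝ} {u r : ℝ}
    {y : S2} (hu : 0 ≤ u) (hr : B.R₀ < r) (R V s : ℝ)
    (heq : 2 * der vT (der (vR B.D) h) (B.bondiPt u r y)
      = B.D r * der (vR B.D) (der (vR B.D) h) (B.bondiPt u r y)
        + (2 * deriv B.D r - 2 * B.D r / r) * der (vR B.D) h (B.bondiPt u r y)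
        + (r ^ 2)⁻¹ * (sphLap h (B.bondiPt u r y) + 2 * h (B.bondiPt u r y))
        + B.coefH r * h (B.bondiPt u r y) + B.coefPhi r * φ (B.bondiPt u r y)) :
    der vT (fun q => cut R ‖q.2‖ * ‖q.2‖ ^ s * (timeCut V q * der (vR B.D) h q ^ 2))
        (B.bondiPt u r y)
      = 1 / 2 * der (vR B.D) (fun q => cut R ‖q.2‖ * ‖q.2‖ ^ s * B.D ‖q.2‖ *
          (timeCut V q * der (vR B.D) h q ^ 2)) (B.bondiPt u r y)
        - 1 / 2 * der (vR B.D) (fun q => cut R ‖q.2‖ * ‖q.2‖ ^ (s - 2) *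
          (timeCut V q * angForm h q)) (B.bondiPt u r y)
        + ∑ i, der (vΩ i) (fun q => cut R ‖q.2‖ * ‖q.2‖ ^ (s - 2) *
          (timeCut V q * (der (vR B.D) h q * der (vΩ i) h q))) (B.bondiPt u r y)
        + B.energyBulk R V s h φ (B.bondiPt u r y) := by
  have hrp := B.R₀_pos.trans hr
  have hp := hW.far_subset (bondiPt_mem_far hu hr y)
  have hne := hW.ne_zero hp
  have hn := norm_bondiPt (u := u) hr y
  have hD := B.D_pos' hr
  have a0 := hasDerivAt_cut_rpow R s hrp
  have a1 := a0.fun_mul (B.hasDerivAt_D (B.rmin_lt.trans hr))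
  have a2 := hasDerivAt_cut_rpow R (s - 2) hrp
  rw [← hn] at a0 a1 a2
  have hg := hW.der_vR hh
  have dg := hW.differentiableAt hg hp
  have dg2 : DifferentiableAt ℝ (fun q => der (vR B.D) h q ^ 2) (B.bondiPt u r y) := dg.fun_pow 2
  have dω := fun i => hW.differentiableAt (hW.der_vΩ hh i) hp
  rw [der_vT_weighted hne a0 dg2, der_vR_weighted hne a1 dg2,
    der_vR_weighted hne a2 (hW.differentiableAt (hW.angForm hh) hp),
    der_vR_angForm hW hh hp, der_sq dg, der_sq dg]
  have hΩ : ∀ i, der (vΩ i) (fun q => cut R ‖q.2‖ * ‖q.2‖ ^ (s - 2) *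
          (timeCut V q * (der (vR B.D) h q * der (vΩ i) h q))) (B.bondiPt u r y)
      = cut R r * r ^ (s - 2) * (timeCut V (B.bondiPt u r y) *
        (der (vR B.D) (der (vΩ i) h) (B.bondiPt u r y) * der (vΩ i) h (B.bondiPt u r y)
          + der (vR B.D) h (B.bondiPt u r y) * der (vΩ i) (der (vΩ i) h) (B.bondiPt u r y))) := by
    intro i
    rw [der_vΩ_weighted (a := fun r => cut R r * r ^ (s - 2)) hne a2 (dg.fun_mul (dω i)),
      der_mul dg (dω i), hW.comm_ΩR hh hp i]
    simp only [hn]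
  simp only [hΩ]
  simp only [energyBulk, RpHierarchy.angForm, RpHierarchy.angSq, sphLap, Fin.sum_univ_three, hn]
    at heq ⊢
  have e1 : r ^ (s - 1) = r ^ s * r⁻¹ := by rw [Real.rpow_sub_one hrp.ne', div_eq_mul_inv]
  have e2 : r ^ (s - 2) = r ^ s * (r ^ 2)⁻¹ := by
    rw [Real.rpow_sub hrp, Real.rpow_two, div_eq_mul_inv]
  have e3 : r ^ (s - 2 - 1) = r ^ s * (r ^ 3)⁻¹ := by
    rw [Real.rpow_sub_one hrp.ne', e2]; field_simp
  rw [e3, e2, e1]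
  generalize der vT (der (vR B.D) h) (B.bondiPt u r y) = Tg at *
  generalize der (vR B.D) (der (vR B.D) h) (B.bondiPt u r y) = Rg at *
  generalize der (vR B.D) h (B.bondiPt u r y) = g at *
  generalize h (B.bondiPt u r y) = h' at *
  generalize φ (B.bondiPt u r y) = φ' at *
  generalize der (vR B.D) (der (vΩ 0) h) (B.bondiPt u r y) = ρ0
  generalize der (vR B.D) (der (vΩ 1) h) (B.bondiPt u r y) = ρ1
  generalize der (vR B.D) (der (vΩ 2) h) (B.bondiPt u r y) = ρ2
  generalize der (vΩ 0) (der (vΩ 0) h) (B.bondiPt u r y) = l0 at *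
  generalize der (vΩ 1) (der (vΩ 1) h) (B.bondiPt u r y) = l1 at *
  generalize der (vΩ 2) (der (vΩ 2) h) (B.bondiPt u r y) = l2 at *
  generalize der (vΩ 0) h (B.bondiPt u r y) = w0
  generalize der (vΩ 1) h (B.bondiPt u r y) = w1
  generalize der (vΩ 2) h (B.bondiPt u r y) = w2
  generalize timeCut V (B.bondiPt u r y) = Z
  generalize timeCutDeriv V (B.bondiPt u r y) = Z'
  generalize cut R r = χ
  generalize cutDeriv R r = χ'
  generalize B.coefH r = b1 at *
  generalize B.coefPhi r = b2 at *
  generalize deriv B.D r = D1 at *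
  generalize B.D r = D at *
  generalize r ^ s = P
  -- The equation is used in the form multiplied by `2χ r^s ζ g`. The product `D g ∂_r g` is half a
  -- derivative of `D g²`, and moving the weight, together with `-2D/r` from the equation, yields
  -- the factor `s + 4`. The product `g(Δ̸ + 2)h` is a rotational divergence minus `½∂_r` of
  -- `angForm`, which yields `2 - s`. The `ζ' g²` terms cancel because `∂_u` and `(D/2)∂_r` advance
  -- `v` at the same unit rate.
  have hTg : Tg = (D * Rg + (2 * D1 - 2 * D / r) * g + (r ^ 2)⁻¹ * (l0 + l1 + l2 + 2 * h') + b1 * h'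
      + b2 * φ') / 2 := by linarith
  rw [hTg]
  field_simp
  ring

end Background

end RpHierarchy

/-! ### The integrated energy inequality. -/

namespace RpHierarchy

namespace Background

variable {B : Background} {W : Set Spt} {h φ : Spt → ℝ} {τ : Measure ℝ} {u₁ u₂ R V b a : ℝ}

/-- Integrated form of a pointwise bound by a linear combination. -/
lemma farInt_le_linear (hW : B.FarNhd W) (hτ : TimeMeasure τ u₁ u₂) (ha : B.R₀ < a)
    {E : Spt → ℝ} (hE : ContinuousOn E W) {n : ℕ} (c : Fin n → ℝ) (F : Fin n → Spt → ℝ)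
    (hF : ∀ i, ContinuousOn (F i) W) (hle : ∀ u ∈ Icc u₁ u₂, ∀ r ∈ Icc a b, ∀ y : S2,
      E (B.bondiPt u r y) ≤ ∑ i, c i * F i (B.bondiPt u r y)) :
    B.farInt τ a b E ≤ ∑ i, c i * B.farInt τ a b (F i) := by
  have hc : ContinuousOn (fun p => ∑ i, c i * F i p) W :=
    continuousOn_finsetSum _ fun i _ => continuousOn_const.fun_mul (hF i)
  refine (farInt_mono hW hE hc hτ ha hle).trans_eq ?_
  refine (integral_finsetSum _ fun i _ => (integrable_box hW (hF i) hτ ha).const_mul (c i)).trans ?_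
  exact Finset.sum_congr rfl fun i _ => integral_const_mul _ _

/-- Bounds for the coefficients of the equation for `r ≥ R - 1`. -/
def CoefBounds (B : Background) (K R : ℝ) : Prop := ∀ r, R - 1 ≤ r →
    1 / 2 ≤ B.D r ∧ B.D r ≤ 2 ∧ |deriv B.D r| ≤ K * r ^ (-1 - B.rate) ∧
    |B.coefH r| ≤ K * r ^ (-2 - B.rate) ∧ |B.coefPhi r| ≤ K * r ^ (-2 - B.rate)

/-- The pointwise estimate of the bulk terms of the energy identity. -/
lemma energyBulk_le {K s : ℝ} (hC : B.CoefBounds K R) (hs : -4 < s) (hs2 : s ≤ 2)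
    (hR : B.R₀ < R - 1) (h1R : 1 ≤ R - 1) {u r : ℝ} (hr : R - 1 ≤ r) (y : S2) (h φ : Spt → ℝ) :
    B.energyBulk R V s h φ (B.bondiPt u r y)
      ≤ -((s + 4) / 4) * (wgt R V (s - 1) (B.bondiPt u r y) * der (vR B.D) h (B.bondiPt u r y) ^ 2)
      + 3 * K * (wgt R V (s - 1 - B.rate) (B.bondiPt u r y) * der (vR B.D) h (B.bondiPt u r y) ^ 2)
      + cutDeriv R ‖(B.bondiPt u r y).2‖ * angSq h (B.bondiPt u r y)
      + K / 2 * (wgt R V (s - 3 - B.rate) (B.bondiPt u r y) * h (B.bondiPt u r y) ^ 2)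
      + K / 2 * (wgt R V (s - 3 - B.rate) (B.bondiPt u r y) * φ (B.bondiPt u r y) ^ 2)
      - (2 - s) / 2 * (wgt R V (s - 3) (B.bondiPt u r y) * angForm h (B.bondiPt u r y))
      + cut R ‖(B.bondiPt u r y).2‖ * ‖(B.bondiPt u r y).2‖ ^ s * timeCutDeriv V (B.bondiPt u r y)
        * (‖(B.bondiPt u r y).2‖ ^ 2 * B.D ‖(B.bondiPt u r y).2‖)⁻¹
        * angForm h (B.bondiPt u r y) := by
  have hr0 := hR.trans_le hr
  have hrp := B.R₀_pos.trans hr0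
  have h1r := h1R.trans hr
  have hn := norm_bondiPt (u := u) hr0 y
  obtain ⟨hD1, hD2, hD', hb1, hb2⟩ := hC r hr
  have hZ := timeCut_nonneg V (B.bondiPt u r y)
  have hZ1 := timeCut_le_one V (B.bondiPt u r y)
  have hχ := cut_nonneg R r
  have hχd := cutDeriv_nonneg R r
  have hA := angSq_nonneg h (B.bondiPt u r y)
  have hr2 : r ^ s * (r ^ 2)⁻¹ ≤ 1 := by
    have : r ^ s * (r ^ 2)⁻¹ = r ^ (s - 2) := by
      rw [Real.rpow_sub hrp, Real.rpow_two, div_eq_mul_inv]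
    rw [this]
    exact Real.rpow_le_one_of_one_le_of_nonpos h1r (by linarith)
  have hP : 0 < r ^ s := Real.rpow_pos_of_pos hrp _
  have hq : 0 < r ^ (-B.rate) := Real.rpow_pos_of_pos hrp _
  have e1 : r ^ (s - 1) = r ^ s * r⁻¹ := by rw [Real.rpow_sub_one hrp.ne', div_eq_mul_inv]
  have e3 : r ^ (s - 3) = r ^ s * (r⁻¹ ^ 3) := by
    rw [Real.rpow_sub hrp, div_eq_mul_inv, inv_pow]; norm_num
  have e1' : r ^ (s - 1 - B.rate) = r ^ s * r⁻¹ * r ^ (-B.rate) := by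
    rw [sub_eq_add_neg, Real.rpow_add hrp, e1]
  have e3' : r ^ (s - 3 - B.rate) = r ^ s * (r⁻¹ ^ 3) * r ^ (-B.rate) := by
    rw [sub_eq_add_neg, Real.rpow_add hrp, e3]
  have e4 : r ^ (-1 - B.rate) = r⁻¹ * r ^ (-B.rate) := by
    rw [sub_eq_add_neg, Real.rpow_add hrp, Real.rpow_neg_one]
  have e5 : r ^ (-2 - B.rate) = r⁻¹ ^ 2 * r ^ (-B.rate) := by
    rw [sub_eq_add_neg, Real.rpow_add hrp, Real.rpow_neg hrp.le, Real.rpow_two, inv_pow]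
  rw [e4] at hD'
  rw [e5] at hb1 hb2
  simp only [energyBulk, wgt, hn, e1, e3, e1', e3']
  have hform : RpHierarchy.angForm h (B.bondiPt u r y)
      = RpHierarchy.angSq h (B.bondiPt u r y) - 2 * h (B.bondiPt u r y) ^ 2 := rfl
  generalize der (vR B.D) h (B.bondiPt u r y) = g
  have hi : 0 < r⁻¹ := inv_pos.mpr hrp
  have t1 : 3 / 2 * deriv B.D r * g ^ 2 ≤ 3 / 2 * (K * (r⁻¹ * r ^ (-B.rate))) * g ^ 2 :=
    mul_le_mul_of_nonneg_right (by linarith [le_abs_self (deriv B.D r)]) (sq_nonneg _)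
  -- The weights `r` and `r⁻¹` distribute the coefficient decay `r^{-2-σ}` as `r^{-1-σ}` on `g²` and
  -- `r^{-3-σ}` on `x²`, each a factor `r^{-σ}` better than the corresponding bulk term.
  have young : ∀ x : ℝ, |g| * |x| ≤ (r * g ^ 2 + r⁻¹ * x ^ 2) / 2 := by
    intro x
    have h1 : (r * g ^ 2 + r⁻¹ * x ^ 2) / 2 - |g| * |x| = r⁻¹ * (r * |g| - |x|) ^ 2 / 2 := by
      rw [← sq_abs g, ← sq_abs x]; field_simp; ring
    have h2 : 0 ≤ r⁻¹ * (r * |g| - |x|) ^ 2 / 2 := by positivity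
    linarith
  have t2 : ∀ c x : ℝ, |c| ≤ K * (r⁻¹ ^ 2 * r ^ (-B.rate)) → g * (c * x)
      ≤ K * (r⁻¹ * r ^ (-B.rate)) / 2 * g ^ 2 + K * (r⁻¹ ^ 3 * r ^ (-B.rate)) / 2 * x ^ 2 := by
    intro c x hc
    calc g * (c * x) ≤ |g * (c * x)| := le_abs_self _
      _ = |c| * (|g| * |x|) := by rw [abs_mul, abs_mul]; ring
      _ ≤ K * (r⁻¹ ^ 2 * r ^ (-B.rate)) * ((r * g ^ 2 + r⁻¹ * x ^ 2) / 2) :=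
          mul_le_mul hc (young x) (by positivity) ((abs_nonneg c).trans hc)
      _ = _ := by field_simp
  have t3 := t2 _ (h (B.bondiPt u r y)) hb1
  have t4 := t2 _ (φ (B.bondiPt u r y)) hb2
  have hK : 0 ≤ K * (r⁻¹ * r ^ (-B.rate)) := (abs_nonneg _).trans hD'
  have t5 : -((s + 4) * B.D r / (2 * r)) * g ^ 2 ≤ -((s + 4) / 4 * r⁻¹) * g ^ 2 := by
    refine mul_le_mul_of_nonneg_right ?_ (sq_nonneg _)
    have e : (s + 4) * B.D r / (2 * r) = (s + 4) / 4 * r⁻¹ * (2 * B.D r) := by field_simp; ring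
    rw [e, neg_le_neg_iff]
    exact le_mul_of_one_le_right (mul_nonneg (by linarith) hi.le) (by linarith)
  have e6 : (2 - s) / (2 * r ^ 3) = (2 - s) / 2 * r⁻¹ ^ 3 := by field_simp
  have main : cut R r * r ^ s * timeCut V (B.bondiPt u r y) *
      ((-((s + 4) * B.D r / (2 * r)) + 3 / 2 * deriv B.D r) * g ^ 2
        + g * (B.coefH r * h (B.bondiPt u r y) + B.coefPhi r * φ (B.bondiPt u r y))
        - (2 - s) / (2 * r ^ 3) * RpHierarchy.angForm h (B.bondiPt u r y))
      ≤ cut R r * r ^ s * timeCut V (B.bondiPt u r y) *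
      (-((s + 4) / 4 * r⁻¹) * g ^ 2 + 3 * (K * (r⁻¹ * r ^ (-B.rate))) * g ^ 2
        + K * (r⁻¹ ^ 3 * r ^ (-B.rate)) / 2 * h (B.bondiPt u r y) ^ 2
        + K * (r⁻¹ ^ 3 * r ^ (-B.rate)) / 2 * φ (B.bondiPt u r y) ^ 2
        - (2 - s) / 2 * r⁻¹ ^ 3 * RpHierarchy.angForm h (B.bondiPt u r y)) := by
    refine mul_le_mul_of_nonneg_left ?_ (by positivity)
    rw [e6]
    have : 0 ≤ K * (r⁻¹ * r ^ (-B.rate)) * g ^ 2 := mul_nonneg hK (sq_nonneg _)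
    linarith
  -- Where the radial cutoff varies, the negative `g²` and `h²` contributions are discarded. The
  -- remaining weight satisfies `r^{s-2} ζ ≤ 1` because `s ≤ 2`.
  have side : cutDeriv R r * r ^ s * timeCut V (B.bondiPt u r y) *
      (-(B.D r / 2) * g ^ 2 + (2 * r ^ 2)⁻¹ * RpHierarchy.angForm h (B.bondiPt u r y))
      ≤ cutDeriv R r * RpHierarchy.angSq h (B.bondiPt u r y) := by
    have s1 : -(B.D r / 2) * g ^ 2 + (2 * r ^ 2)⁻¹ * RpHierarchy.angForm h (B.bondiPt u r y)
        ≤ (r ^ 2)⁻¹ * RpHierarchy.angSq h (B.bondiPt u r y) := by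
      have k1 : 0 ≤ B.D r / 2 * g ^ 2 := by positivity
      have k2 : (2 * r ^ 2)⁻¹ = (r ^ 2)⁻¹ / 2 := by field_simp
      have k3 : 0 ≤ (r ^ 2)⁻¹ * h (B.bondiPt u r y) ^ 2 := by positivity
      have k4 : 0 ≤ (r ^ 2)⁻¹ * RpHierarchy.angSq h (B.bondiPt u r y) := by positivity
      rw [hform, k2]
      linarith
    calc _ ≤ cutDeriv R r * r ^ s * timeCut V (B.bondiPt u r y) *
          ((r ^ 2)⁻¹ * RpHierarchy.angSq h (B.bondiPt u r y)) :=
          mul_le_mul_of_nonneg_left s1 (by positivity)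
      _ = cutDeriv R r * RpHierarchy.angSq h (B.bondiPt u r y)
          * (r ^ s * (r ^ 2)⁻¹ * timeCut V (B.bondiPt u r y)) := by ring
      _ ≤ cutDeriv R r * RpHierarchy.angSq h (B.bondiPt u r y) * (1 * 1) :=
          mul_le_mul_of_nonneg_left (mul_le_mul hr2 hZ1 hZ zero_le_one) (by positivity)
      _ = _ := by ring
  linarith

lemma FarNhd.continuousOn_D (hW : B.FarNhd W) : ContinuousOn (fun p : Spt => B.D ‖p.2‖) W :=
  hW.continuousOn_radial B.contDiffOn_D.continuousOn

/-- The integrated `r^p`-weighted energy inequality. -/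
lemma CutBox.energy_ineq (hB : CutBox B (volume.restrict (Icc u₁ u₂)) u₁ u₂ R V b)
    (h12 : u₁ ≤ u₂) (hW : B.FarNhd W) (hh : ContDiffOn ℝ ∞ h W) (hφ : ContinuousOn φ W)
    (hm : ∀ u r : ℝ, 0 ≤ u → B.R₀ < r → ∫ y : S2, h (B.bondiPt u r y) ∂dω = 0)
    (heq : ∀ u r : ℝ, 0 ≤ u → B.R₀ < r → ∀ y : S2,
      2 * der vT (der (vR B.D) h) (B.bondiPt u r y)
      = B.D r * der (vR B.D) (der (vR B.D) h) (B.bondiPt u r y)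
        + (2 * deriv B.D r - 2 * B.D r / r) * der (vR B.D) h (B.bondiPt u r y)
        + (r ^ 2)⁻¹ * (sphLap h (B.bondiPt u r y) + 2 * h (B.bondiPt u r y))
        + B.coefH r * h (B.bondiPt u r y) + B.coefPhi r * φ (B.bondiPt u r y))
    {K s : ℝ} (hC : B.CoefBounds K R) (hs : -4 < s) (hs2 : s ≤ 2)
    {c : ℝ} (hc : ∀ x, deriv Real.smoothTransition x ≤ c) :
    B.farInt (Measure.dirac u₂) (R - 1) b (fun p => wgt R V s p * der (vR B.D) h p ^ 2)
      + (s + 4) / 4 * B.farInt (volume.restrict (Icc u₁ u₂)) (R - 1) b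
          (fun p => wgt R V (s - 1) p * der (vR B.D) h p ^ 2)
      + (2 - s) / 2 * B.farInt (volume.restrict (Icc u₁ u₂)) (R - 1) b
          (fun p => wgt R V (s - 3) p * angForm h p)
    ≤ B.farInt (Measure.dirac u₁) (R - 1) b (fun p => wgt R V s p * der (vR B.D) h p ^ 2)
      + c * B.farInt (volume.restrict (Icc u₁ u₂)) (R - 1) R (angSq h)
      + 3 * K * B.farInt (volume.restrict (Icc u₁ u₂)) (R - 1) b
          (fun p => wgt R V (s - 1 - B.rate) p * der (vR B.D) h p ^ 2)
      + K / 2 * B.farInt (volume.restrict (Icc u₁ u₂)) (R - 1) b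
          (fun p => wgt R V (s - 3 - B.rate) p * h p ^ 2)
      + K / 2 * B.farInt (volume.restrict (Icc u₁ u₂)) (R - 1) b
          (fun p => wgt R V (s - 3 - B.rate) p * φ p ^ 2) := by
  have hg := hW.der_vR hh
  have hg2 : ContDiffOn ℝ ∞ (fun p => der (vR B.D) h p ^ 2) W := hg.pow 2
  have hab : R - 1 ≤ b := by linarith [hB.le]
  have a0 := contDiffOn_cut_rpow R s B.R₀_pos
  have a1 : ContDiffOn ℝ ∞ (fun r => cut R r * r ^ s * B.D r) (Ioi B.R₀) := a0.mul B.contDiffOn_D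
  have a2 := contDiffOn_cut_rpow R (s - 2) B.R₀_pos
  have w0 := hW.weighted hg2 a0 V
  have w1 := hW.weighted hg2 a1 V
  have w2 := hW.weighted (hW.angForm hh) a2 V
  have w3 := fun i => hW.weighted (hg.mul (hW.der_vΩ hh i)) a2 V
  set N : Spt → ℝ := fun p => cut R ‖p.2‖ * ‖p.2‖ ^ s * timeCutDeriv V p
        * (‖p.2‖ ^ 2 * B.D ‖p.2‖)⁻¹ * RpHierarchy.angForm h p with hN
  have cang := (hW.angForm hh).continuousOn
  have cN : ContinuousOn N W := by
    refine ContinuousOn.mul (ContinuousOn.mul (ContinuousOn.mul (hW.continuousOn_radial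
      a0.continuousOn) (continuous_timeCutDeriv V).continuousOn) (ContinuousOn.inv₀ ?_ ?_)) cang
    · exact ContinuousOn.mul (by fun_prop) hW.continuousOn_D
    · intro p hp
      have h1 := hW.lt p hp
      exact mul_ne_zero (pow_ne_zero 2 (B.R₀_pos.trans h1).ne') (B.D_pos' h1).ne'
  have cw := fun q => hW.continuousOn_wgt R V q
  -- The first five entries are total derivatives and integrate to zero. They are followed by the
  -- main `g²` term, its error, the slab term, the errors in `h` and `φ`, the Poincaré form, and the
  -- term `N` with the derivative of the time cutoff.
  have key := farInt_le_linear (b := b) hW hB.time hB.lt (hW.der_vT w0).continuousOn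
    ![1 / 2, -(1 / 2), 1, 1, 1, -((s + 4) / 4), 3 * K, 1, K / 2, K / 2, -((2 - s) / 2), 1]
    ![der (vR B.D) (fun q => cut R ‖q.2‖ * ‖q.2‖ ^ s * B.D ‖q.2‖ *
          (timeCut V q * der (vR B.D) h q ^ 2)),
      der (vR B.D) (fun q => cut R ‖q.2‖ * ‖q.2‖ ^ (s - 2) *
          (timeCut V q * RpHierarchy.angForm h q)),
      der (vΩ 0) (fun q => cut R ‖q.2‖ * ‖q.2‖ ^ (s - 2) *
          (timeCut V q * (der (vR B.D) h q * der (vΩ 0) h q))),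
      der (vΩ 1) (fun q => cut R ‖q.2‖ * ‖q.2‖ ^ (s - 2) *
          (timeCut V q * (der (vR B.D) h q * der (vΩ 1) h q))),
      der (vΩ 2) (fun q => cut R ‖q.2‖ * ‖q.2‖ ^ (s - 2) *
          (timeCut V q * (der (vR B.D) h q * der (vΩ 2) h q))),
      fun p => wgt R V (s - 1) p * der (vR B.D) h p ^ 2,
      fun p => wgt R V (s - 1 - B.rate) p * der (vR B.D) h p ^ 2,
      fun p => cutDeriv R ‖p.2‖ * RpHierarchy.angSq h p,
      fun p => wgt R V (s - 3 - B.rate) p * h p ^ 2,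
      fun p => wgt R V (s - 3 - B.rate) p * φ p ^ 2,
      fun p => wgt R V (s - 3) p * RpHierarchy.angForm h p, N] ?_ ?_
  · rw [farInt_vT hW w0 hB.time.nonneg h12 hB.lt] at key
    simp only [Fin.sum_univ_succ, Matrix.cons_val_zero, Matrix.cons_val_succ, Finset.univ_eq_empty,
      Finset.sum_empty] at key
    rw [farInt_vR hW w1 hB.time hB.lt hab (fun u hu y => by simp only [hB.cut_left, zero_mul])
        (fun u hu y => by simp only [hB.timeCut_right hu y, zero_mul, mul_zero]),
      farInt_vR hW w2 hB.time hB.lt hab (fun u hu y => by simp only [hB.cut_left, zero_mul])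
        (fun u hu y => by simp only [hB.timeCut_right hu y, zero_mul, mul_zero]),
      farInt_vΩ hW (w3 0) hB.time hB.lt, farInt_vΩ hW (w3 1) hB.time hB.lt,
      farInt_vΩ hW (w3 2) hB.time hB.lt] at key
    have e0 : (fun q : Spt => cut R ‖q.2‖ * ‖q.2‖ ^ s * (timeCut V q * der (vR B.D) h q ^ 2))
        = fun p => wgt R V s p * der (vR B.D) h p ^ 2 := by
      funext q; simp only [wgt]; ring
    rw [e0] at key
    have k1 := hB.cutDeriv_le hW (hW.angSq hh).continuousOn (fun p => angSq_nonneg h p) hc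
    -- The derivative of the time cutoff depends on `v` alone and so is constant on each sphere. It
    -- is nonpositive, and the form it multiplies has nonnegative spherical mean: the flux through
    -- the upper end of the cutoff region has a good sign.
    have k2 : 0 ≤ B.farInt (volume.restrict (Icc u₁ u₂)) (R - 1) b (fun p => (-1) * N p) := by
      refine farInt_nonneg_of_sphere hW (continuousOn_const.fun_mul cN) hB.time hB.lt
        fun u hu r hr => ?_
      have hu0 := hB.time.nonneg.trans hu.1
      have hr0 := hB.lt.trans_le hr.1
      have hrp := B.R₀_pos.trans hr0
      have e : ∀ y : S2, (-1) * N (B.bondiPt u r y)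
          = (-1) * (cut R r * r ^ s * (-deriv Real.smoothTransition (V - (u + 2 * B.rstar r)))
        * (r ^ 2 * B.D r)⁻¹) * RpHierarchy.angForm h (B.bondiPt u r y) := by
        intro y
        simp only [hN, norm_bondiPt hr0]
        simp only [timeCutDeriv, bondiPt]
        ring
      simp only [e]
      rw [integral_const_mul]
      refine mul_nonneg ?_ (integral_angForm_nonneg hW hh hm hu0 hr0)
      have h1 := cut_nonneg R r
      have h2 := deriv_smoothTransition_nonneg (V - (u + 2 * B.rstar r))
      have h3 := B.D_pos' hr0
      have h4 : 0 ≤ cut R r * r ^ s * deriv Real.smoothTransition (V - (u + 2 * B.rstar r))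
        * (r ^ 2 * B.D r)⁻¹ := by positivity
      linarith
    rw [farInt_const_mul] at k2
    linarith
  · simp only [Fin.forall_fin_succ, Matrix.cons_val_zero, Matrix.cons_val_succ]
    refine ⟨(hW.der_vR w1).continuousOn, (hW.der_vR w2).continuousOn,
      (hW.der_vΩ (w3 0) 0).continuousOn, (hW.der_vΩ (w3 1) 1).continuousOn,
      (hW.der_vΩ (w3 2) 2).continuousOn, (cw _).fun_mul hg2.continuousOn,
      (cw _).fun_mul hg2.continuousOn,
      (continuousOn_cutDeriv W R).fun_mul (hW.angSq hh).continuousOn,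
      (cw _).fun_mul (hh.continuousOn.fun_pow 2), (cw _).fun_mul (hφ.fun_pow 2),
      (cw _).fun_mul cang, cN, fun i => i.elim0⟩
  · intro u hu r hr y
    have hu0 := hB.time.nonneg.trans hu.1
    have hr0 := hB.lt.trans_le hr.1
    have h1 := energy_identity hW hh hu0 hr0 R V s (heq u r hu0 hr0 y)
    have h2 := energyBulk_le (V := V) (u := u) hC hs hs2 hB.lt hB.one_le hr.1 y h φ
    rw [h1]
    simp only [Fin.sum_univ_succ, Matrix.cons_val_zero, Matrix.cons_val_succ, Finset.univ_eq_empty,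
      Finset.sum_empty, hN]
    simp only [Fin.succ_zero_eq_one, Fin.succ_one_eq_two]
    linarith

end Background

end RpHierarchy

/-! ### Passing between `Φ` and `Φ + Mφ`. -/

namespace RpHierarchy

namespace Background

variable {B : Background} {W : Set Spt} {ψ : Spt → ℝ} {τ : Measure ℝ} {u₁ u₂ R V b : ℝ}

/-- The relation `∂_rφ = r⁻²Φ` survives rotation, so `hardy_pair` also applies to the pair `Ω_iφ`,
`Ω_iΦ`. -/
lemma der_vR_der_vΩ_radField (hW : B.FarNhd W) (hψ : ContDiffOn ℝ ∞ ψ W) {p : Spt} (hp : p ∈ W)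
    (i : Fin 3) : der (vR B.D) (der (vΩ i) (radField ψ)) p
      = (‖p.2‖ ^ 2)⁻¹ * der (vΩ i) (Phi B.D ψ) p := by
  have hn : ‖p.2‖ ≠ 0 := norm_ne_zero_iff.mpr (hW.ne_zero hp)
  have hd : HasDerivAt (fun r : ℝ => (r ^ 2)⁻¹) (-(2 * ‖p.2‖) / (‖p.2‖ ^ 2) ^ 2) ‖p.2‖ := by
    simpa using (hasDerivAt_pow 2 ‖p.2‖).fun_inv (pow_ne_zero 2 hn)
  rw [← hW.comm_ΩR (hW.radField hψ) hp i,
    hW.der_congr (fun q hq => der_vR_radField_eq hW hq) hp]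
  exact der_vΩ_radial_mul (a := fun r => (r ^ 2)⁻¹) (hW.ne_zero hp) hd
    (hW.differentiableAt (hW.Phi hψ) hp) i

/-- Lowering the exponent of the weight gains a power of `R - 1`. -/
lemma wgt_sub_le (hR : B.R₀ < R - 1) {e d u r : ℝ} (hd : 0 ≤ d) (hr : R - 1 ≤ r) (y : S2) :
    wgt R V (e - d) (B.bondiPt u r y) ≤ (R - 1) ^ (-d) * wgt R V e (B.bondiPt u r y) := by
  have hr0 := hR.trans_le hr
  have hrp := B.R₀_pos.trans hr0
  simp only [wgt, norm_bondiPt hr0]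
  have h1 : r ^ (e - d) = r ^ e * r ^ (-d) := by rw [sub_eq_add_neg, Real.rpow_add hrp]
  have h2 : r ^ (-d) ≤ (R - 1) ^ (-d) :=
    Real.rpow_le_rpow_of_nonpos (B.R₀_pos.trans hR) hr (by linarith)
  have h3 := cut_nonneg R r
  have h4 := timeCut_nonneg V (B.bondiPt u r y)
  rw [h1]
  calc _ = cut R r * r ^ e * timeCut V (B.bondiPt u r y) * r ^ (-d) := by ring
    _ ≤ cut R r * r ^ e * timeCut V (B.bondiPt u r y) * (R - 1) ^ (-d) :=
        mul_le_mul_of_nonneg_left h2 (by positivity)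
    _ = _ := by ring

/-- The weight with exponent lowered by four, as it occurs together with `r⁻² Φ`. -/
lemma wgt_mul_inv_sq (hR : B.R₀ < R - 1) {e u r : ℝ} (hr : R - 1 ≤ r) (y : S2) (x : ℝ) :
    wgt R V e (B.bondiPt u r y) * ((‖(B.bondiPt u r y).2‖ ^ 2)⁻¹ * x) ^ 2
      = wgt R V (e - 4) (B.bondiPt u r y) * x ^ 2 := by
  have hr0 := hR.trans_le hr
  have hrp := B.R₀_pos.trans hr0
  simp only [wgt, norm_bondiPt hr0]
  have h1 : r ^ (e - 4) = r ^ e * (r ^ 4)⁻¹ := by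
    rw [Real.rpow_sub hrp, div_eq_mul_inv]; norm_num
  rw [h1]
  field_simp

lemma inv_sq_eq_rpow {x : ℝ} (hx : 0 < x) : (x ^ 2)⁻¹ = x ^ (-2 : ℝ) := by
  rw [Real.rpow_neg hx.le, Real.rpow_two]

lemma wgt_sub_four_le (hR : B.R₀ < R - 1) {e u r : ℝ} (hr : R - 1 ≤ r) (y : S2) :
    wgt R V (e - 4) (B.bondiPt u r y) ≤ ((R - 1) ^ 2)⁻¹ * wgt R V (e - 2) (B.bondiPt u r y) := by
  have h := wgt_sub_le (V := V) hR (e := e - 2) (d := 2) (u := u) (by norm_num) hr y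
  rwa [inv_sq_eq_rpow (B.R₀_pos.trans hR), show e - 4 = e - 2 - 2 by ring]

section Conversions

variable (hB : CutBox B τ u₁ u₂ R V b) (hW : B.FarNhd W) (hψ : ContDiffOn ℝ ∞ ψ W)
  {c : ℝ} (hc : ∀ x, deriv Real.smoothTransition x ≤ c)
include hB hW hψ hc

/-- Hardy with exponent `e - 4`, where `κ = 1` is admissible since `e ≤ 2`. It needs only the weight
`r^{e-2}` on the derivative; the two spare powers of `r` become the small factor `(R-1)⁻²`. -/
lemma hardy_Phi {e : ℝ} (he : e ≤ 2) :
    B.farInt τ (R - 1) b (fun p => wgt R V (e - 4) p * Phi B.D ψ p ^ 2)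
      ≤ 2 * c * B.farInt τ (R - 1) R (fun p => Phi B.D ψ p ^ 2)
        + 4 * (((R - 1) ^ 2)⁻¹
          * B.farInt τ (R - 1) b (fun p => wgt R V e p * der (vR B.D) (Phi B.D ψ) p ^ 2)) := by
  have h := hB.hardy hW (hW.Phi hψ) hc one_pos (q := e - 4) (by linarith)
  have hf2 := ((hW.der_vR (hW.Phi hψ)).pow 2).continuousOn
  have h2 := farInt_mono (b := b) hW ((hW.continuousOn_wgt R V (e - 4 + 2)).fun_mul hf2)
    (continuousOn_const (c := ((R - 1) ^ 2)⁻¹) |>.fun_mul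
      ((hW.continuousOn_wgt R V e).fun_mul hf2)) hB.time hB.lt fun u hu r hr y => by
        have h3 := wgt_sub_le (V := V) hB.lt (e := e) (d := 2) (u := u) (by norm_num) hr.1 y
        rw [show e - 4 + 2 = e - 2 by ring, ← mul_assoc, inv_sq_eq_rpow (B.R₀_pos.trans hB.lt)]
        exact mul_le_mul_of_nonneg_right h3 (sq_nonneg _)
  rw [farInt_const_mul] at h2
  norm_num at h
  linarith

/-- `∂_rΦ = ∂_r h - M r⁻²Φ`. By `hardy_Phi` the last term costs at most `8M²(R-1)⁻² ≤ 1/2` of the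
left side, apart from a slab term, and is absorbed. -/
lemma flux_f_le (hR : 16 * B.M ^ 2 ≤ (R - 1) ^ 2) {e : ℝ} (he : e ≤ 2) :
    B.farInt τ (R - 1) b (fun p => wgt R V e p * der (vR B.D) (Phi B.D ψ) p ^ 2)
      ≤ 4 * B.farInt τ (R - 1) b (fun p => wgt R V e p * der (vR B.D) (B.hatPhi ψ) p ^ 2)
        + 8 * B.M ^ 2 * c * B.farInt τ (R - 1) R (fun p => Phi B.D ψ p ^ 2) := by
  have hf2 := ((hW.der_vR (hW.Phi hψ)).pow 2).continuousOn
  have hg2 := ((hW.der_vR (hW.hatPhi hψ)).pow 2).continuousOn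
  have hP2 := ((hW.Phi hψ).pow 2).continuousOn
  have h1 := hardy_Phi hB hW hψ hc he
  have h2 := farInt_le_linear (b := b) hW hB.time hB.lt ((hW.continuousOn_wgt R V e).fun_mul hf2)
    ![2, 2 * B.M ^ 2] ![fun p => wgt R V e p * der (vR B.D) (B.hatPhi ψ) p ^ 2,
      fun p => wgt R V (e - 4) p * Phi B.D ψ p ^ 2] ?_ ?_
  · simp only [Fin.sum_univ_two, Matrix.cons_val_zero, Matrix.cons_val_one] at h2
    have hF0 : 0 ≤ B.farInt τ (R - 1) b
        (fun p => wgt R V e p * der (vR B.D) (Phi B.D ψ) p ^ 2) :=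
      farInt_nonneg hB.time fun u _ r _ y => mul_nonneg (wgt_nonneg _ _ _ _) (sq_nonneg _)
    set I := B.farInt τ (R - 1) b (fun p => wgt R V e p * der (vR B.D) (Phi B.D ψ) p ^ 2)
    have hp : 0 < (R - 1) ^ 2 := by have := hB.one_le; positivity
    have h3 : 16 * B.M ^ 2 * ((R - 1) ^ 2)⁻¹ ≤ 1 := by
      rw [← div_eq_mul_inv, div_le_one hp]; exact hR
    have h4 := mul_le_mul_of_nonneg_right h3 hF0
    have h5 := mul_le_mul_of_nonneg_left h1 (by positivity : 0 ≤ 2 * B.M ^ 2)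
    linarith
  · simp only [Fin.forall_fin_two, Matrix.cons_val_zero, Matrix.cons_val_one]
    exact ⟨(hW.continuousOn_wgt _ _ _).fun_mul hg2, (hW.continuousOn_wgt _ _ _).fun_mul hP2⟩
  · intro u hu r hr y
    have hp := hW.far_subset (bondiPt_mem_far (hB.time.nonneg.trans hu.1) (hB.lt.trans_le hr.1) y)
    simp only [Fin.sum_univ_two, Matrix.cons_val_zero, Matrix.cons_val_one]
    rw [← wgt_mul_inv_sq hB.lt hr.1, der_vR_hatPhi hW hψ hp]
    have h0 := wgt_nonneg R V e (B.bondiPt u r y)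
    generalize der (vR B.D) (Phi B.D ψ) (B.bondiPt u r y) = f
    generalize (‖(B.bondiPt u r y).2‖ ^ 2)⁻¹ * Phi B.D ψ (B.bondiPt u r y) = x
    have h6 : f ^ 2 ≤ 2 * (f + B.M * x) ^ 2 + 2 * B.M ^ 2 * x ^ 2 := by
      nlinarith [sq_nonneg (f + 2 * B.M * x)]
    nlinarith [mul_le_mul_of_nonneg_left h6 h0]

/-- The converse comparison, with the same use of `hardy_Phi` but without absorption, since the `Φ`
term is bounded directly by the flux of `∂_rΦ`. -/
lemma flux_g_le (hR : 16 * B.M ^ 2 ≤ (R - 1) ^ 2) {e : ℝ} (he : e ≤ 2) :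
    B.farInt τ (R - 1) b (fun p => wgt R V e p * der (vR B.D) (B.hatPhi ψ) p ^ 2)
      ≤ 3 * B.farInt τ (R - 1) b (fun p => wgt R V e p * der (vR B.D) (Phi B.D ψ) p ^ 2)
        + 4 * B.M ^ 2 * c * B.farInt τ (R - 1) R (fun p => Phi B.D ψ p ^ 2) := by
  have hf2 := ((hW.der_vR (hW.Phi hψ)).pow 2).continuousOn
  have hg2 := ((hW.der_vR (hW.hatPhi hψ)).pow 2).continuousOn
  have hP2 := ((hW.Phi hψ).pow 2).continuousOn
  have h1 := hardy_Phi hB hW hψ hc he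
  have h2 := farInt_le_linear (b := b) hW hB.time hB.lt ((hW.continuousOn_wgt R V e).fun_mul hg2)
    ![2, 2 * B.M ^ 2] ![fun p => wgt R V e p * der (vR B.D) (Phi B.D ψ) p ^ 2,
      fun p => wgt R V (e - 4) p * Phi B.D ψ p ^ 2] ?_ ?_
  · simp only [Fin.sum_univ_two, Matrix.cons_val_zero, Matrix.cons_val_one] at h2
    have hF0 : 0 ≤ B.farInt τ (R - 1) b
        (fun p => wgt R V e p * der (vR B.D) (Phi B.D ψ) p ^ 2) :=
      farInt_nonneg hB.time fun u _ r _ y => mul_nonneg (wgt_nonneg _ _ _ _) (sq_nonneg _)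
    set I := B.farInt τ (R - 1) b (fun p => wgt R V e p * der (vR B.D) (Phi B.D ψ) p ^ 2)
    have hp : 0 < (R - 1) ^ 2 := by have := hB.one_le; positivity
    have h3 : 16 * B.M ^ 2 * ((R - 1) ^ 2)⁻¹ ≤ 1 := by
      rw [← div_eq_mul_inv, div_le_one hp]; exact hR
    have h4 := mul_le_mul_of_nonneg_right h3 hF0
    have h5 := mul_le_mul_of_nonneg_left h1 (by positivity : 0 ≤ 2 * B.M ^ 2)
    linarith
  · simp only [Fin.forall_fin_two, Matrix.cons_val_zero, Matrix.cons_val_one]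
    exact ⟨(hW.continuousOn_wgt _ _ _).fun_mul hf2, (hW.continuousOn_wgt _ _ _).fun_mul hP2⟩
  · intro u hu r hr y
    have hp := hW.far_subset (bondiPt_mem_far (hB.time.nonneg.trans hu.1) (hB.lt.trans_le hr.1) y)
    simp only [Fin.sum_univ_two, Matrix.cons_val_zero, Matrix.cons_val_one]
    rw [← wgt_mul_inv_sq hB.lt hr.1, der_vR_hatPhi hW hψ hp]
    have h0 := wgt_nonneg R V e (B.bondiPt u r y)
    generalize der (vR B.D) (Phi B.D ψ) (B.bondiPt u r y) = f
    generalize (‖(B.bondiPt u r y).2‖ ^ 2)⁻¹ * Phi B.D ψ (B.bondiPt u r y) = x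
    have h6 : (f + B.M * x) ^ 2 ≤ 2 * f ^ 2 + 2 * B.M ^ 2 * x ^ 2 := by
      nlinarith [sq_nonneg (f - B.M * x)]
    nlinarith [mul_le_mul_of_nonneg_left h6 h0]

end Conversions

/-- Hardy's inequality for a pair `Y, Y₁` with `∂_r Y = r⁻² Y₁` and `H = Y₁ + M Y`. -/
lemma hardy_pair (hB : CutBox B τ u₁ u₂ R V b) (hW : B.FarNhd W)
    {c : ℝ} (hc : ∀ x, deriv Real.smoothTransition x ≤ c) {Y Y₁ H : Spt → ℝ} (hY : ContDiffOn ℝ ∞ Y W) (hY₁ : ContinuousOn Y₁ W)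
    (hH : ContinuousOn H W) (hd : ∀ p ∈ W, der (vR B.D) Y p = (‖p.2‖ ^ 2)⁻¹ * Y₁ p)
    (hs : ∀ p ∈ W, H p = Y₁ p + B.M * Y p) {κ e : ℝ} (hκ : 0 < κ) (he : κ ≤ 2 - e)
    (hR : 16 * B.M ^ 2 ≤ κ ^ 2 * (R - 1) ^ 2) :
    B.farInt τ (R - 1) b (fun p => wgt R V (e - 3) p * Y p ^ 2)
        ≤ 4 * c / κ * B.farInt τ (R - 1) R (fun p => Y p ^ 2)
          + 16 / κ ^ 2 * B.farInt τ (R - 1) b (fun p => wgt R V (e - 3) p * H p ^ 2) ∧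
    B.farInt τ (R - 1) b (fun p => wgt R V (e - 3) p * Y₁ p ^ 2)
        ≤ 8 * B.M ^ 2 * c / κ * B.farInt τ (R - 1) R (fun p => Y p ^ 2)
          + 4 * B.farInt τ (R - 1) b (fun p => wgt R V (e - 3) p * H p ^ 2) := by
  have h1 := hB.hardy hW hY hc hκ (q := e - 3) (by linarith)
  have cw := hW.continuousOn_wgt R V
  have cY := hY.continuousOn.fun_pow 2
  have cY₁ := hY₁.fun_pow 2
  have cH := hH.fun_pow 2
  have hpt : ∀ u ∈ Icc u₁ u₂, ∀ r ∈ Icc (R - 1) b, ∀ y : S2, B.bondiPt u r y ∈ W :=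
    fun u hu r hr y => hW.far_subset
      (bondiPt_mem_far (hB.time.nonneg.trans hu.1) (hB.lt.trans_le hr.1) y)
  have h2 := farInt_mono (b := b) hW ((cw (e - 3 + 2)).fun_mul ((hW.der_vR hY).continuousOn.fun_pow 2))
    (continuousOn_const (c := ((R - 1) ^ 2)⁻¹) |>.fun_mul ((cw (e - 3)).fun_mul cY₁))
    hB.time hB.lt fun u hu r hr y => by
      rw [hd _ (hpt u hu r hr y), wgt_mul_inv_sq hB.lt hr.1, ← mul_assoc]
      have := wgt_sub_four_le (V := V) hB.lt (e := e - 3 + 2) (u := u) hr.1 y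
      rw [show e - 3 + 2 - 2 = e - 3 by ring] at this
      exact mul_le_mul_of_nonneg_right this (sq_nonneg _)
  rw [farInt_const_mul] at h2
  have h3 := farInt_le_linear (b := b) hW hB.time hB.lt ((cw (e - 3)).fun_mul cY₁)
    ![2, 2 * B.M ^ 2] ![fun p => wgt R V (e - 3) p * H p ^ 2,
      fun p => wgt R V (e - 3) p * Y p ^ 2]
    (by
      simp only [Fin.forall_fin_two, Matrix.cons_val_zero, Matrix.cons_val_one]
      exact ⟨(cw _).fun_mul cH, (cw _).fun_mul cY⟩)
    (fun u hu r hr y => by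
      simp only [Fin.sum_univ_two, Matrix.cons_val_zero, Matrix.cons_val_one]
      rw [hs _ (hpt u hu r hr y)]
      have h0 := wgt_nonneg R V (e - 3) (B.bondiPt u r y)
      generalize Y (B.bondiPt u r y) = x
      generalize Y₁ (B.bondiPt u r y) = f
      have h6 : f ^ 2 ≤ 2 * (f + B.M * x) ^ 2 + 2 * B.M ^ 2 * x ^ 2 := by
        nlinarith [sq_nonneg (f + 2 * B.M * x)]
      nlinarith [mul_le_mul_of_nonneg_left h6 h0])
  simp only [Fin.sum_univ_two, Matrix.cons_val_zero, Matrix.cons_val_one] at h3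
  have n1 : 0 ≤ B.farInt τ (R - 1) b (fun p => wgt R V (e - 3) p * Y p ^ 2) :=
    farInt_nonneg hB.time fun u _ r _ y => mul_nonneg (wgt_nonneg _ _ _ _) (sq_nonneg _)
  have n2 : 0 ≤ B.farInt τ (R - 1) b (fun p => wgt R V (e - 3) p * Y₁ p ^ 2) :=
    farInt_nonneg hB.time fun u _ r _ y => mul_nonneg (wgt_nonneg _ _ _ _) (sq_nonneg _)
  have n3 : 0 ≤ B.farInt τ (R - 1) b (fun p => wgt R V (e - 3) p * H p ^ 2) :=
    farInt_nonneg hB.time fun u _ r _ y => mul_nonneg (wgt_nonneg _ _ _ _) (sq_nonneg _)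
  have hp : 1 ≤ (R - 1) ^ 2 := one_le_pow₀ hB.one_le
  have hp0 : 0 < (R - 1) ^ 2 := by linarith
  generalize B.farInt τ (R - 1) b (fun p => wgt R V (e - 3) p * Y p ^ 2) = IY at *
  generalize B.farInt τ (R - 1) b (fun p => wgt R V (e - 3) p * Y₁ p ^ 2) = I1 at *
  generalize B.farInt τ (R - 1) b (fun p => wgt R V (e - 3) p * H p ^ 2) = IH at *
  generalize B.farInt τ (R - 1) R (fun p => Y p ^ 2) = S at *
  have k0 : ((R - 1) ^ 2)⁻¹ ≤ 1 := inv_le_one_of_one_le₀ hp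
  -- Hardy bounds `Y` by `Y₁`, and `Y₁² ≤ 2H² + 2M²Y²` brings `Y` back. This factor, halved, is the
  -- coefficient with which either quantity returns, so the loop closes for large `R`.
  have k1 : 16 * B.M ^ 2 / κ ^ 2 * ((R - 1) ^ 2)⁻¹ ≤ 1 := by
    rw [← div_eq_mul_inv, div_div, div_le_one (by positivity)]; exact hR
  have k2 : IY ≤ 2 * c / κ * S + 4 / κ ^ 2 * (((R - 1) ^ 2)⁻¹ * I1) :=
    h1.trans (by gcongr)
  have k3 : 4 / κ ^ 2 * (((R - 1) ^ 2)⁻¹ * I1)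
      ≤ 4 / κ ^ 2 * (((R - 1) ^ 2)⁻¹ * (2 * IH + 2 * B.M ^ 2 * IY)) := by gcongr
  have k4 : 4 / κ ^ 2 * (((R - 1) ^ 2)⁻¹ * (2 * IH)) ≤ 4 / κ ^ 2 * (1 * (2 * IH)) := by gcongr
  have k5 := mul_le_mul_of_nonneg_right k1 n1
  have k6 := mul_le_mul_of_nonneg_right k1 n2
  constructor
  · have : 4 / κ ^ 2 * (((R - 1) ^ 2)⁻¹ * (2 * B.M ^ 2 * IY))
        = 16 * B.M ^ 2 / κ ^ 2 * ((R - 1) ^ 2)⁻¹ * IY / 2 := by ring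
    have e2 : 4 * c / κ * S = 2 * (2 * c / κ * S) := by ring
    have e3 : 16 / κ ^ 2 * IH = 2 * (4 / κ ^ 2 * (1 * (2 * IH))) := by ring
    rw [e2, e3]
    linarith
  · have k7 := mul_le_mul_of_nonneg_left k2 (by positivity : 0 ≤ 2 * B.M ^ 2)
    have e1 : 2 * B.M ^ 2 * (2 * c / κ * S + 4 / κ ^ 2 * (((R - 1) ^ 2)⁻¹ * I1))
        = 8 * B.M ^ 2 * c / κ * S / 2 + 16 * B.M ^ 2 / κ ^ 2 * ((R - 1) ^ 2)⁻¹ * I1 / 2 := by ring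
    linarith

end Background

end RpHierarchy

/-! ### Absorption of the errors, and the estimate up to slab terms. -/

namespace RpHierarchy

namespace Background

variable {B : Background} {W : Set Spt} {ψ : Spt → ℝ} {τ : Measure ℝ} {u₁ u₂ R V b : ℝ}

/-- The terms that have to be controlled in the slab `R - 1 ≤ r ≤ R`. -/
def slabTerms (B : Background) (ψ : Spt → ℝ) (p : Spt) : ℝ :=
  radField ψ p ^ 2 + Phi B.D ψ p ^ 2 + angSq (radField ψ) p + angSq (Phi B.D ψ) p

lemma continuousOn_slabTerms (hW : B.FarNhd W) (hψ : ContDiffOn ℝ ∞ ψ W) :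
    ContinuousOn (B.slabTerms ψ) W :=
  ((((hW.radField hψ).pow 2).add ((hW.Phi hψ).pow 2)).add (hW.angSq (hW.radField hψ))).add
    (hW.angSq (hW.Phi hψ)) |>.continuousOn

lemma sq_hatPhi_le (p : Spt) : B.hatPhi ψ p ^ 2 ≤ 2 * (1 + B.M ^ 2) * B.slabTerms ψ p := by
  have h1 := angSq_nonneg (radField ψ) p
  have h2 := angSq_nonneg (Phi B.D ψ) p
  simp only [hatPhi, slabTerms]
  have h3 : 0 ≤ B.M ^ 2 * angSq (radField ψ) p := by positivity
  have h4 : 0 ≤ B.M ^ 2 * angSq (Phi B.D ψ) p := by positivity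
  have h5 : 0 ≤ B.M ^ 2 * Phi B.D ψ p ^ 2 := by positivity
  nlinarith [sq_nonneg (Phi B.D ψ p - B.M * radField ψ p), sq_nonneg (radField ψ p)]

lemma angSq_hatPhi_le (hW : B.FarNhd W) (hψ : ContDiffOn ℝ ∞ ψ W) {p : Spt} (hp : p ∈ W) :
    angSq (B.hatPhi ψ) p ≤ 2 * (1 + B.M ^ 2) * B.slabTerms ψ p := by
  have h1 : angSq (B.hatPhi ψ) p
      ≤ 2 * angSq (Phi B.D ψ) p + 2 * B.M ^ 2 * angSq (radField ψ) p := by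
    simp only [angSq, Finset.mul_sum, ← Finset.sum_add_distrib]
    refine Finset.sum_le_sum fun i _ => ?_
    rw [der_hatPhi hW hψ hp]
    nlinarith [sq_nonneg (der (vΩ i) (Phi B.D ψ) p - B.M * der (vΩ i) (radField ψ) p)]
  have h1' := angSq_nonneg (radField ψ) p
  have h2 := angSq_nonneg (Phi B.D ψ) p
  have h3 : 0 ≤ B.M ^ 2 * angSq (Phi B.D ψ) p := by positivity
  have h5 : 0 ≤ B.M ^ 2 * (radField ψ p ^ 2 + Phi B.D ψ p ^ 2) := by positivity
  simp only [slabTerms]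
  nlinarith [sq_nonneg (radField ψ p), sq_nonneg (Phi B.D ψ p)]

lemma sq_radField_le (p : Spt) : radField ψ p ^ 2 ≤ B.slabTerms ψ p := by
  have h1 := angSq_nonneg (radField ψ) p
  have h2 := angSq_nonneg (Phi B.D ψ) p
  have h3 := sq_nonneg (Phi B.D ψ p)
  simp only [slabTerms]
  linarith

lemma sq_Phi_le (p : Spt) : Phi B.D ψ p ^ 2 ≤ B.slabTerms ψ p := by
  have h1 := angSq_nonneg (radField ψ) p
  have h2 := angSq_nonneg (Phi B.D ψ) p
  have h3 := sq_nonneg (radField ψ p)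
  simp only [slabTerms]
  linarith

lemma angSq_radField_le (p : Spt) : angSq (radField ψ) p ≤ B.slabTerms ψ p := by
  have h1 := sq_nonneg (Phi B.D ψ p)
  have h2 := angSq_nonneg (Phi B.D ψ) p
  have h3 := sq_nonneg (radField ψ p)
  simp only [slabTerms]
  linarith

/-- The constant in front of `∫ r^{s-1-σ} g²` in the error terms. -/
def errConst (B : Background) (K : ℝ) : ℝ :=
  3 * K + K / 2 * (1 + 16 / B.rate ^ 2) * (4 / B.rate ^ 2)

/-- The constant in front of the slab terms of the error. -/
def slabConst (B : Background) (K c : ℝ) : ℝ :=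
  2 * c * (1 + B.M ^ 2)
    + K / 2 * ((1 + 16 / B.rate ^ 2) * (2 * c / B.rate * (2 * (1 + B.M ^ 2))) + 4 * c / B.rate)

/-- The energy estimate for `g = ∂_r h`, with the errors absorbed. -/
lemma CutBox.energy_absorbed (hB : CutBox B (volume.restrict (Icc u₁ u₂)) u₁ u₂ R V b)
    (h12 : u₁ ≤ u₂) (hW : B.FarNhd W) (hψ : ContDiffOn ℝ ∞ ψ W)
    (hbox : ∀ p ∈ B.far, box B.D ψ p = 0)
    (hm : ∀ u r : ℝ, 0 ≤ u → B.R₀ < r → ∫ y : S2, B.hatPhi ψ (B.bondiPt u r y) ∂dω = 0)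
    {K s : ℝ} (hK : 0 < K) (hC : B.CoefBounds K R) (hs : -4 < s) (hs2 : s ≤ 2)
    {c : ℝ} (hc0 : 0 < c) (hc : ∀ x, deriv Real.smoothTransition x ≤ c)
    (hR1 : 16 * B.M ^ 2 ≤ B.rate ^ 2 * (R - 1) ^ 2)
    (hR2 : B.errConst K * (R - 1) ^ (-B.rate) ≤ (s + 4) / 8) :
    B.farInt (Measure.dirac u₂) (R - 1) b (fun p => wgt R V s p * der (vR B.D) (B.hatPhi ψ) p ^ 2)
      + (s + 4) / 8 * B.farInt (volume.restrict (Icc u₁ u₂)) (R - 1) b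
          (fun p => wgt R V (s - 1) p * der (vR B.D) (B.hatPhi ψ) p ^ 2)
      + (2 - s) / 2 * B.farInt (volume.restrict (Icc u₁ u₂)) (R - 1) b
          (fun p => wgt R V (s - 3) p * angForm (B.hatPhi ψ) p)
    ≤ B.farInt (Measure.dirac u₁) (R - 1) b
          (fun p => wgt R V s p * der (vR B.D) (B.hatPhi ψ) p ^ 2)
      + B.slabConst K c * B.farInt (volume.restrict (Icc u₁ u₂)) (R - 1) R (B.slabTerms ψ) := by
  have hσ := B.rate_pos
  have hh := hW.hatPhi hψ
  have hφ := hW.radField hψ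
  have hΦ := hW.Phi hψ
  have cm := continuousOn_slabTerms hW hψ
  have E := hB.energy_ineq h12 hW hh hφ.continuousOn hm
    (fun u r hu hr y => wave_der_vR_hatPhi hW hψ hbox hu hr y) hC hs hs2 hc
  -- The extra decay makes `κ = σ` admissible for every `s ≤ 2`, including `s = 2`, where the
  -- exponent `s - 3` alone would be critical for Hardy's inequality.
  have H1 := hB.hardy hW hh hc hσ (q := s - 3 - B.rate) (by linarith)
  have H2 := (hardy_pair hB hW hc hφ hΦ.continuousOn hh.continuousOn
    (fun p hp => der_vR_radField_eq hW hp) (fun p _ => rfl) hσ (e := s - B.rate)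
    (by linarith) hR1).1
  rw [show s - B.rate - 3 = s - 3 - B.rate by ring] at H2
  rw [show s - 3 - B.rate + 2 = s - 1 - B.rate by ring] at H1
  have hg2 := ((hW.der_vR hh).pow 2).continuousOn
  have G1 := farInt_mono (b := b) hW ((hW.continuousOn_wgt R V (s - 1 - B.rate)).fun_mul hg2)
    (continuousOn_const (c := (R - 1) ^ (-B.rate)) |>.fun_mul
      ((hW.continuousOn_wgt R V (s - 1)).fun_mul hg2)) hB.time hB.lt fun u hu r hr y => by
        rw [← mul_assoc]
        exact mul_le_mul_of_nonneg_right (wgt_sub_le hB.lt hσ.le hr.1 y) (sq_nonneg _)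
  have S1 := farInt_mono (b := R) hW (hh.pow 2).continuousOn
    (continuousOn_const (c := 2 * (1 + B.M ^ 2)) |>.fun_mul cm) hB.time hB.lt
    fun u hu r hr y => sq_hatPhi_le _
  have S2 := farInt_mono (b := R) hW (hφ.pow 2).continuousOn cm hB.time hB.lt
    fun u hu r hr y => sq_radField_le _
  have S3 := farInt_mono (b := R) hW (hW.angSq hh).continuousOn
    (continuousOn_const (c := 2 * (1 + B.M ^ 2)) |>.fun_mul cm) hB.time hB.lt
    fun u hu r hr y => angSq_hatPhi_le hW hψ
      (hW.far_subset (bondiPt_mem_far (hB.time.nonneg.trans hu.1) (hB.lt.trans_le hr.1) y))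
  rw [farInt_const_mul] at G1 S1 S3
  have G0 : 0 ≤ B.farInt (volume.restrict (Icc u₁ u₂)) (R - 1) b
      (fun p => wgt R V (s - 1) p * der (vR B.D) (B.hatPhi ψ) p ^ 2) :=
    farInt_nonneg hB.time fun u _ r _ y => mul_nonneg (wgt_nonneg _ _ _ _) (sq_nonneg _)
  generalize B.farInt (volume.restrict (Icc u₁ u₂)) (R - 1) b
    (fun p => wgt R V (s - 1) p * der (vR B.D) (B.hatPhi ψ) p ^ 2) = G at *
  generalize B.farInt (volume.restrict (Icc u₁ u₂)) (R - 1) b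
    (fun p => wgt R V (s - 1 - B.rate) p * der (vR B.D) (B.hatPhi ψ) p ^ 2) = G' at *
  generalize B.farInt (volume.restrict (Icc u₁ u₂)) (R - 1) b
    (fun p => wgt R V (s - 3 - B.rate) p * B.hatPhi ψ p ^ 2) = Hh at *
  generalize B.farInt (volume.restrict (Icc u₁ u₂)) (R - 1) b
    (fun p => wgt R V (s - 3 - B.rate) p * radField ψ p ^ 2) = Hφ at *
  generalize B.farInt (volume.restrict (Icc u₁ u₂)) (R - 1) R (B.slabTerms ψ) = Sm at *
  generalize B.farInt (volume.restrict (Icc u₁ u₂)) (R - 1) R (fun p => B.hatPhi ψ p ^ 2) = Sh at *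
  generalize B.farInt (volume.restrict (Icc u₁ u₂)) (R - 1) R (fun p => radField ψ p ^ 2) = Sφ at *
  generalize B.farInt (volume.restrict (Icc u₁ u₂)) (R - 1) R (angSq (B.hatPhi ψ)) = SΩ at *
  generalize (R - 1) ^ (-B.rate) = ε at *
  have k1 : 2 * c / B.rate * Sh ≤ 2 * c / B.rate * (2 * (1 + B.M ^ 2) * Sm) := by gcongr
  have k2 : 4 / B.rate ^ 2 * G' ≤ 4 / B.rate ^ 2 * (ε * G) := by gcongr
  have k3 : 4 * c / B.rate * Sφ ≤ 4 * c / B.rate * Sm := by gcongr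
  have k4 : Hh ≤ 2 * c / B.rate * (2 * (1 + B.M ^ 2) * Sm) + 4 / B.rate ^ 2 * (ε * G) := by linarith
  have k5 : (1 + 16 / B.rate ^ 2) * Hh ≤ (1 + 16 / B.rate ^ 2) *
      (2 * c / B.rate * (2 * (1 + B.M ^ 2) * Sm) + 4 / B.rate ^ 2 * (ε * G)) := by gcongr
  have k6 : K / 2 * (Hh + Hφ) ≤ K / 2 * ((1 + 16 / B.rate ^ 2) *
      (2 * c / B.rate * (2 * (1 + B.M ^ 2) * Sm) + 4 / B.rate ^ 2 * (ε * G))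
      + 4 * c / B.rate * Sm) := by
    refine mul_le_mul_of_nonneg_left ?_ (by positivity)
    linarith
  have k7 : c * SΩ ≤ c * (2 * (1 + B.M ^ 2) * Sm) := by gcongr
  have k8 : 3 * K * G' ≤ 3 * K * (ε * G) := by gcongr
  -- The errors are at most `errConst · (R-1)^{-σ}` times the bulk, up to slab terms. Half of the
  -- coefficient `(s+4)/4` pays for them and `(s+4)/8` remains.
  have k9 := mul_le_mul_of_nonneg_right hR2 G0
  simp only [errConst] at k9
  simp only [slabConst]
  linarith

/-- The constant of the weighted estimate up to slab terms. -/
def coreConst (B : Background) (K c R : ℝ) : ℝ :=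
  (44 + 256 * R ^ 2) * (3 + 4 * B.M ^ 2 * c + B.slabConst K c) + 64 * B.M ^ 2 * c
    + 32 * c * (1 + B.M ^ 2)

/-- The weighted estimate for `∂_r Φ` with cutoffs, up to terms on the slab `R - 1 ≤ r ≤ R`. -/
lemma CutBox.core (hB : CutBox B (volume.restrict (Icc u₁ u₂)) u₁ u₂ R V b)
    (h12 : u₁ ≤ u₂) (hW : B.FarNhd W) (hψ : ContDiffOn ℝ ∞ ψ W)
    (hbox : ∀ p ∈ B.far, box B.D ψ p = 0)
    (hm : ∀ u r : ℝ, 0 ≤ u → B.R₀ < r → ∫ y : S2, B.hatPhi ψ (B.bondiPt u r y) ∂dω = 0)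
    {K s : ℝ} (hK : 0 < K) (hC : B.CoefBounds K R) (hs : -4 < s) (hs2 : s ≤ 2)
    {c : ℝ} (hc0 : 0 < c) (hc : ∀ x, deriv Real.smoothTransition x ≤ c)
    (hR1 : 16 * B.M ^ 2 ≤ B.rate ^ 2 * (R - 1) ^ 2)
    (hR2 : B.errConst K * (R - 1) ^ (-B.rate) ≤ (s + 4) / 8)
    (hR3 : 1 ≤ R * (s + 4))
    (hR4 : s = 2 ∨ (1 ≤ R * (2 - s) ∧ 16 * B.M ^ 2 ≤ (2 - s) ^ 2 * (R - 1) ^ 2)) :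
    B.farInt (Measure.dirac u₂) (R - 1) b (fun p => wgt R V s p * der (vR B.D) (Phi B.D ψ) p ^ 2)
      + (s + 4) * B.farInt (volume.restrict (Icc u₁ u₂)) (R - 1) b
          (fun p => wgt R V (s - 1) p * der (vR B.D) (Phi B.D ψ) p ^ 2)
      + (2 - s) * B.farInt (volume.restrict (Icc u₁ u₂)) (R - 1) b
          (fun p => wgt R V (s - 3) p * angSq (Phi B.D ψ) p)
    ≤ B.coreConst K c R * (B.farInt (Measure.dirac u₁) (R - 1) b
          (fun p => wgt R V s p * der (vR B.D) (Phi B.D ψ) p ^ 2)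
      + B.farInt (Measure.dirac u₁) (R - 1) R (fun p => Phi B.D ψ p ^ 2)
      + B.farInt (Measure.dirac u₂) (R - 1) R (fun p => Phi B.D ψ p ^ 2)
      + B.farInt (volume.restrict (Icc u₁ u₂)) (R - 1) R (B.slabTerms ψ)) := by
  have hσ := B.rate_pos
  have hσ1 := B.rate_le_one
  have hh := hW.hatPhi hψ
  have hφ := hW.radField hψ
  have hΦ := hW.Phi hψ
  have cm := continuousOn_slabTerms hW hψ
  have hu1 := hB.time.nonneg
  have hR' : 16 * B.M ^ 2 ≤ (R - 1) ^ 2 := hR1.trans (by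
    have : B.rate ^ 2 ≤ 1 := pow_le_one₀ hσ.le hσ1
    nlinarith [sq_nonneg (R - 1)])
  have hB1 : CutBox B (Measure.dirac u₁) u₁ u₁ R V b :=
    ⟨timeMeasure_dirac hu1, hB.lt, hB.one_le, hB.le, hB.vanish⟩
  have hB2 : CutBox B (Measure.dirac u₂) u₂ u₂ R V b :=
    ⟨timeMeasure_dirac (hu1.trans h12), hB.lt, hB.one_le, hB.le, by linarith [hB.vanish]⟩
  have E := hB.energy_absorbed h12 hW hψ hbox hm hK hC hs hs2 hc0 hc hR1 hR2
  have F1 := flux_g_le hB1 hW hψ hc hR' (e := s) hs2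
  have F2 := flux_f_le hB2 hW hψ hc hR' (e := s) hs2
  have F3 := flux_f_le hB hW hψ hc hR' (e := s - 1) (by linarith)
  have L1 := farInt_mono (b := R) hW (hh.pow 2).continuousOn
    (continuousOn_const (c := 2 * (1 + B.M ^ 2)) |>.fun_mul cm) hB.time hB.lt
    fun u hu r hr y => sq_hatPhi_le _
  have L2 := farInt_mono (b := R) hW (hΦ.pow 2).continuousOn cm hB.time hB.lt
    fun u hu r hr y => sq_Phi_le _
  rw [farInt_const_mul] at L1
  have nn : ∀ {τ : Measure ℝ} {v w : ℝ} (_ : TimeMeasure τ v w) (a b : ℝ) {F : Spt → ℝ},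
      (∀ p, 0 ≤ F p) → 0 ≤ B.farInt τ a b F := fun hτ a b F hF =>
    farInt_nonneg hτ fun u _ r _ y => hF _
  have n1 := nn hB1.time (R - 1) b
    (F := fun p => wgt R V s p * der (vR B.D) (Phi B.D ψ) p ^ 2)
    fun p => mul_nonneg (wgt_nonneg _ _ _ _) (sq_nonneg _)
  have n2 := nn hB2.time (R - 1) b
    (F := fun p => wgt R V s p * der (vR B.D) (B.hatPhi ψ) p ^ 2)
    fun p => mul_nonneg (wgt_nonneg _ _ _ _) (sq_nonneg _)
  have n3 := nn hB.time (R - 1) b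
    (F := fun p => wgt R V (s - 1) p * der (vR B.D) (B.hatPhi ψ) p ^ 2)
    fun p => mul_nonneg (wgt_nonneg _ _ _ _) (sq_nonneg _)
  have n4 := nn hB1.time (R - 1) R (F := fun p => Phi B.D ψ p ^ 2) fun p => sq_nonneg _
  have n5 := nn hB2.time (R - 1) R (F := fun p => Phi B.D ψ p ^ 2) fun p => sq_nonneg _
  have n6 := nn hB.time (R - 1) R (F := B.slabTerms ψ)
    fun p => (sq_nonneg _).trans (sq_Phi_le p)
  have n7 : 0 ≤ B.farInt (volume.restrict (Icc u₁ u₂)) (R - 1) b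
      (fun p => wgt R V (s - 3) p * angForm (B.hatPhi ψ) p) := by
    refine farInt_nonneg_of_sphere hW ((hW.continuousOn_wgt _ _ _).fun_mul
      (hW.angForm hh).continuousOn) hB.time hB.lt fun u hu r hr => ?_
    have hr0 := hB.lt.trans_le hr.1
    have hu0 := hu1.trans hu.1
    have e : ∀ y : S2, wgt R V (s - 3) (B.bondiPt u r y) * angForm (B.hatPhi ψ) (B.bondiPt u r y)
        = cut R r * r ^ (s - 3) * Real.smoothTransition (V - (u + 2 * B.rstar r))
          * angForm (B.hatPhi ψ) (B.bondiPt u r y) := by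
      intro y
      simp only [wgt, norm_bondiPt hr0]
      rfl
    simp only [e]
    rw [integral_const_mul]
    have := cut_nonneg R r
    have := Real.smoothTransition.nonneg (V - (u + 2 * B.rstar r))
    have := B.R₀_pos.trans hr0
    exact mul_nonneg (by positivity) (integral_angForm_nonneg hW hh hm hu0 hr0)
  -- the angular term
  have A : (2 - s) * B.farInt (volume.restrict (Icc u₁ u₂)) (R - 1) b
          (fun p => wgt R V (s - 3) p * angSq (Phi B.D ψ) p)
      ≤ 4 * (2 - s) * B.farInt (volume.restrict (Icc u₁ u₂)) (R - 1) b
          (fun p => wgt R V (s - 3) p * angForm (B.hatPhi ψ) p)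
        + (8 * B.M ^ 2 * c + 32 * c * (1 + B.M ^ 2))
          * B.farInt (volume.restrict (Icc u₁ u₂)) (R - 1) R (B.slabTerms ψ)
        + 32 * R * B.farInt (volume.restrict (Icc u₁ u₂)) (R - 1) b
            (fun p => wgt R V (s - 1) p * der (vR B.D) (B.hatPhi ψ) p ^ 2) := by
    have hRp : 0 ≤ R := by linarith [hB.one_le]
    -- At `s = 2` the angular term carries the factor zero. For `s < 2`, `hardy_pair` bounds `|ΩΦ|²`
    -- by `|Ωh|² = angForm h + 2h²`, and Hardy with `κ = 2 - s` bounds the `h²` part by the `g²`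
    -- bulk. After multiplication by `2 - s` only one factor `1/(2-s)` is left, and it is at most
    -- `R`.
    rcases hR4 with rfl | ⟨hR5, hR6⟩
    · rw [show (2 : ℝ) - 2 = 0 by norm_num, zero_mul, mul_zero, zero_mul, zero_add]
      exact add_nonneg (mul_nonneg (by positivity) n6) (mul_nonneg (by positivity) n3)
    · have hκ : 0 < 2 - s := by
        by_contra hcon
        nlinarith
      have P := fun i => (hardy_pair hB hW hc (hW.der_vΩ hφ i) (hW.der_vΩ hΦ i).continuousOn
        (hW.der_vΩ hh i).continuousOn (fun p hp => der_vR_der_vΩ_radField hW hψ hp i)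
        (fun p hp => der_hatPhi hW hψ hp (vΩ i)) hκ (e := s) le_rfl hR6).2
      have cw := hW.continuousOn_wgt R V (s - 3)
      have sumw : ∀ {F : Spt → ℝ}, ContDiffOn ℝ ∞ F W →
          ∑ i, B.farInt (volume.restrict (Icc u₁ u₂)) (R - 1) b
            (fun p => wgt R V (s - 3) p * der (vΩ i) F p ^ 2)
          = B.farInt (volume.restrict (Icc u₁ u₂)) (R - 1) b
            (fun p => wgt R V (s - 3) p * angSq F p) := by
        intro F hF
        rw [← farInt_sum hW hB.time hB.lt fun i =>
          cw.fun_mul ((hW.der_vΩ hF i).continuousOn.fun_pow 2)]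
        simp only [angSq, Finset.mul_sum]
      have P1 := Finset.sum_le_sum fun i (_ : i ∈ Finset.univ) => P i
      rw [Finset.sum_add_distrib, ← Finset.mul_sum, ← Finset.mul_sum, sumw hΦ, sumw hh,
        ← farInt_sum hW hB.time hB.lt fun i => (hW.der_vΩ hφ i).continuousOn.fun_pow 2] at P1
      have L3 : B.farInt (volume.restrict (Icc u₁ u₂)) (R - 1) R
          (fun p => ∑ i, der (vΩ i) (radField ψ) p ^ 2)
          ≤ B.farInt (volume.restrict (Icc u₁ u₂)) (R - 1) R (B.slabTerms ψ) :=
        farInt_mono hW (hW.angSq hφ).continuousOn cm hB.time hB.lt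
          fun u hu r hr y => angSq_radField_le _
      have H := hB.hardy hW hh hc hκ (q := s - 3) (by linarith)
      rw [show s - 3 + 2 = s - 1 by ring] at H
      have Q : B.farInt (volume.restrict (Icc u₁ u₂)) (R - 1) b
            (fun p => wgt R V (s - 3) p * angSq (B.hatPhi ψ) p)
          = B.farInt (volume.restrict (Icc u₁ u₂)) (R - 1) b
            (fun p => wgt R V (s - 3) p * angForm (B.hatPhi ψ) p)
          + 2 * B.farInt (volume.restrict (Icc u₁ u₂)) (R - 1) b
            (fun p => wgt R V (s - 3) p * B.hatPhi ψ p ^ 2) := by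
        rw [← farInt_const_mul, ← farInt_add hW (cw.fun_mul (hW.angForm hh).continuousOn)
          (continuousOn_const.fun_mul (cw.fun_mul (hh.pow 2).continuousOn)) hB.time hB.lt]
        congr 1
        funext p
        simp only [angForm]
        ring
      rw [Q] at P1
      generalize B.farInt (volume.restrict (Icc u₁ u₂)) (R - 1) b
        (fun p => wgt R V (s - 3) p * angForm (B.hatPhi ψ) p) = Qf at *
      generalize B.farInt (volume.restrict (Icc u₁ u₂)) (R - 1) b
        (fun p => wgt R V (s - 3) p * angSq (Phi B.D ψ) p) = AΦ at *
      generalize B.farInt (volume.restrict (Icc u₁ u₂)) (R - 1) b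
        (fun p => wgt R V (s - 3) p * B.hatPhi ψ p ^ 2) = Ah at *
      generalize B.farInt (volume.restrict (Icc u₁ u₂)) (R - 1) b
        (fun p => wgt R V (s - 1) p * der (vR B.D) (B.hatPhi ψ) p ^ 2) = G at *
      generalize B.farInt (volume.restrict (Icc u₁ u₂)) (R - 1) R (B.slabTerms ψ) = Sm at *
      generalize B.farInt (volume.restrict (Icc u₁ u₂)) (R - 1) R
        (fun p => ∑ i, der (vΩ i) (radField ψ) p ^ 2) = SΩ at *
      generalize B.farInt (volume.restrict (Icc u₁ u₂)) (R - 1) R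
        (fun p => B.hatPhi ψ p ^ 2) = Sh at *
      generalize 2 - s = κ at *
      have j1 := mul_le_mul_of_nonneg_left P1 hκ.le
      have j2 : κ * (8 * B.M ^ 2 * c / κ * SΩ + 4 * (Qf + 2 * Ah))
          = 8 * B.M ^ 2 * c * SΩ + 4 * κ * Qf + 8 * (κ * Ah) := by
        field_simp
        ring
      have j3 := mul_le_mul_of_nonneg_left H hκ.le
      have j4 : κ * (2 * c / κ * Sh + 4 / κ ^ 2 * G) = 2 * c * Sh + 4 * (1 / κ) * G := by
        field_simp
      have j5 : 1 / κ ≤ R := by rw [div_le_iff₀ hκ]; linarith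
      have j6 := mul_le_mul_of_nonneg_right j5 n3
      have j7 : 8 * B.M ^ 2 * c * SΩ ≤ 8 * B.M ^ 2 * c * Sm := by gcongr
      have j8 : 2 * c * Sh ≤ 2 * c * (2 * (1 + B.M ^ 2) * Sm) := by gcongr
      linarith
  generalize B.farInt (volume.restrict (Icc u₁ u₂)) (R - 1) b
    (fun p => wgt R V (s - 3) p * angForm (B.hatPhi ψ) p) = Qf at *
  generalize B.farInt (volume.restrict (Icc u₁ u₂)) (R - 1) b
    (fun p => wgt R V (s - 3) p * angSq (Phi B.D ψ) p) = AΦ at *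
  generalize B.farInt (volume.restrict (Icc u₁ u₂)) (R - 1) b
    (fun p => wgt R V (s - 1) p * der (vR B.D) (B.hatPhi ψ) p ^ 2) = G at *
  generalize B.farInt (volume.restrict (Icc u₁ u₂)) (R - 1) b
    (fun p => wgt R V (s - 1) p * der (vR B.D) (Phi B.D ψ) p ^ 2) = Gf at *
  generalize B.farInt (Measure.dirac u₁) (R - 1) b
    (fun p => wgt R V s p * der (vR B.D) (B.hatPhi ψ) p ^ 2) = J1 at *
  generalize B.farInt (Measure.dirac u₂) (R - 1) b
    (fun p => wgt R V s p * der (vR B.D) (B.hatPhi ψ) p ^ 2) = J2 at *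
  generalize B.farInt (Measure.dirac u₁) (R - 1) b
    (fun p => wgt R V s p * der (vR B.D) (Phi B.D ψ) p ^ 2) = I1 at *
  generalize B.farInt (Measure.dirac u₂) (R - 1) b
    (fun p => wgt R V s p * der (vR B.D) (Phi B.D ψ) p ^ 2) = I2 at *
  generalize B.farInt (volume.restrict (Icc u₁ u₂)) (R - 1) R (B.slabTerms ψ) = Sm at *
  generalize B.farInt (volume.restrict (Icc u₁ u₂)) (R - 1) R (fun p => Phi B.D ψ p ^ 2) = SΦ at *
  generalize B.farInt (Measure.dirac u₁) (R - 1) R (fun p => Phi B.D ψ p ^ 2) = T1 at *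
  generalize B.farInt (Measure.dirac u₂) (R - 1) R (fun p => Phi B.D ψ p ^ 2) = T2 at *
  clear hbox hm hC cm hh hφ hΦ L1 nn hB1 hB2 hB hW hψ hR2 hR1 hR4 hR' hc
  have hRp : 0 < R := by
    by_contra hcon
    nlinarith
  have hCs : 0 ≤ B.slabConst K c := by
    have hM := B.M_nonneg
    simp only [slabConst]
    positivity
  simp only [coreConst]
  generalize B.slabConst K c = C0 at *
  set x := B.M ^ 2 with hx
  have hx0 : 0 ≤ x := sq_nonneg _
  set X : ℝ := J1 + C0 * Sm with hX
  set T := I1 + T1 + T2 + Sm with hT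
  have hT1 : I1 ≤ T := by linarith
  have hT2 : T1 ≤ T := by linarith
  have hT3 : T2 ≤ T := by linarith
  have hT4 : Sm ≤ T := by linarith
  have hT0 : 0 ≤ T := by linarith
  have b1 : X ≤ (3 + 4 * x * c + C0) * T := by
    have i1 : C0 * Sm ≤ C0 * T := by gcongr
    have i2 : 4 * x * c * T1 ≤ 4 * x * c * T := by gcongr
    linarith
  have hG : 0 ≤ (s + 4) / 8 * G := mul_nonneg (by linarith) n3
  have hQ : 0 ≤ (2 - s) / 2 * Qf := mul_nonneg (by linarith) n7
  have hX0 : 0 ≤ X := by linarith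
  -- The factor `1/(s+4)` is replaced by `R`, which keeps the final constant independent of the
  -- exponent.
  have b2 : G ≤ 8 * R * X := by
    have i1 : 1 * G ≤ R * (s + 4) * G := mul_le_mul_of_nonneg_right hR3 n3
    have i2 : (s + 4) * G ≤ 8 * X := by linarith
    have i3 := mul_le_mul_of_nonneg_left i2 hRp.le
    linarith
  have b3 : 32 * R * G ≤ 32 * R * (8 * R * X) := by gcongr
  have b4 : (s + 4) * Gf ≤ (s + 4) * (4 * G + 8 * x * c * SΦ) :=
    mul_le_mul_of_nonneg_left F3 (by linarith)
  have b5 : (s + 4) * (8 * x * c * SΦ) ≤ 6 * (8 * x * c * Sm) := by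
    have i1 : 8 * x * c * SΦ ≤ 8 * x * c * Sm := by gcongr
    have i2 : 0 ≤ 8 * x * c * Sm := by positivity
    nlinarith
  have b6 : 8 * x * c * T2 + (56 * x * c) * Sm + 32 * c * (1 + x) * Sm
      ≤ (64 * x * c + 32 * c * (1 + x)) * T := by
    have i1 : 8 * x * c * T2 ≤ 8 * x * c * T := by gcongr
    have i2 : 56 * x * c * Sm ≤ 56 * x * c * T := by gcongr
    have i3 : 32 * c * (1 + x) * Sm ≤ 32 * c * (1 + x) * T := by gcongr
    linarith
  -- The energy estimate bounds `J2`, `(s+4)G/8` and `(2-s)Qf/2` together by `X`. The flux, the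
  -- radial bulk and the angular form are needed with the multiples `4`, `32` and `8` of these,
  -- whence `44`; the term `32 R G` contributes `32R · 8R = 256R²`.
  have b7 : (44 + 256 * R ^ 2) * X ≤ (44 + 256 * R ^ 2) * ((3 + 4 * x * c + C0) * T) := by gcongr
  linarith

end Background

end RpHierarchy

/-! ### The `T`-energy flux through cones and what it controls on bounded ranges of `r`. -/

namespace RpHierarchy

/-- Lagrange's identity for the rotation generators. -/
lemma norm_sq_mul_norm_sq (x w : E3) :
    ‖x‖ ^ 2 * ‖w‖ ^ 2 = ⟪w, x⟫ ^ 2 + ∑ i, ⟪w, rotGen i x⟫ ^ 2 := by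
  obtain ⟨c00, c01, c02, c10, c11, c12, c20, c21, c22⟩ := rotGen_coords
  rw [EuclideanSpace.real_norm_sq_eq, EuclideanSpace.real_norm_sq_eq]
  simp only [PiLp.inner_apply, Fin.sum_univ_three, c00, c01, c02, c10, c11, c12, c20, c21, c22,
    RCLike.inner_apply, conj_trivial]
  ring

lemma sq_inner_radial_add {p : Spt} (hp : p.2 ≠ 0) (f : Spt → ℝ) :
    ‖spatialGrad f p‖ ^ 2 = fderiv ℝ f p (0, radial p.2) ^ 2 + angSq f p / ‖p.2‖ ^ 2 := by
  have hn : ‖p.2‖ ≠ 0 := norm_ne_zero_iff.mpr hp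
  have h := norm_sq_mul_norm_sq p.2 (spatialGrad f p)
  have h1 : ⟪spatialGrad f p, p.2⟫ = ‖p.2‖ * fderiv ℝ f p (0, radial p.2) := by
    rw [← inner_spatialGrad, ← real_inner_smul_right, norm_smul_radial]
  have h2 : ∀ i, ⟪spatialGrad f p, rotGen i p.2⟫ = der (vΩ i) f p := fun i => by
    rw [inner_spatialGrad]; rfl
  simp only [h1, h2] at h
  simp only [angSq]
  field_simp
  linarith

/-- The flux density of the `T`-energy through outgoing null cones. -/
def fluxDensity (D : ℝ → ℝ) (f : Spt → ℝ) (p : Spt) : ℝ :=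
  ‖p.2‖ ^ 2 * D ‖p.2‖ ^ 2 / 4 * der (vR D) f p ^ 2 + D ‖p.2‖ / 4 * angSq f p

namespace Background

variable {B : Background} {W : Set Spt} {f ψ : Spt → ℝ} {τ : Measure ℝ} {u₁ u₂ R a b : ℝ}

/-- The cone is null, so the `∂_u`-derivative drops out of the flux and only the tangential
derivatives `∂_r` and `Ω_i` remain, both with positive weights. -/
lemma nullDensity_fieldT {p : Spt} (hp : p.2 ≠ 0) (hD : B.D ‖p.2‖ ≠ 0) (f : Spt → ℝ) :
    B.nullDensity fieldT f p = fluxDensity B.D f p := by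
  have hn : ‖p.2‖ ≠ 0 := norm_ne_zero_iff.mpr hp
  have hrr := inner_radial_self hp
  have hg := sq_inner_radial_add hp f
  have split : ∀ a (z : E3), fderiv ℝ f p (a, z) = a * fderiv ℝ f p (1, 0) + fderiv ℝ f p (0, z) := by
    intro a z
    have : ((a, z) : Spt) = a • ((1 : ℝ), (0 : E3)) + ((0 : ℝ), z) := by simp
    rw [this, map_add, map_smul, smul_eq_mul]
  have hlin : ∀ (c : ℝ) (z : E3), fderiv ℝ f p (0, c • z) = c * fderiv ℝ f p (0, z) := by
    intro c z
    have : ((0, c • z) : Spt) = c • ((0 : ℝ), z) := by simp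
    rw [this, map_smul, smul_eq_mul]
  have hadd : ∀ (z w : E3), fderiv ℝ f p (0, z + w) = fderiv ℝ f p (0, z) + fderiv ℝ f p (0, w) := by
    intro z w
    have : ((0, z + w) : Spt) = ((0 : ℝ), z) + ((0 : ℝ), w) := by simp
    rw [this, map_add]
  have hvL : vL B.D p = (1, (B.D ‖p.2‖ / 2) • radial p.2) := by
    refine Prod.ext ?_ rfl
    change B.D ‖p.2‖ / 2 * (2 / B.D ‖p.2‖) = 1
    field_simp
  have hR : der (vR B.D) f p
      = 2 / B.D ‖p.2‖ * fderiv ℝ f p (1, 0) + fderiv ℝ f p (0, radial p.2) := split _ _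
  have hsg : fderiv ℝ f p (0, spatialGrad f p) = ‖spatialGrad f p‖ ^ 2 := by
    rw [← inner_spatialGrad, real_inner_self_eq_norm_sq]
  simp only [nullDensity, stress, metric, fieldT, grad, hvL, fluxDensity]
  rw [split _ ((B.D ‖p.2‖ / 2) • radial p.2), split (fderiv ℝ f p (0, radial p.2)), hadd, hlin, hlin,
    hsg, hg, hR]
  simp only [inner_smul_right, inner_zero_left, inner_zero_right, hrr]
  field_simp
  ring

lemma FarNhd.fluxDensity (hW : B.FarNhd W) (hf : ContDiffOn ℝ ∞ f W) :
    ContinuousOn (fluxDensity B.D f) W := by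
  have hD := hW.continuousOn_D
  have h1 := (hW.der_vR hf).continuousOn
  have h2 := (hW.angSq hf).continuousOn
  have h3 : ContinuousOn (fun p : Spt => ‖p.2‖ ^ 2) W := by fun_prop
  exact (((h3.fun_mul (hD.fun_pow 2)).div_const 4).fun_mul (h1.fun_pow 2)).fun_add
    ((hD.div_const 4).fun_mul h2)

lemma fluxDensity_nonneg {p : Spt} (hp : B.R₀ < ‖p.2‖) (f : Spt → ℝ) :
    0 ≤ RpHierarchy.fluxDensity B.D f p := by
  have h1 := B.D_pos' hp
  have h2 := angSq_nonneg f p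
  unfold RpHierarchy.fluxDensity
  positivity

lemma nullInt_congr {u : ℝ} {I : Set ℝ} {F G : Spt → ℝ} (hI : MeasurableSet I)
    (h : ∀ r ∈ I, ∀ y : S2, F (B.bondiPt u r y) = G (B.bondiPt u r y)) :
    B.nullInt u I F = B.nullInt u I G :=
  setLIntegral_congr_fun hI fun r hr => lintegral_congr fun y => by rw [h r hr y]

/-- The flux through a part of a cone is bounded by the energy. -/
lemma nullInt_fluxDensity_le_energy {N : E3 → Spt} (hN : B.IsEnergyField N) {u : ℝ}
    (ha : B.R₀ < a) (f : Spt → ℝ) :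
    B.nullInt u (Icc a b) (RpHierarchy.fluxDensity B.D f) ≤ B.energy N u f := by
  have hNT : ∀ x : E3, B.R₀ ≤ ‖x‖ → N x = fieldT x := by
    rcases hN with rfl | h
    · exact fun _ _ => rfl
    · exact h.2.2.2
  have h1 : B.nullInt u (Icc a b) (RpHierarchy.fluxDensity B.D f)
      = B.nullInt u (Icc a b) (B.nullDensity N f) := by
    refine nullInt_congr measurableSet_Icc fun r hr y => ?_
    have hr0 := ha.trans_le hr.1
    have hn := norm_bondiPt (u := u) hr0 y
    rw [← nullDensity_fieldT]
    · simp only [nullDensity]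
      rw [hNT _ (by rw [hn]; exact hr0.le)]
    · rw [← norm_ne_zero_iff, hn]
      exact (B.R₀_pos.trans hr0).ne'
    · rw [hn]
      exact (B.D_pos' hr0).ne'
  rw [h1, energy]
  exact (nullInt_mono_set fun r hr => ha.trans_le hr.1).trans le_add_self

section Basic

variable (hW : B.FarNhd W) (hf : ContDiffOn ℝ ∞ f W) (hτ : TimeMeasure τ u₁ u₂) (ha : B.R₀ < a)
  (h1a : 1 ≤ a) (hD : ∀ r, a ≤ r → 1 / 2 ≤ B.D r)
include hW hf hτ ha hD

lemma farInt_angSq_le : B.farInt τ a b (RpHierarchy.angSq f)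
    ≤ 8 * B.farInt τ a b (RpHierarchy.fluxDensity B.D f) := by
  rw [← farInt_const_mul]
  refine farInt_mono hW (hW.angSq hf).continuousOn
    (continuousOn_const.fun_mul (hW.fluxDensity hf)) hτ ha fun u hu r hr y => ?_
  have hn := norm_bondiPt (u := u) (ha.trans_le hr.1) y
  have h1 := hD r hr.1
  have h2 := angSq_nonneg f (B.bondiPt u r y)
  simp only [RpHierarchy.fluxDensity, hn]
  have h3 : 0 ≤ r ^ 2 * B.D r ^ 2 / 4 * der (vR B.D) f (B.bondiPt u r y) ^ 2 := by positivity
  nlinarith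

include h1a in
lemma farInt_sq_der_vR_le : B.farInt τ a b (fun p => der (vR B.D) f p ^ 2)
    ≤ 16 * B.farInt τ a b (RpHierarchy.fluxDensity B.D f) := by
  rw [← farInt_const_mul]
  refine farInt_mono hW ((hW.der_vR hf).pow 2).continuousOn
    (continuousOn_const.fun_mul (hW.fluxDensity hf)) hτ ha fun u hu r hr y => ?_
  have hn := norm_bondiPt (u := u) (ha.trans_le hr.1) y
  have h1 := hD r hr.1
  have h2 := angSq_nonneg f (B.bondiPt u r y)
  simp only [RpHierarchy.fluxDensity, hn]
  have h3 : 0 ≤ B.D r / 4 * RpHierarchy.angSq f (B.bondiPt u r y) := by positivity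
  have h4 : 1 ≤ r ^ 2 := one_le_pow₀ (h1a.trans hr.1)
  have h5 : 1 / 4 ≤ B.D r ^ 2 := by nlinarith
  have h6 : 1 / 16 ≤ r ^ 2 * B.D r ^ 2 / 4 := by nlinarith
  have h7 := mul_le_mul_of_nonneg_right h6 (sq_nonneg (der (vR B.D) f (B.bondiPt u r y)))
  linarith

/-- The flux has no zeroth order term; for mean zero the Poincaré inequality supplies it from the
rotational derivatives. -/
lemma farInt_sq_le
    (hm : ∀ u r : ℝ, 0 ≤ u → B.R₀ < r → ∫ y : S2, f (B.bondiPt u r y) ∂dω = 0) :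
    B.farInt τ a b (fun p => f p ^ 2) ≤ 4 * B.farInt τ a b (RpHierarchy.fluxDensity B.D f) := by
  have h1 : B.farInt τ a b (fun p => 2 * f p ^ 2) ≤ B.farInt τ a b (RpHierarchy.angSq f) := by
    refine farInt_mono_of_sphere hW (continuousOn_const.fun_mul (hf.continuousOn.fun_pow 2))
      (hW.angSq hf).continuousOn hτ ha fun u hu r hr => ?_
    rw [integral_const_mul]
    exact poincare_ev hW hf (hτ.nonneg.trans hu.1) (ha.trans_le hr.1)
      (hm u r (hτ.nonneg.trans hu.1) (ha.trans_le hr.1))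
  rw [farInt_const_mul] at h1
  linarith [farInt_angSq_le hW hf hτ ha hD (b := b)]

include h1a

/-- `Φ = r²(f + r∂_rf)` is of first order in `f`, so a single flux controls it. Applied to `Tψ` and
`Ω_iψ` instead of `ψ`, it controls the corresponding derivatives of `Φ`. -/
lemma farInt_sq_Phi_le
    (hm : ∀ u r : ℝ, 0 ≤ u → B.R₀ < r → ∫ y : S2, f (B.bondiPt u r y) ∂dω = 0) :
    B.farInt τ a b (fun p => Phi B.D f p ^ 2)
      ≤ 40 * b ^ 6 * B.farInt τ a b (RpHierarchy.fluxDensity B.D f) := by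
  have h := farInt_le_linear (b := b) hW hτ ha ((hW.Phi hf).pow 2).continuousOn
    ![2 * b ^ 6, 2 * b ^ 6] ![fun p => f p ^ 2, fun p => der (vR B.D) f p ^ 2] ?_ ?_
  · simp only [Fin.sum_univ_two, Matrix.cons_val_zero, Matrix.cons_val_one] at h
    have h1 := farInt_sq_le hW hf hτ ha hD hm (b := b)
    have h2 := farInt_sq_der_vR_le hW hf hτ ha h1a hD (b := b)
    have h3 : 0 ≤ 2 * b ^ 6 := by positivity
    have h4 := mul_le_mul_of_nonneg_left h1 h3
    have h5 := mul_le_mul_of_nonneg_left h2 h3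
    linarith
  · simp only [Fin.forall_fin_two, Matrix.cons_val_zero, Matrix.cons_val_one]
    exact ⟨hf.continuousOn.fun_pow 2, (hW.der_vR hf).continuousOn.fun_pow 2⟩
  · intro u hu r hr y
    have hr0 := ha.trans_le hr.1
    have hn := norm_bondiPt (u := u) hr0 y
    have hp := hW.far_subset (bondiPt_mem_far (hτ.nonneg.trans hu.1) hr0 y)
    simp only [Fin.sum_univ_two, Matrix.cons_val_zero, Matrix.cons_val_one, Phi]
    rw [der_vR_radField hW hf hp, hn]
    generalize f (B.bondiPt u r y) = x
    generalize der (vR B.D) f (B.bondiPt u r y) = x'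
    have h1r := h1a.trans hr.1
    have h4 : r ^ 4 ≤ b ^ 6 := (pow_le_pow_right₀ h1r (by norm_num : 4 ≤ 6)).trans
      (pow_le_pow_left₀ (by linarith) hr.2 6)
    have h6 : r ^ 6 ≤ b ^ 6 := pow_le_pow_left₀ (by linarith) hr.2 6
    calc (r ^ 2 * (x + r * x')) ^ 2 ≤ 2 * r ^ 4 * x ^ 2 + 2 * r ^ 6 * x' ^ 2 := by
          nlinarith [sq_nonneg (r ^ 2 * x - r ^ 3 * x')]
      _ ≤ 2 * b ^ 6 * x ^ 2 + 2 * b ^ 6 * x' ^ 2 := by gcongr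

lemma farInt_sq_radField_le
    (hm : ∀ u r : ℝ, 0 ≤ u → B.R₀ < r → ∫ y : S2, f (B.bondiPt u r y) ∂dω = 0) :
    B.farInt τ a b (fun p => radField f p ^ 2)
      ≤ 4 * b ^ 2 * B.farInt τ a b (RpHierarchy.fluxDensity B.D f) := by
  have h := farInt_mono (b := b) hW ((hW.radField hf).pow 2).continuousOn
    (continuousOn_const (c := b ^ 2) |>.fun_mul (hf.continuousOn.fun_pow 2)) hτ ha
    fun u hu r hr y => by
      have hn := norm_bondiPt (u := u) (ha.trans_le hr.1) y
      simp only [radField, hn, mul_pow]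
      have : r ^ 2 ≤ b ^ 2 := pow_le_pow_left₀ (by linarith [hr.1]) hr.2 2
      gcongr
  rw [farInt_const_mul] at h
  have h1 := mul_le_mul_of_nonneg_left (farInt_sq_le hW hf hτ ha hD hm (b := b)) (sq_nonneg b)
  linarith

lemma farInt_angSq_radField_le : B.farInt τ a b (RpHierarchy.angSq (radField f))
      ≤ 8 * b ^ 2 * B.farInt τ a b (RpHierarchy.fluxDensity B.D f) := by
  have h := farInt_mono (b := b) hW (hW.angSq (hW.radField hf)).continuousOn
    (continuousOn_const (c := b ^ 2) |>.fun_mul (hW.angSq hf).continuousOn) hτ ha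
    fun u hu r hr y => by
      have hr0 := ha.trans_le hr.1
      have hn := norm_bondiPt (u := u) hr0 y
      have hp := hW.far_subset (bondiPt_mem_far (hτ.nonneg.trans hu.1) hr0 y)
      simp only [RpHierarchy.angSq, der_vΩ_radField hW hf hp, hn, mul_pow, Finset.mul_sum]
      have : r ^ 2 ≤ b ^ 2 := pow_le_pow_left₀ (by linarith [hr.1]) hr.2 2
      gcongr
  rw [farInt_const_mul] at h
  have h1 := mul_le_mul_of_nonneg_left (farInt_angSq_le hW hf hτ ha hD (b := b)) (sq_nonneg b)
  linarith

end Basic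

/-- `T` commutes with `r` and with `∂_r`. A `T`-derivative of `Φ` is thus the `Φ` of `Tψ`, and no
further derivative has to be estimated. -/
lemma der_vT_Phi_eq (hW : B.FarNhd W) (hψ : ContDiffOn ℝ ∞ ψ W) {p : Spt} (hp : p ∈ W) :
    der vT (Phi B.D ψ) p = Phi B.D (der vT ψ) p := by
  rw [der_vT_Phi hW hψ hp, Phi, hW.comm_TR (hW.radField hψ) hp]
  congr 1
  exact hW.der_congr (fun q hq => der_vT_radField hW hψ hq) hp

lemma der_vΩ_Phi_eq (hW : B.FarNhd W) (hψ : ContDiffOn ℝ ∞ ψ W) {p : Spt} (hp : p ∈ W)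
    (i : Fin 3) : der (vΩ i) (Phi B.D ψ) p = Phi B.D (der (vΩ i) ψ) p := by
  have h1 : der (vΩ i) (Phi B.D ψ) p = ‖p.2‖ ^ 2 * der (vΩ i) (der (vR B.D) (radField ψ)) p :=
    der_vΩ_radial_mul (a := fun r => r ^ 2) (hW.ne_zero hp) (hasDerivAt_pow 2 ‖p.2‖)
      (hW.differentiableAt (hW.der_vR (hW.radField hψ)) hp) i
  rw [h1, Phi, hW.comm_ΩR (hW.radField hψ) hp i]
  congr 1
  exact hW.der_congr (fun q hq => der_vΩ_radField hW hψ hq i) hp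

end Background

end RpHierarchy

/-! ### The elliptic estimate along a cone. -/

namespace RpHierarchy

/-- A bump function of `r`, divided by `r`: it is `1 / r` on `[R - 1, R]` and vanishes outside
`[R - 2, R + 1]`. -/
def bump (R r : ℝ) : ℝ :=
  Real.smoothTransition (r - (R - 2)) * Real.smoothTransition (R + 1 - r) * r⁻¹

lemma contDiffOn_bump (R : ℝ) {R₀ : ℝ} (h : 0 < R₀) : ContDiffOn ℝ ∞ (bump R) (Ioi R₀) :=
  ((Real.smoothTransition.contDiff.comp (contDiff_id.sub contDiff_const)).mul
    (Real.smoothTransition.contDiff.comp (contDiff_const.sub contDiff_id))).contDiffOn.mul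
    (contDiffOn_id.inv fun _ hr => (h.trans hr).ne')

lemma bump_left (R : ℝ) : bump R (R - 2) = 0 := by
  rw [bump, Real.smoothTransition.zero_of_nonpos (by simp), zero_mul, zero_mul]

lemma bump_right (R : ℝ) : bump R (R + 1) = 0 := by
  rw [bump, Real.smoothTransition.zero_of_nonpos (x := R + 1 - (R + 1)) (by simp), mul_zero,
    zero_mul]

lemma bump_of_mem {R r : ℝ} (h : r ∈ Icc (R - 1) R) : bump R r = r⁻¹ := by
  rw [bump, Real.smoothTransition.one_of_one_le (by linarith [h.1]),
    Real.smoothTransition.one_of_one_le (by linarith [h.2])]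
  simp

lemma sq_mul_bump_le {R r : ℝ} (hr : 0 < r) : (r * bump R r) ^ 2 ≤ 1 := by
  have h : r * bump R r
      = Real.smoothTransition (r - (R - 2)) * Real.smoothTransition (R + 1 - r) := by
    rw [bump]; field_simp
  rw [h]
  exact pow_le_one₀ (mul_nonneg (Real.smoothTransition.nonneg _) (Real.smoothTransition.nonneg _))
    (mul_le_one₀ (Real.smoothTransition.le_one _) (Real.smoothTransition.nonneg _)
      (Real.smoothTransition.le_one _))

lemma exists_deriv_bump_le {R R₀ : ℝ} (h : 0 < R₀) (hR : R₀ < R - 2) :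
    ∃ c : ℝ, 0 < c ∧ ∀ r ∈ Icc (R - 2) (R + 1), deriv (bump R) r ^ 2 ≤ c := by
  have h1 : ContinuousOn (deriv (bump R)) (Ioi R₀) :=
    ((contDiffOn_infty_iff_deriv_of_isOpen isOpen_Ioi).mp (contDiffOn_bump R h)).2.continuousOn
  obtain ⟨c, hc⟩ := isCompact_Icc.exists_bound_of_continuousOn
    (h1.mono fun r (hr : r ∈ Icc (R - 2) (R + 1)) => hR.trans_le hr.1)
  refine ⟨max c 1 ^ 2, by positivity, fun r hr => ?_⟩
  rw [← sq_abs]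
  exact pow_le_pow_left₀ (abs_nonneg _) ((hc r hr).trans (le_max_left _ _)) 2

namespace Background

variable {B : Background} {W : Set Spt} {ψ φ : Spt → ℝ} {u R K : ℝ}

/-- `D ∂_r φ`. -/
def flow (B : Background) (φ : Spt → ℝ) (p : Spt) : ℝ := B.D ‖p.2‖ * der (vR B.D) φ p

lemma FarNhd.flow (hW : B.FarNhd W) (hφ : ContDiffOn ℝ ∞ φ W) : ContDiffOn ℝ ∞ (B.flow φ) W :=
  hW.radial_mul (hW.der_vR hφ) B.contDiffOn_D

lemma der_vΩ_der_vR_flow (hW : B.FarNhd W) (hφ : ContDiffOn ℝ ∞ φ W) {p : Spt} (hp : p ∈ W)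
    (i : Fin 3) : der (vΩ i) (der (vR B.D) (B.flow φ)) p
      = der (vR B.D) (B.flow (der (vΩ i) φ)) p := by
  rw [hW.comm_ΩR (hW.flow hφ) hp i]
  refine hW.der_congr (fun q hq => ?_) hp
  have h := der_vΩ_radial_mul (hW.ne_zero hq) (B.hasDerivAt_D (B.rmin_lt.trans (hW.lt q hq)))
    (hW.differentiableAt (hW.der_vR hφ) hq) i
  refine h.trans ?_
  rw [hW.comm_ΩR hφ hq i]
  rfl

/-- The elliptic estimate for `∂_r (D ∂_r φ) + r⁻² Δ φ` with a bump function. -/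
lemma elliptic (hW : B.FarNhd W) (hφ : ContDiffOn ℝ ∞ φ W) (hu : 0 ≤ u) (hR : B.R₀ < R - 2)
    {c : ℝ} (hc : ∀ r ∈ Icc (R - 2) (R + 1), deriv (bump R) r ^ 2 ≤ c)
    (hD2 : ∀ r, R - 2 ≤ r → B.D r ≤ 2) :
    B.farInt (Measure.dirac u) (R - 2) (R + 1)
        (fun p => (‖p.2‖ * bump R ‖p.2‖) ^ 2 * der (vR B.D) (B.flow φ) p ^ 2)
      ≤ B.farInt (Measure.dirac u) (R - 2) (R + 1)
          (fun p => (der (vR B.D) (B.flow φ) p + (‖p.2‖ ^ 2)⁻¹ * sphLap φ p) ^ 2)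
        + 4 * c * B.farInt (Measure.dirac u) (R - 2) (R + 1) (angSq φ) := by
  have hτ := timeMeasure_dirac hu
  have hR3 : R - 2 ≤ R + 1 := by linarith
  have hP := hW.der_vR (hW.flow hφ)
  have hY := fun i => hW.der_vΩ hφ i
  have hG := fun i => hW.flow (hY i)
  have hb := contDiffOn_bump R B.R₀_pos
  have hb2 : ContDiffOn ℝ ∞ (fun r => 2 * bump R r ^ 2) (Ioi B.R₀) := contDiffOn_const.mul (hb.pow 2)
  have w1 := fun i => hW.radial_mul (hP.mul (hY i)) hb2
  have w2 := fun i => hW.radial_mul ((hG i).mul (hY i)) hb2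
  have cb : ContinuousOn (fun p : Spt => ‖p.2‖ * bump R ‖p.2‖) W :=
    ContinuousOn.mul (by fun_prop) (hW.continuousOn_radial hb.continuousOn)
  have cinv : ContinuousOn (fun p : Spt => (‖p.2‖ ^ 2)⁻¹) W :=
    ContinuousOn.inv₀ (by fun_prop) fun p hp => pow_ne_zero 2 (norm_ne_zero_iff.mpr (hW.ne_zero hp))
  -- With `P = ∂_r(D∂_rφ)` and `β` the bump, the square `(rβ)²(P + r⁻²Δ̸φ)²` has the cross term
  -- `2β²PΔ̸φ`. Integrating by parts over the spheres and then in `r` turns it into `2β²D(∂_rΩφ)² ≥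
  -- 0` plus a term with `ββ'`. The factor `1/r` in `bump` cancels the powers of `r` here, so that
  -- no derivative of a power of `r` occurs separately.
  have key := farInt_le_linear (b := R + 1) hW hτ hR
    ((cb.fun_pow 2).fun_mul (hP.continuousOn.fun_pow 2))
    ![1, -1, -1, -1, 1, 1, 1, 4 * c]
    ![fun p => (der (vR B.D) (B.flow φ) p + (‖p.2‖ ^ 2)⁻¹ * RpHierarchy.sphLap φ p) ^ 2,
      der (vΩ 0) (fun q => 2 * bump R ‖q.2‖ ^ 2 * (der (vR B.D) (B.flow φ) q * der (vΩ 0) φ q)),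
      der (vΩ 1) (fun q => 2 * bump R ‖q.2‖ ^ 2 * (der (vR B.D) (B.flow φ) q * der (vΩ 1) φ q)),
      der (vΩ 2) (fun q => 2 * bump R ‖q.2‖ ^ 2 * (der (vR B.D) (B.flow φ) q * der (vΩ 2) φ q)),
      der (vR B.D) (fun q => 2 * bump R ‖q.2‖ ^ 2 * (B.flow (der (vΩ 0) φ) q * der (vΩ 0) φ q)),
      der (vR B.D) (fun q => 2 * bump R ‖q.2‖ ^ 2 * (B.flow (der (vΩ 1) φ) q * der (vΩ 1) φ q)),
      der (vR B.D) (fun q => 2 * bump R ‖q.2‖ ^ 2 * (B.flow (der (vΩ 2) φ) q * der (vΩ 2) φ q)),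
      RpHierarchy.angSq φ] ?_ ?_
  · simp only [Fin.sum_univ_succ, Matrix.cons_val_zero, Matrix.cons_val_succ, Finset.univ_eq_empty,
      Finset.sum_empty] at key
    have z : ∀ i, B.farInt (Measure.dirac u) (R - 2) (R + 1) (der (vR B.D)
        (fun q => 2 * bump R ‖q.2‖ ^ 2 * (B.flow (der (vΩ i) φ) q * der (vΩ i) φ q))) = 0 := by
      intro i
      refine farInt_vR hW (w2 i) hτ hR hR3 (fun u hu y => ?_) fun u hu y => ?_
      · simp only [norm_bondiPt hR, bump_left]; ring
      · simp only [norm_bondiPt (hR.trans_le hR3), bump_right]; ring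
    rw [z, z, z, farInt_vΩ hW (w1 0) hτ hR, farInt_vΩ hW (w1 1) hτ hR,
      farInt_vΩ hW (w1 2) hτ hR] at key
    linarith
  · simp only [Fin.forall_fin_succ, Matrix.cons_val_zero, Matrix.cons_val_succ]
    refine ⟨(hP.continuousOn.fun_add (cinv.fun_mul (hW.sphLap hφ).continuousOn)).fun_pow 2,
      (hW.der_vΩ (w1 0) 0).continuousOn, (hW.der_vΩ (w1 1) 1).continuousOn,
      (hW.der_vΩ (w1 2) 2).continuousOn, (hW.der_vR (w2 0)).continuousOn,
      (hW.der_vR (w2 1)).continuousOn, (hW.der_vR (w2 2)).continuousOn,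
      (hW.angSq hφ).continuousOn, fun i => i.elim0⟩
  · intro v hv r hr y
    have hv0 : 0 ≤ v := hu.trans hv.1
    have hr0 := hR.trans_le hr.1
    have hrp := B.R₀_pos.trans hr0
    have hp := hW.far_subset (bondiPt_mem_far hv0 hr0 y)
    have hne := hW.ne_zero hp
    have hn := norm_bondiPt (u := v) hr0 y
    have a0 : HasDerivAt (bump R) (deriv (bump R) r) r :=
      ((hb.contDiffAt (Ioi_mem_nhds hr0)).differentiableAt (by simp)).hasDerivAt
    have a1 : HasDerivAt (fun r => 2 * bump R r ^ 2) (4 * (bump R r * deriv (bump R) r)) r := by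
      refine ((a0.fun_pow 2).const_mul 2).congr_deriv ?_
      norm_num
      ring
    rw [← hn] at a1
    have dP := hW.differentiableAt hP hp
    have dY := fun i => hW.differentiableAt (hY i) hp
    have dG := fun i => hW.differentiableAt (hG i) hp
    have e1 : ∀ i, der (vΩ i)
        (fun q => 2 * bump R ‖q.2‖ ^ 2 * (der (vR B.D) (B.flow φ) q * der (vΩ i) φ q))
        (B.bondiPt v r y) = 2 * bump R r ^ 2 *
        (der (vR B.D) (B.flow (der (vΩ i) φ)) (B.bondiPt v r y) * der (vΩ i) φ (B.bondiPt v r y)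
          + der (vR B.D) (B.flow φ) (B.bondiPt v r y)
            * der (vΩ i) (der (vΩ i) φ) (B.bondiPt v r y)) := by
      intro i
      rw [der_vΩ_radial_mul (a := fun r => 2 * bump R r ^ 2) hne a1 (dP.fun_mul (dY i)),
        der_mul dP (dY i), der_vΩ_der_vR_flow hW hφ hp i]
      simp only [hn]
    have e2 : ∀ i, der (vR B.D)
        (fun q => 2 * bump R ‖q.2‖ ^ 2 * (B.flow (der (vΩ i) φ) q * der (vΩ i) φ q))
        (B.bondiPt v r y) = 4 * (bump R r * deriv (bump R) r)
            * (B.D r * der (vR B.D) (der (vΩ i) φ) (B.bondiPt v r y) * der (vΩ i) φ (B.bondiPt v r y))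
          + 2 * bump R r ^ 2 *
        (der (vR B.D) (B.flow (der (vΩ i) φ)) (B.bondiPt v r y) * der (vΩ i) φ (B.bondiPt v r y)
          + B.D r * der (vR B.D) (der (vΩ i) φ) (B.bondiPt v r y) ^ 2) := by
      intro i
      rw [der_vR_radial_mul (a := fun r => 2 * bump R r ^ 2) hne a1 ((dG i).fun_mul (dY i)),
        der_mul (dG i) (dY i)]
      simp only [hn, Background.flow]
      ring
    simp only [Fin.sum_univ_succ, Matrix.cons_val_zero, Matrix.cons_val_succ, Finset.univ_eq_empty,
      Finset.sum_empty]
    simp only [Fin.succ_zero_eq_one, Fin.succ_one_eq_two, e1, e2, RpHierarchy.sphLap,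
      RpHierarchy.angSq, Fin.sum_univ_three, hn]
    -- Completing the square: the `ββ'` term is compensated by the good term up to `2D β'²(Ω_iφ)²`,
    -- which is at most `4c(Ω_iφ)²` since `D ≤ 2`.
    have hsq : ∀ i, 0 ≤ 4 * c * der (vΩ i) φ (B.bondiPt v r y) ^ 2
        + 4 * (bump R r * deriv (bump R) r)
            * (B.D r * der (vR B.D) (der (vΩ i) φ) (B.bondiPt v r y) * der (vΩ i) φ (B.bondiPt v r y))
        + 2 * bump R r ^ 2 * (B.D r * der (vR B.D) (der (vΩ i) φ) (B.bondiPt v r y) ^ 2) := by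
      intro i
      have hDp := B.D_pos' hr0
      generalize der (vR B.D) (der (vΩ i) φ) (B.bondiPt v r y) = X
      generalize der (vΩ i) φ (B.bondiPt v r y) = Y
      have h1 : 0 ≤ 2 * B.D r * (bump R r * X + deriv (bump R) r * Y) ^ 2 := by positivity
      have h2 : 2 * B.D r * deriv (bump R) r ^ 2 * Y ^ 2 ≤ 4 * c * Y ^ 2 := by
        refine mul_le_mul_of_nonneg_right ?_ (sq_nonneg Y)
        have := hc r hr
        have h3 : B.D r * deriv (bump R) r ^ 2 ≤ 2 * c :=
          mul_le_mul (hD2 r hr.1) this (sq_nonneg _) (by norm_num)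
        linarith
      nlinarith
    have h0 := hsq 0
    have h1 := hsq 1
    have h2 := hsq 2
    have hθ := sq_mul_bump_le (R := R) hrp
    generalize der (vR B.D) (B.flow φ) (B.bondiPt v r y) = P at *
    generalize der (vΩ 0) (der (vΩ 0) φ) (B.bondiPt v r y) = l0 at *
    generalize der (vΩ 1) (der (vΩ 1) φ) (B.bondiPt v r y) = l1 at *
    generalize der (vΩ 2) (der (vΩ 2) φ) (B.bondiPt v r y) = l2 at *
    generalize bump R r = β at *
    have h3 : (r * β) ^ 2 * (P + (r ^ 2)⁻¹ * (l0 + l1 + l2)) ^ 2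
        ≤ 1 * (P + (r ^ 2)⁻¹ * (l0 + l1 + l2)) ^ 2 :=
      mul_le_mul_of_nonneg_right hθ (sq_nonneg _)
    have h4 : (r * β) ^ 2 * (P + (r ^ 2)⁻¹ * (l0 + l1 + l2)) ^ 2
        = (r * β) ^ 2 * P ^ 2 + 2 * β ^ 2 * (P * (l0 + l1 + l2))
          + (β * r⁻¹ * (l0 + l1 + l2)) ^ 2 := by
      field_simp
      ring
    have h5 := sq_nonneg (β * r⁻¹ * (l0 + l1 + l2))
    linarith

set_option maxHeartbeats 1600000 in
/-- The estimate for `∂_r Φ` in a slab of a cone, by the energies of `ψ` and `T ψ`. -/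
lemma slab_der_vR_Phi_le (hW : B.FarNhd W) (hψ : ContDiffOn ℝ ∞ ψ W)
    (hbox : ∀ p ∈ B.far, box B.D ψ p = 0)
    (hm : ∀ u r : ℝ, 0 ≤ u → B.R₀ < r → ∫ y : S2, ψ (B.bondiPt u r y) ∂dω = 0)
    (hu : 0 ≤ u) (hR : B.R₀ < R - 2) (h1R : 1 ≤ R - 2) {c : ℝ} (hc0 : 0 < c)
    (hc : ∀ r ∈ Icc (R - 2) (R + 1), deriv (bump R) r ^ 2 ≤ c)
    (hD1 : ∀ r, R - 2 ≤ r → 1 / 2 ≤ B.D r) (hD2 : ∀ r, R - 2 ≤ r → B.D r ≤ 2)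
    (hD' : ∀ r, R - 2 ≤ r → |deriv B.D r| ≤ K) :
    B.farInt (Measure.dirac u) (R - 1) R (fun p => der (vR B.D) (Phi B.D ψ) p ^ 2)
      ≤ 5000 * (1 + K ^ 2) * (1 + c) * (R + 1) ^ 10
        * (B.farInt (Measure.dirac u) (R - 2) (R + 1) (fluxDensity B.D ψ)
          + B.farInt (Measure.dirac u) (R - 2) (R + 1) (fluxDensity B.D (der vT ψ))) := by
  have hτ := timeMeasure_dirac hu
  have hφ := hW.radField hψ
  have hT := hW.der_vT hψ
  have hmT : ∀ u r : ℝ, 0 ≤ u → B.R₀ < r → ∫ y : S2, der vT ψ (B.bondiPt u r y) ∂dω = 0 :=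
    fun u r hu hr => integral_vT_eq_zero hW hψ hm hu hr
  have hP := hW.der_vR (hW.flow hφ)
  have hΦ := hW.Phi hψ
  have cinv : ContinuousOn (fun p : Spt => (‖p.2‖ ^ 2)⁻¹) W :=
    ContinuousOn.inv₀ (by fun_prop) fun p hp => pow_ne_zero 2 (norm_ne_zero_iff.mpr (hW.ne_zero hp))
  -- The flux of `ψ` contains only one `r`-derivative, whereas `∂_rΦ` contains two. The missing one
  -- is obtained on the single cone by treating the wave equation there as an elliptic equation for
  -- `φ`; the bump has to extend beyond `[R-1, R]`, which explains the larger interval `[R-2, R+1]`.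
  have E := elliptic hW hφ hu hR hc hD2
  have A1 := farInt_sq_Phi_le hW hψ hτ hR h1R hD1 hm (b := R + 1)
  have A2 := farInt_sq_Phi_le hW hT hτ hR h1R hD1 hmT (b := R + 1)
  have A3 := farInt_sq_radField_le hW hψ hτ hR h1R hD1 hm (b := R + 1)
  have A4 := farInt_angSq_radField_le hW hψ hτ hR h1R hD1 (b := R + 1)
  have hR1 : B.R₀ < R - 1 := by linarith
  have hsub : Icc (R - 1) R ⊆ Icc (R - 2) (R + 1) := Icc_subset_Icc (by linarith) (by linarith)
  -- the flow form of the second derivative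
  have hflow : ∀ p ∈ W, der (vR B.D) (B.flow (radField ψ)) p
      = deriv B.D ‖p.2‖ * der (vR B.D) (radField ψ) p
        + B.D ‖p.2‖ * der (vR B.D) (der (vR B.D) (radField ψ)) p := fun p hp =>
    der_vR_radial_mul (hW.ne_zero hp) (B.hasDerivAt_D (B.rmin_lt.trans (hW.lt p hp)))
      (hW.differentiableAt (hW.der_vR hφ) hp) B.D
  -- By the wave equation the elliptic operator applied to `φ` equals `2r⁻²Φ[Tψ] + (D'/r)φ`, where
  -- `Φ[Tψ]` is controlled by the flux of `Tψ`.
  have E1 := farInt_le_linear (b := R + 1) hW hτ hR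
    ((hP.continuousOn.fun_add (cinv.fun_mul (hW.sphLap hφ).continuousOn)).fun_pow 2)
    ![8, 2 * K ^ 2] ![fun p => Phi B.D (der vT ψ) p ^ 2, fun p => radField ψ p ^ 2]
    (by
      simp only [Fin.forall_fin_two, Matrix.cons_val_zero, Matrix.cons_val_one]
      exact ⟨(hW.Phi hT).continuousOn.fun_pow 2, hφ.continuousOn.fun_pow 2⟩)
    (fun v hv r hr y => by
      have hv0 : 0 ≤ v := hu.trans hv.1
      have hr0 := hR.trans_le hr.1
      have hrp := B.R₀_pos.trans hr0
      have hf := bondiPt_mem_far hv0 hr0 y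
      have hp := hW.far_subset hf
      have hn := norm_bondiPt (u := v) hr0 y
      have h1 := wave_radField hW hψ hp (hbox _ hf)
      have h2 := hflow _ hp
      have h3 : der vT (der (vR B.D) (radField ψ)) (B.bondiPt v r y)
          = (r ^ 2)⁻¹ * Phi B.D (der vT ψ) (B.bondiPt v r y) := by
        rw [← der_vT_Phi_eq hW hψ hp, der_vT_Phi hW hψ hp, hn]
        field_simp
      simp only [Fin.sum_univ_two, Matrix.cons_val_zero, Matrix.cons_val_one]
      rw [h3] at h1
      rw [hn] at h1 h2 ⊢
      have h4 : der (vR B.D) (B.flow (radField ψ)) (B.bondiPt v r y)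
          + (r ^ 2)⁻¹ * RpHierarchy.sphLap (radField ψ) (B.bondiPt v r y)
          = 2 * ((r ^ 2)⁻¹ * Phi B.D (der vT ψ) (B.bondiPt v r y))
            + deriv B.D r / r * radField ψ (B.bondiPt v r y) := by linarith
      rw [h4]
      have h1r : 1 ≤ r := h1R.trans hr.1
      have h5 : ((r ^ 2)⁻¹) ^ 2 ≤ 1 :=
        pow_le_one₀ (by positivity) (inv_le_one_of_one_le₀ (one_le_pow₀ h1r))
      have h6 : (deriv B.D r / r) ^ 2 ≤ K ^ 2 := by
        rw [← sq_abs]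
        refine pow_le_pow_left₀ (abs_nonneg _) ?_ 2
        rw [abs_div, abs_of_pos hrp]
        exact (div_le_self (abs_nonneg _) h1r).trans (hD' r hr.1)
      have h7 := mul_le_mul_of_nonneg_right h5 (sq_nonneg (Phi B.D (der vT ψ) (B.bondiPt v r y)))
      have h8 := mul_le_mul_of_nonneg_right h6 (sq_nonneg (radField ψ (B.bondiPt v r y)))
      generalize Phi B.D (der vT ψ) (B.bondiPt v r y) = X at *
      generalize radField ψ (B.bondiPt v r y) = Y at *
      nlinarith [sq_nonneg (2 * ((r ^ 2)⁻¹ * X) - deriv B.D r / r * Y)])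
  simp only [Fin.sum_univ_two, Matrix.cons_val_zero, Matrix.cons_val_one] at E1
  have cθ : ContinuousOn (fun p : Spt => (‖p.2‖ * bump R ‖p.2‖) ^ 2
      * der (vR B.D) (B.flow (radField ψ)) p ^ 2) W :=
    (ContinuousOn.fun_pow (ContinuousOn.fun_mul (by fun_prop)
      (hW.continuousOn_radial (contDiffOn_bump R B.R₀_pos).continuousOn)) 2).fun_mul
      (hP.continuousOn.fun_pow 2)
  have M1 := farInt_mono_set hW cθ hτ hR hsub
    fun v hv r hr y => mul_nonneg (sq_nonneg _) (sq_nonneg _)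
  have M2 := farInt_mono_set hW (hΦ.continuousOn.fun_pow 2) hτ hR hsub fun v hv r hr y => sq_nonneg _
  -- On `[R-1, R]` the cutoff `r · bump` is `1`. There `∂_rΦ = 2r∂_rφ + r²∂_r²φ` is recovered from
  -- `∂_r(D∂_rφ)` and `Φ` by dividing by `D ≥ 1/2`.
  have F := farInt_le_linear (b := R) hW hτ hR1 ((hW.der_vR hΦ).continuousOn.fun_pow 2)
    ![12 + 12 * K ^ 2, 12 * (R + 1) ^ 4]
    ![fun p => Phi B.D ψ p ^ 2, fun p => (‖p.2‖ * bump R ‖p.2‖) ^ 2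
      * der (vR B.D) (B.flow (radField ψ)) p ^ 2]
    (by
      simp only [Fin.forall_fin_two, Matrix.cons_val_zero, Matrix.cons_val_one]
      exact ⟨hΦ.continuousOn.fun_pow 2, cθ⟩)
    (fun v hv r hr y => by
      have hv0 : 0 ≤ v := hu.trans hv.1
      have hr0 := hR1.trans_le hr.1
      have hrp := B.R₀_pos.trans hr0
      have hp := hW.far_subset (bondiPt_mem_far hv0 hr0 y)
      have hn := norm_bondiPt (u := v) hr0 y
      have h2 := hflow _ hp
      simp only [Fin.sum_univ_two, Matrix.cons_val_zero, Matrix.cons_val_one]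
      rw [der_vR_Phi hW hψ hp, der_vR_radField_eq hW hp] at *
      rw [hn] at h2 ⊢
      have hr2 : R - 2 ≤ r := by linarith [hr.1]
      rw [bump_of_mem hr, mul_inv_cancel₀ hrp.ne', one_pow, one_mul]
      have h1r : 1 ≤ r := h1R.trans hr2
      have hDl := hD1 r hr2
      have hD0 : B.D r ≠ 0 := by linarith
      generalize der (vR B.D) (B.flow (radField ψ)) (B.bondiPt v r y) = P at *
      generalize der (vR B.D) (der (vR B.D) (radField ψ)) (B.bondiPt v r y) = Q at *
      generalize Phi B.D ψ (B.bondiPt v r y) = X at *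
      have h3 : r ^ 2 * Q = r ^ 2 * (B.D r)⁻¹ * P - deriv B.D r * (B.D r)⁻¹ * X := by
        rw [h2]; field_simp; ring
      have h4 : 2 * r * ((r ^ 2)⁻¹ * X) = 2 * r⁻¹ * X := by field_simp
      rw [h3, h4]
      have hDi : (B.D r)⁻¹ ≤ 2 := by
        rw [inv_le_comm₀ (by linarith) (by norm_num)]; linarith
      have hDi0 : 0 ≤ (B.D r)⁻¹ := inv_nonneg.mpr (by linarith)
      have b1 : (r⁻¹) ^ 2 ≤ 1 := pow_le_one₀ (by positivity) (inv_le_one_of_one_le₀ h1r)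
      have b2 : (r ^ 2 * (B.D r)⁻¹) ^ 2 ≤ ((R + 1) ^ 2 * 2) ^ 2 := by
        refine pow_le_pow_left₀ (by positivity) (mul_le_mul ?_ hDi hDi0 (by positivity)) 2
        exact pow_le_pow_left₀ hrp.le (by linarith [hr.2]) 2
      have b3 : (deriv B.D r * (B.D r)⁻¹) ^ 2 ≤ (K * 2) ^ 2 := by
        rw [← sq_abs, abs_mul, abs_of_nonneg hDi0]
        exact pow_le_pow_left₀ (by positivity) (mul_le_mul (hD' r hr2) hDi hDi0
          ((abs_nonneg _).trans (hD' r hr2))) 2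
      have c1 := mul_le_mul_of_nonneg_right b1 (sq_nonneg X)
      have c2 := mul_le_mul_of_nonneg_right b2 (sq_nonneg P)
      have c3 := mul_le_mul_of_nonneg_right b3 (sq_nonneg X)
      generalize r ^ 2 * (B.D r)⁻¹ = A at *
      generalize deriv B.D r * (B.D r)⁻¹ = E at *
      generalize r⁻¹ = I at *
      have d1 : (2 * I * X + (A * P - E * X)) ^ 2
          ≤ 3 * (4 * (I ^ 2 * X ^ 2) + A ^ 2 * P ^ 2 + E ^ 2 * X ^ 2) := by
        nlinarith [sq_nonneg (2 * I * X - A * P), sq_nonneg (2 * I * X + E * X),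
          sq_nonneg (A * P + E * X)]
      nlinarith)
  simp only [Fin.sum_univ_two, Matrix.cons_val_zero, Matrix.cons_val_one] at F
  have nn : ∀ f, 0 ≤ B.farInt (Measure.dirac u) (R - 2) (R + 1) (fluxDensity B.D f) := fun f =>
    farInt_nonneg hτ fun v hv r hr y => fluxDensity_nonneg
      (by rw [norm_bondiPt (hR.trans_le hr.1)]; exact hR.trans_le hr.1) f
  have n1 := nn ψ
  have n2 := nn (der vT ψ)
  generalize B.farInt (Measure.dirac u) (R - 2) (R + 1) (fluxDensity B.D ψ) = e1 at *
  generalize B.farInt (Measure.dirac u) (R - 2) (R + 1) (fluxDensity B.D (der vT ψ)) = e2 at *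
  generalize B.farInt (Measure.dirac u) (R - 1) R
    (fun p => der (vR B.D) (Phi B.D ψ) p ^ 2) = Y at *
  set ρ := R + 1 with hρ
  have hρ1 : 1 ≤ ρ := by linarith
  have p2 : ρ ^ 2 ≤ ρ ^ 6 := pow_le_pow_right₀ hρ1 (by norm_num)
  have p6 : ρ ^ 6 ≤ ρ ^ 10 := pow_le_pow_right₀ hρ1 (by norm_num)
  have k1 : 2 * K ^ 2 * B.farInt (Measure.dirac u) (R - 2) ρ (fun p => radField ψ p ^ 2)
      ≤ 2 * K ^ 2 * (4 * ρ ^ 6 * e1) :=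
    mul_le_mul_of_nonneg_left (A3.trans (by gcongr)) (by positivity)
  have k2 : 4 * c * B.farInt (Measure.dirac u) (R - 2) ρ (angSq (radField ψ))
      ≤ 4 * c * (8 * ρ ^ 6 * e1) :=
    mul_le_mul_of_nonneg_left (A4.trans (by gcongr)) (by positivity)
  have k3 : B.farInt (Measure.dirac u) (R - 1) R (fun p => (‖p.2‖ * bump R ‖p.2‖) ^ 2
      * der (vR B.D) (B.flow (radField ψ)) p ^ 2)
      ≤ ρ ^ 6 * (320 * e2 + (8 * K ^ 2 + 32 * c) * e1) := by linarith
  have k4 := mul_le_mul_of_nonneg_left k3 (by positivity : 0 ≤ 12 * ρ ^ 4)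
  have k5 := mul_le_mul_of_nonneg_left (M2.trans A1) (by positivity : 0 ≤ 12 + 12 * K ^ 2)
  have k6 : (12 + 12 * K ^ 2) * (40 * ρ ^ 6 * e1) ≤ (12 + 12 * K ^ 2) * (40 * ρ ^ 10 * e1) := by
    gcongr
  have k7 : Y ≤ ρ ^ 10 * ((480 * (1 + K ^ 2) + 96 * K ^ 2 + 384 * c) * e1 + 3840 * e2) := by
    have : 12 * ρ ^ 4 * (ρ ^ 6 * (320 * e2 + (8 * K ^ 2 + 32 * c) * e1))
        = ρ ^ 10 * ((96 * K ^ 2 + 384 * c) * e1 + 3840 * e2) := by ring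
    linarith
  refine k7.trans ?_
  have k8 : (480 * (1 + K ^ 2) + 96 * K ^ 2 + 384 * c) * e1 + 3840 * e2
      ≤ 5000 * (1 + K ^ 2) * (1 + c) * (e1 + e2) := by
    have q1 : 480 * (1 + K ^ 2) + 96 * K ^ 2 + 384 * c ≤ 5000 * (1 + K ^ 2) * (1 + c) := by
      have : 0 ≤ K ^ 2 * c := by positivity
      nlinarith [sq_nonneg K]
    have q2 : 3840 ≤ 5000 * (1 + K ^ 2) * (1 + c) := by
      have : 0 ≤ K ^ 2 * c := by positivity
      nlinarith [sq_nonneg K]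
    have := mul_le_mul_of_nonneg_right q1 n1
    have := mul_le_mul_of_nonneg_right q2 n2
    linarith
  calc _ ≤ ρ ^ 10 * (5000 * (1 + K ^ 2) * (1 + c) * (e1 + e2)) :=
        mul_le_mul_of_nonneg_left k8 (by positivity)
    _ = _ := by ring

end Background

end RpHierarchy

/-! ### Control of the slab terms by local energy decay. -/

namespace RpHierarchy

namespace Background

variable {B : Background} {W : Set Spt} {F ψ : Spt → ℝ} {N : E3 → Spt} {τ : Measure ℝ}
  {u u₁ u₂ R V a b c : ℝ}

lemma farInt_adjacent (hW : B.FarNhd W) (hF : ContinuousOn F W) (hτ : TimeMeasure τ u₁ u₂)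
    (ha : B.R₀ < a) (hab : a ≤ b) (hbc : b ≤ c) :
    B.farInt τ a c F = B.farInt τ a b F + B.farInt τ b c F := by
  have := hτ.finite
  have h1 : (volume : Measure ℝ).restrict (Icc a c)
      = volume.restrict (Icc a b) + volume.restrict (Icc b c) := by
    rw [← Icc_union_Ioc_eq_Icc hab hbc, Measure.restrict_union
      (Set.disjoint_left.mpr fun x hx hx' => absurd hx.2 (not_le.mpr hx'.1)) measurableSet_Ioc,
      Measure.restrict_congr_set Ioc_ae_eq_Icc]
  have h2 : boxMeasure τ a c = boxMeasure τ a b + boxMeasure τ b c := by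
    rw [boxMeasure, h1, Measure.add_prod, Measure.prod_add]
    rfl
  rw [farInt, h2]
  exact integral_add_measure (integrable_box hW hF hτ ha)
    (integrable_box hW hF hτ (ha.trans_le hab))

lemma FarNhd.wordDer (hW : B.FarNhd W) (hψ : ContDiffOn ℝ ∞ ψ W) (α : List (Fin 5)) :
    ContDiffOn ℝ ∞ (wordDer B.D α ψ) W := by
  induction α with
  | nil => exact hψ
  | cons i α ih =>
    fin_cases i
    exacts [hW.der_vT ih, hW.der_vR ih, hW.der_vΩ ih 0, hW.der_vΩ ih 1, hW.der_vΩ ih 2]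

/-- The energies of `ψ` and `T ψ`. -/
def energyT (B : Background) (N : E3 → Spt) (u : ℝ) (ψ : Spt → ℝ) : ENNReal :=
  ∑ l ∈ Finset.range 2, B.energy N u ((der vT)^[l] ψ)

lemma energy_le_energyT (l : ℕ) (hl : l < 2) :
    B.energy N u ((der vT)^[l] ψ) ≤ B.energyT N u ψ :=
  Finset.single_le_sum (f := fun l => B.energy N u ((der vT)^[l] ψ))
    (fun _ _ => zero_le) (Finset.mem_range.mpr hl)

lemma farInt_fluxDensity_dirac_le {f : Spt → ℝ} (hN : B.IsEnergyField N) (hW : B.FarNhd W)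
    (hf : ContDiffOn ℝ ∞ f W) (hu : 0 ≤ u) (ha : B.R₀ < a) {X : ENNReal} (hX : X ≠ ⊤)
    (h : B.energy N u f ≤ X) :
    B.farInt (Measure.dirac u) a b (fluxDensity B.D f) ≤ X.toReal := by
  have h0 : ∀ r ∈ Icc a b, ∀ y : S2, 0 ≤ fluxDensity B.D f (B.bondiPt u r y) := fun r hr y =>
    fluxDensity_nonneg (by rw [norm_bondiPt (ha.trans_le hr.1)]; exact ha.trans_le hr.1) f
  have h1 := ofReal_farInt_dirac hW (hW.fluxDensity hf) hu ha h0
  rw [← ENNReal.ofReal_le_iff_le_toReal hX, h1]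
  exact (nullInt_fluxDensity_le_energy hN ha f).trans h

/-- The local decay assumption for words of length at most one, as a bound on real integrals. -/
lemma exists_farInt_wordDer_le (hMor : B.LocalMorawetz N) (hR : B.R₀ < R - 1) (α : List (Fin 5))
    (hα : α.length ≤ 1) : ∃ C : ℝ, 0 < C ∧ ∀ (ψ : Spt → ℝ) (W : Set Spt) (u₁ u₂ : ℝ),
      B.IsSolution ψ → B.FarNhd W → ContDiffOn ℝ ∞ ψ W → 0 ≤ u₁ → u₁ < u₂ →
      B.energyT N u₁ ψ ≠ ⊤ →
      B.farInt (volume.restrict (Icc u₁ u₂)) (R - 1) R (fluxDensity B.D (wordDer B.D α ψ))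
        ≤ C * (B.energyT N u₁ ψ).toReal := by
  obtain ⟨C, hC, h⟩ := hMor α (R - 1) hR.le
  refine ⟨C, hC, fun ψ W u₁ u₂ hsol hW hψ hu h12 hE => ?_⟩
  have hf := hW.wordDer hψ α
  have h0 : ∀ u ∈ Icc u₁ u₂, ∀ r ∈ Icc (R - 1) R, ∀ y : S2,
      0 ≤ fluxDensity B.D (wordDer B.D α ψ) (B.bondiPt u r y) := fun u hu r hr y =>
    fluxDensity_nonneg (by rw [norm_bondiPt (hR.trans_le hr.1)]; exact hR.trans_le hr.1) _
  have h1 := (ofReal_farInt hW (hW.fluxDensity hf) (timeMeasure_restrict hu) hR h0).1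
  have h2 := h ψ hsol u₁ u₂ hu h12
  have h3 : ∀ u ∈ Ioc u₁ u₂,
      B.nullInt u (Icc (R - 1) (R - 1 + 1)) (B.nullDensity fieldT (wordDer B.D α ψ))
        = B.nullInt u (Icc (R - 1) R) (fluxDensity B.D (wordDer B.D α ψ)) := by
    intro u hu'
    rw [sub_add_cancel]
    refine nullInt_congr measurableSet_Icc fun r hr y => ?_
    have hr0 := hR.trans_le hr.1
    have hp := hW.far_subset (bondiPt_mem_far (hu.trans hu'.1.le) hr0 y)
    refine nullDensity_fieldT (hW.ne_zero hp) ?_ _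
    rw [norm_bondiPt hr0]
    exact (B.D_pos' hr0).ne'
  rw [setLIntegral_congr_fun measurableSet_Ioc h3,
    Measure.restrict_congr_set Ioc_ae_eq_Icc, ← h1] at h2
  have h4 : ∑ k ∈ Finset.range (α.length + 1), B.energy N u₁ ((der vT)^[k] ψ)
      ≤ B.energyT N u₁ ψ :=
    Finset.sum_le_sum_of_subset (Finset.range_mono (by omega))
  have h5 : ENNReal.ofReal C * B.energyT N u₁ ψ ≠ ⊤ := ENNReal.mul_ne_top ENNReal.ofReal_ne_top hE
  have h6 := (ENNReal.ofReal_le_iff_le_toReal h5).mp (h2.trans (by gcongr))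
  rwa [ENNReal.toReal_mul, ENNReal.toReal_ofReal hC.le] at h6

/-- The slab terms are controlled by the fluxes of `ψ` and `Ω_i ψ`. -/
lemma farInt_slabTerms_le (hW : B.FarNhd W) (hψ : ContDiffOn ℝ ∞ ψ W) (hτ : TimeMeasure τ u₁ u₂)
    (ha : B.R₀ < a) (h1a : 1 ≤ a) (hab : a ≤ b) (hD : ∀ r, a ≤ r → 1 / 2 ≤ B.D r)
    (hm : ∀ u r : ℝ, 0 ≤ u → B.R₀ < r → ∫ y : S2, ψ (B.bondiPt u r y) ∂dω = 0) :
    B.farInt τ a b (B.slabTerms ψ) ≤ 60 * b ^ 6 * (B.farInt τ a b (fluxDensity B.D ψ)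
      + ∑ i, B.farInt τ a b (fluxDensity B.D (der (vΩ i) ψ))) := by
  have hφ := hW.radField hψ
  have hΦ := hW.Phi hψ
  have hY := fun i => hW.der_vΩ hψ i
  have e : B.farInt τ a b (B.slabTerms ψ)
      = B.farInt τ a b (fun p => radField ψ p ^ 2) + B.farInt τ a b (fun p => Phi B.D ψ p ^ 2)
        + B.farInt τ a b (angSq (radField ψ)) + B.farInt τ a b (angSq (Phi B.D ψ)) := by
    rw [← farInt_add hW (hφ.pow 2).continuousOn (hΦ.pow 2).continuousOn hτ ha,
      ← farInt_add hW ((hφ.pow 2).add (hΦ.pow 2)).continuousOn (hW.angSq hφ).continuousOn hτ ha,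
      ← farInt_add hW (((hφ.pow 2).add (hΦ.pow 2)).add (hW.angSq hφ)).continuousOn
        (hW.angSq hΦ).continuousOn hτ ha]
    rfl
  have e2 : B.farInt τ a b (angSq (Phi B.D ψ))
      = ∑ i, B.farInt τ a b (fun p => Phi B.D (der (vΩ i) ψ) p ^ 2) := by
    rw [← farInt_sum hW hτ ha fun i => ((hW.Phi (hY i)).pow 2).continuousOn]
    refine farInt_congr hτ fun u hu r hr y => ?_
    have hp := hW.far_subset (bondiPt_mem_far (hτ.nonneg.trans hu.1) (ha.trans_le hr.1) y)
    simp only [angSq, der_vΩ_Phi_eq hW hψ hp]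
  have A1 := farInt_sq_radField_le hW hψ hτ ha h1a hD hm (b := b)
  have A2 := farInt_sq_Phi_le hW hψ hτ ha h1a hD hm (b := b)
  have A3 := farInt_angSq_radField_le hW hψ hτ ha h1a hD (b := b)
  have A4 := Finset.sum_le_sum fun i (_ : i ∈ Finset.univ) =>
    farInt_sq_Phi_le hW (hY i) hτ ha h1a hD
      (fun u r hu hr => integral_vΩ hW hψ hu hr i) (b := b)
  rw [← Finset.mul_sum] at A4
  rw [e, e2]
  have nn : ∀ f, 0 ≤ B.farInt τ a b (fluxDensity B.D f) := fun f =>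
    farInt_nonneg hτ fun v hv r hr y => fluxDensity_nonneg
      (by rw [norm_bondiPt (ha.trans_le hr.1)]; exact ha.trans_le hr.1) f
  have n1 := nn ψ
  have n2 := Finset.sum_nonneg fun i (_ : i ∈ Finset.univ) => nn (der (vΩ i) ψ)
  generalize ∑ i, B.farInt τ a b (fluxDensity B.D (der (vΩ i) ψ)) = S at *
  generalize B.farInt τ a b (fluxDensity B.D ψ) = P at *
  have hb1 : 1 ≤ b := h1a.trans hab
  have hb : b ^ 2 ≤ b ^ 6 := pow_le_pow_right₀ hb1 (by norm_num)
  have i1 := mul_le_mul_of_nonneg_right hb n1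
  have i2 : 0 ≤ b ^ 6 * S := by positivity
  have i3 : 0 ≤ b ^ 6 * P := by positivity
  linarith

/-- The sum of the error terms on the slab `R - 1 ≤ r ≤ R` is controlled by the energies of `ψ`
and `T ψ`. -/
lemma exists_slab_le (hN : B.IsEnergyField N) (hMor : B.LocalMorawetz N) (hR : B.R₀ < R - 1)
    (h1R : 1 ≤ R - 1) (hD : ∀ r, R - 1 ≤ r → 1 / 2 ≤ B.D r) :
    ∃ C : ℝ, 0 < C ∧ ∀ (ψ : Spt → ℝ) (W : Set Spt) (u₁ u₂ : ℝ),
      B.IsSolution ψ → B.FarNhd W → ContDiffOn ℝ ∞ ψ W →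
      (∀ u r : ℝ, 0 ≤ u → B.R₀ < r → ∫ y : S2, ψ (B.bondiPt u r y) ∂dω = 0) →
      0 ≤ u₁ → u₁ < u₂ → B.energyT N u₁ ψ ≠ ⊤ →
      B.farInt (Measure.dirac u₁) (R - 1) R (fun p => Phi B.D ψ p ^ 2)
        + B.farInt (Measure.dirac u₂) (R - 1) R (fun p => Phi B.D ψ p ^ 2)
        + B.farInt (volume.restrict (Icc u₁ u₂)) (R - 1) R (B.slabTerms ψ)
      ≤ C * (B.energyT N u₁ ψ).toReal := by
  -- The words `[]`, `[0]`, `[2]`, `[3]`, `[4]` stand for `ψ`, `Tψ` and the three `Ω_iψ`. Length at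
  -- most one keeps the right-hand side at the energies of `ψ` and `Tψ`.
  obtain ⟨C0, hC0, h0⟩ := exists_farInt_wordDer_le hMor hR [] (by simp)
  obtain ⟨CT, hCT, hT⟩ := exists_farInt_wordDer_le hMor hR [0] (by simp)
  obtain ⟨C1, hC1, h1⟩ := exists_farInt_wordDer_le hMor hR [2] (by simp)
  obtain ⟨C2, hC2, h2⟩ := exists_farInt_wordDer_le hMor hR [3] (by simp)
  obtain ⟨C3, hC3, h3⟩ := exists_farInt_wordDer_le hMor hR [4] (by simp)
  have hRp : 0 < R := by linarith
  -- The first term is twice `40R⁶`: the flux of `Φ²` at `u₁` is counted itself and again in the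
  -- bound for the flux at `u₂`. The second pays for the growth from `u₁` to `u₂`, the third for
  -- `slabTerms`.
  refine ⟨80 * R ^ 6 + 40 * R ^ 6 * (C0 + CT) + 60 * R ^ 6 * (C0 + (C1 + C2 + C3)), by positivity,
    fun ψ W u₁ u₂ hsol hW hψ hm hu h12 hE => ?_⟩
  have hτ := timeMeasure_restrict hu (u₂ := u₂)
  have hΦ := hW.Phi hψ
  have hψT := hW.der_vT hψ
  have S := farInt_slabTerms_le hW hψ hτ hR h1R (by linarith : R - 1 ≤ R) hD hm
  simp only [Fin.sum_univ_three] at S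
  have M0 := h0 ψ W u₁ u₂ hsol hW hψ hu h12 hE
  have MT := hT ψ W u₁ u₂ hsol hW hψ hu h12 hE
  have M1 := h1 ψ W u₁ u₂ hsol hW hψ hu h12 hE
  have M2 := h2 ψ W u₁ u₂ hsol hW hψ hu h12 hE
  have M3 := h3 ψ W u₁ u₂ hsol hW hψ hu h12 hE
  simp only [wordDer, frame, Matrix.cons_val_zero, Matrix.cons_val] at M0 MT M1 M2 M3
  have A := farInt_sq_Phi_le hW hψ (timeMeasure_dirac hu) hR h1R hD hm (b := R)
  have A' := farInt_fluxDensity_dirac_le (b := R) hN hW hψ hu hR hE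
    (energy_le_energyT (ψ := ψ) 0 (by norm_num))
  have P := farInt_sq_Phi_le hW hψ hτ hR h1R hD hm (b := R)
  have PT := farInt_sq_Phi_le hW hψT hτ hR h1R hD
    (fun u r hu hr => integral_vT_eq_zero hW hψ hm hu hr) (b := R)
  -- The slab flux of `Φ²` through the later cone is reached from `u₁` by integrating `∂_u(Φ²) =
  -- 2Φ·Φ[Tψ] ≤ Φ² + Φ[Tψ]²`. No energy at `u₂` is needed, hence no boundedness of energies in time.
  have G := farInt_vT hW (hΦ.pow 2) hu h12.le hR (b := R)
  have K := farInt_le_linear (b := R) hW hτ hR (hW.der_vT (hΦ.pow 2)).continuousOn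
    ![1, 1] ![fun p => Phi B.D ψ p ^ 2, fun p => Phi B.D (der vT ψ) p ^ 2]
    (by
      simp only [Fin.forall_fin_two, Matrix.cons_val_zero, Matrix.cons_val_one]
      exact ⟨(hΦ.pow 2).continuousOn, ((hW.Phi hψT).pow 2).continuousOn⟩)
    (fun v hv r hr y => by
      have hp := hW.far_subset (bondiPt_mem_far (hu.trans hv.1) (hR.trans_le hr.1) y)
      have e : der vT (fun p => Phi B.D ψ p ^ 2) (B.bondiPt v r y)
          = 2 * Phi B.D ψ (B.bondiPt v r y) * Phi B.D (der vT ψ) (B.bondiPt v r y) := by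
        rw [der_sq (hW.differentiableAt hΦ hp), der_vT_Phi_eq hW hψ hp]
        ring
      simp only [Fin.sum_univ_two, Matrix.cons_val_zero, Matrix.cons_val_one]
      rw [e]
      nlinarith [sq_nonneg (Phi B.D ψ (B.bondiPt v r y) - Phi B.D (der vT ψ) (B.bondiPt v r y))])
  rw [G] at K
  simp only [Fin.sum_univ_two, Matrix.cons_val_zero, Matrix.cons_val_one] at K
  generalize (B.energyT N u₁ ψ).toReal = E at *
  generalize B.farInt (Measure.dirac u₁) (R - 1) R (fun p => Phi B.D ψ p ^ 2) = X1 at *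
  generalize B.farInt (Measure.dirac u₂) (R - 1) R (fun p => Phi B.D ψ p ^ 2) = X2 at *
  generalize B.farInt (volume.restrict (Icc u₁ u₂)) (R - 1) R (fun p => Phi B.D ψ p ^ 2) = X3 at *
  have hR6 : 0 ≤ R ^ 6 := by positivity
  have q1 := mul_le_mul_of_nonneg_left A' hR6
  have q2 := mul_le_mul_of_nonneg_left M0 hR6
  have q3 := mul_le_mul_of_nonneg_left MT hR6
  have q4 := mul_le_mul_of_nonneg_left (add_le_add (add_le_add M1 M2) M3) hR6
  linarith

end Background

end RpHierarchy

/-! ### Removal of the cutoffs, choice of the radius, and the theorem. -/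

namespace RpHierarchy

namespace Background

variable {B : Background} {W : Set Spt} {F H ψ : Spt → ℝ} {N : E3 → Spt} {τ : Measure ℝ}
  {u u₁ u₂ R V b d s K : ℝ}

lemma IsSolution.box_eq_zero (h : B.IsSolution ψ) : ∀ p ∈ B.far, box B.D ψ p = 0 := by
  intro p hp
  have h1 := B.rmin_lt.trans hp.1
  refine h.wave p ⟨h1.le, ?_⟩ h1
  simpa only [Background.s, not_le.mpr hp.1, if_false] using hp.2

lemma integral_hatPhi_eq_zero (hW : B.FarNhd W) (hψ : ContDiffOn ℝ ∞ ψ W)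
    (hm : ∀ u r : ℝ, 0 ≤ u → B.R₀ < r → ∫ y : S2, ψ (B.bondiPt u r y) ∂dω = 0)
    {u r : ℝ} (hu : 0 ≤ u) (hr : B.R₀ < r) : ∫ y : S2, B.hatPhi ψ (B.bondiPt u r y) ∂dω = 0 := by
  have h1 : ∀ u r : ℝ, 0 ≤ u → B.R₀ < r → ∫ y : S2, radField ψ (B.bondiPt u r y) ∂dω = 0 := by
    intro u r hu hr
    simp only [radField, norm_bondiPt hr]
    rw [integral_const_mul, hm u r hu hr, mul_zero]
  have h2 : ∫ y : S2, Phi B.D ψ (B.bondiPt u r y) ∂dω = 0 := by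
    simp only [Phi, norm_bondiPt hr]
    rw [integral_const_mul, integral_vR_eq_zero hW (hW.radField hψ) h1 hu hr, mul_zero]
  have i1 := integrable_sphere (integrable_ev hW (hW.Phi hψ).continuousOn hu hr)
  have i2 := integrable_sphere (integrable_ev hW (hW.radField hψ).continuousOn hu hr)
  simp only [hatPhi]
  rw [integral_add i1 (i2.const_mul _), integral_const_mul, h1 u r hu hr, h2]
  simp

/-- Where the cutoffs equal one, the weight is a power of `r`. -/
lemma farInt_rpow_le (hW : B.FarNhd W) (hH : ContinuousOn H W) (h0 : ∀ p, 0 ≤ H p)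
    (hτ : TimeMeasure τ u₁ u₂) (hR : B.R₀ < R - 1) (hdb : d ≤ b)
    (hV : ∀ r ∈ Icc R d, u₂ + 2 * B.rstar r ≤ V - 1) :
    B.farInt τ R d (fun p => ‖p.2‖ ^ s * H p)
      ≤ B.farInt τ (R - 1) b (fun p => wgt R V s p * H p) := by
  have hR0 : B.R₀ < R := by linarith
  have h1 : B.farInt τ R d (fun p => ‖p.2‖ ^ s * H p)
      = B.farInt τ R d (fun p => wgt R V s p * H p) := by
    refine farInt_congr hτ fun u hu r hr y => ?_
    have ht : timeCut V (B.bondiPt u r y) = 1 :=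
      timeCut_eq_one (by simp only [bondiPt]; linarith [hV r hr, hu.2])
    simp only [wgt, ht, norm_bondiPt (hR0.trans_le hr.1), cut_eq_one hr.1]
    ring
  rw [h1]
  exact farInt_mono_set hW ((hW.continuousOn_wgt R V s).fun_mul hH) hτ hR
    (Icc_subset_Icc (by linarith) hdb) fun u hu r hr y => mul_nonneg (wgt_nonneg _ _ _ _) (h0 _)

lemma wgt_le_rpow (R V s : ℝ) (p : Spt) : wgt R V s p ≤ ‖p.2‖ ^ s := by
  have h1 := Real.rpow_nonneg (norm_nonneg p.2) s
  have h2 : cut R ‖p.2‖ * ‖p.2‖ ^ s ≤ ‖p.2‖ ^ s := mul_le_of_le_one_left h1 (cut_le_one _ _)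
  exact (mul_le_of_le_one_right (mul_nonneg (cut_nonneg _ _) h1) (timeCut_le_one _ _)).trans h2

/-- The weighted flux with cutoffs, split at `r = R`. -/
lemma farInt_wgt_le (hW : B.FarNhd W) (hH : ContinuousOn H W) (h0 : ∀ p, 0 ≤ H p)
    (hu : 0 ≤ u) (hR : B.R₀ < R - 1) (h1R : 1 ≤ R - 1) (hRb : R ≤ b) (hs : s ≤ 2) :
    B.farInt (Measure.dirac u) (R - 1) b (fun p => wgt R V s p * H p)
      ≤ R ^ 2 * B.farInt (Measure.dirac u) (R - 1) R H
        + B.farInt (Measure.dirac u) R b (fun p => ‖p.2‖ ^ s * H p) := by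
  have hτ := timeMeasure_dirac hu
  have hR0 : B.R₀ < R := by linarith
  have hw := (hW.continuousOn_wgt R V s).fun_mul hH
  rw [farInt_adjacent hW hw hτ hR (by linarith) hRb, ← farInt_const_mul]
  refine add_le_add ?_ ?_
  · refine farInt_mono hW hw (continuousOn_const.fun_mul hH) hτ hR fun v hv r hr y => ?_
    refine mul_le_mul_of_nonneg_right ((wgt_le_rpow _ _ _ _).trans ?_) (h0 _)
    rw [norm_bondiPt (hR.trans_le hr.1)]
    have h1r : 1 ≤ r := h1R.trans hr.1
    calc r ^ s ≤ r ^ (2 : ℝ) := Real.rpow_le_rpow_of_exponent_le h1r hs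
      _ = r ^ 2 := Real.rpow_two r
      _ ≤ R ^ 2 := pow_le_pow_left₀ (by linarith) hr.2 2
  · exact farInt_mono hW hw ((hW.continuousOn_rpow s).fun_mul hH) hτ hR0 fun v hv r hr y =>
      mul_le_mul_of_nonneg_right (wgt_le_rpow _ _ _ _) (h0 _)

lemma farInt_le_rpFlux {p : ℝ} (hW : B.FarNhd W) (hψ : ContDiffOn ℝ ∞ ψ W) (hu : 0 ≤ u)
    (hR : B.R₀ < R) (hfin : B.rpFlux p R u ψ ≠ ⊤) :
    B.farInt (Measure.dirac u) R b (fun q => ‖q.2‖ ^ p * der (vR B.D) (Phi B.D ψ) q ^ 2)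
      ≤ (B.rpFlux p R u ψ).toReal := by
  have hc := (hW.continuousOn_rpow p).fun_mul ((hW.der_vR (hW.Phi hψ)).continuousOn.fun_pow 2)
  rw [← ENNReal.ofReal_le_iff_le_toReal hfin, ofReal_farInt_dirac hW hc hu hR
    fun r _ y => mul_nonneg (Real.rpow_nonneg (norm_nonneg _) _) (sq_nonneg _)]
  rw [nullInt, ← Measure.restrict_congr_set Ioc_ae_eq_Icc]
  exact nullInt_mono_set Ioc_subset_Ioi_self

/-- The radii `R` for which the estimate with the exponent `p` holds. -/
structure LargeRadius (B : Background) (K R p : ℝ) : Prop where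
  err : B.errConst K * (R - 1) ^ (-B.rate) ≤ (p + 4) / 8
  left : 1 ≤ R * (p + 4)
  right : p = 2 ∨ (1 ≤ R * (2 - p) ∧ 16 * B.M ^ 2 ≤ (2 - p) ^ 2 * (R - 1) ^ 2)

/-- The conditions linking `R` and `p`. The first holds eventually since `(R-1)^{-σ} → 0` while `p +
4 > 0` is fixed, the others since positive multiples of `R` and `R - 1` are unbounded; at `p = 2`
the last one is satisfied by its first alternative. -/
lemma eventually_largeRadius (B : Background) (K : ℝ) {p : ℝ} (hp : -4 < p) (hp2 : p ≤ 2) :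
    ∀ᶠ R in atTop, B.LargeRadius K R p := by
  have t1 : Tendsto (fun R : ℝ => R - 1) atTop atTop := tendsto_atTop_add_const_right _ _ tendsto_id
  have e1 : ∀ᶠ R : ℝ in atTop, B.errConst K * (R - 1) ^ (-B.rate) ≤ (p + 4) / 8 := by
    have h := ((tendsto_rpow_neg_atTop B.rate_pos).comp t1).const_mul (B.errConst K)
    rw [mul_zero] at h
    exact h.eventually_le_const (by linarith)
  have e2 : ∀ᶠ R : ℝ in atTop, 1 ≤ R * (p + 4) :=
    (tendsto_id.atTop_mul_const (by linarith : 0 < p + 4)).eventually_ge_atTop 1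
  have e3 : ∀ᶠ R : ℝ in atTop,
      p = 2 ∨ (1 ≤ R * (2 - p) ∧ 16 * B.M ^ 2 ≤ (2 - p) ^ 2 * (R - 1) ^ 2) := by
    rcases hp2.eq_or_lt with rfl | h
    · exact Eventually.of_forall fun _ => Or.inl rfl
    · have h0 : 0 < 2 - p := by linarith
      filter_upwards [(tendsto_id.atTop_mul_const h0).eventually_ge_atTop 1,
        (t1.const_mul_atTop h0).eventually_ge_atTop (4 * B.M)] with R h1 h2
      refine Or.inr ⟨h1, ?_⟩
      have hM := B.M_nonneg
      have := pow_le_pow_left₀ (by positivity) h2 2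
      linarith
  filter_upwards [e1, e2, e3] with R h1 h2 h3 using ⟨h1, h2, h3⟩

set_option maxHeartbeats 1000000 in
/-- The weighted estimate at a fixed radius, with a constant that is uniform in the exponent. -/
lemma exists_rp_estimate (hN : B.IsEnergyField N) (hMor : B.LocalMorawetz N) (hK : 0 < K)
    (hR : B.R₀ < R - 2) (h1R : 1 ≤ R - 2) (hC : B.CoefBounds K (R - 1))
    (hM : 16 * B.M ^ 2 ≤ B.rate ^ 2 * (R - 1) ^ 2) :
    ∃ C : ℝ, 0 < C ∧ ∀ p : ℝ, -4 < p → p ≤ 2 → B.LargeRadius K R p → ∀ ψ : Spt → ℝ,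
      B.IsSolution ψ → B.HighFrequency ψ → ∀ u₁ u₂ : ℝ, 0 ≤ u₁ → u₁ < u₂ →
        B.rpFlux p R u₂ ψ + B.rpBulk p R u₁ u₂ ψ
          ≤ ENNReal.ofReal C * (B.rpFlux p R u₁ ψ + B.energyT N u₁ ψ) := by
  have hR1 : B.R₀ < R - 1 := by linarith
  have hR0 : B.R₀ < R := by linarith
  have h1R1 : 1 ≤ R - 1 := by linarith
  have hC2 : ∀ r, R - 2 ≤ r → R - 1 - 1 ≤ r := fun r hr => by linarith
  have hCR : B.CoefBounds K R := fun r hr => hC r (by linarith)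
  have hD : ∀ r, R - 2 ≤ r → 1 / 2 ≤ B.D r := fun r hr => (hC r (hC2 r hr)).1
  have hD2 : ∀ r, R - 2 ≤ r → B.D r ≤ 2 := fun r hr => (hC r (hC2 r hr)).2.1
  have hD' : ∀ r, R - 2 ≤ r → |deriv B.D r| ≤ K := fun r hr =>
    (hC r (hC2 r hr)).2.2.1.trans (mul_le_of_le_one_right hK.le
      (Real.rpow_le_one_of_one_le_of_nonpos (h1R.trans hr) (by linarith [B.rate_pos])))
  obtain ⟨c, hc0, hc⟩ := exists_deriv_smoothTransition_le
  obtain ⟨c', hc'0, hc'⟩ := exists_deriv_bump_le B.R₀_pos hR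
  obtain ⟨C₁, hC₁, hslab⟩ := exists_slab_le hN hMor hR1 h1R1 fun r hr => hD r (by linarith)
  set C₂ : ℝ := 5000 * (1 + K ^ 2) * (1 + c') * (R + 1) ^ 10 with hC₂
  have hRp : 0 < R := by linarith
  have hC₂0 : 0 < C₂ := by positivity
  set A : ℝ := |B.coreConst K c R| + 1 with hA
  have hA0 : 0 < A := by positivity
  have hC0 : 0 < A * (1 + 2 * R ^ 2 * C₂ + C₁) := by positivity
  refine ⟨A * (1 + 2 * R ^ 2 * C₂ + C₁), hC0, fun p hp hp2 hL ψ hsol hhf u₁ u₂ hu h12 => ?_⟩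
  -- If the right-hand side is infinite nothing is left to prove; otherwise everything reduces to
  -- real integrals over bounded sets.
  by_cases hfin : B.rpFlux p R u₁ ψ ≠ ⊤ ∧ B.energyT N u₁ ψ ≠ ⊤
  swap
  · have h : B.rpFlux p R u₁ ψ + B.energyT N u₁ ψ = ⊤ := by
      rw [ENNReal.add_eq_top]
      tauto
    rw [h, ENNReal.mul_top (ENNReal.ofReal_pos.mpr hC0).ne']
    exact le_top
  obtain ⟨hfl, hE⟩ := hfin
  obtain ⟨W, hW, hψ⟩ := B.exists_farNhd hsol.smooth
  have hbox := hsol.box_eq_zero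
  have hm : ∀ u r : ℝ, 0 ≤ u → B.R₀ < r → ∫ y : S2, ψ (B.bondiPt u r y) ∂dω = 0 :=
    fun u r hu hr => integral_eq_zero_of_highFrequency hhf hu hr
  have hΦ := hW.Phi hψ
  have hf : ContinuousOn (fun q => der (vR B.D) (Phi B.D ψ) q ^ 2) W :=
    (hW.der_vR hΦ).continuousOn.fun_pow 2
  have ha := (hW.angSq hΦ).continuousOn
  have hf0 : ∀ q : Spt, 0 ≤ der (vR B.D) (Phi B.D ψ) q ^ 2 := fun q => sq_nonneg _
  have hν := timeMeasure_restrict hu (u₂ := u₂)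
  have hu2 : 0 ≤ u₂ := hu.trans h12.le
  have hang : ∀ q : Spt, angGradSq (Phi B.D ψ) q = angSq (Phi B.D ψ) q / ‖q.2‖ ^ 2 := fun _ => rfl
  have hnorm : ∀ q ∈ W, ‖q.2‖ ≠ 0 := fun q hq => norm_ne_zero_iff.mpr (hW.ne_zero hq)
  have hfc := (hW.continuousOn_rpow p).fun_mul hf
  have hbulk1 := continuousOn_const (c := p + 4) |>.fun_mul ((hW.continuousOn_rpow (p - 1)).fun_mul hf)
  have hbulk2 := continuousOn_const (c := 2 - p) |>.fun_mul ((hW.continuousOn_rpow (p - 3)).fun_mul ha)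
  have hGe : ∀ q ∈ W, (p + 4) * ‖q.2‖ ^ (p - 1) * der (vR B.D) (Phi B.D ψ) q ^ 2
        + (2 - p) * ‖q.2‖ ^ (p - 1) * angGradSq (Phi B.D ψ) q
      = (p + 4) * (‖q.2‖ ^ (p - 1) * der (vR B.D) (Phi B.D ψ) q ^ 2)
        + (2 - p) * (‖q.2‖ ^ (p - 3) * angSq (Phi B.D ψ) q) := by
    intro q hq
    have h1 : ‖q.2‖ ^ (p - 3) = ‖q.2‖ ^ (p - 1) / ‖q.2‖ ^ 2 := by
      rw [← Real.rpow_two, ← Real.rpow_sub ((norm_nonneg _).lt_of_ne' (hnorm q hq))]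
      ring_nf
    rw [hang, h1]
    ring
  -- the energy of the data
  have hslab' := hslab ψ W u₁ u₂ hsol hW hψ hm hu h12 hE
  -- The cut-off flux at `u₁` starts at `r = R - 1`, but `rpFlux` only at `R`. The difference is a
  -- slab flux of `∂_rΦ`, paid for by the energies of `ψ` and `Tψ` through the elliptic estimate.
  have hdata : B.farInt (Measure.dirac u₁) (R - 1) R (fun q => der (vR B.D) (Phi B.D ψ) q ^ 2)
      ≤ 2 * C₂ * (B.energyT N u₁ ψ).toReal := by
    have h := slab_der_vR_Phi_le hW hψ hbox hm hu hR h1R hc'0 hc' hD hD2 hD'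
    have e1 := farInt_fluxDensity_dirac_le (b := R + 1) hN hW hψ hu hR hE
      (energy_le_energyT (ψ := ψ) 0 (by norm_num))
    have e2 := farInt_fluxDensity_dirac_le (b := R + 1) hN hW (hW.der_vT hψ) hu hR hE
      (energy_le_energyT (ψ := ψ) 1 (by norm_num))
    have e3 := mul_le_mul_of_nonneg_left (add_le_add e1 e2) hC₂0.le
    rw [← hC₂] at h
    linarith
  have key : ∀ n : ℕ, B.farInt (Measure.dirac u₂) R (R + n)
        (fun q => ‖q.2‖ ^ p * der (vR B.D) (Phi B.D ψ) q ^ 2)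
      + B.farInt (volume.restrict (Icc u₁ u₂)) R (R + n)
        (fun q => (p + 4) * ‖q.2‖ ^ (p - 1) * der (vR B.D) (Phi B.D ψ) q ^ 2
          + (2 - p) * ‖q.2‖ ^ (p - 1) * angGradSq (Phi B.D ψ) q)
      ≤ A * (1 + 2 * R ^ 2 * C₂ + C₁)
        * ((B.rpFlux p R u₁ ψ).toReal + (B.energyT N u₁ ψ).toReal) := by
    intro n
    obtain ⟨m, hmb⟩ := (isCompact_Icc (a := R) (b := R + n)).exists_bound_of_continuousOn
      (B.contDiffOn_rstar.continuousOn.mono fun r hr => B.rmin_lt.trans (hR0.trans_le hr.1))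
    -- `V` is so large that the time cutoff equals `1` for `R ≤ r ≤ R + n` and `u ≤ u₂`; then `b` is
    -- so large that the cutoff vanishes at `r = b` from `u₁` on. The resulting bound involves
    -- neither `V`, `b` nor `n`.
    set V : ℝ := u₂ + 2 * m + 1 with hV
    obtain ⟨b, hb1, hb2⟩ := ((B.tendsto_rstar.eventually_ge_atTop ((V - u₁) / 2)).and
      (eventually_ge_atTop (R + n))).exists
    have hVr : ∀ r ∈ Icc R (R + n), u₂ + 2 * B.rstar r ≤ V - 1 := fun r hr => by
      have := (le_abs_self _).trans (hmb r hr)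
      linarith
    have hn0 : (0 : ℝ) ≤ n := n.cast_nonneg
    have hB : CutBox B (volume.restrict (Icc u₁ u₂)) u₁ u₂ R V b :=
      ⟨hν, hR1, h1R1, by linarith, by linarith⟩
    have core := hB.core h12.le hW hψ hbox (fun u r hu hr => integral_hatPhi_eq_zero hW hψ hm hu hr)
      hK hCR hp hp2 hc0 hc hM hL.err hL.left hL.right
    have l1 := farInt_rpow_le (s := p) hW hf hf0 (timeMeasure_dirac hu2) hR1 hb2 hVr
    have l2 := farInt_rpow_le (s := p - 1) hW hf hf0 hν hR1 hb2 hVr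
    have l3 := farInt_rpow_le (s := p - 3) hW ha (fun q => angSq_nonneg _ q) hν hR1 hb2 hVr
    have eG : B.farInt (volume.restrict (Icc u₁ u₂)) R (R + n)
        (fun q => (p + 4) * ‖q.2‖ ^ (p - 1) * der (vR B.D) (Phi B.D ψ) q ^ 2
          + (2 - p) * ‖q.2‖ ^ (p - 1) * angGradSq (Phi B.D ψ) q)
        = (p + 4) * B.farInt (volume.restrict (Icc u₁ u₂)) R (R + n)
            (fun q => ‖q.2‖ ^ (p - 1) * der (vR B.D) (Phi B.D ψ) q ^ 2)
          + (2 - p) * B.farInt (volume.restrict (Icc u₁ u₂)) R (R + n)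
            (fun q => ‖q.2‖ ^ (p - 3) * angSq (Phi B.D ψ) q) := by
      rw [← farInt_const_mul, ← farInt_const_mul, ← farInt_add hW hbulk1 hbulk2 hν hR0]
      exact farInt_congr hν fun u hu' r hr y =>
        hGe _ (hW.far_subset (bondiPt_mem_far (hu.trans hu'.1) (hR0.trans_le hr.1) y))
    have r1 := farInt_wgt_le (V := V) (b := b) hW hf hf0 hu hR1 h1R1 hB.le hp2
    have r2 := farInt_le_rpFlux (b := b) hW hψ hu hR0 hfl
    have w1 : 0 ≤ B.farInt (Measure.dirac u₁) (R - 1) b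
        (fun q => wgt R V p q * der (vR B.D) (Phi B.D ψ) q ^ 2) :=
      farInt_nonneg (timeMeasure_dirac hu) fun u _ r _ y =>
        mul_nonneg (wgt_nonneg _ _ _ _) (hf0 _)
    have w2 : 0 ≤ B.farInt (Measure.dirac u₁) (R - 1) R (fun q => Phi B.D ψ q ^ 2) :=
      farInt_nonneg (timeMeasure_dirac hu) fun u _ r _ y => sq_nonneg _
    have w3 : 0 ≤ B.farInt (Measure.dirac u₂) (R - 1) R (fun q => Phi B.D ψ q ^ 2) :=
      farInt_nonneg (timeMeasure_dirac hu2) fun u _ r _ y => sq_nonneg _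
    have w4 : 0 ≤ B.farInt (volume.restrict (Icc u₁ u₂)) (R - 1) R (B.slabTerms ψ) :=
      farInt_nonneg hν fun u _ r _ y => (sq_nonneg _).trans (sq_Phi_le _)
    have f1 : 0 ≤ (B.rpFlux p R u₁ ψ).toReal := ENNReal.toReal_nonneg
    have f2 : 0 ≤ (B.energyT N u₁ ψ).toReal := ENNReal.toReal_nonneg
    rw [eG]
    have hA1 : B.coreConst K c R ≤ A := (le_abs_self _).trans (by linarith)
    have l2' := mul_le_mul_of_nonneg_left l2 (by linarith : 0 ≤ p + 4)
    have l3' := mul_le_mul_of_nonneg_left l3 (by linarith : 0 ≤ 2 - p)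
    have x1 := mul_le_mul_of_nonneg_right hA1 (add_nonneg (add_nonneg (add_nonneg w1 w2) w3) w4)
    have x2 := mul_le_mul_of_nonneg_left hdata (sq_nonneg R)
    generalize (B.rpFlux p R u₁ ψ).toReal = f at *
    generalize (B.energyT N u₁ ψ).toReal = E at *
    have x3 : B.farInt (Measure.dirac u₁) (R - 1) b
          (fun q => wgt R V p q * der (vR B.D) (Phi B.D ψ) q ^ 2)
        + B.farInt (Measure.dirac u₁) (R - 1) R (fun q => Phi B.D ψ q ^ 2)
        + B.farInt (Measure.dirac u₂) (R - 1) R (fun q => Phi B.D ψ q ^ 2)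
        + B.farInt (volume.restrict (Icc u₁ u₂)) (R - 1) R (B.slabTerms ψ)
        ≤ (1 + 2 * R ^ 2 * C₂ + C₁) * (f + E) := by
      have y1 : 0 ≤ (2 * R ^ 2 * C₂ + C₁) * f := by positivity
      linarith
    have x4 := mul_le_mul_of_nonneg_left x3 hA0.le
    linarith
  have final := nullInt_add_bulk_le hW hfc ((hbulk1.fun_add hbulk2).congr hGe) hu h12.le hR0
    (fun u _ r _ y => mul_nonneg (Real.rpow_nonneg (norm_nonneg _) _) (hf0 _))
    (fun u _ r _ y => add_nonneg (mul_nonneg (mul_nonneg (by linarith)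
      (Real.rpow_nonneg (norm_nonneg _) _)) (hf0 _)) (mul_nonneg (mul_nonneg (by linarith)
      (Real.rpow_nonneg (norm_nonneg _) _)) (div_nonneg (angSq_nonneg _ _) (sq_nonneg _)))) key
  refine final.trans_eq ?_
  rw [ENNReal.ofReal_mul hC0.le, ENNReal.ofReal_add ENNReal.toReal_nonneg ENNReal.toReal_nonneg,
    ENNReal.ofReal_toReal hfl, ENNReal.ofReal_toReal hE]

end Background

end RpHierarchy

end

theorem theorem1p3 (B : Background) (N : E3 → Spt) (hN : B.IsEnergyField N)
    (hMor : B.LocalMorawetz N) :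
    ∃ C : ℝ → ℝ, (∀ R, 0 < C R) ∧
      ∀ p : ℝ, -4 < p → p ≤ 2 → ∃ R : ℝ, B.R₀ ≤ R ∧
        ∀ ψ : Spt → ℝ, B.IsSolution ψ → B.HighFrequency ψ → B.DataAssumptions ψ →
          ∀ u₁ u₂ : ℝ, 0 ≤ u₁ → u₁ < u₂ →
            B.rpFlux p R u₂ ψ + B.rpBulk p R u₁ u₂ ψ
              ≤ ENNReal.ofReal (C R) *
                (B.rpFlux p R u₁ ψ
                  + ∑ l ∈ Finset.range 2, B.energy N u₁ ((der vT)^[l] ψ)) := by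
  obtain ⟨K, r₁, hK, hr₁, h1r₁, hbd⟩ := B.exists_coef_bounds
  -- The `2` ensures `R - 2 ≥ r₁`, where the elliptic estimate needs the coefficient bounds; the
  -- last summand gives `16M² ≤ σ²(R-1)²`.
  set R₁ : ℝ := r₁ + 2 + 4 * B.M / B.rate with hR₁
  have hM := B.M_nonneg
  have hσ := B.rate_pos
  have hMσ : 0 ≤ 4 * B.M / B.rate := by positivity
  -- The constant is fixed for each `R` before `p` is given, and holds for all exponents for which
  -- `R` is a large radius. Below `R₁` the value `1` is arbitrary, since such radii are never
  -- selected.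
  have key : ∀ R, ∃ C : ℝ, 0 < C ∧ (R₁ ≤ R → ∀ p : ℝ, -4 < p → p ≤ 2 →
      B.LargeRadius K R p → ∀ ψ : Spt → ℝ,
      B.IsSolution ψ → B.HighFrequency ψ → ∀ u₁ u₂ : ℝ, 0 ≤ u₁ → u₁ < u₂ →
        B.rpFlux p R u₂ ψ + B.rpBulk p R u₁ u₂ ψ
          ≤ ENNReal.ofReal C * (B.rpFlux p R u₁ ψ + B.energyT N u₁ ψ)) := by
    intro R
    by_cases hR : R₁ ≤ R
    · have hMR : 16 * B.M ^ 2 ≤ B.rate ^ 2 * (R - 1) ^ 2 := by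
        have h1 : 4 * B.M ≤ B.rate * (R - 1) := by
          have h2 : 4 * B.M / B.rate ≤ R - 1 := by linarith
          rw [div_le_iff₀ hσ] at h2
          linarith
        have := pow_le_pow_left₀ (by positivity) h1 2
        linarith
      obtain ⟨C, hC, h⟩ := Background.exists_rp_estimate hN hMor hK (R := R) (by linarith)
        (by linarith) (fun r hr => hbd r (by linarith)) hMR
      exact ⟨C, hC, fun _ => h⟩
    · exact ⟨1, one_pos, fun h => absurd h hR⟩
  choose C hC hest using key
  refine ⟨C, hC, fun p hp hp2 => ?_⟩
  obtain ⟨R, hL, hR⟩ :=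
    ((B.eventually_largeRadius K hp hp2).and (eventually_ge_atTop R₁)).exists
  exact ⟨R, by linarith, fun ψ hsol hhf _ u₁ u₂ hu h12 =>
    hest R hR p hp hp2 hL ψ hsol hhf u₁ u₂ hu h12⟩
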